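/- Let $X$ be a compact $C^\infty$ manifold and let $\varphi_t=e^{tV}$ be a $C^\infty$ Anosov flow on $X$, with generator $V$ (nowhere zero) and invariant continuous splitting $T_xX=\mathbb R V(x)\oplus E_u(x)\oplus E_s(x)$. Fix a smooth positive density $dx$ on $X$ and $k\ge 0$. Let $\mathcal E_0^k$ be the bundle of (complex valued) $k$-forms $u$ with $\iota_Vu=0$, let $P=\frac1i\mathcal L_V$, and let $e^{-itP}=\varphi_{-t}^*$ be its propagator, which acts on $C^\infty(X;\mathcal E_0^k)$. If $\varphi_{t_0}(x_0)=x_0$ with $t_0\ne0$, let $\gamma$ be the corresponding closed trajectory and $\mathcal P_\gamma=d\varphi_{-t_0}(x_0)|_{E_u(x_0)\oplus E_s(x_0)}$. Let $K(t,y,x)$ be the Schwartz kernel of $\varphi_{-t}^*$ on functions, $f(\varphi_{-t}(y))=\int_X K(t,y,x)f(x)\,dx$; for a smooth local frame $(\mathbf e_j)$ of $\mathcal E_0^k$ over an open set $U\subset X$ write $e^{-itP}(f\mathbf e_l)=\sum_j (B_{jl}(t)f)\,\mathbf e_j$, let $K_{jl}$ be the kernel of $B_{jl}$ on $\{t\ne0\}\times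 U\times U$, and $K^k=\sum_jK_{jj}$. Let $\iota(t,x)=(t,x,x)$. Pullbacks by $\iota$ are taken in the sense of Hörmander, for distributions whose wave front set does not meet the conormal bundle $N^*(\mathbb R_t\times\Delta(X))$ of the range of $\iota$. (1) The kernels are distributions, and over $t\neq0$ $$\mathrm{WF}(K)\cap N^*(\mathbb R_t\times\Delta(X))=\emptyset ,\qquad \mathrm{WF}(K_{jl})\cap N^*(\mathbb R_t\times\Delta(X))=\emptyset$$ for every local frame and all $j,l$. The pullback $\iota^*K=K(t,x,x)$ exists on $\{t\ne0\}\times X$. There is a distribution $K^k(t,x,x)$ on $\{t\ne 0\}\times X$ that is equal to $\iota^*K^k$ over the domain of every local frame, and its pushforward to $t$, the flat trace $$\operatorname{tr}^\flat e^{-itP}|_{C^\infty(X;\mathcal E_0^k)}=\int_X K^k(t,x,x)\,dx ,$$ is a well defined distribution on $\mathbb R\setminus0$. (2) If $\varphi_{t_0}(x_0)=x_0$ with $t_0\neq0$, then $\det(I-\mathcal P_\gamma)\ne0$ and there are $\varepsilon>0$ and an open neighbourhood $U$ of $x_0$ such that $\varphi_s(x_0)\in U$ for $|s|<\varepsilon$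 and, for each $\chi\in C_c^\infty((t_0-\varepsilon,t_0+\varepsilon)\times U)$, $$\int_{\mathbb R\times X}\chi(t,x)K(t,x,x)\,dx\,dt=\frac1{|\det(I-\mathcal P_\gamma)|}\int_{-\varepsilon}^{\varepsilon}\chi(t_0,\varphi_s(x_0))\,ds .$$ Likewise, for suitable $\varepsilon$ and $U$, $$\int_{\mathbb R\times X}\chi(t,x)K^k(t,x,x)\,dx\,dt=\frac{\operatorname{tr}(\wedge^k\mathcal P_\gamma)}{|\det(I-\mathcal P_\gamma)|}\int_{-\varepsilon}^{\varepsilon}\chi(t_0,\varphi_s(x_0))\,ds .$$ (3) As distributions in $t>0$, $$\operatorname{tr}^\flat e^{-itP}|_{C^\infty(X;\mathcal E_0^k)}=\sum_\gamma\frac{T_\gamma^\sharp\operatorname{tr}(\wedge^k\mathcal P_\gamma)\,\delta(t-T_\gamma)}{|\det(I-\mathcal P_\gamma)|},$$ where $\gamma$ runs over the periodic orbits with all their periods $T_\gamma>0$ (an orbit with primitive period $T^\sharp_\gamma$ counts once for each of the periods $mT^\sharp_\gamma$, $m\ge1$), and the base point on $\gamma$ used to form $\mathcal P_\gamma=d\varphi_{-T_\gamma}|_{E_u\oplus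 E_s}$ is arbitrary. For each $R$ there are only finitely many $\gamma$ with $T_\gamma\le R$. -/

import Mathlib

open scoped Manifold ContDiff Topology
open MeasureTheory Set Filter

noncomputable section

namespace Guillemin

/-! ### Distributions, wave front sets and pullbacks on manifolds -/

section Distributions

variable {F : Type*} [NormedAddCommGroup F] [NormedSpace ℝ F]
  {H : Type*} [TopologicalSpace H] (I : ModelWithCorners ℝ F H)
  {M : Type*} [TopologicalSpace M] [ChartedSpace H M]

/-- `Φ ∈ C_c^∞(O)`, as a function on all of `M` that vanishes outside of `O`. -/
def IsTest (O : Set M) (Φ : M → ℂ) : Prop :=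
  ContMDiff I 𝓘(ℝ, ℂ) ∞ Φ ∧ HasCompactSupport Φ ∧ tsupport Φ ⊆ O

/-- `u` is a distribution on the open set `O`: it is linear on test functions, and near every
point of `O` it is bounded, in a chart, by finitely many derivatives of the test function.
(Values of `u` on functions that are not test functions are irrelevant.) -/
def IsDistribution (O : Set M) (u : (M → ℂ) → ℂ) : Prop :=
  (∀ Φ Ψ, IsTest I O Φ → IsTest I O Ψ → u (fun q => Φ q + Ψ q) = u Φ + u Ψ) ∧
  (∀ (c : ℂ) Φ, IsTest I O Φ → u (fun q => c * Φ q) = c * u Φ) ∧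
  ∀ p ∈ O, ∃ L ∈ 𝓝 p, ∃ (m : ℕ) (C : ℝ), ∀ Φ, IsTest I O Φ → tsupport Φ ⊆ L →
    ∀ B : ℝ, (∀ i ≤ m, ∀ z ∈ (extChartAt I p).target,
        ‖iteratedFDerivWithin ℝ i (fun z => Φ ((extChartAt I p).symm z))
          (extChartAt I p).target z‖ ≤ B) →
      ‖u Φ‖ ≤ C * B

/-- The value at the covector `η` of the Fourier transform of `Φ u`, computed in the chart
at `p`. -/
def localFourier (u : (M → ℂ) → ℂ) (Φ : M → ℂ) (p : M) (η : F →L[ℝ] ℝ) : ℂ :=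
  u (fun q => Φ q * Complex.exp (-Complex.I * (η (extChartAt I p q) : ℂ)))

/-- A family `u j` of distributions on `O` is microlocally smooth at the covector `ξ` at `p`,
uniformly in `j`: for some cutoff `Φ` with `Φ p ≠ 0`, supported in the domain of the chart at `p`,
the Fourier transforms of `Φ (u j)` are `O(|ξ'|^{-∞})` for `ξ'` in a conic neighbourhood of `ξ`,
uniformly in `j`. (The tangent space at `p` is identified with the model space by the same
chart at `p`.) -/
def UniformlyMicroSmoothAt {ι : Type*} (O : Set M) (u : ι → (M → ℂ) → ℂ) (p : M)
    (ξ : TangentSpace I p →L[ℝ] ℝ) : Prop :=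
  ∃ Φ : M → ℂ, IsTest I O Φ ∧ tsupport Φ ⊆ (extChartAt I p).source ∧ Φ p ≠ 0 ∧
    ∃ W ∈ 𝓝 (show F →L[ℝ] ℝ from ξ), ∀ N : ℕ, ∃ C : ℝ, ∀ j, ∀ η ∈ W, ∀ s : ℝ, 1 ≤ s →
      s ^ N * ‖localFourier I (u j) Φ p (s • η)‖ ≤ C

/-- The wave front set of the distribution `u` on `O`, a set of nonzero covectors. -/
def waveFrontSet (O : Set M) (u : (M → ℂ) → ℂ) : Set (Σ p : M, (TangentSpace I p →L[ℝ] ℝ)) :=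
  {z | z.1 ∈ O ∧ z.2 ≠ 0 ∧ ¬ UniformlyMicroSmoothAt I O (fun _ : Unit => u) z.1 z.2}

variable {F' : Type*} [NormedAddCommGroup F'] [NormedSpace ℝ F']
  {H' : Type*} [TopologicalSpace H'] (I' : ModelWithCorners ℝ F' H')
  {Y : Type*} [TopologicalSpace Y] [ChartedSpace H' Y]

/-- The set of normals of a map `f : Y → M`: the covectors at `f y` that annihilate the range
of `df(y)`. If `f` is an embedding, this is the conormal bundle of its image. -/
def normals (f : Y → M) : Set (Σ p : M, (TangentSpace I p →L[ℝ] ℝ)) :=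
  {z | ∃ (y : Y) (ζ : TangentSpace I (f y) →L[ℝ] ℝ),
    ζ.comp (mfderiv I' I f y) = 0 ∧ z = ⟨f y, ζ⟩}

/-- A sequence `v j` of smooth functions on `O` converges to `u` in `𝓓'_Γ(O)` for a closed cone
`Γ` of covectors that is disjoint from the normals of `f`: it converges weakly, and it is
microlocally smooth, uniformly in `j`, at all nonzero normals of `f`. (The largest such `Γ` is
the set of nonzero covectors where uniform microlocal smoothness fails.) Functions on `M` are
distributions by means of the density `ν`. -/
def ConvergesOffNormals [MeasurableSpace M] (ν : Measure M) (f : Y → M) (O : Set M)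
    (v : ℕ → M → ℂ) (u : (M → ℂ) → ℂ) : Prop :=
  (∀ j, ContMDiffOn I 𝓘(ℝ, ℂ) ∞ (v j) O) ∧
  (∀ Φ, IsTest I O Φ → Tendsto (fun j => ∫ q, v j q * Φ q ∂ν) atTop (𝓝 (u Φ))) ∧
  ∀ z ∈ normals I I' f, z.1 ∈ O → z.2 ≠ 0 →
    UniformlyMicroSmoothAt I O (fun j Φ => ∫ q, v j q * Φ q ∂ν) z.1 z.2

/-- `w` is the pullback `f^* u` of the distribution `u` on `O ⊆ M`, a distribution on `f⁻¹(O)`, in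
the sense of Hörmander: the unique extension by sequential continuity from smooth functions,
where `f^* v = v ∘ f`, to the spaces `𝓓'_Γ(O)` with `Γ` disjoint from the normals of `f`. -/
def IsPullback [MeasurableSpace M] [MeasurableSpace Y] (ν : Measure M) (ν' : Measure Y)
    (f : Y → M) (O : Set M) (u : (M → ℂ) → ℂ) (w : (Y → ℂ) → ℂ) : Prop :=
  (∃ v, ConvergesOffNormals I I' ν f O v u) ∧
  ∀ v, ConvergesOffNormals I I' ν f O v u → ∀ χ, IsTest I' (f ⁻¹' O) χ →
    Tendsto (fun j => ∫ y, v j (f y) * χ y ∂ν') atTop (𝓝 (w χ))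

end Distributions

/-! ### Anosov flows -/

section Flows

variable {n : ℕ} {X : Type*} [TopologicalSpace X] [ChartedSpace (EuclideanSpace ℝ (Fin n)) X]

/-- A `C^∞` flow on `X`. -/
structure IsSmoothFlow (φ : ℝ → X → X) : Prop where
  smooth : ContMDiff (𝓘(ℝ, ℝ).prod (𝓡 n)) (𝓡 n) ∞ (fun p : ℝ × X => φ p.1 p.2)
  zero : ∀ x, φ 0 x = x
  add : ∀ s t x, φ (s + t) x = φ s (φ t x)

/-- The generator `V(x) = d/dt φ_t(x)` at `t = 0`. -/
def generator (φ : ℝ → X → X) (x : X) : TangentSpace (𝓡 n) x :=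
  (mfderiv 𝓘(ℝ, ℝ) (𝓡 n) (fun t : ℝ => φ t x) 0 : ℝ →L[ℝ] EuclideanSpace ℝ (Fin n)) 1

/-- `E` is a continuous subbundle of `TX`: it has continuous local frames. -/
def IsContinuousSubbundle [IsManifold (𝓡 n) ∞ X]
    (E : ∀ x : X, Submodule ℝ (TangentSpace (𝓡 n) x)) : Prop :=
  ∀ x₀ : X, ∃ U : Set X, IsOpen U ∧ x₀ ∈ U ∧
    ∃ (d : ℕ) (e : Fin d → ∀ x : X, TangentSpace (𝓡 n) x),
      (∀ i, ContinuousOn (fun x => (⟨x, e i x⟩ : TangentBundle (𝓡 n) X)) U) ∧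
      ∀ x ∈ U, LinearIndependent ℝ (fun i => e i x) ∧
        Submodule.span ℝ (range fun i => e i x) = E x

/-- `φ` is an Anosov flow with stable and unstable bundles `Es` and `Eu`. -/
structure IsAnosov [IsManifold (𝓡 n) ∞ X] (φ : ℝ → X → X)
    (Es Eu : ∀ x : X, Submodule ℝ (TangentSpace (𝓡 n) x)) : Prop extends
    IsSmoothFlow (n := n) φ where
  generator_ne_zero : ∀ x : X, generator (n := n) φ x ≠ 0
  continuous_stable : IsContinuousSubbundle Es
  continuous_unstable : IsContinuousSubbundle Eu
  /-- `E_u(x)` and `E_s(x)` are independent, and `T_x X = ℝ V(x) ⊕ (E_u(x) ⊕ E_s(x))`. -/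
  disjoint : ∀ x, Disjoint (Eu x) (Es x)
  isCompl : ∀ x, IsCompl (Submodule.span ℝ {generator (n := n) φ x}) (Eu x ⊔ Es x)
  map_stable : ∀ t x, (Es x).map (mfderiv (𝓡 n) (𝓡 n) (φ t) x).toLinearMap = Es (φ t x)
  map_unstable : ∀ t x, (Eu x).map (mfderiv (𝓡 n) (𝓡 n) (φ t) x).toLinearMap = Eu (φ t x)
  /-- Exponential contraction, forwards on `E_s` and backwards on `E_u`, in the norm of a smooth
  Riemannian metric. -/
  hyperbolic : ∃ (g : Bundle.ContMDiffRiemannianMetric (𝓡 n) ∞ (EuclideanSpace ℝ (Fin n))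
      (fun x : X => TangentSpace (𝓡 n) x)) (C θ : ℝ), 0 < θ ∧
    (∀ (x : X), ∀ v ∈ Es x, ∀ t : ℝ, 0 < t →
      √(g.inner (φ t x) (mfderiv (𝓡 n) (𝓡 n) (φ t) x v) (mfderiv (𝓡 n) (𝓡 n) (φ t) x v))
        ≤ C * Real.exp (-θ * |t|) * √(g.inner x v v)) ∧
    (∀ (x : X), ∀ v ∈ Eu x, ∀ t : ℝ, t < 0 →
      √(g.inner (φ t x) (mfderiv (𝓡 n) (𝓡 n) (φ t) x v) (mfderiv (𝓡 n) (𝓡 n) (φ t) x v))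
        ≤ C * Real.exp (-θ * |t|) * √(g.inner x v v))

variable {φ : ℝ → X → X}

theorem IsSmoothFlow.neg_period (h : IsSmoothFlow (n := n) φ) {x : X} {T : ℝ} (hx : φ T x = x) :
    φ (-T) x = x := by
  have h1 := h.add (-T) T x
  rw [hx, neg_add_cancel, h.zero] at h1
  exact h1.symm

/-- The differential `dφ_{-T}(x)` at a point with `φ_T(x) = x`, as an endomorphism of `T_x X`
(both tangent spaces are the model space, through the same chart). -/
def returnMap (φ : ℝ → X → X) (T : ℝ) (x : X) :
    TangentSpace (𝓡 n) x →ₗ[ℝ] TangentSpace (𝓡 n) x :=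
  (mfderiv (𝓡 n) (𝓡 n) (φ (-T)) x :
    EuclideanSpace ℝ (Fin n) →L[ℝ] EuclideanSpace ℝ (Fin n)).toLinearMap

theorem IsAnosov.returnMap_mem [IsManifold (𝓡 n) ∞ X]
    {Es Eu : ∀ x : X, Submodule ℝ (TangentSpace (𝓡 n) x)} (h : IsAnosov φ Es Eu)
    {x : X} {T : ℝ} (hx : φ T x = x) :
    ∀ v ∈ Eu x ⊔ Es x, returnMap (n := n) φ T x v ∈ Eu x ⊔ Es x := by
  have hx' := h.toIsSmoothFlow.neg_period hx
  have key : ∀ E : ∀ x : X, Submodule ℝ (TangentSpace (𝓡 n) x),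
      (∀ t x, (E x).map (mfderiv (𝓡 n) (𝓡 n) (φ t) x).toLinearMap = E (φ t x)) →
      ∀ v ∈ E x, returnMap (n := n) φ T x v ∈ E x := by
    intro E hE v hv
    have h2 : ∀ y, y = x → ∀ w : EuclideanSpace ℝ (Fin n),
        w ∈ (show Submodule ℝ (EuclideanSpace ℝ (Fin n)) from E y) →
        w ∈ (show Submodule ℝ (EuclideanSpace ℝ (Fin n)) from E x) := by
      rintro y rfl w hw
      exact hw
    apply h2 _ hx'
    have h3 := Submodule.mem_map_of_mem
      (f := (mfderiv (𝓡 n) (𝓡 n) (φ (-T)) x).toLinearMap) hv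
    rw [hE (-T) x] at h3
    exact h3
  intro v hv
  obtain ⟨a, ha, b, hb, rfl⟩ := Submodule.mem_sup.1 hv
  rw [map_add]
  exact add_mem (Submodule.mem_sup_left (key Eu h.map_unstable a ha))
    (Submodule.mem_sup_right (key Es h.map_stable b hb))

/-- The linearized Poincaré map `dφ_{-T}(x)` restricted to `E_u(x) ⊕ E_s(x)`, for
`φ_T(x) = x`. -/
def IsAnosov.poincare [IsManifold (𝓡 n) ∞ X]
    {Es Eu : ∀ x : X, Submodule ℝ (TangentSpace (𝓡 n) x)} (h : IsAnosov φ Es Eu)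
    {x : X} {T : ℝ} (hx : φ T x = x) :
    ↥(Eu x ⊔ Es x) →ₗ[ℝ] ↥(Eu x ⊔ Es x) :=
  (returnMap (n := n) φ T x).restrict (h.returnMap_mem hx)

/-- `|det(I - P)|`, with `P` the linearized Poincaré map. -/
def IsAnosov.absDet [IsManifold (𝓡 n) ∞ X]
    {Es Eu : ∀ x : X, Submodule ℝ (TangentSpace (𝓡 n) x)} (h : IsAnosov φ Es Eu)
    {x : X} {T : ℝ} (hx : φ T x = x) : ℝ :=
  |LinearMap.det (LinearMap.id - h.poincare hx)|

/-- `tr(∧^k P)`, with `P` the linearized Poincaré map. -/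
def IsAnosov.traceExt [IsManifold (𝓡 n) ∞ X]
    {Es Eu : ∀ x : X, Submodule ℝ (TangentSpace (𝓡 n) x)} (h : IsAnosov φ Es Eu)
    {x : X} {T : ℝ} (hx : φ T x = x) (k : ℕ) : ℝ :=
  LinearMap.trace ℝ _ (exteriorPower.map k (h.poincare hx))

/-- A periodic orbit: an orbit together with a period `T > 0`, not necessarily primitive. -/
@[ext] structure ClosedOrbit (φ : ℝ → X → X) where
  carrier : Set X
  period : ℝ
  period_pos : 0 < period
  exists_base : ∃ x, carrier = range (fun t => φ t x) ∧ φ period x = x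

theorem ClosedOrbit.apply_period (h : IsSmoothFlow (n := n) φ) (γ : ClosedOrbit φ) {x : X}
    (hx : x ∈ γ.carrier) : φ γ.period x = x := by
  obtain ⟨y, hy, hp⟩ := γ.exists_base
  rw [hy] at hx
  obtain ⟨s, rfl⟩ := hx
  show φ γ.period (φ s y) = φ s y
  rw [← h.add, add_comm, h.add, hp]

/-- The primitive (least positive) period of a periodic point. -/
def primitivePeriod (φ : ℝ → X → X) (x : X) : ℝ :=
  sInf {t | 0 < t ∧ φ t x = x}

/-! ### Densities, differential forms, and the propagator -/

/-- `μ` is a smooth positive density on `X`: in each chart it is a smooth positive multiple of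
Lebesgue measure. -/
def IsSmoothDensity [MeasurableSpace X] (μ : Measure X) : Prop :=
  ∀ x₀ : X, ∃ ρ : EuclideanSpace ℝ (Fin n) → ℝ,
    ContDiffOn ℝ ∞ ρ (extChartAt (𝓡 n) x₀).target ∧
    (∀ z ∈ (extChartAt (𝓡 n) x₀).target, 0 < ρ z) ∧
    ∀ A : Set X, MeasurableSet A → A ⊆ (extChartAt (𝓡 n) x₀).source →
      μ A = ∫⁻ z in extChartAt (𝓡 n) x₀ '' A, ENNReal.ofReal (ρ z)

variable (n X) in
/-- Complex valued differential `k`-forms on `X` (with no regularity). -/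
abbrev Form (k : ℕ) : Type _ := ∀ x : X, TangentSpace (𝓡 n) x [⋀^Fin k]→L[ℝ] ℂ

/-- The form `u` is `C^∞` at `x₀`: its coefficients in the chart at `x₀` are. -/
def Form.SmoothAt [IsManifold (𝓡 n) ∞ X] {k : ℕ} (u : Form n X k) (x₀ : X) : Prop :=
  ContMDiffAt (𝓡 n) 𝓘(ℝ, EuclideanSpace ℝ (Fin n) [⋀^Fin k]→L[ℝ] ℂ) ∞
    (fun x => (u x).compContinuousLinearMap
      ((trivializationAt (EuclideanSpace ℝ (Fin n)) (TangentSpace (𝓡 n)) x₀).symmL ℝ x)) x₀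

/-- The condition `ι_V α = 0` on an alternating `k`-form `α` at `x`, i.e. membership in the fibre
at `x` of the bundle `E_0^k`. For `k = 0` there is no condition. -/
def Annihilated (φ : ℝ → X → X) {k : ℕ} (x : X) (α : TangentSpace (𝓡 n) x [⋀^Fin k]→L[ℝ] ℂ) :
    Prop :=
  ∀ v : Fin k → TangentSpace (𝓡 n) x, (∃ i, v i = generator φ x) → α v = 0

/-- The pullback of forms `φ_t^* u`. -/
def pullForm (φ : ℝ → X → X) {k : ℕ} (t : ℝ) (u : Form n X k) : Form n X k :=
  fun y => (u (φ t y)).compContinuousLinearMap (mfderiv (𝓡 n) (𝓡 n) (φ t) y)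

/-- The operator `P = (1/i) L_V`, where `L_V u = d/dt φ_t^* u` at `t = 0`, evaluated at `x` and
on tangent vectors `v`. -/
def opP (φ : ℝ → X → X) {k : ℕ} (u : Form n X k) (x : X)
    (v : Fin k → TangentSpace (𝓡 n) x) : ℂ :=
  (1 / Complex.I) * deriv (fun t : ℝ => pullForm φ t u x v) 0

/-- The propagator `e^{-itP} = φ_{-t}^*` on `k`-forms. -/
def propagator (φ : ℝ → X → X) {k : ℕ} (t : ℝ) (u : Form n X k) : Form n X k :=
  pullForm φ (-t) u

/-- The propagator `φ_{-t}^*` on functions. -/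
def propagatorFun (φ : ℝ → X → X) (t : ℝ) (f : X → ℂ) (y : X) : ℂ := f (φ (-t) y)

/-- A smooth local frame `e` of the bundle `E_0^k` over `U`, with the coordinate functionals of
the frame. -/
structure LocalFrame [IsManifold (𝓡 n) ∞ X] (φ : ℝ → X → X) (k : ℕ) (U : Set X) (r : ℕ) where
  e : Fin r → Form n X k
  coord : Fin r → ∀ x : X, (TangentSpace (𝓡 n) x [⋀^Fin k]→L[ℝ] ℂ) →ₗ[ℂ] ℂ
  smooth : ∀ j, ∀ x ∈ U, (e j).SmoothAt x
  annihilated : ∀ j, ∀ x ∈ U, Annihilated φ x (e j x)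
  coord_e : ∀ i j, ∀ x ∈ U, coord i x (e j x) = if i = j then 1 else 0
  sum_coord : ∀ x ∈ U, ∀ α, Annihilated φ x α → ∑ j, coord j x α • e j x = α

/-- The matrix entry `B_{jl}(t)` of `e^{-itP}` in the local frame:
`e^{-itP} (f e_l) = ∑_j (B_{jl}(t) f) e_j`. -/
def LocalFrame.entry [IsManifold (𝓡 n) ∞ X] {k : ℕ} {U : Set X} {r : ℕ}
    (𝓕 : LocalFrame (n := n) φ k U r) (j l : Fin r) (t : ℝ) (f : X → ℂ) (y : X) : ℂ :=
  𝓕.coord j y (propagator φ t (fun x => f x • 𝓕.e l x) y)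

/-- The Schwartz kernel `K(t, y, x)`, with respect to the density `μ`, of a family of
operators `A t`: formally `(A t f)(y) = ∫ K(t, y, x) f(x) dμ(x)`, so that the pairing of `K`
with `Φ` is `∫∫ (A t (Φ(t, y, ·)))(y) dμ(y) dt`. -/
def schwartzKernel [MeasurableSpace X] (μ : Measure X) (A : ℝ → (X → ℂ) → X → ℂ)
    (Φ : ℝ × X × X → ℂ) : ℂ :=
  ∫ q : ℝ × X, A q.1 (fun x => Φ (q.1, q.2, x)) q.2 ∂(volume.prod μ)

/-! ### The flat trace -/

/-- The map `ι(t, x) = (t, x, x)`. -/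
def diag (q : ℝ × X) : ℝ × X × X := (q.1, q.2, q.2)

/-- The part of `ℝ × X × X` over `t ≠ 0` and `U × U`. -/
def domainOver (U : Set X) : Set (ℝ × X × X) := {q | q.1 ≠ 0 ∧ q.2.1 ∈ U ∧ q.2.2 ∈ U}

variable (n) in
/-- `w` is the pullback `ι^* K` of the distribution `K` on `{t ≠ 0} × U × U` to the diagonal, a
distribution on `{t ≠ 0} × U`. -/
def IsDiagonalPullback [MeasurableSpace X] (μ : Measure X) (U : Set X)
    (K : (ℝ × X × X → ℂ) → ℂ) (w : (ℝ × X → ℂ) → ℂ) : Prop :=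
  IsPullback (𝓘(ℝ, ℝ).prod ((𝓡 n).prod (𝓡 n))) (𝓘(ℝ, ℝ).prod (𝓡 n))
    (volume.prod (μ.prod μ)) (volume.prod μ) diag (domainOver U) K w

variable (n) in
/-- `τ` is the restriction to the diagonal of the (fibrewise trace of the) kernel of `e^{-itP}` on
sections of `E_0^k`, a distribution on `{t ≠ 0} × X`: over the domain of any local frame it is
`ι^* K^k`, with `K^k` the kernel of the sum of the diagonal entries `B_{jj}(t)`. -/
def IsDiagonalTrace [IsManifold (𝓡 n) ∞ X] [MeasurableSpace X] (φ : ℝ → X → X) (μ : Measure X)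
    (k : ℕ) (τ : (ℝ × X → ℂ) → ℂ) : Prop :=
  IsDistribution (𝓘(ℝ, ℝ).prod (𝓡 n)) {q : ℝ × X | q.1 ≠ 0} τ ∧
  ∀ (U : Set X), IsOpen U → ∀ (r : ℕ) (𝓕 : LocalFrame (n := n) φ k U r),
    IsDiagonalPullback n μ U (schwartzKernel μ fun t f y => ∑ j, 𝓕.entry j j t f y) τ

variable (n) in
/-- `T` is the flat trace of `e^{-itP}` on `C^∞(X; E_0^k)`, a distribution in `t ≠ 0`: the
pushforward under `(t, x) ↦ t` of the restriction of the kernel to the diagonal. -/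
def IsFlatTrace [IsManifold (𝓡 n) ∞ X] [MeasurableSpace X] (φ : ℝ → X → X) (μ : Measure X)
    (k : ℕ) (T : (ℝ → ℂ) → ℂ) : Prop :=
  ∃ τ, IsDiagonalTrace n φ μ k τ ∧ ∀ χ, IsTest 𝓘(ℝ, ℝ) {t : ℝ | t ≠ 0} χ →
    T χ = τ (fun q => χ q.1)

end Flows

end Guillemin

end

/-! The kernel of `φ_{-t}^*` is the delta distribution on the graph `x = φ_{-t}(y)`; on forms, in a
local frame, it carries in addition a smooth coefficient `a(t, y)`. Everything is therefore proved
for `graphKernel μ φ a`. Over the diagonal this distribution lives at the periodic points. A normal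
covector of the diagonal has the form `(0, -ξ, ξ)`, and it is conormal to the graph at a periodic
point exactly when `ξ` annihilates `V` and the range of `dφ_{-t} - I`. An eigenvector of the
linearized Poincaré map `P` with eigenvalue 1 would contradict exponential contraction, so `I - P`
is invertible on `E_u ⊕ E_s` (`IsAnosov.absDet_pos`), and such a `ξ` is zero. This transversality is
the only place where hyperbolicity acts, and it is used twice.

For the wave front set, the kernel is approximated by smooth functions `mollSum`, mollified in
charts. At a periodic point, pairing them with an exponential gives an average of oscillatory
integrals over shifted graphs, whose phase is nonstationary at the normals of the diagonal
(`IsAnosov.exists_nonstationary_phase`). Integration by parts gives rapid decay uniformly along the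
approximation (`IsAnosov.convergesOffNormals_mollSum`); in the limit the wave front set misses the
normals.

For the value of the restriction, the diagonal values of the approximations are computed directly.
The map `(t, z) ↦ (ℓ z, φ_{-t} z - z)` is a local diffeomorphism near a periodic point, with
Jacobian `|ℓ(V)| |det(I - P)|`. A change of variables turns the mollifier into a delta function in
the second component and leaves an integral over an arc of the orbit, divided by `|det(I - P)|`
(`IsAnosov.tendsto_integral_displacement`). That every other admissible approximation has the same
limit is Hörmander's theorem, proved here for the diagonal by Fourier analysis
(`exists_tendsto_diag`): the limit is an integral of local Fourier transforms, dominated because one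
factor decays near the normals and the other one away from them.

The arc integrals are assembled into one functional `orbitSum` on `{t ≠ 0} × X`. By compactness only
finitely many closed orbits have bounded period. On forms the coefficient at a periodic point is the
trace of the pullback by `dφ_{-T}` on forms annihilated by `V`, which is `tr(∧^k P)`
(`sum_coord_comp_eq_trace`). Existence of local frames makes the diagonal trace unique, and
integration along each orbit in the pushforward to `t` produces the primitive period. -/

noncomputable section

namespace Guillemin

set_option linter.unusedSectionVars false

/-! ### Fourier inversion and decay on a finite dimensional normed space. -/

section Fourier

variable {F : Type*} [NormedAddCommGroup F] [NormedSpace ℝ F] [MeasurableSpace F]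

/-- The Fourier transform of `g` at the covector `η`. -/
def fourierAt (μ : Measure F) (g : F → ℂ) (η : F →L[ℝ] ℝ) : ℂ :=
  ∫ x, g x * Complex.exp (-Complex.I * (η x : ℂ)) ∂μ

theorem norm_exp_neg_I_mul (r : ℝ) : ‖Complex.exp (-Complex.I * (r : ℂ))‖ = 1 := by
  rw [neg_mul, mul_comm, ← neg_mul, ← Complex.ofReal_neg, Complex.norm_exp_ofReal_mul_I]

theorem norm_exp_I_mul (r : ℝ) : ‖Complex.exp (Complex.I * (r : ℂ))‖ = 1 := by
  rw [mul_comm, Complex.norm_exp_ofReal_mul_I]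

theorem norm_fourierAt_le (μ : Measure F) (g : F → ℂ) (η : F →L[ℝ] ℝ) :
    ‖fourierAt μ g η‖ ≤ ∫ x, ‖g x‖ ∂μ := by
  refine (norm_integral_le_integral_norm _).trans (le_of_eq ?_)
  simp only [norm_mul, norm_exp_neg_I_mul, mul_one]

variable [FiniteDimensional ℝ F] [BorelSpace F]

/-- Covectors on `F`, parametrized by the Euclidean space of the same dimension. -/
def covectorParam (F : Type*) [NormedAddCommGroup F] [NormedSpace ℝ F] [FiniteDimensional ℝ F] :
    EuclideanSpace ℝ (Fin (Module.finrank ℝ F)) →L[ℝ] (F →L[ℝ] ℝ) :=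
  -- The factor `2 * Real.pi` matches the convention `exp(-2πi⟨v, w⟩)` of the Fourier transform on
  -- Euclidean space, while `fourierAt` uses `exp(-iη(x))`.
  (2 * Real.pi) • (((ContinuousLinearMap.compL ℝ F
    (EuclideanSpace ℝ (Fin (Module.finrank ℝ F))) ℝ).flip
      ((toEuclidean : F ≃L[ℝ] _) : F →L[ℝ] _)).comp (innerSL ℝ))

theorem covectorParam_apply (v : EuclideanSpace ℝ (Fin (Module.finrank ℝ F))) (x : F) :
    covectorParam F v x = 2 * Real.pi * inner ℝ v (toEuclidean x) := by
  simp [covectorParam]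

theorem covectorParam_surjective : Function.Surjective (covectorParam F) := by
  intro η
  refine ⟨(2 * Real.pi)⁻¹ • (InnerProductSpace.toDual ℝ _).symm
    (η.comp ((toEuclidean : F ≃L[ℝ] _).symm :
      EuclideanSpace ℝ (Fin (Module.finrank ℝ F)) →L[ℝ] F)), ?_⟩
  ext x
  rw [covectorParam_apply, inner_smul_left, InnerProductSpace.toDual_symm_apply]
  have : (2 * Real.pi) ≠ 0 := by positivity
  simp
  field_simp

theorem exists_norm_le_covectorParam :
    ∃ C : ℝ, 0 ≤ C ∧ ∀ v, ‖v‖ ≤ C * ‖covectorParam F v‖ := by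
  refine ⟨‖((toEuclidean : F ≃L[ℝ] _).symm :
    EuclideanSpace ℝ (Fin (Module.finrank ℝ F)) →L[ℝ] F)‖, norm_nonneg _, fun v => ?_⟩
  by_cases hv : v = 0
  · simp [hv]
  have h1 : covectorParam F v ((toEuclidean : F ≃L[ℝ] _).symm v) = 2 * Real.pi * ‖v‖ ^ 2 := by
    rw [covectorParam_apply, ContinuousLinearEquiv.apply_symm_apply, real_inner_self_eq_norm_sq]
  have h2 := (covectorParam F v).le_opNorm ((toEuclidean : F ≃L[ℝ] _).symm v)
  rw [h1, Real.norm_of_nonneg (by positivity)] at h2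
  have h3 := ((toEuclidean : F ≃L[ℝ] _).symm :
    EuclideanSpace ℝ (Fin (Module.finrank ℝ F)) →L[ℝ] F).le_opNorm v
  have h4 : 0 < ‖v‖ := norm_pos_iff.2 hv
  have h5 : 2 * Real.pi * ‖v‖ ^ 2 ≤ ‖covectorParam F v‖ *
      (‖((toEuclidean : F ≃L[ℝ] _).symm :
        EuclideanSpace ℝ (Fin (Module.finrank ℝ F)) →L[ℝ] F)‖ * ‖v‖) :=
    h2.trans (mul_le_mul_of_nonneg_left h3 (norm_nonneg _))
  have h6 : ‖v‖ ^ 2 ≤ 2 * Real.pi * ‖v‖ ^ 2 := by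
    nlinarith [Real.pi_gt_three, sq_nonneg ‖v‖]
  have h7 := h6.trans h5
  refine le_of_mul_le_mul_right ?_ h4
  nlinarith

/-- Fourier inversion and decay for smooth functions with compact support. -/
theorem exists_fourier_inversion (μ : Measure F) [μ.IsAddHaarMeasure] :
    ∃ c : ℂ, ∀ g : F → ℂ, ContDiff ℝ ∞ g → HasCompactSupport g →
      Continuous (fun v => fourierAt μ g (covectorParam F v)) ∧
      (∀ k : ℕ, Integrable fun v => (1 + ‖covectorParam F v‖) ^ k *
        ‖fourierAt μ g (covectorParam F v)‖) ∧
      (∀ k : ℕ, ∃ C : ℝ, ∀ η, (1 + ‖η‖) ^ k * ‖fourierAt μ g η‖ ≤ C) ∧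
      ∀ x, g x = c * ∫ v, fourierAt μ g (covectorParam F v) *
        Complex.exp (Complex.I * (covectorParam F v x : ℂ)) := by
  let e : F ≃L[ℝ] EuclideanSpace ℝ (Fin (Module.finrank ℝ F)) := toEuclidean
  have he : (Measure.map e μ).IsAddHaarMeasure := e.isAddHaarMeasure_map μ
  -- By uniqueness of Haar measure, `μ` is `c₀` times Lebesgue measure in Euclidean coordinates; the
  -- inversion constant is the inverse of `c₀`.
  obtain ⟨c₀, hc₀, hc⟩ : ∃ c₀ : ENNReal, (c₀ ≠ 0 ∧ c₀ ≠ ⊤) ∧ Measure.map e μ = c₀ • volume := by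
    refine ⟨Measure.addHaarScalarFactor (Measure.map e μ) volume, ⟨?_, ENNReal.coe_ne_top⟩,
      Measure.isAddLeftInvariant_eq_smul _ _⟩
    exact_mod_cast (Measure.addHaarScalarFactor_pos_of_isAddHaarMeasure _ _).ne'
  have hc1 : c₀.toReal ≠ 0 := ENNReal.toReal_ne_zero.2 hc₀
  refine ⟨(c₀.toReal : ℂ)⁻¹, fun g hg hgc => ?_⟩
  have hf1 : ContDiff ℝ ∞ (g ∘ e.symm) := hg.comp e.symm.contDiff
  have hf2 : HasCompactSupport (g ∘ e.symm) := hgc.comp_homeomorph e.symm.toHomeomorph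
  let f : SchwartzMap _ ℂ := hf2.toSchwartzMap hf1
  have hfe : ∀ w, f w = g (e.symm w) := fun w => rfl
  have key : ∀ v, fourierAt μ g (covectorParam F v) = c₀.toReal * (FourierTransform.fourier f) v := by
    intro v
    have h1 : fourierAt μ g (covectorParam F v) =
        ∫ w, f w * Complex.exp (-Complex.I * ((2 * Real.pi * inner ℝ v w : ℝ) : ℂ))
          ∂(Measure.map e μ) := by
      rw [show (e : F → _) = e.toHomeomorph from rfl,
        e.toHomeomorph.measurableEmbedding.integral_map]
      unfold fourierAt
      congr 1
      ext x
      have : e.toHomeomorph x = toEuclidean x := rfl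
      rw [covectorParam_apply, hfe, this]
      simp [e]
    rw [h1, hc, integral_smul_measure, SchwartzMap.fourier_coe, Real.fourier_eq']
    rw [Complex.real_smul]
    congr 2
    ext w
    rw [smul_eq_mul, mul_comm, real_inner_comm]
    congr 2
    push_cast
    ring
  have hcont : Continuous (fun v => fourierAt μ g (covectorParam F v)) := by
    simp_rw [key]
    exact continuous_const.mul (FourierTransform.fourier f).continuous
  obtain ⟨C₁, hC₁, hC₁'⟩ := exists_norm_le_covectorParam (F := F)
  have hLn : ∀ v, ‖covectorParam F v‖ ≤ ‖covectorParam F‖ * ‖v‖ := (covectorParam F).le_opNorm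
  -- Weights in the covector are dominated by weights in the Euclidean parameter, so that the
  -- Schwartz seminorms control both integrability and pointwise decay.
  have h2 : ∀ (k : ℕ) v, (1 + ‖covectorParam F v‖) ^ k ≤
      2 ^ k * (1 + ‖covectorParam F‖) ^ k * (1 + ‖v‖ ^ k) := by
    intro k v
    have : 1 + ‖covectorParam F v‖ ≤ (1 + ‖covectorParam F‖) * (1 + ‖v‖) := by
      nlinarith [hLn v, norm_nonneg v, norm_nonneg (covectorParam F)]
    calc (1 + ‖covectorParam F v‖) ^ k ≤ ((1 + ‖covectorParam F‖) * (1 + ‖v‖)) ^ k := by gcongr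
      _ = (1 + ‖covectorParam F‖) ^ k * (1 + ‖v‖) ^ k := mul_pow _ _ _
      _ ≤ (1 + ‖covectorParam F‖) ^ k * (2 ^ k * (1 + ‖v‖ ^ k)) := by
        gcongr
        have h3 : (1 + ‖v‖) ≤ 2 * max 1 ‖v‖ := by
          rcases le_total 1 ‖v‖ with h | h
          · rw [max_eq_right h]; linarith
          · rw [max_eq_left h]; linarith
        calc (1 + ‖v‖) ^ k ≤ (2 * max 1 ‖v‖) ^ k := by gcongr
          _ = 2 ^ k * (max 1 ‖v‖) ^ k := mul_pow _ _ _
          _ ≤ 2 ^ k * (1 + ‖v‖ ^ k) := by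
            gcongr
            rcases le_total 1 ‖v‖ with h | h
            · rw [max_eq_right h]; linarith
            · rw [max_eq_left h, one_pow]; linarith [pow_nonneg (norm_nonneg v) k]
      _ = _ := by ring
  refine ⟨hcont, fun k => ?_, fun k => ?_, fun x => ?_⟩
  · have h1 := ((FourierTransform.fourier f).integrable.norm.add
      ((FourierTransform.fourier f).integrable_pow_mul volume k)).const_mul
        (2 ^ k * (1 + ‖covectorParam F‖) ^ k * c₀.toReal)
    refine h1.mono' ?_ (Eventually.of_forall fun v => ?_)
    · exact (Continuous.mul (by fun_prop) hcont.norm).aestronglyMeasurable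
    · rw [key, norm_mul, norm_norm, norm_mul,
        Real.norm_of_nonneg (by positivity), Complex.norm_real,
        Real.norm_of_nonneg ENNReal.toReal_nonneg]
      simp only [Pi.add_apply]
      calc (1 + ‖covectorParam F v‖) ^ k * (c₀.toReal * ‖(FourierTransform.fourier f) v‖)
          ≤ (2 ^ k * (1 + ‖covectorParam F‖) ^ k * (1 + ‖v‖ ^ k)) *
            (c₀.toReal * ‖(FourierTransform.fourier f) v‖) := by gcongr; exact h2 k v
        _ = _ := by ring
  · obtain ⟨A, -, hA⟩ := (FourierTransform.fourier f).decay 0 0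
    obtain ⟨B, -, hB⟩ := (FourierTransform.fourier f).decay k 0
    simp only [norm_iteratedFDeriv_zero, pow_zero, one_mul] at hA hB
    refine ⟨2 ^ k * (1 + ‖covectorParam F‖) ^ k * c₀.toReal * (A + B), fun η => ?_⟩
    obtain ⟨v, rfl⟩ := covectorParam_surjective η
    rw [key, norm_mul, Complex.norm_real, Real.norm_of_nonneg ENNReal.toReal_nonneg]
    calc (1 + ‖covectorParam F v‖) ^ k * (c₀.toReal * ‖(FourierTransform.fourier f) v‖)
        ≤ (2 ^ k * (1 + ‖covectorParam F‖) ^ k * (1 + ‖v‖ ^ k)) *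
          (c₀.toReal * ‖(FourierTransform.fourier f) v‖) := by gcongr; exact h2 k v
      _ = 2 ^ k * (1 + ‖covectorParam F‖) ^ k * c₀.toReal * (‖(FourierTransform.fourier f) v‖ +
            ‖v‖ ^ k * ‖(FourierTransform.fourier f) v‖) := by ring
      _ ≤ _ := by gcongr <;> [exact hA v; exact hB v]
  · have h1 := congrFun (f.continuous.fourierInv_fourier_eq f.integrable
      (FourierTransform.fourier f).integrable) (e x)
    rw [hfe, e.symm_apply_apply, Real.fourierInv_eq'] at h1
    rw [← h1]
    simp_rw [key]
    have h2 : ∀ v, (c₀.toReal : ℂ) * (FourierTransform.fourier f) v *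
        Complex.exp (Complex.I * (covectorParam F v x : ℂ)) = (c₀.toReal : ℂ) *
        ((FourierTransform.fourier f) v *
        Complex.exp (Complex.I * (covectorParam F v x : ℂ))) := fun v => by ring
    simp_rw [h2]
    rw [integral_const_mul, ← mul_assoc, inv_mul_cancel₀ (by exact_mod_cast hc1), one_mul]
    congr 1
    ext v
    rw [covectorParam_apply, smul_eq_mul, mul_comm, SchwartzMap.fourier_coe]
    congr 2
    rw [mul_comm]

end Fourier

end Guillemin

end

/-! ### Nonstationary phase, uniformly in parameters. -/

noncomputable section

namespace Guillemin

set_option linter.unusedSectionVars false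

section NonStationary

variable {Q D : Type*} [NormedAddCommGroup Q] [NormedSpace ℝ Q]
  [NormedAddCommGroup D] [NormedSpace ℝ D]

/-- Off the support of `A` the product vanishes locally, so nothing is needed of `f` there. This
allows division by a phase derivative that may vanish elsewhere. -/
theorem contDiff_mul_of_tsupport {f A : D → ℂ} (hA : ContDiff ℝ ∞ A)
    (hf : ∀ x ∈ tsupport A, ContDiffAt ℝ ∞ f x) : ContDiff ℝ ∞ (fun x => A x * f x) := by
  rw [contDiff_iff_contDiffAt]
  intro x
  by_cases hx : x ∈ tsupport A
  · exact hA.contDiffAt.mul (hf x hx)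
  · have h : (fun x => A x * f x) =ᶠ[𝓝 x] fun _ => 0 := by
      filter_upwards [notMem_tsupport_iff_eventuallyEq.1 hx] with y hy
      rw [hy]; simp
    exact contDiffAt_const.congr_of_eventuallyEq h

variable [FiniteDimensional ℝ D] [MeasurableSpace D] [BorelSpace D]

/-- Nonstationary phase with parameters: an oscillatory integral decays rapidly, uniformly in the
parameters, if the derivative of the phase in some direction vanishes nowhere on the support of
the amplitude. -/
theorem exists_nonstationary_bound (μ : Measure D) [μ.IsAddHaarMeasure]
    (p : Q × D → ℝ) (e : D) (N : ℕ) :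
    ∀ A : Q × D → ℂ, ContDiff ℝ ∞ A → HasCompactSupport A →
    (∀ x ∈ tsupport A, ContDiffAt ℝ ∞ p x ∧ fderiv ℝ p x (0, e) ≠ 0) →
    ∃ C : ℝ, ∀ q : Q, ∀ s : ℝ, 1 ≤ s →
      s ^ N * ‖∫ d, A (q, d) * Complex.exp (-Complex.I * ((s * p (q, d) : ℝ) : ℂ)) ∂μ‖ ≤ C := by
  -- The amplitude is quantified after `N`: each integration by parts gains a factor `1/s` and
  -- replaces `A` by the `e`-derivative of `A` divided by the `e`-derivative of the phase, whose
  -- support is no larger.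
  induction N with
  | zero =>
    intro A hA hAc _
    obtain ⟨M, hM⟩ := hAc.exists_bound_of_continuous hA.continuous
    have hK : IsCompact (Prod.snd '' tsupport A) := hAc.isCompact.image continuous_snd
    refine ⟨M * μ.real (Prod.snd '' tsupport A), fun q s _ => ?_⟩
    rw [pow_zero, one_mul, ← setIntegral_eq_integral_of_forall_compl_eq_zero
      (s := Prod.snd '' tsupport A)]
    · refine norm_setIntegral_le_of_norm_le_const hK.measure_lt_top fun d _ => ?_
      rw [norm_mul, norm_exp_neg_I_mul, mul_one]
      exact hM _
    · intro d hd
      have : A (q, d) = 0 := by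
        by_contra h
        exact hd ⟨(q, d), subset_tsupport _ h, rfl⟩
      rw [this, zero_mul]
  | succ N ih =>
    intro A hA hAc hp
    set P : Q × D → ℂ := fun x => ((fderiv ℝ p x (0, e) : ℝ) : ℂ)⁻¹ with hP
    have hfp : ∀ x ∈ tsupport A, ContDiffAt ℝ ∞ (fun x => fderiv ℝ p x (0, e)) x := fun x hx =>
      ((hp x hx).1.fderiv_right (m := ∞) (by simp)).clm_apply contDiffAt_const
    have hPs : ∀ x ∈ tsupport A, ContDiffAt ℝ ∞ P x := by
      intro x hx
      have h1 : ContDiffAt ℝ ∞ (fun x => ((fderiv ℝ p x (0, e) : ℝ) : ℂ)) x :=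
        Complex.ofRealCLM.contDiff.contDiffAt.comp x (hfp x hx)
      exact h1.inv (by exact_mod_cast (hp x hx).2)
    set B : Q × D → ℂ := fun x => A x * P x with hB
    have hBs : ContDiff ℝ ∞ B := contDiff_mul_of_tsupport hA hPs
    have hBt : tsupport B ⊆ tsupport A := closure_mono (Function.support_mul_subset_left _ _)
    have hBc : HasCompactSupport B := hAc.mul_right
    set A' : Q × D → ℂ := fun x => fderiv ℝ B x (0, e) with hA'
    have hA's : ContDiff ℝ ∞ A' := (hBs.fderiv_right (m := ∞) (by simp)).clm_apply contDiff_const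
    have hA't : tsupport A' ⊆ tsupport A := by
      refine (closure_minimal ?_ (isClosed_tsupport B)).trans hBt
      intro x hx
      apply tsupport_fderiv_subset ℝ
      apply subset_tsupport
      intro h
      apply hx
      simp only [A']
      rw [h]; rfl
    have hA'c : HasCompactSupport A' := hAc.mono' ((subset_tsupport _).trans hA't)
    obtain ⟨C, hC⟩ := ih A' hA's hA'c fun x hx => hp x (hA't hx)
    refine ⟨C, fun q s hs => ?_⟩
    have hs0 : (s : ℂ) ≠ 0 := by
      have : s ≠ 0 := by linarith
      exact_mod_cast this
    set Ex : Q × D → ℂ := fun x => Complex.exp (-Complex.I * ((s * p x : ℝ) : ℂ)) with hEx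
    have hExs : ∀ x ∈ tsupport A, ContDiffAt ℝ ∞ Ex x := by
      intro x hx
      refine Complex.contDiff_exp.contDiffAt.comp x (contDiffAt_const.mul ?_)
      exact Complex.ofRealCLM.contDiff.contDiffAt.comp x (contDiffAt_const.mul (hp x hx).1)
    have hint : ∀ G : Q × D → ℂ, ContDiff ℝ ∞ G → tsupport G ⊆ tsupport A →
        Integrable (fun d => G (q, d) * Ex (q, d)) μ := by
      intro G hG hGt
      have h1 : Continuous (fun d => G (q, d) * Ex (q, d)) :=
        (contDiff_mul_of_tsupport hG fun x hx => hExs x (hGt hx)).continuous.comp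
          (by fun_prop : Continuous fun d : D => (q, d))
      refine h1.integrable_of_hasCompactSupport ?_
      refine HasCompactSupport.intro (hAc.isCompact.image continuous_snd) fun d hd => ?_
      have : G (q, d) = 0 := by
        by_contra h
        exact hd ⟨(q, d), hGt (subset_tsupport _ h), rfl⟩
      rw [this, zero_mul]
    have hin : ∀ d : D, HasFDerivAt (fun d : D => (q, d)) (ContinuousLinearMap.inr ℝ Q D) d :=
      fun d => hasFDerivAt_prodMk_right q d
    have hb : ∀ d : D, HasFDerivAt (fun d => B (q, d))
        ((fderiv ℝ B (q, d)).comp (ContinuousLinearMap.inr ℝ Q D)) d := fun d =>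
      (hBs.differentiable (by simp) (q, d)).hasFDerivAt.comp d (hin d)
    have hE1 : ∀ d : D, (q, d) ∈ tsupport A → HasFDerivAt (fun d => Ex (q, d))
        ((fderiv ℝ Ex (q, d)).comp (ContinuousLinearMap.inr ℝ Q D)) d := fun d hd =>
      ((hExs _ hd).differentiableAt (by simp)).hasFDerivAt.comp d (hin d)
    have hE2 : ∀ x ∈ tsupport A, fderiv ℝ Ex x (0, e) =
        -Complex.I * s * (fderiv ℝ p x (0, e) : ℝ) * Ex x := by
      intro x hx
      have h1 : HasFDerivAt p (fderiv ℝ p x) x := ((hp x hx).1.differentiableAt (by simp)).hasFDerivAt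
      have h2 : HasFDerivAt (fun x => -Complex.I * ((s * p x : ℝ) : ℂ))
          ((-Complex.I) • (Complex.ofRealCLM.comp (s • fderiv ℝ p x))) x :=
        ((Complex.ofRealCLM.hasFDerivAt.comp x (h1.const_mul s))).const_mul _
      rw [(h2.cexp).fderiv]
      simp [Ex]
      ring
    have htA : ∀ d : D, d ∈ tsupport (fun d => B (q, d)) → (q, d) ∈ tsupport A := by
      intro d hd
      have h1 : IsClosed {d : D | (q, d) ∈ tsupport A} :=
        (isClosed_tsupport A).preimage (by fun_prop : Continuous fun d : D => (q, d))
      refine closure_minimal (fun d hd => ?_) h1 hd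
      exact hBt (subset_tsupport _ hd)
    -- The `e`-derivative of the exponential is `-is ∂_e p` times the exponential; dividing by `∂_e
    -- p`, which is nonzero on the support of `A`, displays the integrand as a multiple of a
    -- derivative.
    have hpt : ∀ d, A (q, d) * Ex (q, d) =
        (Complex.I / s) * (B (q, d) * fderiv ℝ (fun d => Ex (q, d)) d e) := by
      intro d
      by_cases hd : (q, d) ∈ tsupport A
      · have h1 := hE2 _ hd
        have hne : ((fderiv ℝ p (q, d) (0, e) : ℝ) : ℂ) ≠ 0 := by exact_mod_cast (hp _ hd).2
        rw [(hE1 d hd).fderiv]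
        have h3 : (((fderiv ℝ Ex (q, d)).comp (ContinuousLinearMap.inr ℝ Q D)) e) =
          fderiv ℝ Ex (q, d) (0, e) := rfl
        rw [h3, h1]
        simp only [B, P]
        field_simp
        linear_combination (1 : ℂ) * A (q, d) * Ex (q, d) * Complex.I_sq
      · have : A (q, d) = 0 := by
          by_contra h
          exact hd (subset_tsupport _ h)
        simp [B, this]
    have hI0 : Complex.I / s ≠ 0 := div_ne_zero Complex.I_ne_zero hs0
    have hparts := integral_mul_fderiv_eq_neg_fderiv_mul_of_integrable (μ := μ)
      (f := fun d => B (q, d)) (g := fun d => Ex (q, d)) (v := e)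
      (by
        refine (hint A' hA's hA't).congr (Eventually.of_forall fun d => ?_)
        simp only
        rw [(hb d).fderiv]; rfl)
      (by
        have h1 := (hint A hA subset_rfl).const_mul ((Complex.I / s)⁻¹)
        refine h1.congr (Eventually.of_forall fun d => ?_)
        simp only
        rw [hpt, inv_mul_cancel_left₀ hI0])
      (hint B hBs hBt)
      (fun d _ => (hb d).differentiableAt) (fun d hd => (hE1 d (htA d hd)).differentiableAt)
    have hfin : ∫ d, A (q, d) * Ex (q, d) ∂μ = -(Complex.I / s) * ∫ d, A' (q, d) * Ex (q, d) ∂μ := by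
      simp_rw [hpt]
      rw [integral_const_mul, hparts, mul_neg, neg_mul]
      congr 2
      refine integral_congr_ae (Eventually.of_forall fun d => ?_)
      simp only
      rw [(hb d).fderiv]; rfl
    have hC' := hC q s hs
    change s ^ (N + 1) * ‖∫ d, A (q, d) * Ex (q, d) ∂μ‖ ≤ C
    rw [hfin, norm_mul, norm_neg, norm_div, Complex.norm_I, Complex.norm_real,
      Real.norm_of_nonneg (by linarith)]
    refine le_trans (le_of_eq ?_) hC'
    have : s ≠ 0 := by linarith
    change _ = s ^ N * ‖∫ d, A' (q, d) * Ex (q, d) ∂μ‖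
    generalize ‖∫ d, A' (q, d) * Ex (q, d) ∂μ‖ = z
    field_simp
    ring

end NonStationary

end Guillemin

end

/-! ### Uniform polynomial bounds for Fourier transforms. -/

noncomputable section

namespace Guillemin

set_option linter.unusedSectionVars false

section PolyBound

variable {F : Type*} [NormedAddCommGroup F] [NormedSpace ℝ F]

theorem iteratedDeriv_exp_neg_I (k : ℕ) :
    iteratedDeriv k (fun r : ℝ => Complex.exp (-Complex.I * (r : ℂ))) =
      fun r : ℝ => (-Complex.I) ^ k * Complex.exp (-Complex.I * (r : ℂ)) := by
  induction k with
  | zero => simp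
  | succ k ih =>
    rw [iteratedDeriv_succ, ih]
    ext r
    have h : HasDerivAt (fun r : ℝ => -Complex.I * (r : ℂ)) (-Complex.I * 1) r :=
      (Complex.ofRealCLM.hasDerivAt (x := r)).const_mul _
    rw [(h.cexp.const_mul _).deriv]
    ring

theorem norm_iteratedFDeriv_exp_le (η : F →L[ℝ] ℝ) (k : ℕ) (x : F) :
    ‖iteratedFDeriv ℝ k (fun x => Complex.exp (-Complex.I * (η x : ℂ))) x‖ ≤ ‖η‖ ^ k := by
  have h1 : ContDiff ℝ ∞ (fun r : ℝ => Complex.exp (-Complex.I * (r : ℂ))) :=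
    Complex.contDiff_exp.comp (contDiff_const.mul Complex.ofRealCLM.contDiff)
  have h2 := η.iteratedFDeriv_comp_right h1 x (i := k) (by exact_mod_cast le_top)
  have h3 : (fun x => Complex.exp (-Complex.I * (η x : ℂ))) =
    (fun r : ℝ => Complex.exp (-Complex.I * (r : ℂ))) ∘ η := rfl
  rw [h3, h2]
  refine (ContinuousMultilinearMap.norm_compContinuousLinearMap_le _ _).trans ?_
  rw [norm_iteratedFDeriv_eq_norm_iteratedDeriv, iteratedDeriv_exp_neg_I, norm_mul,
    norm_exp_neg_I_mul]
  simp

variable [MeasurableSpace F]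

/-- The uniform boundedness principle for the Fourier transforms of a family of functions that is
bounded when tested against smooth functions. -/
theorem exists_fourierAt_poly_bound {ι : Type*} (μ : Measure F) (g : ι → F → ℂ)
    (hg : ∀ j, Integrable (g j) μ) [OpensMeasurableSpace F] [SecondCountableTopology F]
    (H : ∀ h : F → ℂ, ContDiff ℝ ∞ h → ∃ B : ℝ, ∀ j, ‖∫ x, g j x * h x ∂μ‖ ≤ B) :
    ∃ (N : ℕ) (C : ℝ), ∀ j η, ‖fourierAt μ (g j) η‖ ≤ C * (1 + ‖η‖) ^ N := by
  by_contra hcon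
  push Not at hcon
  -- If no bound held, then for each `m` the bound with exponent `m` and constant `m` would fail at
  -- some index `j m` and covector `η m`.
  choose j η hjη using fun m : ℕ => hcon m m
  -- With this weight the derivatives of `e m` of order at most `m` are bounded by 1. For each order
  -- only finitely many `m` are exceptional, hence every `ℓ¹` combination of the `e m` is smooth.
  set w : ℕ → ℝ := fun m => ((1 + ‖η m‖) ^ m)⁻¹ with hw
  have hw0 : ∀ m, 0 < w m := fun m => by positivity
  have hw1 : ∀ m, w m ≤ 1 := fun m => inv_le_one_of_one_le₀ (one_le_pow₀ (by linarith [norm_nonneg (η m)]))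
  set e : ℕ → F → ℂ := fun m x => (w m : ℂ) * Complex.exp (-Complex.I * (η m x : ℂ)) with he
  have hen : ∀ m x, ‖e m x‖ ≤ 1 := fun m x => by
    rw [norm_mul, norm_exp_neg_I_mul, mul_one, Complex.norm_real, Real.norm_of_nonneg (hw0 m).le]
    exact hw1 m
  have hes : ∀ m, ContDiff ℝ ∞ (e m) := fun m =>
    contDiff_const.mul (Complex.contDiff_exp.comp
      (contDiff_const.mul (Complex.ofRealCLM.contDiff.comp (η m).contDiff)))
  have hed : ∀ k m x, ‖iteratedFDeriv ℝ k (e m) x‖ ≤ w m * ‖η m‖ ^ k := by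
    intro k m x
    have h1 : e m = fun x => (w m : ℂ) • Complex.exp (-Complex.I * (η m x : ℂ)) := rfl
    have h2 : ContDiff ℝ ∞ (fun x => Complex.exp (-Complex.I * (η m x : ℂ))) :=
      (Complex.contDiff_exp.comp
      (contDiff_const.mul (Complex.ofRealCLM.contDiff.comp (η m).contDiff)))
    rw [h1, iteratedFDeriv_const_smul_apply' (h2.contDiffAt.of_le (by exact_mod_cast le_top)),
      norm_smul, Complex.norm_real, Real.norm_of_nonneg (hw0 m).le]
    exact mul_le_mul_of_nonneg_left (norm_iteratedFDeriv_exp_le _ _ _) (hw0 m).le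
  have hl : ∀ a : lp (fun _ : ℕ => ℂ) 1, Summable fun m => ‖a m‖ := fun a => by
    simpa using (lp.memℓp a).summable (by simp)
  have hln : ∀ a : lp (fun _ : ℕ => ℂ) 1, ‖a‖ = ∑' m, ‖a m‖ := fun a => by
    simpa using lp.norm_eq_tsum_rpow (p := 1) (by simp) a
  have hsum : ∀ (a : lp (fun _ : ℕ => ℂ) 1) x, Summable fun m => a m * e m x := fun a x =>
    Summable.of_norm_bounded (hl a) fun m => by
      rw [norm_mul]
      exact mul_le_of_le_one_right (norm_nonneg _) (hen m x)
  have hsm : ∀ a : lp (fun _ : ℕ => ℂ) 1, ContDiff ℝ ∞ (fun x => ∑' m, a m * e m x) := by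
    intro a
    refine contDiff_tsum (N := ⊤) (v := fun k m => ‖a m‖ * (w m * ‖η m‖ ^ k))
      (fun m => contDiff_const.mul (hes m)) (fun k _ => ?_) (fun k m x _ => ?_)
    · refine Summable.of_norm_bounded_eventually_nat (hl a) ?_
      filter_upwards [eventually_ge_atTop k] with m hm
      rw [Real.norm_of_nonneg (mul_nonneg (norm_nonneg _) (mul_nonneg (hw0 m).le (by positivity)))]
      refine mul_le_of_le_one_right (norm_nonneg _) ?_
      rw [hw]
      rw [inv_mul_le_iff₀ (by positivity), mul_one]
      calc ‖η m‖ ^ k ≤ (1 + ‖η m‖) ^ k := by gcongr; linarith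
        _ ≤ (1 + ‖η m‖) ^ m := pow_le_pow_right₀ (by linarith [norm_nonneg (η m)]) hm
    · have h1 : (fun x => a m * e m x) = fun x => a m • e m x := rfl
      rw [h1, iteratedFDeriv_const_smul_apply' ((hes m).contDiffAt.of_le (by exact_mod_cast le_top)),
        norm_smul]
      exact mul_le_mul_of_nonneg_left (hed k m x) (norm_nonneg _)
  have hbd : ∀ (a : lp (fun _ : ℕ => ℂ) 1) x, ‖∑' m, a m * e m x‖ ≤ ‖a‖ := fun a x => by
    rw [hln]
    refine tsum_of_norm_bounded (hl a).hasSum fun m => ?_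
    rw [norm_mul]
    exact mul_le_of_le_one_right (norm_nonneg _) (hen m x)
  have hint : ∀ (a : lp (fun _ : ℕ => ℂ) 1) i, Integrable (fun x => g i x * ∑' m, a m * e m x) μ :=
    fun a i => (hg i).mul_bdd (c := ‖a‖) (hsm a).continuous.aestronglyMeasurable
      (Eventually.of_forall (hbd a))
  -- Pairing with `ℓ¹` combinations of the exponentials moves the problem to a Banach space, where
  -- pointwise boundedness, given by `H`, implies boundedness in norm.
  let T : ι → (lp (fun _ : ℕ => ℂ) 1 →L[ℂ] ℂ) := fun i => LinearMap.mkContinuous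
    { toFun := fun a => ∫ x, g i x * ∑' m, a m * e m x ∂μ
      map_add' := fun a b => by
        rw [← integral_add (hint a i) (hint b i)]
        congr 1
        ext x
        rw [← mul_add, ← (hsum a x).tsum_add (hsum b x)]
        congr 2
        ext m
        rw [lp.coeFn_add, Pi.add_apply, add_mul]
      map_smul' := fun c a => by
        rw [RingHom.id_apply, smul_eq_mul, ← integral_const_mul]
        congr 1
        ext x
        have : (fun m => (c • a) m * e m x) = fun m => c * (a m * e m x) := by
          ext m
          rw [lp.coeFn_smul, Pi.smul_apply, smul_eq_mul, mul_assoc]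
        rw [this, tsum_mul_left]
        ring }
    (∫ x, ‖g i x‖ ∂μ) (fun a => by
      simp only [LinearMap.coe_mk, AddHom.coe_mk]
      rw [← integral_mul_const]
      refine norm_integral_le_of_norm_le ((hg i).norm.mul_const _) (Eventually.of_forall fun x => ?_)
      rw [norm_mul]
      exact mul_le_mul_of_nonneg_left (hbd a x) (norm_nonneg _))
  have hT : ∀ i a, T i a = ∫ x, g i x * ∑' m, a m * e m x ∂μ := fun i a => rfl
  obtain ⟨C', hC'⟩ := banach_steinhaus (g := T) (fun a => by
    obtain ⟨B, hB⟩ := H _ (hsm a)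
    exact ⟨B, fun i => by rw [hT]; exact hB i⟩)
  -- On the `m`th unit vector, `T (j m)` has modulus greater than `m` by the choice of `η m`,
  -- contradicting the norm bound `C'`.
  obtain ⟨m, hm'⟩ := exists_nat_gt C'
  have h1 := (T (j m)).le_of_opNorm_le (hC' (j m)) (lp.single 1 m (1 : ℂ))
  rw [lp.norm_single (by simp), norm_one, mul_one, hT] at h1
  have h2 : ∀ x, ∑' l, (lp.single 1 m (1 : ℂ) : lp (fun _ : ℕ => ℂ) 1) l * e l x = e m x := by
    intro x
    rw [tsum_eq_single m]
    · rw [lp.single_apply_self, one_mul]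
    · intro l hl
      rw [lp.single_apply_ne _ _ _ hl, zero_mul]
  simp_rw [h2] at h1
  have h3 : ∫ x, g (j m) x * e m x ∂μ = (w m : ℂ) * fourierAt μ (g (j m)) (η m) := by
    rw [fourierAt, ← integral_const_mul]
    congr 1
    ext x
    simp only [e]
    ring
  rw [h3, norm_mul, Complex.norm_real, Real.norm_of_nonneg (hw0 m).le] at h1
  have h4 := hjη m
  have h5 : (m : ℝ) < w m * ‖fourierAt μ (g (j m)) (η m)‖ := by
    rw [hw]
    rw [lt_inv_mul_iff₀ (by positivity)]
    linarith
  linarith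

end PolyBound

end Guillemin

end

/-! ### Conic decay of Fourier transforms, and restriction to a linear subspace in the limit. -/

noncomputable section

namespace Guillemin

set_option linter.unusedSectionVars false

section Decay

variable {F : Type*} [NormedAddCommGroup F] [NormedSpace ℝ F] [MeasurableSpace F]

/-- The Fourier transforms of the `g j` are rapidly decreasing near the direction `ζ`, uniformly
in `j`. -/
def DecaysNear {ι : Type*} (μ : Measure F) (g : ι → F → ℂ) (ζ : F →L[ℝ] ℝ) : Prop :=
  ∃ W ∈ 𝓝 ζ, ∀ N : ℕ, ∃ C : ℝ, ∀ j, ∀ η ∈ W, ∀ s : ℝ, 1 ≤ s →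
    s ^ N * ‖fourierAt μ (g j) (s • η)‖ ≤ C

/-- The Fourier transforms of the `g j` are polynomially bounded, uniformly in `j`. -/
def PolyBounded {ι : Type*} (μ : Measure F) (g : ι → F → ℂ) : Prop :=
  ∃ (N : ℕ) (C : ℝ), ∀ j η, ‖fourierAt μ (g j) η‖ ≤ C * (1 + ‖η‖) ^ N

variable [FiniteDimensional ℝ F] [BorelSpace F]

theorem continuous_fourierAt (μ : Measure F) {g : F → ℂ} (hg : Integrable g μ) :
    Continuous (fourierAt μ g) := by
  refine continuous_of_dominated (bound := fun x => ‖g x‖) (fun η => ?_) (fun η => ?_) hg.norm ?_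
  · refine hg.aestronglyMeasurable.mul (Continuous.aestronglyMeasurable ?_)
    fun_prop
  · refine Eventually.of_forall fun x => ?_
    rw [norm_mul, norm_exp_neg_I_mul, mul_one]
  · refine Eventually.of_forall fun x => ?_
    fun_prop

/-- The convolution theorem: insert the inversion formula for `ψ` and exchange the integrals.
Inversion is required of `ψ` only, so `g` may be merely integrable. -/
theorem fourierAt_mul_eq (μ : Measure F) [μ.IsAddHaarMeasure] {c : ℂ} {ψ g : F → ℂ}
    (hg : Integrable g μ)
    (hψi : Integrable fun v => ‖fourierAt μ ψ (covectorParam F v)‖)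
    (hψc : Continuous fun v => fourierAt μ ψ (covectorParam F v))
    (hψ : ∀ x, ψ x = c * ∫ v, fourierAt μ ψ (covectorParam F v) *
        Complex.exp (Complex.I * (covectorParam F v x : ℂ))) (η : F →L[ℝ] ℝ) :
    fourierAt μ (fun x => ψ x * g x) η = c * ∫ v, fourierAt μ ψ (covectorParam F v) *
      fourierAt μ g (η - covectorParam F v) := by
  have hψi' : Integrable fun v => fourierAt μ ψ (covectorParam F v) :=
    (integrable_norm_iff hψc.aestronglyMeasurable).1 hψi
  have hint : Integrable (fun z : F × EuclideanSpace ℝ (Fin (Module.finrank ℝ F)) =>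
      (g z.1 * fourierAt μ ψ (covectorParam F z.2)) *
        Complex.exp (-Complex.I * ((η - covectorParam F z.2) z.1 : ℂ))) (μ.prod volume) := by
    refine (hg.mul_prod hψi').mul_bdd (c := 1) (Continuous.aestronglyMeasurable ?_)
      (Eventually.of_forall fun z => (norm_exp_neg_I_mul _).le)
    have : Continuous fun z : F × EuclideanSpace ℝ (Fin (Module.finrank ℝ F)) =>
      (η - covectorParam F z.2) z.1 := by
      exact (continuous_const.sub ((covectorParam F).continuous.comp continuous_snd)).clm_apply
        continuous_fst
    fun_prop
  have h1 : ∀ x, ψ x * g x * Complex.exp (-Complex.I * (η x : ℂ)) =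
      c * ∫ v, (g x * fourierAt μ ψ (covectorParam F v)) *
        Complex.exp (-Complex.I * ((η - covectorParam F v) x : ℂ)) := by
    intro x
    have h2 : ∀ v, (g x * fourierAt μ ψ (covectorParam F v)) *
        Complex.exp (-Complex.I * ((η - covectorParam F v) x : ℂ)) =
        (g x * Complex.exp (-Complex.I * (η x : ℂ))) * (fourierAt μ ψ (covectorParam F v) *
        Complex.exp (Complex.I * (covectorParam F v x : ℂ))) := by
      intro v
      have : Complex.exp (-Complex.I * ((η - covectorParam F v) x : ℂ)) =
          Complex.exp (-Complex.I * (η x : ℂ)) *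
            Complex.exp (Complex.I * (covectorParam F v x : ℂ)) := by
        rw [← Complex.exp_add]
        congr 1
        rw [sub_apply]
        push_cast
        ring
      rw [this]
      ring
    simp_rw [h2]
    rw [integral_const_mul, hψ x]
    ring
  rw [fourierAt]
  simp_rw [h1]
  rw [integral_const_mul, integral_integral_swap hint]
  congr 1
  congr 1
  ext v
  generalize fourierAt μ ψ (covectorParam F v) = a
  rw [fourierAt, ← integral_const_mul]
  congr 1
  ext x
  ring

/-- Multiplication by a test function preserves rapid decay of the Fourier transform near a
direction. -/
theorem DecaysNear.mul {ι : Type*} (μ : Measure F) [μ.IsAddHaarMeasure] {g : ι → F → ℂ}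
    (hg : ∀ j, Integrable (g j) μ) (hp : PolyBounded μ g) {ζ : F →L[ℝ] ℝ}
    (hd : DecaysNear μ g ζ) {ψ : F → ℂ} (hψ : ContDiff ℝ ∞ ψ) (hψc : HasCompactSupport ψ) :
    DecaysNear μ (fun j x => ψ x * g j x) ζ := by
  obtain ⟨c, hc⟩ := exists_fourier_inversion μ
  obtain ⟨hcont, hintk, -, hinv⟩ := hc ψ hψ hψc
  obtain ⟨m, C₀, hC₀⟩ := hp
  obtain ⟨W, hW, hWd⟩ := hd
  obtain ⟨δ, hδ, hδW⟩ := Metric.mem_nhds_iff.1 hW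
  have hd0 : Integrable fun v => ‖fourierAt μ ψ (covectorParam F v)‖ := by
    simpa using hintk 0
  refine ⟨Metric.ball ζ (δ / 2), Metric.ball_mem_nhds _ (by positivity), fun N => ?_⟩
  obtain ⟨C₁, hC₁⟩ := hWd N
  set R : ℝ := ‖ζ‖ + δ with hR
  have hR0 : 0 < R := by positivity
  set C₂ : ℝ := |C₁| + (2 / δ) ^ N * (|C₀| * (1 + (2 / δ) * R + 1) ^ m) with hC₂
  have hC₂0 : 0 ≤ C₂ := by positivity
  refine ⟨‖c‖ * ∫ v, C₂ * ((1 + ‖covectorParam F v‖) ^ (m + N) *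
    ‖fourierAt μ ψ (covectorParam F v)‖), fun j η hη s hs => ?_⟩
  have hs0 : 0 < s := by linarith
  -- If `‖θ‖ ≤ δ s / 2`, then `η - θ / s` is still in the ball of radius `δ`, where decay is known.
  -- Otherwise `s ≤ (2 / δ) ‖θ‖`, and the polynomial bound costs only powers of `1 + ‖θ‖`, which the
  -- decay of the transform of `ψ` absorbs in the convolution.
  have key : ∀ θ : F →L[ℝ] ℝ, s ^ N * ‖fourierAt μ (g j) (s • η - θ)‖ ≤
      C₂ * (1 + ‖θ‖) ^ (m + N) := by
    intro θ
    have hone : 1 ≤ (1 + ‖θ‖) ^ (m + N) := one_le_pow₀ (by linarith [norm_nonneg θ])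
    rcases le_or_gt (‖θ‖) (δ / 2 * s) with h | h
    · have h1 : s • η - θ = s • (η - s⁻¹ • θ) := by
        rw [smul_sub, smul_inv_smul₀ hs0.ne']
      have h2 : η - s⁻¹ • θ ∈ W := by
        apply hδW
        rw [Metric.mem_ball, dist_eq_norm]
        rw [Metric.mem_ball, dist_eq_norm] at hη
        have h3 : ‖s⁻¹ • θ‖ ≤ δ / 2 := by
          rw [norm_smul, norm_inv, Real.norm_of_nonneg hs0.le, inv_mul_le_iff₀ hs0]
          linarith
        calc ‖η - s⁻¹ • θ - ζ‖ = ‖(η - ζ) - s⁻¹ • θ‖ := by congr 1; abel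
          _ ≤ ‖η - ζ‖ + ‖s⁻¹ • θ‖ := norm_sub_le _ _
          _ < δ := by linarith
      rw [h1]
      calc _ ≤ C₁ := hC₁ j _ h2 s hs
        _ ≤ |C₁| * 1 := by rw [mul_one]; exact le_abs_self _
        _ ≤ C₂ * (1 + ‖θ‖) ^ (m + N) := by
          apply mul_le_mul _ hone zero_le_one hC₂0
          rw [hC₂]
          have : 0 ≤ (2 / δ) ^ N * (|C₀| * (1 + (2 / δ) * R + 1) ^ m) := by positivity
          linarith
    · have hsθ : s ≤ 2 / δ * ‖θ‖ := by
        rw [div_mul_eq_mul_div, le_div_iff₀ hδ]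
        linarith
      have hηR : ‖η‖ ≤ R := by
        rw [Metric.mem_ball, dist_eq_norm] at hη
        have := norm_sub_norm_le η ζ
        rw [hR]
        linarith
      have h1 : ‖s • η - θ‖ ≤ (2 / δ * R + 1) * ‖θ‖ := by
        calc ‖s • η - θ‖ ≤ ‖s • η‖ + ‖θ‖ := norm_sub_le _ _
          _ ≤ (2 / δ * ‖θ‖) * R + ‖θ‖ := by
            rw [norm_smul, Real.norm_of_nonneg hs0.le]
            gcongr
          _ = _ := by ring
      have h2 : 1 + ‖s • η - θ‖ ≤ (1 + (2 / δ) * R + 1) * (1 + ‖θ‖) := by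
        have : 0 ≤ 2 / δ * R := by positivity
        nlinarith [norm_nonneg θ]
      calc s ^ N * ‖fourierAt μ (g j) (s • η - θ)‖
          ≤ (2 / δ * (1 + ‖θ‖)) ^ N * (|C₀| * ((1 + (2 / δ) * R + 1) * (1 + ‖θ‖)) ^ m) := by
            have hsθ' : s ≤ 2 / δ * (1 + ‖θ‖) := hsθ.trans (by gcongr; linarith)
            have h4 : ‖fourierAt μ (g j) (s • η - θ)‖ ≤ |C₀| * (1 + ‖s • η - θ‖) ^ m :=
              (hC₀ j _).trans (by gcongr; exact le_abs_self _)
            refine mul_le_mul (by gcongr) (h4.trans (by gcongr)) (norm_nonneg _) (by positivity)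
        _ = (2 / δ) ^ N * (|C₀| * (1 + (2 / δ) * R + 1) ^ m) * (1 + ‖θ‖) ^ (m + N) := by
            rw [mul_pow, mul_pow, pow_add]; ring
        _ ≤ _ := by
          gcongr
          rw [hC₂]
          linarith [abs_nonneg C₁]
  rw [fourierAt_mul_eq μ (hg j) hd0 hcont hinv, norm_mul]
  calc s ^ N * (‖c‖ * ‖∫ v, fourierAt μ ψ (covectorParam F v) *
        fourierAt μ (g j) (s • η - covectorParam F v)‖)
      = ‖c‖ * ‖∫ v, ((s ^ N : ℝ) : ℂ) * (fourierAt μ ψ (covectorParam F v) *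
        fourierAt μ (g j) (s • η - covectorParam F v))‖ := by
        rw [integral_const_mul, norm_mul, Complex.norm_real, Real.norm_of_nonneg (by positivity)]
        ring
    _ ≤ _ := by
        gcongr
        refine norm_integral_le_of_norm_le ((hintk (m + N)).const_mul C₂)
          (Eventually.of_forall fun v => ?_)
        rw [norm_mul, norm_mul, Complex.norm_real, Real.norm_of_nonneg (by positivity)]
        calc _ = ‖fourierAt μ ψ (covectorParam F v)‖ *
              (s ^ N * ‖fourierAt μ (g j) (s • η - covectorParam F v)‖) := by ring
          _ ≤ ‖fourierAt μ ψ (covectorParam F v)‖ *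
              (C₂ * (1 + ‖covectorParam F v‖) ^ (m + N)) :=
            mul_le_mul_of_nonneg_left (key _) (norm_nonneg _)
          _ = _ := by ring

variable {D : Type*} [NormedAddCommGroup D] [NormedSpace ℝ D] [MeasurableSpace D]
  [FiniteDimensional ℝ D] [BorelSpace D]

/-- The unit sphere of covectors is compact and every nonzero covector is a positive multiple of a
unit one, so finitely many conic estimates cover all covectors of norm greater than 1; the remaining
ones are bounded by `hb`. -/
theorem exists_global_bound_of_local {ι : Type*} {f : ι → (F →L[ℝ] ℝ) → ℝ}
    (hb : ∃ B : ℝ, ∀ j η, ‖η‖ ≤ 1 → f j η ≤ B)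
    (h : ∀ ζ : F →L[ℝ] ℝ, ‖ζ‖ = 1 → ∃ W ∈ 𝓝 ζ, ∀ N : ℕ, ∃ C : ℝ, ∀ j, ∀ η ∈ W, ∀ s : ℝ, 1 ≤ s →
      s ^ N * f j (s • η) ≤ C) (N : ℕ) :
    ∃ C : ℝ, 0 ≤ C ∧ ∀ j η, f j η ≤ C * ((1 + ‖η‖) ^ N)⁻¹ := by
  obtain ⟨B, hB⟩ := hb
  choose! W hW hWd using h
  have hcpt : IsCompact (Metric.sphere (0 : F →L[ℝ] ℝ) 1) := isCompact_sphere 0 1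
  obtain ⟨t, ht, htc⟩ := hcpt.elim_nhds_subcover W fun ζ hζ => hW ζ (by simpa using hζ)
  have ht' : ∀ ζ ∈ t, ‖ζ‖ = 1 := fun ζ hζ => by simpa using ht ζ hζ
  choose! C hC using fun ζ (hζ : ‖ζ‖ = 1) => hWd ζ hζ N
  refine ⟨2 ^ N * (|B| + ∑ ζ ∈ t, |C ζ|), by positivity, fun j η => ?_⟩
  rw [← div_eq_mul_inv, le_div_iff₀ (by positivity)]
  have hsum : 0 ≤ ∑ ζ ∈ t, |C ζ| := by positivity
  rcases le_or_gt ‖η‖ 1 with h1 | h1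
  · calc f j η * (1 + ‖η‖) ^ N ≤ |B| * 2 ^ N := by
          have h2 : f j η ≤ |B| := (hB j η h1).trans (le_abs_self _)
          have h3 : (1 + ‖η‖) ^ N ≤ 2 ^ N := by gcongr; linarith
          calc _ ≤ |B| * (1 + ‖η‖) ^ N := by gcongr
            _ ≤ _ := by gcongr
      _ ≤ _ := by nlinarith [pow_pos (zero_lt_two' ℝ) N]
  · have hη0 : 0 < ‖η‖ := by linarith
    have hmem : ‖η‖⁻¹ • η ∈ Metric.sphere (0 : F →L[ℝ] ℝ) 1 := by
      rw [mem_sphere_zero_iff_norm, norm_smul, norm_inv, norm_norm, inv_mul_cancel₀ hη0.ne']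
    obtain ⟨ζ, hζ, hηζ⟩ := mem_iUnion₂.1 (htc hmem)
    have h2 := hC ζ (ht' ζ hζ) j _ hηζ ‖η‖ h1.le
    rw [smul_inv_smul₀ hη0.ne'] at h2
    have h3 : |C ζ| ≤ ∑ ζ ∈ t, |C ζ| := Finset.single_le_sum (f := fun ζ => |C ζ|)
      (fun _ _ => abs_nonneg _) hζ
    have h4 : ‖η‖ ^ N * f j η ≤ |B| + ∑ ζ ∈ t, |C ζ| := by
      linarith [le_abs_self (C ζ), abs_nonneg B]
    rcases le_or_gt (f j η) 0 with h5 | h5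
    · have : f j η * (1 + ‖η‖) ^ N ≤ 0 := mul_nonpos_of_nonpos_of_nonneg h5 (by positivity)
      have : 0 ≤ 2 ^ N * (|B| + ∑ ζ ∈ t, |C ζ|) := by positivity
      linarith
    · calc f j η * (1 + ‖η‖) ^ N ≤ f j η * (2 * ‖η‖) ^ N := by gcongr; linarith
        _ = 2 ^ N * (‖η‖ ^ N * f j η) := by rw [mul_pow]; ring
        _ ≤ _ := by gcongr

theorem fourierAt_decay_of_ne_zero (μ : Measure D) [μ.IsAddHaarMeasure] {χ : D → ℂ}
    (hχ : ContDiff ℝ ∞ χ) (hχc : HasCompactSupport χ) (k : ℕ) :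
    ∃ C : ℝ, ∀ η, (1 + ‖η‖) ^ k * ‖fourierAt μ χ η‖ ≤ C := by
  obtain ⟨c, hc⟩ := exists_fourier_inversion μ
  exact (hc χ hχ hχc).2.2.1 k

/-- Restriction to (the range of) a linear map `ι`, in the limit: if the Fourier transforms of
`g j` converge pointwise, with uniform polynomial bounds, and decay rapidly near the normals of
`ι`, then the pullbacks `g j ∘ ι` converge weakly, to a limit that is determined by the limits of
the Fourier transforms. -/
theorem exists_tendsto_integral_comp_linear (μ : Measure F) [μ.IsAddHaarMeasure]
    (μ' : Measure D) [μ'.IsAddHaarMeasure] (ι : D →L[ℝ] F) {χ : D → ℂ}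
    (hχ : ContDiff ℝ ∞ χ) (hχc : HasCompactSupport χ) :
    ∃ Λ : ((F →L[ℝ] ℝ) → ℂ) → ℂ, ∀ (g : ℕ → F → ℂ) (G : (F →L[ℝ] ℝ) → ℂ),
      (∀ j, ContDiff ℝ ∞ (g j)) → (∀ j, HasCompactSupport (g j)) → PolyBounded μ g →
      (∀ ζ : F →L[ℝ] ℝ, ‖ζ‖ = 1 → ζ.comp ι = 0 → DecaysNear μ g ζ) →
      (∀ η, Tendsto (fun j => fourierAt μ (g j) η) atTop (𝓝 (G η))) →
      Tendsto (fun j => ∫ d, g j (ι d) * χ d ∂μ') atTop (𝓝 (Λ G)) := by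
  obtain ⟨c, hc⟩ := exists_fourier_inversion μ
  have hχi : Integrable χ μ' := hχ.continuous.integrable_of_hasCompactSupport hχc
  -- This is the Parseval formula for the pairing of `g ∘ ι` with `χ`. It involves only the limit
  -- `G` of the transforms and is fixed before the sequence, so two sequences with the same limit
  -- transforms give the same value.
  refine ⟨fun G => c * ∫ v, G (covectorParam F v) * fourierAt μ' χ (-(covectorParam F v).comp ι),
    fun g G hg hgc hpb hdec hG => ?_⟩
  have hgi : ∀ j, Integrable (g j) μ := fun j =>
    (hg j).continuous.integrable_of_hasCompactSupport (hgc j)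
  have hcχ : Continuous fun η : F →L[ℝ] ℝ => fourierAt μ' χ (-η.comp ι) :=
    (continuous_fourierAt μ' hχi).comp
      ((ContinuousLinearMap.compL ℝ D F ℝ).flip ι).continuous.neg
  have hform : ∀ j, ∫ d, g j (ι d) * χ d ∂μ' = c * ∫ v, fourierAt μ (g j) (covectorParam F v) *
      fourierAt μ' χ (-(covectorParam F v).comp ι) := by
    intro j
    obtain ⟨hcont, hintk, -, hinv⟩ := hc (g j) (hg j) (hgc j)
    have hgi' : Integrable fun v => fourierAt μ (g j) (covectorParam F v) :=
      (integrable_norm_iff hcont.aestronglyMeasurable).1 (by simpa using hintk 0)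
    have hint : Integrable (fun z : D × EuclideanSpace ℝ (Fin (Module.finrank ℝ F)) =>
        (χ z.1 * fourierAt μ (g j) (covectorParam F z.2)) *
          Complex.exp (Complex.I * (covectorParam F z.2 (ι z.1) : ℂ))) (μ'.prod volume) := by
      refine (hχi.mul_prod hgi').mul_bdd (c := 1) (Continuous.aestronglyMeasurable ?_)
        (Eventually.of_forall fun z => (norm_exp_I_mul _).le)
      have : Continuous fun z : D × EuclideanSpace ℝ (Fin (Module.finrank ℝ F)) =>
          (covectorParam F z.2) (ι z.1) :=
        ((covectorParam F).continuous.comp continuous_snd).clm_apply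
          (ι.continuous.comp continuous_fst)
      fun_prop
    have h1 : ∀ d, g j (ι d) * χ d = c * ∫ v, (χ d * fourierAt μ (g j) (covectorParam F v)) *
          Complex.exp (Complex.I * (covectorParam F v (ι d) : ℂ)) := by
      intro d
      simp_rw [mul_assoc]
      rw [integral_const_mul, hinv (ι d)]
      ring
    simp_rw [h1]
    rw [integral_const_mul, integral_integral_swap hint]
    congr 2
    ext v
    generalize fourierAt μ (g j) (covectorParam F v) = a
    rw [mul_comm a, fourierAt, ← integral_mul_const]
    congr 1
    ext d
    have : Complex.exp (-Complex.I * ((-(covectorParam F v).comp ι) d : ℝ)) =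
        Complex.exp (Complex.I * (covectorParam F v (ι d) : ℂ)) := by
      congr 1
      rw [neg_apply, ContinuousLinearMap.comp_apply]
      push_cast
      ring
    rw [this]
    ring
  simp_rw [hform]
  refine Tendsto.const_mul c ?_
  obtain ⟨m, C₀, hC₀⟩ := hpb
  set f : ℕ → (F →L[ℝ] ℝ) → ℝ := fun j η => ‖fourierAt μ (g j) η * fourierAt μ' χ (-η.comp ι)‖
    with hf
  have hχb : ∀ η, ‖fourierAt μ' χ η‖ ≤ ∫ x, ‖χ x‖ ∂μ' := norm_fourierAt_le μ' χ
  have hχb0 : 0 ≤ ∫ x, ‖χ x‖ ∂μ' := integral_nonneg fun _ => norm_nonneg _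
  obtain ⟨C₁, hC₁⟩ := exists_norm_le_covectorParam (F := F)
  -- One more than the dimension is an integrable order of decay; the resulting function is the
  -- majorant for dominated convergence.
  obtain ⟨K, hK⟩ : ∃ K : ℕ, Integrable fun v : EuclideanSpace ℝ (Fin (Module.finrank ℝ F)) =>
      ((1 + ‖covectorParam F v‖) ^ K)⁻¹ := by
    let K := Module.finrank ℝ F + 1
    refine ⟨K, ?_⟩
    have h1 : Integrable fun v : EuclideanSpace ℝ (Fin (Module.finrank ℝ F)) =>
        (1 + ‖v‖) ^ (-(K : ℝ)) := integrable_one_add_norm (by simp [K])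
    refine (h1.const_mul ((1 + C₁) ^ K)).mono' ?_ (Eventually.of_forall fun v => ?_)
    · refine Continuous.aestronglyMeasurable (Continuous.inv₀ (by fun_prop) fun v => ?_)
      positivity
    · rw [Real.norm_of_nonneg (by positivity), Real.rpow_neg (by positivity), Real.rpow_natCast,
        inv_le_iff_one_le_mul₀ (by positivity)]
      have h2 : 1 + ‖v‖ ≤ (1 + C₁) * (1 + ‖covectorParam F v‖) := by
        nlinarith [hC₁.2 v, hC₁.1, norm_nonneg (covectorParam F v)]
      have h3 : (1 + ‖v‖) ^ K ≤ (1 + C₁) ^ K * (1 + ‖covectorParam F v‖) ^ K := by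
        rw [← mul_pow]; gcongr
      have h4 : 0 < (1 + ‖v‖) ^ K := by positivity
      calc (1 : ℝ) = (1 + ‖v‖) ^ K * ((1 + ‖v‖) ^ K)⁻¹ := (mul_inv_cancel₀ h4.ne').symm
        _ ≤ ((1 + C₁) ^ K * (1 + ‖covectorParam F v‖) ^ K) * ((1 + ‖v‖) ^ K)⁻¹ := by gcongr
        _ = _ := by ring
  obtain ⟨C, hC0, hC⟩ := exists_global_bound_of_local (f := f)
    ⟨|C₀| * 2 ^ m * ∫ x, ‖χ x‖ ∂μ', fun j η hη => by
      simp only [f]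
      rw [norm_mul]
      refine mul_le_mul ((hC₀ j η).trans ?_) (hχb _) (norm_nonneg _) (by positivity)
      have : (1 + ‖η‖) ^ m ≤ 2 ^ m := by gcongr; linarith
      exact mul_le_mul (le_abs_self _) this (by positivity) (abs_nonneg _)⟩
    (fun ζ hζ => by
      -- Near a normal of `ι` the transforms of the `g j` decay by hypothesis. At any other `ζ` the
      -- pulled back covector is nonzero, so the transform of `χ` decays and beats the polynomial
      -- growth of the transforms of the `g j`.
      by_cases hn : ζ.comp ι = 0
      · obtain ⟨W, hW, hWd⟩ := hdec ζ hζ hn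
        refine ⟨W, hW, fun N => ?_⟩
        obtain ⟨C, hC⟩ := hWd N
        refine ⟨C * ∫ x, ‖χ x‖ ∂μ', fun j η hη s hs => ?_⟩
        simp only [f]
        rw [norm_mul, ← mul_assoc]
        have h1 := hC j η hη s hs
        have h2 : 0 ≤ s ^ N * ‖fourierAt μ (g j) (s • η)‖ := by
          have : 0 ≤ s := by linarith
          positivity
        exact mul_le_mul h1 (hχb _) (norm_nonneg _) (h2.trans h1)
      · set r := ‖ζ.comp ι‖ with hr
        have hr0 : 0 < r := norm_pos_iff.2 hn
        have hcι : Continuous fun η : F →L[ℝ] ℝ => ‖η.comp ι‖ :=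
          ((ContinuousLinearMap.compL ℝ D F ℝ).flip ι).continuous.norm
        refine ⟨{η | r / 2 < ‖η.comp ι‖ ∧ ‖η‖ < 2}, ?_, fun N => ?_⟩
        · refine IsOpen.mem_nhds ((isOpen_lt continuous_const hcι).inter
            (isOpen_lt continuous_norm continuous_const)) ⟨?_, ?_⟩
          · show r / 2 < r
            linarith
          · show ‖ζ‖ < 2
            rw [hζ]; norm_num
        · obtain ⟨C, hC⟩ := fourierAt_decay_of_ne_zero μ' hχ hχc (N + m)
          refine ⟨|C₀| * 3 ^ m * ((2 / r) ^ (N + m) * |C|), fun j η hη s hs => ?_⟩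
          simp only [f]
          have hs0 : 0 < s := by linarith
          rw [norm_mul]
          have h1 : ‖fourierAt μ (g j) (s • η)‖ ≤ |C₀| * (3 * s) ^ m := by
            refine (hC₀ j _).trans (mul_le_mul (le_abs_self _) ?_ (by positivity) (abs_nonneg _))
            gcongr
            rw [norm_smul, Real.norm_of_nonneg hs0.le]
            nlinarith [hη.2]
          have h2 : s ^ (N + m) * ‖fourierAt μ' χ (-(s • η).comp ι)‖ ≤ (2 / r) ^ (N + m) * |C| := by
            have h3 : s ≤ 2 / r * (1 + ‖-(s • η).comp ι‖) := by
              rw [norm_neg, ContinuousLinearMap.smul_comp, norm_smul, Real.norm_of_nonneg hs0.le,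
                div_mul_eq_mul_div, le_div_iff₀ hr0]
              nlinarith [hη.1]
            calc s ^ (N + m) * ‖fourierAt μ' χ (-(s • η).comp ι)‖
                ≤ (2 / r * (1 + ‖-(s • η).comp ι‖)) ^ (N + m) *
                  ‖fourierAt μ' χ (-(s • η).comp ι)‖ := by gcongr
              _ = (2 / r) ^ (N + m) * ((1 + ‖-(s • η).comp ι‖) ^ (N + m) *
                  ‖fourierAt μ' χ (-(s • η).comp ι)‖) := by rw [mul_pow]; ring
              _ ≤ _ := by gcongr; exact (hC _).trans (le_abs_self _)
          calc s ^ N * (‖fourierAt μ (g j) (s • η)‖ * ‖fourierAt μ' χ (-(s • η).comp ι)‖)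
              ≤ s ^ N * ((|C₀| * (3 * s) ^ m) * ‖fourierAt μ' χ (-(s • η).comp ι)‖) := by gcongr
            _ = |C₀| * 3 ^ m * (s ^ (N + m) * ‖fourierAt μ' χ (-(s • η).comp ι)‖) := by
              rw [mul_pow, pow_add]; ring
            _ ≤ _ := by gcongr) K
  refine tendsto_integral_of_dominated_convergence
    (fun v => C * ((1 + ‖covectorParam F v‖) ^ K)⁻¹) (fun j => ?_) (hK.const_mul C)
    (fun j => Eventually.of_forall fun v => hC j _) (Eventually.of_forall fun v => ?_)
  · exact (((continuous_fourierAt μ (hgi j)).mul hcχ).comp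
      (covectorParam F).continuous).aestronglyMeasurable
  · exact (hG _).mul_const _

end Decay

end Guillemin

end

/-! ### Test functions on manifolds and localization. -/

noncomputable section

namespace Guillemin

set_option linter.unusedSectionVars false

theorem contDiff_of_contDiffOn_of_eq_zero {V : Type*} [NormedAddCommGroup V] [NormedSpace ℝ V]
    {f : V → ℂ} {T K : Set V} (hT : IsOpen T) (hK : IsCompact K) (hKT : K ⊆ T)
    (hf : ContDiffOn ℝ ∞ f T) (h0 : ∀ x ∉ K, f x = 0) :
    ContDiff ℝ ∞ f ∧ HasCompactSupport f := by
  refine ⟨contDiff_iff_contDiffAt.2 fun x => ?_, HasCompactSupport.intro hK h0⟩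
  by_cases hx : x ∈ T
  · exact hf.contDiffAt (hT.mem_nhds hx)
  · have hx' : x ∈ Kᶜ := fun h => hx (hKT h)
    refine contDiffAt_const (c := (0 : ℂ)) |>.congr_of_eventuallyEq ?_
    filter_upwards [hK.isClosed.isOpen_compl.mem_nhds hx'] with y hy
    exact h0 y hy

section Tests

variable {F : Type*} [NormedAddCommGroup F] [NormedSpace ℝ F]
  {H : Type*} [TopologicalSpace H] {I : ModelWithCorners ℝ F H}
  {M : Type*} [TopologicalSpace M] [ChartedSpace H M]

theorem tsupport_subset_of_forall_notMem {Φ : M → ℂ} {s : Set M} (hs : IsClosed s)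
    (h : ∀ x ∉ s, Φ x = 0) : tsupport Φ ⊆ s :=
  closure_minimal (fun x hx => by_contra fun hxs => hx (h x hxs)) hs

theorem eq_zero_of_notMem_tsupport {Φ : M → ℂ} {x : M} (hx : x ∉ tsupport Φ) : Φ x = 0 :=
  by_contra fun h => hx (subset_tsupport _ h)

theorem tsupport_comp_eq_subset {Φ Ψ : M → ℂ} (h : ∀ x, Φ x = 0 → Ψ x = 0) :
    tsupport Ψ ⊆ tsupport Φ :=
  closure_mono fun x hx hx' => hx (h x hx')

theorem IsTest.mono {O O' : Set M} {Φ : M → ℂ} (h : IsTest I O Φ) (hO : tsupport Φ ⊆ O') :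
    IsTest I O' Φ := ⟨h.1, h.2.1, hO⟩

theorem IsTest.continuous {O : Set M} {Φ : M → ℂ} (h : IsTest I O Φ) : Continuous Φ :=
  h.1.continuous

theorem contMDiffAt_mul {f g : M → ℂ} {x : M} (hf : ContMDiffAt I 𝓘(ℝ, ℂ) ∞ f x)
    (hg : ContMDiffAt I 𝓘(ℝ, ℂ) ∞ g x) : ContMDiffAt I 𝓘(ℝ, ℂ) ∞ (fun y => f y * g y) x := by
  have h : ContDiff ℝ ∞ (fun p : ℂ × ℂ => p.1 * p.2) := contDiff_fst.mul contDiff_snd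
  exact h.contMDiff.contMDiffAt.comp x (hf.prodMk_space hg)

theorem isTest_zero (O : Set M) : IsTest I O (fun _ : M => (0 : ℂ)) := by
  refine ⟨contMDiff_const, HasCompactSupport.zero, ?_⟩
  have : tsupport (fun _ : M => (0 : ℂ)) = ∅ := by
    rw [tsupport_eq_empty_iff]; rfl
  rw [this]
  exact empty_subset _

theorem contMDiff_mul_of_tsupport {O : Set M} {f Φ : M → ℂ} (hΦ : ContMDiff I 𝓘(ℝ, ℂ) ∞ Φ)
    (hO : IsOpen O) (hΦO : tsupport Φ ⊆ O) (hf : ContMDiffOn I 𝓘(ℝ, ℂ) ∞ f O) :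
    ContMDiff I 𝓘(ℝ, ℂ) ∞ (fun x => f x * Φ x) := by
  intro x
  by_cases hx : x ∈ O
  · exact contMDiffAt_mul (hf.contMDiffAt (hO.mem_nhds hx)) (hΦ x)
  · have hx' : x ∉ tsupport Φ := fun h => hx (hΦO h)
    refine (contMDiffAt_const (c := (0 : ℂ))).congr_of_eventuallyEq ?_
    filter_upwards [notMem_tsupport_iff_eventuallyEq.1 hx'] with y hy
    rw [hy]; simp

theorem IsTest.mul_left {O O' : Set M} {f Φ : M → ℂ} (hΦ : IsTest I O Φ)
    (hO' : IsOpen O') (hΦO : tsupport Φ ⊆ O') (hf : ContMDiffOn I 𝓘(ℝ, ℂ) ∞ f O') :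
    IsTest I O (fun x => f x * Φ x) := by
  refine ⟨contMDiff_mul_of_tsupport hΦ.1 hO' hΦO hf, hΦ.2.1.mul_left, ?_⟩
  exact (tsupport_comp_eq_subset fun x hx => by simp [hx]).trans hΦ.2.2

theorem IsTest.mul {O : Set M} {f Φ : M → ℂ} (hΦ : IsTest I O Φ)
    (hf : ContMDiff I 𝓘(ℝ, ℂ) ∞ f) : IsTest I O (fun x => f x * Φ x) :=
  hΦ.mul_left isOpen_univ (subset_univ _) hf.contMDiffOn

theorem IsTest.add {O : Set M} {Φ Ψ : M → ℂ} (hΦ : IsTest I O Φ) (hΨ : IsTest I O Ψ) :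
    IsTest I O (fun x => Φ x + Ψ x) := by
  refine ⟨hΦ.1.add hΨ.1, hΦ.2.1.add hΨ.2.1, ?_⟩
  exact (tsupport_add Φ Ψ).trans (union_subset hΦ.2.2 hΨ.2.2)

theorem IsTest.sum {ι : Type*} {O : Set M} {Φ : ι → M → ℂ} (s : Finset ι)
    (h : ∀ i ∈ s, IsTest I O (Φ i)) : IsTest I O (fun x => ∑ i ∈ s, Φ i x) := by
  classical
  induction s using Finset.induction_on with
  | empty => simpa using isTest_zero O
  | insert i s his ih =>
    simp_rw [Finset.sum_insert his]
    exact (h i (Finset.mem_insert_self _ _)).add (ih fun j hj => h j (Finset.mem_insert_of_mem hj))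

variable [FiniteDimensional ℝ F] [IsManifold I ∞ M] [T2Space M]

theorem exists_isTest_eq_one {N : Set M} {p : M} (hN : N ∈ 𝓝 p) :
    ∃ Φ : M → ℂ, IsTest I N Φ ∧ Φ =ᶠ[𝓝 p] fun _ => 1 := by
  obtain ⟨f, -, hf⟩ := (SmoothBumpFunction.nhds_basis_tsupport (I := I) p).mem_iff.1 hN
  have hsub : tsupport (fun x => ((f x : ℝ) : ℂ)) ⊆ tsupport f :=
    closure_mono fun x hx hx' => hx (by simp [hx'])
  refine ⟨fun x => ((f x : ℝ) : ℂ), ⟨?_, ?_, hsub.trans hf⟩, ?_⟩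
  · exact Complex.ofRealCLM.contDiff.contMDiff.comp f.contMDiff
  · exact f.hasCompactSupport.mono' ((subset_tsupport _).trans hsub)
  · filter_upwards [f.eventuallyEq_one] with x hx
    rw [hx]; simp

variable [SigmaCompactSpace M]

/-- Localization: an additive property of test functions holds as soon as it holds for those
with small support. -/
theorem IsTest.induction_on {O : Set M} {P : (M → ℂ) → Prop}
    (h0 : P fun _ => 0)
    (hadd : ∀ Φ Ψ, IsTest I O Φ → IsTest I O Ψ → P Φ → P Ψ → P fun x => Φ x + Ψ x)
    (hloc : ∀ q ∈ O, ∃ N ∈ 𝓝 q, ∀ Φ, IsTest I O Φ → tsupport Φ ⊆ N → P Φ)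
    {χ : M → ℂ} (hχ : IsTest I O χ) : P χ := by
  classical
  choose! N hN hP using hloc
  -- A partition of unity on the support of `χ`, subordinate to the given neighbourhoods; by
  -- compactness only finitely many members meet that support, so additivity suffices.
  obtain ⟨f, hf⟩ := SmoothPartitionOfUnity.exists_isSubordinate I (isClosed_tsupport χ)
    (fun q : tsupport χ => interior (N q)) (fun _ => isOpen_interior)
    (fun q hq => mem_iUnion.2 ⟨⟨q, hq⟩, mem_interior_iff_mem_nhds.2 (hN q (hχ.2.2 hq))⟩)
  have hfin := f.locallyFinite.finite_nonempty_inter_compact hχ.2.1.isCompact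
  set t := hfin.toFinset with ht
  have hsm : ∀ i, ContMDiff I 𝓘(ℝ, ℂ) ∞ (fun x => ((f i x : ℝ) : ℂ)) := fun i =>
    Complex.ofRealCLM.contDiff.contMDiff.comp (f i).contMDiff
  have hT : ∀ i, IsTest I O (fun x => ((f i x : ℝ) : ℂ) * χ x) := fun i => hχ.mul (hsm i)
  have hPt : ∀ i, P (fun x => ((f i x : ℝ) : ℂ) * χ x) := fun i => by
    refine hP i (hχ.2.2 i.2) _ (hT i) ?_
    have h1 : tsupport (fun x => ((f i x : ℝ) : ℂ) * χ x) ⊆ tsupport (f i) :=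
      closure_mono fun x hx hx' => hx (by simp [hx'])
    exact h1.trans ((hf i).trans interior_subset)
  have hsum : χ = fun x => ∑ i ∈ t, ((f i x : ℝ) : ℂ) * χ x := by
    ext x
    by_cases hx : x ∈ tsupport χ
    · have h1 := f.sum_eq_one hx
      rw [finsum_eq_sum_of_support_subset (s := t)] at h1
      · rw [← Finset.sum_mul, ← Complex.ofReal_sum, h1, Complex.ofReal_one, one_mul]
      · intro i hi
        rw [ht, Finite.coe_toFinset]
        exact ⟨x, hi, hx⟩
    · simp [eq_zero_of_notMem_tsupport hx]
  have key : ∀ s : Finset (tsupport χ), P (fun x => ∑ i ∈ s, ((f i x : ℝ) : ℂ) * χ x) := by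
    intro s
    induction s using Finset.induction_on with
    | empty => simpa using h0
    | insert i s his ih =>
      simp_rw [Finset.sum_insert his]
      exact hadd _ _ (hT i) (IsTest.sum s fun j _ => hT j) (hPt i) ih
  rw [hsum]
  exact key t

end Tests

end Guillemin

end

/-! ### Integration against a smooth density in charts. -/

noncomputable section

namespace Guillemin

set_option linter.unusedSectionVars false

section ChartIntegrals

variable {n : ℕ} {X : Type*} [TopologicalSpace X] [ChartedSpace (EuclideanSpace ℝ (Fin n)) X]

/-- The inverse of the chart at `x₀`, extended by a constant. -/
def chartInv (x₀ : X) (z : EuclideanSpace ℝ (Fin n)) : X :=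
  open Classical in if z ∈ (extChartAt (𝓡 n) x₀).target then (extChartAt (𝓡 n) x₀).symm z else x₀

theorem chartInv_of_mem {x₀ : X} {z : EuclideanSpace ℝ (Fin n)}
    (hz : z ∈ (extChartAt (𝓡 n) x₀).target) : chartInv x₀ z = (extChartAt (𝓡 n) x₀).symm z :=
  if_pos hz

theorem extChartAt_chartInv {x₀ : X} {z : EuclideanSpace ℝ (Fin n)}
    (hz : z ∈ (extChartAt (𝓡 n) x₀).target) : extChartAt (𝓡 n) x₀ (chartInv x₀ z) = z := by
  rw [chartInv_of_mem hz, (extChartAt (𝓡 n) x₀).right_inv hz]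

theorem chartInv_extChartAt {x₀ x : X} (hx : x ∈ (extChartAt (𝓡 n) x₀).source) :
    chartInv x₀ (extChartAt (𝓡 n) x₀ x) = x := by
  rw [chartInv_of_mem ((extChartAt (𝓡 n) x₀).map_source hx), (extChartAt (𝓡 n) x₀).left_inv hx]

theorem contMDiffOn_chartInv [IsManifold (𝓡 n) ∞ X] (x₀ : X) :
    ContMDiffOn 𝓘(ℝ, EuclideanSpace ℝ (Fin n)) (𝓡 n) ∞ (chartInv x₀)
      (extChartAt (𝓡 n) x₀).target :=
  (contMDiffOn_extChartAt_symm x₀).congr fun _ hz => chartInv_of_mem hz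

variable [MeasurableSpace X]

/-- The density `μ` in the chart at `x₀`, extended by zero. -/
def chartDensity {μ : Measure X} (hμ : IsSmoothDensity (n := n) μ) (x₀ : X) :
    EuclideanSpace ℝ (Fin n) → ℝ :=
  (extChartAt (𝓡 n) x₀).target.indicator (hμ x₀).choose

variable {μ : Measure X} (hμ : IsSmoothDensity (n := n) μ)

theorem chartDensity_of_notMem {x₀ : X} {z : EuclideanSpace ℝ (Fin n)}
    (hz : z ∉ (extChartAt (𝓡 n) x₀).target) : chartDensity hμ x₀ z = 0 :=
  indicator_of_notMem hz _

theorem chartDensity_pos {x₀ : X} {z : EuclideanSpace ℝ (Fin n)}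
    (hz : z ∈ (extChartAt (𝓡 n) x₀).target) : 0 < chartDensity hμ x₀ z := by
  rw [chartDensity, indicator_of_mem hz]
  exact (hμ x₀).choose_spec.2.1 z hz

theorem contDiffOn_chartDensity (x₀ : X) :
    ContDiffOn ℝ ∞ (chartDensity hμ x₀) (extChartAt (𝓡 n) x₀).target :=
  (hμ x₀).choose_spec.1.congr fun _ hz => indicator_of_mem hz _

theorem chartDensity_nonneg (x₀ : X) (z : EuclideanSpace ℝ (Fin n)) :
    0 ≤ chartDensity hμ x₀ z := by
  by_cases hz : z ∈ (extChartAt (𝓡 n) x₀).target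
  · exact (chartDensity_pos hμ hz).le
  · rw [chartDensity_of_notMem hμ hz]

theorem measurable_chartDensity (x₀ : X) : Measurable (chartDensity hμ x₀) := by
  classical
  have ht := (isOpen_extChartAt_target (I := 𝓡 n) x₀)
  have h1 := ContinuousOn.measurable_piecewise (f := (hμ x₀).choose) (g := fun _ => (0 : ℝ))
    (hμ x₀).choose_spec.1.continuousOn continuousOn_const ht.measurableSet
  convert h1 using 1
  ext z
  simp only [Set.piecewise, chartDensity, indicator]

variable [BorelSpace X] [IsManifold (𝓡 n) ∞ X]

theorem measurable_chartInv (x₀ : X) : Measurable (chartInv (n := n) x₀) := by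
  classical
  have ht := (isOpen_extChartAt_target (I := 𝓡 n) x₀)
  have h1 := ContinuousOn.measurable_piecewise (f := (extChartAt (𝓡 n) x₀).symm)
    (g := fun _ => x₀) (continuousOn_extChartAt_symm x₀) continuousOn_const ht.measurableSet
  convert h1 using 1
  ext z
  simp only [Set.piecewise, chartInv]

/-- Writing the density on a chart as a pushforward of weighted Lebesgue measure reduces integrals
on `X`, and on its products, to the rules for `Measure.map` and `withDensity`. -/
theorem restrict_source_eq_map (x₀ : X) :
    μ.restrict (extChartAt (𝓡 n) x₀).source =
      (volume.withDensity fun z => ENNReal.ofReal (chartDensity hμ x₀ z)).map (chartInv x₀) := by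
  have ht := (isOpen_extChartAt_target (I := 𝓡 n) x₀)
  ext A hA
  rw [Measure.map_apply (measurable_chartInv x₀) hA, Measure.restrict_apply hA,
    withDensity_apply _ (measurable_chartInv x₀ hA), inter_comm,
    (hμ x₀).choose_spec.2.2 _ ((isOpen_extChartAt_source x₀).measurableSet.inter hA)
      inter_subset_left, (extChartAt (𝓡 n) x₀).image_source_inter_eq']
  have h1 : (fun z => ENNReal.ofReal (chartDensity hμ x₀ z)) =
      (extChartAt (𝓡 n) x₀).target.indicator (fun z => ENNReal.ofReal ((hμ x₀).choose z)) := by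
    ext z
    by_cases hz : z ∈ (extChartAt (𝓡 n) x₀).target
    · rw [indicator_of_mem hz, chartDensity, indicator_of_mem hz]
    · rw [indicator_of_notMem hz, chartDensity, indicator_of_notMem hz, ENNReal.ofReal_zero]
  rw [h1, lintegral_indicator ht.measurableSet, Measure.restrict_restrict ht.measurableSet]
  congr 2
  ext z
  constructor
  · rintro ⟨hz, hzA⟩
    refine ⟨hz, ?_⟩
    rw [mem_preimage, chartInv_of_mem hz]; exact hzA
  · rintro ⟨hz, hzA⟩
    refine ⟨hz, ?_⟩
    rw [mem_preimage, chartInv_of_mem hz] at hzA; exact hzA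

/-- The coefficient of the density is continuous, hence bounded on a compact ball in the chart. -/
theorem IsSmoothDensity.isLocallyFiniteMeasure (hμ : IsSmoothDensity (n := n) μ) : IsLocallyFiniteMeasure μ := by
  refine ⟨fun x₀ => ?_⟩
  have ht := (isOpen_extChartAt_target (I := 𝓡 n) x₀)
  obtain ⟨r, hr, hrt⟩ := Metric.nhds_basis_closedBall.mem_iff.1
    (ht.mem_nhds (mem_extChartAt_target (I := 𝓡 n) x₀))
  set B := Metric.closedBall (extChartAt (𝓡 n) x₀ x₀) r
  refine ⟨(extChartAt (𝓡 n) x₀).source ∩ extChartAt (𝓡 n) x₀ ⁻¹' (Metric.ball _ r),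
    Filter.inter_mem (extChartAt_source_mem_nhds x₀)
      ((continuousAt_extChartAt x₀).preimage_mem_nhds (Metric.ball_mem_nhds _ hr)), ?_⟩
  have hm : MeasurableSet ((extChartAt (𝓡 n) x₀).source ∩
      extChartAt (𝓡 n) x₀ ⁻¹' (Metric.ball (extChartAt (𝓡 n) x₀ x₀) r)) :=
    ((continuousOn_extChartAt x₀).isOpen_inter_preimage (isOpen_extChartAt_source x₀)
      Metric.isOpen_ball).measurableSet
  rw [(hμ x₀).choose_spec.2.2 _ hm inter_subset_left]
  have hsub : extChartAt (𝓡 n) x₀ '' ((extChartAt (𝓡 n) x₀).source ∩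
      extChartAt (𝓡 n) x₀ ⁻¹' (Metric.ball (extChartAt (𝓡 n) x₀ x₀) r)) ⊆ B := by
    rintro _ ⟨x, ⟨-, hx⟩, rfl⟩
    exact Metric.ball_subset_closedBall hx
  have hcB : IsCompact B := isCompact_closedBall _ _
  obtain ⟨C, hC⟩ := hcB.exists_bound_of_continuousOn
    (((hμ x₀).choose_spec.1.continuousOn).mono hrt)
  calc _ ≤ ∫⁻ z in B, ENNReal.ofReal ((hμ x₀).choose z) := lintegral_mono_set hsub
    _ ≤ ∫⁻ _ in B, ENNReal.ofReal C := by
      refine setLIntegral_mono_ae (by fun_prop) (Eventually.of_forall fun z hz => ?_)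
      exact ENNReal.ofReal_le_ofReal ((le_abs_self _).trans (hC z hz))
    _ = ENNReal.ofReal C * volume B := by rw [setLIntegral_const]
    _ < ⊤ := ENNReal.mul_lt_top ENNReal.ofReal_lt_top hcB.measure_lt_top

theorem integral_chart_time [SFinite μ] (x₀ : X) {f : ℝ × X → ℂ} (hf : StronglyMeasurable f)
    (h0 : ∀ q : ℝ × X, q.2 ∉ (extChartAt (𝓡 n) x₀).source → f q = 0) :
    ∫ q, f q ∂(volume.prod μ) = ∫ d : ℝ × EuclideanSpace ℝ (Fin n),
      (chartDensity hμ x₀ d.2 : ℂ) * f (d.1, chartInv x₀ d.2) := by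
  have hm : Measurable fun z => ENNReal.ofReal (chartDensity hμ x₀ z) :=
    (measurable_chartDensity hμ x₀).ennreal_ofReal
  have h1 : (volume.prod μ : Measure (ℝ × X)).restrict (univ ×ˢ (extChartAt (𝓡 n) x₀).source) =
      Measure.map (Prod.map id (chartInv x₀)) ((volume.prod volume).withDensity
        fun d : ℝ × EuclideanSpace ℝ (Fin n) => 1 * ENNReal.ofReal (chartDensity hμ x₀ d.2)) := by
    rw [← Measure.prod_restrict, restrict_source_eq_map hμ, Measure.restrict_univ,
      ← prod_withDensity measurable_const hm,
      ← Measure.map_prod_map _ _ measurable_id (measurable_chartInv x₀), Measure.map_id,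
      withDensity_const, one_smul]
  rw [← setIntegral_eq_integral_of_forall_compl_eq_zero
      (s := univ ×ˢ (extChartAt (𝓡 n) x₀).source) (fun q hq => h0 q fun h => hq ⟨mem_univ _, h⟩),
    h1, integral_map (measurable_id.prodMap (measurable_chartInv x₀)).aemeasurable
      hf.aestronglyMeasurable, integral_withDensity_eq_integral_toReal_smul
      (f := fun d : ℝ × EuclideanSpace ℝ (Fin n) =>
        1 * ENNReal.ofReal (chartDensity hμ x₀ d.2)) (measurable_const.mul
      (hm.comp measurable_snd)) (Eventually.of_forall fun _ => by
        rw [one_mul]; exact ENNReal.ofReal_lt_top)]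
  congr 1
  ext z
  rw [one_mul, ENNReal.toReal_ofReal (chartDensity_nonneg hμ x₀ z.2), Complex.real_smul]
  rfl

theorem integral_chart_time_pair [SFinite μ] (y₀ x₀ : X) {f : ℝ × X × X → ℂ}
    (hf : StronglyMeasurable f)
    (h0 : ∀ q : ℝ × X × X, (q.2.1 ∉ (extChartAt (𝓡 n) y₀).source ∨
      q.2.2 ∉ (extChartAt (𝓡 n) x₀).source) → f q = 0) :
    ∫ q, f q ∂(volume.prod (μ.prod μ)) =
      ∫ d : ℝ × EuclideanSpace ℝ (Fin n) × EuclideanSpace ℝ (Fin n),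
      ((chartDensity hμ y₀ d.2.1 * chartDensity hμ x₀ d.2.2 : ℝ) : ℂ) *
        f (d.1, chartInv y₀ d.2.1, chartInv x₀ d.2.2) := by
  have hm : ∀ x₀, Measurable fun z => ENNReal.ofReal (chartDensity hμ x₀ z) := fun x₀ =>
    (measurable_chartDensity hμ x₀).ennreal_ofReal
  have h1 : (volume.prod (μ.prod μ) : Measure (ℝ × X × X)).restrict
      (univ ×ˢ ((extChartAt (𝓡 n) y₀).source ×ˢ (extChartAt (𝓡 n) x₀).source)) =
      Measure.map (Prod.map id (Prod.map (chartInv y₀) (chartInv x₀)))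
        ((volume.prod (volume.prod volume)).withDensity
        fun d : ℝ × EuclideanSpace ℝ (Fin n) × EuclideanSpace ℝ (Fin n) =>
          1 * (ENNReal.ofReal (chartDensity hμ y₀ d.2.1) *
            ENNReal.ofReal (chartDensity hμ x₀ d.2.2))) := by
    rw [← Measure.prod_restrict, ← Measure.prod_restrict, restrict_source_eq_map hμ,
      restrict_source_eq_map hμ, Measure.restrict_univ,
      ← prod_withDensity (f := fun _ => 1) (g := fun d : EuclideanSpace ℝ (Fin n) ×
        EuclideanSpace ℝ (Fin n) => ENNReal.ofReal (chartDensity hμ y₀ d.1) *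
            ENNReal.ofReal (chartDensity hμ x₀ d.2)) measurable_const
            (((hm y₀).comp measurable_fst).mul ((hm x₀).comp measurable_snd)),
      ← prod_withDensity (hm y₀) (hm x₀),
      ← Measure.map_prod_map _ _ measurable_id
        ((measurable_chartInv y₀).prodMap (measurable_chartInv x₀)), Measure.map_id,
      ← Measure.map_prod_map _ _ (measurable_chartInv y₀) (measurable_chartInv x₀),
      withDensity_const, one_smul]
  rw [← setIntegral_eq_integral_of_forall_compl_eq_zero
      (s := univ ×ˢ ((extChartAt (𝓡 n) y₀).source ×ˢ (extChartAt (𝓡 n) x₀).source))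
      (fun q hq => h0 q (by
        by_contra! h
        exact hq ⟨mem_univ _, h.1, h.2⟩)),
    h1, integral_map (measurable_id.prodMap ((measurable_chartInv y₀).prodMap
        (measurable_chartInv x₀))).aemeasurable hf.aestronglyMeasurable,
    integral_withDensity_eq_integral_toReal_smul (f := fun d : ℝ × EuclideanSpace ℝ (Fin n) ×
        EuclideanSpace ℝ (Fin n) => 1 * (ENNReal.ofReal (chartDensity hμ y₀ d.2.1) *
            ENNReal.ofReal (chartDensity hμ x₀ d.2.2))) (measurable_const.mul
      (((hm y₀).comp (measurable_fst.comp measurable_snd)).mul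
        ((hm x₀).comp (measurable_snd.comp measurable_snd))))
      (Eventually.of_forall fun _ => by
        rw [one_mul]; exact ENNReal.mul_lt_top ENNReal.ofReal_lt_top ENNReal.ofReal_lt_top)]
  congr 1
  ext z
  rw [one_mul, ENNReal.toReal_mul, ENNReal.toReal_ofReal (chartDensity_nonneg hμ y₀ z.2.1),
    ENNReal.toReal_ofReal (chartDensity_nonneg hμ x₀ z.2.2), Complex.real_smul]
  rfl

end ChartIntegrals

end Guillemin

end

/-! ### Hörmander's restriction to the diagonal: independence of the approximation. -/

noncomputable section

namespace Guillemin

set_option linter.unusedSectionVars false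

local notation "𝔼[" n "]" => EuclideanSpace ℝ (Fin n)
local notation "𝓙[" n "]" => ModelWithCorners.prod 𝓘(ℝ, ℝ) (ModelWithCorners.prod (𝓡 n) (𝓡 n))
local notation "𝓘₁[" n "]" => ModelWithCorners.prod 𝓘(ℝ, ℝ) (𝓡 n)

instance (n : ℕ) : (volume : Measure (ℝ × 𝔼[n])).IsAddHaarMeasure :=
  Measure.prod.instIsAddHaarMeasure _ _

instance (n : ℕ) : (volume : Measure (ℝ × 𝔼[n] × 𝔼[n])).IsAddHaarMeasure :=
  haveI : (volume : Measure (𝔼[n] × 𝔼[n])).IsAddHaarMeasure :=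
    Measure.prod.instIsAddHaarMeasure _ _
  Measure.prod.instIsAddHaarMeasure _ _

section Restriction

variable {n : ℕ} {X : Type*} [TopologicalSpace X] [ChartedSpace 𝔼[n] X] [IsManifold (𝓡 n) ∞ X]

theorem extChartAt_triple_apply (p q : ℝ × X × X) :
    extChartAt 𝓙[n] p q =
      (q.1, extChartAt (𝓡 n) p.2.1 q.2.1, extChartAt (𝓡 n) p.2.2 q.2.2) := by
  rw [extChartAt_prod, extChartAt_prod]
  rfl

theorem mem_extChartAt_triple_source (p q : ℝ × X × X) :
    q ∈ (extChartAt 𝓙[n] p).source ↔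
      q.2.1 ∈ (extChartAt (𝓡 n) p.2.1).source ∧ q.2.2 ∈ (extChartAt (𝓡 n) p.2.2).source := by
  rw [extChartAt_prod, extChartAt_prod]
  simp [PartialEquiv.prod_source, chartAt_self_eq]

/-- The product vanishes off a compact subset of the chart targets, hence extends smoothly by zero
to the whole vector space. The factor `r` is left free so that it can be a density or an indicator
function. -/
theorem smooth_rep_pair (y₀ x₀ : X) {r : ℝ × 𝔼[n] × 𝔼[n] → ℂ}
    (hr : ContDiffOn ℝ ∞ r {d | d.2.1 ∈ (extChartAt (𝓡 n) y₀).target ∧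
      d.2.2 ∈ (extChartAt (𝓡 n) x₀).target})
    (hr0 : ∀ d : ℝ × 𝔼[n] × 𝔼[n], ¬(d.2.1 ∈ (extChartAt (𝓡 n) y₀).target ∧
      d.2.2 ∈ (extChartAt (𝓡 n) x₀).target) → r d = 0)
    {O : Set (ℝ × X × X)} {w : ℝ × X × X → ℂ} (hw : IsTest 𝓙[n] O w)
    (hws : ∀ q ∈ tsupport w, q.2.1 ∈ (extChartAt (𝓡 n) y₀).source ∧
      q.2.2 ∈ (extChartAt (𝓡 n) x₀).source) :
    ContDiff ℝ ∞ (fun d => r d * w (d.1, chartInv y₀ d.2.1, chartInv x₀ d.2.2)) ∧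
      HasCompactSupport (fun d => r d * w (d.1, chartInv y₀ d.2.1, chartInv x₀ d.2.2)) := by
  set T : Set (ℝ × 𝔼[n] × 𝔼[n]) := {d | d.2.1 ∈ (extChartAt (𝓡 n) y₀).target ∧
      d.2.2 ∈ (extChartAt (𝓡 n) x₀).target} with hT
  have hTo : IsOpen T :=
    ((isOpen_extChartAt_target (I := 𝓡 n) y₀).preimage (by fun_prop : Continuous
      fun d : ℝ × 𝔼[n] × 𝔼[n] => d.2.1)).inter ((isOpen_extChartAt_target (I := 𝓡 n) x₀).preimage
      (by fun_prop : Continuous fun d : ℝ × 𝔼[n] × 𝔼[n] => d.2.2))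
  set c : ℝ × X × X → ℝ × 𝔼[n] × 𝔼[n] := fun q =>
    (q.1, extChartAt (𝓡 n) y₀ q.2.1, extChartAt (𝓡 n) x₀ q.2.2)
  have hc : ContinuousOn c (tsupport w) := by
    refine continuousOn_fst.prodMk (ContinuousOn.prodMk ?_ ?_)
    · exact (continuousOn_extChartAt y₀).comp (by fun_prop) fun q hq => (hws q hq).1
    · exact (continuousOn_extChartAt x₀).comp (by fun_prop) fun q hq => (hws q hq).2
  have hsm : ContDiffOn ℝ ∞ (fun d : ℝ × 𝔼[n] × 𝔼[n] =>
      w (d.1, chartInv y₀ d.2.1, chartInv x₀ d.2.2)) T := by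
    apply ContMDiffOn.contDiffOn
    refine hw.1.comp_contMDiffOn (s := T) (ContMDiffOn.prodMk ?_ (ContMDiffOn.prodMk ?_ ?_))
    · exact contDiff_fst.contMDiff.contMDiffOn
    · exact (contMDiffOn_chartInv y₀).comp
        ((contDiff_fst.comp contDiff_snd).contMDiff.contMDiffOn) fun d hd => hd.1
    · exact (contMDiffOn_chartInv x₀).comp
        ((contDiff_snd.comp contDiff_snd).contMDiff.contMDiffOn) fun d hd => hd.2
  refine contDiff_of_contDiffOn_of_eq_zero hTo (hw.2.1.isCompact.image_of_continuousOn hc) ?_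
    (hr.mul hsm) fun d hd => ?_
  · rintro _ ⟨q, hq, rfl⟩
    exact ⟨(extChartAt (𝓡 n) y₀).map_source (hws q hq).1,
      (extChartAt (𝓡 n) x₀).map_source (hws q hq).2⟩
  · by_cases hdT : d ∈ T
    · refine mul_eq_zero_of_right _ (eq_zero_of_notMem_tsupport fun h => ?_)
      refine hd ⟨_, h, ?_⟩
      simp only [c]
      rw [extChartAt_chartInv hdT.1, extChartAt_chartInv hdT.2]
    · rw [hr0 d hdT, zero_mul]

theorem smooth_rep_time (x₀ : X) {r : ℝ × 𝔼[n] → ℂ}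
    (hr : ContDiffOn ℝ ∞ r {d | d.2 ∈ (extChartAt (𝓡 n) x₀).target})
    (hr0 : ∀ d : ℝ × 𝔼[n], d.2 ∉ (extChartAt (𝓡 n) x₀).target → r d = 0)
    {O : Set (ℝ × X)} {w : ℝ × X → ℂ} (hw : IsTest 𝓘₁[n] O w)
    (hws : ∀ q ∈ tsupport w, q.2 ∈ (extChartAt (𝓡 n) x₀).source) :
    ContDiff ℝ ∞ (fun d => r d * w (d.1, chartInv x₀ d.2)) ∧
      HasCompactSupport (fun d => r d * w (d.1, chartInv x₀ d.2)) := by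
  set T : Set (ℝ × 𝔼[n]) := {d | d.2 ∈ (extChartAt (𝓡 n) x₀).target} with hT
  have hTo : IsOpen T := (isOpen_extChartAt_target (I := 𝓡 n) x₀).preimage continuous_snd
  set c : ℝ × X → ℝ × 𝔼[n] := fun q => (q.1, extChartAt (𝓡 n) x₀ q.2)
  have hc : ContinuousOn c (tsupport w) :=
    continuousOn_fst.prodMk ((continuousOn_extChartAt x₀).comp (by fun_prop) fun q hq => hws q hq)
  have hsm : ContDiffOn ℝ ∞ (fun d : ℝ × 𝔼[n] => w (d.1, chartInv x₀ d.2)) T := by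
    apply ContMDiffOn.contDiffOn
    refine hw.1.comp_contMDiffOn (s := T) (ContMDiffOn.prodMk ?_ ?_)
    · exact contDiff_fst.contMDiff.contMDiffOn
    · exact (contMDiffOn_chartInv x₀).comp contDiff_snd.contMDiff.contMDiffOn fun d hd => hd
  refine contDiff_of_contDiffOn_of_eq_zero hTo (hw.2.1.isCompact.image_of_continuousOn hc) ?_
    (hr.mul hsm) fun d hd => ?_
  · rintro _ ⟨q, hq, rfl⟩
    exact (extChartAt (𝓡 n) x₀).map_source (hws q hq)
  · by_cases hdT : d ∈ T
    · refine mul_eq_zero_of_right _ (eq_zero_of_notMem_tsupport fun h => ?_)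
      refine hd ⟨_, h, ?_⟩
      simp only [c]
      rw [extChartAt_chartInv hdT]
    · rw [hr0 d hdT, zero_mul]

variable [MeasurableSpace X] {μ : Measure X} (hμ : IsSmoothDensity (n := n) μ)

/-- A function on `ℝ × X × X`, multiplied by the density, in the charts at `y₀` and `x₀`. -/
def pullChart (y₀ x₀ : X) (w : ℝ × X × X → ℂ) (d : ℝ × 𝔼[n] × 𝔼[n]) : ℂ :=
  ((chartDensity hμ y₀ d.2.1 * chartDensity hμ x₀ d.2.2 : ℝ) : ℂ) *
    w (d.1, chartInv y₀ d.2.1, chartInv x₀ d.2.2)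

theorem contDiff_pullChart {y₀ x₀ : X} {O : Set (ℝ × X × X)} {w : ℝ × X × X → ℂ}
    (hw : IsTest 𝓙[n] O w)
    (hws : ∀ q ∈ tsupport w, q.2.1 ∈ (extChartAt (𝓡 n) y₀).source ∧
      q.2.2 ∈ (extChartAt (𝓡 n) x₀).source) :
    ContDiff ℝ ∞ (pullChart hμ y₀ x₀ w) ∧ HasCompactSupport (pullChart hμ y₀ x₀ w) := by
  refine smooth_rep_pair y₀ x₀ (Complex.ofRealCLM.contDiff.comp_contDiffOn
    (ContDiffOn.mul ?_ ?_)) ?_ hw hws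
  · exact (contDiffOn_chartDensity hμ y₀).comp (by fun_prop) fun d hd => hd.1
  · exact (contDiffOn_chartDensity hμ x₀).comp (by fun_prop) fun d hd => hd.2
  · intro d hd
    rw [not_and_or] at hd
    rcases hd with hd | hd <;> simp [chartDensity_of_notMem hμ hd]

variable [BorelSpace X] [T2Space X] [CompactSpace X] [SecondCountableTopology X]
  [IsLocallyFiniteMeasure μ]

theorem integral_pullChart_mul {p : ℝ × X × X} {O : Set (ℝ × X × X)} {w : ℝ × X × X → ℂ}
    (hw : IsTest 𝓙[n] O w) (hws : tsupport w ⊆ (extChartAt 𝓙[n] p).source)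
    {h : ℝ × 𝔼[n] × 𝔼[n] → ℂ} (hh : ContDiff ℝ ∞ h) :
    ∫ d, pullChart hμ p.2.1 p.2.2 w d * h d =
      ∫ q, h (extChartAt 𝓙[n] p q) * w q ∂(volume.prod (μ.prod μ)) := by
  have hf : IsTest 𝓙[n] O (fun q => h (extChartAt 𝓙[n] p q) * w q) := by
    refine hw.mul_left (isOpen_extChartAt_source p) hws ?_
    have h1 : ContMDiffOn 𝓙[n] 𝓘(ℝ, ℝ × 𝔼[n] × 𝔼[n]) ∞ (extChartAt 𝓙[n] p)
        (extChartAt 𝓙[n] p).source := by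
      rw [extChartAt_source]
      exact contMDiffOn_extChartAt
    exact hh.contMDiff.comp_contMDiffOn h1
  rw [integral_chart_time_pair hμ p.2.1 p.2.2 hf.continuous.stronglyMeasurable]
  · congr 1
    ext d
    rw [pullChart, extChartAt_triple_apply]
    by_cases hd : d.2.1 ∈ (extChartAt (𝓡 n) p.2.1).target ∧ d.2.2 ∈ (extChartAt (𝓡 n) p.2.2).target
    · simp only
      rw [extChartAt_chartInv hd.1, extChartAt_chartInv hd.2]
      ring
    · rw [not_and_or] at hd
      rcases hd with hd | hd <;> simp [chartDensity_of_notMem hμ hd]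
  · intro q hq
    have : q ∉ tsupport w := fun h => by
      have := (mem_extChartAt_triple_source p q).1 (hws h)
      rcases hq with hq | hq
      · exact hq this.1
      · exact hq this.2
    rw [eq_zero_of_notMem_tsupport this, mul_zero]

/-- The bridge between Fourier analysis on the model space and the local transforms in the
definition of the wave front set: `pullChart` absorbs the density. -/
theorem fourierAt_pullChart {p : ℝ × X × X} {O : Set (ℝ × X × X)} {v Φ : ℝ × X × X → ℂ}
    (hO : IsOpen O) (hv : ContMDiffOn 𝓙[n] 𝓘(ℝ, ℂ) ∞ v O)
    (hΦ : IsTest 𝓙[n] O Φ) (hws : tsupport Φ ⊆ (extChartAt 𝓙[n] p).source)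
    (η : (ℝ × 𝔼[n] × 𝔼[n]) →L[ℝ] ℝ) :
    fourierAt volume (pullChart hμ p.2.1 p.2.2 (fun q => v q * Φ q)) η =
      localFourier 𝓙[n] (fun Φ => ∫ q, v q * Φ q ∂(volume.prod (μ.prod μ))) Φ p η := by
  have hw : IsTest 𝓙[n] O (fun q => v q * Φ q) := hΦ.mul_left hO hΦ.2.2 hv
  rw [fourierAt, integral_pullChart_mul hμ (h := fun d => Complex.exp (-Complex.I * (η d : ℂ))) hw
    ((tsupport_comp_eq_subset fun x hx => by simp [hx]).trans hws)]
  · rw [localFourier]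
    congr 1
    ext q
    ring
  · exact Complex.contDiff_exp.comp
      (contDiff_const.mul (Complex.ofRealCLM.contDiff.comp η.contDiff))

/-- The linear map `(t, z) ↦ (t, z, z)`. -/
def diagLin (n : ℕ) : (ℝ × 𝔼[n]) →L[ℝ] (ℝ × 𝔼[n] × 𝔼[n]) :=
  (ContinuousLinearMap.fst ℝ ℝ 𝔼[n]).prod
    ((ContinuousLinearMap.snd ℝ ℝ 𝔼[n]).prod (ContinuousLinearMap.snd ℝ ℝ 𝔼[n]))

theorem mfderiv_diag (q : ℝ × X) :
    mfderiv 𝓘₁[n] 𝓙[n] (diag (X := X)) q = diagLin n := by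
  have h := (hasMFDerivAt_fst (I := 𝓘(ℝ, ℝ)) (I' := 𝓡 n) q).prodMk
    ((hasMFDerivAt_snd (I := 𝓘(ℝ, ℝ)) (I' := 𝓡 n) q).prodMk
      (hasMFDerivAt_snd (I := 𝓘(ℝ, ℝ)) (I' := 𝓡 n) q))
  exact h.mfderiv

theorem contMDiff_diag : ContMDiff 𝓘₁[n] 𝓙[n] ∞ (diag (X := X)) :=
  contMDiff_fst.prodMk (contMDiff_snd.prodMk contMDiff_snd)

theorem continuous_diag : Continuous (diag (X := X)) := by
  unfold diag
  fun_prop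

variable {O : Set (ℝ × X × X)} {u : (ℝ × X × X → ℂ) → ℂ} {v : ℕ → ℝ × X × X → ℂ}

/-- Weak convergence bounds the pairings with each fixed test function;
`exists_fourierAt_poly_bound` makes this a uniform bound on the transforms. -/
theorem polyBounded_pullChart (hO : IsOpen O)
    (hv : ConvergesOffNormals 𝓙[n] 𝓘₁[n] (volume.prod (μ.prod μ)) diag O v u)
    {p : ℝ × X × X} {Φ : ℝ × X × X → ℂ} (hΦ : IsTest 𝓙[n] O Φ)
    (hΦs : tsupport Φ ⊆ (extChartAt 𝓙[n] p).source) :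
    PolyBounded volume (fun j => pullChart hμ p.2.1 p.2.2 (fun q => v j q * Φ q)) := by
  have hsub : ∀ j, tsupport (fun q => v j q * Φ q) ⊆ (extChartAt 𝓙[n] p).source := fun j =>
    (tsupport_comp_eq_subset fun x hx => by simp [hx]).trans hΦs
  have hw : ∀ j, IsTest 𝓙[n] O (fun q => v j q * Φ q) := fun j =>
    hΦ.mul_left hO hΦ.2.2 (hv.1 j)
  refine exists_fourierAt_poly_bound volume _ (fun j => ?_) fun h hh => ?_
  · obtain ⟨h1, h2⟩ := contDiff_pullChart hμ (hw j)
      fun q hq => (mem_extChartAt_triple_source p q).1 (hsub j hq)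
    exact h1.continuous.integrable_of_hasCompactSupport h2
  · have h1 : IsTest 𝓙[n] O (fun q => h (extChartAt 𝓙[n] p q) * Φ q) := by
      refine hΦ.mul_left (isOpen_extChartAt_source p) hΦs ?_
      have h1 : ContMDiffOn 𝓙[n] 𝓘(ℝ, ℝ × 𝔼[n] × 𝔼[n]) ∞ (extChartAt 𝓙[n] p)
          (extChartAt 𝓙[n] p).source := by
        rw [extChartAt_source]
        exact contMDiffOn_extChartAt
      exact hh.contMDiff.comp_contMDiffOn h1
    obtain ⟨B, hB⟩ := (hv.2.1 _ h1).norm.bddAbove_range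
    refine ⟨B, fun j => ?_⟩
    rw [integral_pullChart_mul hμ (hw j) (hsub j) hh]
    refine le_trans (le_of_eq ?_) (hB ⟨j, rfl⟩)
    simp only
    congr 2
    ext q
    ring

theorem decaysNear_pullChart_mul (hO : IsOpen O)
    (hv : ConvergesOffNormals 𝓙[n] 𝓘₁[n] (volume.prod (μ.prod μ)) diag O v u)
    {p : ℝ × X × X} {Φ Ψ : ℝ × X × X → ℂ} (hΦ : IsTest 𝓙[n] O Φ)
    (hΦs : tsupport Φ ⊆ (extChartAt 𝓙[n] p).source) (hΨ : IsTest 𝓙[n] O Ψ)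
    (hΨs : tsupport Ψ ⊆ (extChartAt 𝓙[n] p).source) {ζ : (ℝ × 𝔼[n] × 𝔼[n]) →L[ℝ] ℝ}
    (hd : DecaysNear volume
      (fun j => pullChart hμ p.2.1 p.2.2 (fun q => v j q * Φ q)) ζ) :
    DecaysNear volume
      (fun j => pullChart hμ p.2.1 p.2.2 (fun q => v j q * (Ψ q * Φ q))) ζ := by
  classical
  have hsub : ∀ j, tsupport (fun q => v j q * Φ q) ⊆ (extChartAt 𝓙[n] p).source := fun j =>
    (tsupport_comp_eq_subset fun x hx => by simp [hx]).trans hΦs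
  have hw : ∀ j, IsTest 𝓙[n] O (fun q => v j q * Φ q) := fun j =>
    hΦ.mul_left hO hΦ.2.2 (hv.1 j)
  obtain ⟨h1, h2⟩ := smooth_rep_pair (n := n) p.2.1 p.2.2 (r := indicator {d | d.2.1 ∈
      (extChartAt (𝓡 n) p.2.1).target ∧ d.2.2 ∈ (extChartAt (𝓡 n) p.2.2).target} 1)
    (contDiffOn_const (c := (1 : ℂ)) |>.congr fun d hd => indicator_of_mem (by exact hd) _)
    (fun d hd => indicator_of_notMem (by exact hd) _) hΨ
    fun q hq => (mem_extChartAt_triple_source p q).1 (hΨs hq)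
  have h3 := hd.mul (μ := volume) (fun j => by
    obtain ⟨h1, h2⟩ := contDiff_pullChart hμ (hw j)
      fun q hq => (mem_extChartAt_triple_source p q).1 (hsub j hq)
    exact h1.continuous.integrable_of_hasCompactSupport h2)
    (polyBounded_pullChart hμ hO hv hΦ hΦs) h1 h2
  convert h3 using 3 with j d
  unfold pullChart
  by_cases hd : d.2.1 ∈ (extChartAt (𝓡 n) p.2.1).target ∧ d.2.2 ∈ (extChartAt (𝓡 n) p.2.2).target
  · rw [indicator_of_mem (by exact hd)]
    simp only [Pi.one_apply]
    ring
  · rw [not_and_or] at hd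
    rcases hd with hd | hd <;> simp [chartDensity_of_notMem hμ hd]

/-- Uniform microlocal smoothness supplies a cutoff that depends on the covector. Unit normals form
a compact set, and decay survives multiplication by test functions, so a product of finitely many
cutoffs serves all normals. The additional factor `Ψ` makes it possible to multiply the cutoffs
belonging to two different sequences. -/
theorem exists_common_cutoff (hO : IsOpen O)
    (hv : ConvergesOffNormals 𝓙[n] 𝓘₁[n] (volume.prod (μ.prod μ)) diag O v u)
    {q : ℝ × X} (hq : diag q ∈ O) :
    ∃ Φ : ℝ × X × X → ℂ, IsTest 𝓙[n] O Φ ∧ tsupport Φ ⊆ (extChartAt 𝓙[n] (diag q)).source ∧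
      Φ (diag q) ≠ 0 ∧ ∀ Ψ, IsTest 𝓙[n] O Ψ → tsupport Ψ ⊆ (extChartAt 𝓙[n] (diag q)).source →
      ∀ ζ : (ℝ × 𝔼[n] × 𝔼[n]) →L[ℝ] ℝ, ‖ζ‖ = 1 → ζ.comp (diagLin n) = 0 →
        DecaysNear volume
          (fun j => pullChart hμ q.2 q.2 (fun x => v j x * (Ψ x * Φ x))) ζ := by
  classical
  set S : Set ((ℝ × 𝔼[n] × 𝔼[n]) →L[ℝ] ℝ) := {ζ | ‖ζ‖ = 1 ∧ ζ.comp (diagLin n) = 0} with hS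
  have hScpt : IsCompact S := by
    refine (isCompact_sphere (0 : (ℝ × 𝔼[n] × 𝔼[n]) →L[ℝ] ℝ) 1).of_isClosed_subset ?_
      fun ζ hζ => by simpa using hζ.1
    refine (isClosed_eq continuous_norm continuous_const).inter (isClosed_eq ?_ continuous_const)
    exact ((ContinuousLinearMap.compL ℝ _ _ ℝ).flip (diagLin n)).continuous
  have hloc : ∀ ζ ∈ S, ∃ Φ : ℝ × X × X → ℂ, ∃ W ∈ 𝓝 ζ, IsTest 𝓙[n] O Φ ∧
      tsupport Φ ⊆ (extChartAt 𝓙[n] (diag q)).source ∧ Φ (diag q) ≠ 0 ∧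
      ∀ ζ' ∈ W, DecaysNear volume (fun j => pullChart hμ q.2 q.2 (fun x => v j x * Φ x)) ζ' := by
    intro ζ hζ
    have hζ0 : ζ ≠ 0 := by
      rintro rfl
      simpa using hζ.1
    have hn : (⟨diag q, ζ⟩ : Σ p : ℝ × X × X, (TangentSpace 𝓙[n] p →L[ℝ] ℝ)) ∈
        normals 𝓙[n] 𝓘₁[n] (diag (X := X)) := by
      refine ⟨q, ζ, ?_, rfl⟩
      rw [mfderiv_diag]
      exact hζ.2
    obtain ⟨Φ, hΦ, hΦs, hΦ0, W, hW, hWd⟩ := hv.2.2 _ hn hq hζ0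
    refine ⟨Φ, interior W, interior_mem_nhds.2 hW, hΦ, hΦs, hΦ0, fun ζ' hζ' =>
      ⟨W, mem_interior_iff_mem_nhds.1 hζ', fun N => ?_⟩⟩
    obtain ⟨C, hC⟩ := hWd N
    refine ⟨C, fun j η hη s hs => ?_⟩
    have := fourierAt_pullChart hμ hO (hv.1 j) hΦ hΦs (s • η)
    simp only [diag] at this
    rw [this]
    exact hC j η hη s hs
  choose! Φ W hW hΦ hΦs hΦ0 hWd using hloc
  obtain ⟨t, ht, htc⟩ := hScpt.elim_nhds_subcover W hW
  obtain ⟨Φ₀, hΦ₀, hΦ₀1⟩ := exists_isTest_eq_one (I := 𝓙[n]) (p := diag q)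
    (Filter.inter_mem (hO.mem_nhds hq) (extChartAt_source_mem_nhds (I := 𝓙[n]) (diag q)))
  have hprod : ∀ s : Finset ((ℝ × 𝔼[n] × 𝔼[n]) →L[ℝ] ℝ), s ⊆ t →
      ContMDiff 𝓙[n] 𝓘(ℝ, ℂ) ∞ (fun x => ∏ ζ ∈ s, Φ ζ x) := by
    intro s
    induction s using Finset.induction_on with
    | empty => intro _; simpa using contMDiff_const
    | insert i s his ih =>
      intro hs
      simp_rw [Finset.prod_insert his]
      exact fun x => contMDiffAt_mul ((hΦ i (ht i (hs (Finset.mem_insert_self _ _)))).1 x)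
        (ih (fun j hj => hs (Finset.mem_insert_of_mem hj)) x)
  have hΦ₀O : IsTest 𝓙[n] O Φ₀ := hΦ₀.mono (hΦ₀.2.2.trans inter_subset_left)
  have hT : ∀ s ⊆ t, IsTest 𝓙[n] O (fun x => (∏ ζ ∈ s, Φ ζ x) * Φ₀ x) := fun s hs =>
    hΦ₀O.mul (hprod s hs)
  have hTs : ∀ s ⊆ t, tsupport (fun x => (∏ ζ ∈ s, Φ ζ x) * Φ₀ x) ⊆
      (extChartAt 𝓙[n] (diag q)).source := fun s _ =>
    (tsupport_comp_eq_subset fun x hx => by simp [hx]).trans (hΦ₀.2.2.trans inter_subset_right)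
  refine ⟨fun x => (∏ ζ ∈ t, Φ ζ x) * Φ₀ x, hT t subset_rfl, hTs t subset_rfl, ?_,
    fun Ψ hΨ hΨs ζ hζ1 hζ2 => ?_⟩
  · show (∏ ζ ∈ t, Φ ζ (diag q)) * Φ₀ (diag q) ≠ 0
    rw [hΦ₀1.eq_of_nhds, mul_one]
    exact Finset.prod_ne_zero_iff.2 fun ζ hζ => hΦ0 ζ (ht ζ hζ)
  · obtain ⟨ζ', hζ't, hζ'⟩ := mem_iUnion₂.1 (htc (⟨hζ1, hζ2⟩ : ζ ∈ S))
    have h1 := hWd ζ' (ht ζ' hζ't) ζ hζ'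
    have h2 : IsTest 𝓙[n] O (fun x => Ψ x * ((∏ ζ ∈ t.erase ζ', Φ ζ x) * Φ₀ x)) :=
      (hT _ (Finset.erase_subset _ _)).mul hΨ.1
    have h3 := decaysNear_pullChart_mul hμ (p := diag q) hO hv (hΦ ζ' (ht ζ' hζ't))
      (hΦs ζ' (ht ζ' hζ't)) h2 ((tsupport_comp_eq_subset fun x hx => by simp [hx]).trans hΨs) h1
    have h4 : (fun x => Ψ x * ((∏ ζ ∈ t, Φ ζ x) * Φ₀ x)) =
        fun x => (Ψ x * ((∏ ζ ∈ t.erase ζ', Φ ζ x) * Φ₀ x)) * Φ ζ' x := by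
      ext x
      rw [← Finset.mul_prod_erase t _ hζ't]
      ring
    have h5 : ∀ j, (fun x => v j x * (Ψ x * ((∏ ζ ∈ t, Φ ζ x) * Φ₀ x))) =
        fun x => v j x * ((Ψ x * ((∏ ζ ∈ t.erase ζ', Φ ζ x) * Φ₀ x)) * Φ ζ' x) := fun j =>
      funext fun x => congrArg (v j x * ·) (congrFun h4 x)
    simp_rw [h5]
    exact h3

/-- The diagonal restrictions of two approximations of the same distribution have the same
limit. -/
theorem exists_tendsto_diag (hO : IsOpen O) {v' : ℕ → ℝ × X × X → ℂ}
    (hv : ConvergesOffNormals 𝓙[n] 𝓘₁[n] (volume.prod (μ.prod μ)) diag O v u)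
    (hv' : ConvergesOffNormals 𝓙[n] 𝓘₁[n] (volume.prod (μ.prod μ)) diag O v' u)
    (hμ : IsSmoothDensity (n := n) μ)
    {χ : ℝ × X → ℂ} (hχ : IsTest 𝓘₁[n] (diag ⁻¹' O) χ) :
    ∃ Λ : ℂ, Tendsto (fun j => ∫ q, v j (diag q) * χ q ∂(volume.prod μ)) atTop (𝓝 Λ) ∧
      Tendsto (fun j => ∫ q, v' j (diag q) * χ q ∂(volume.prod μ)) atTop (𝓝 Λ) := by
  have hOd : IsOpen (diag ⁻¹' O : Set (ℝ × X)) := hO.preimage continuous_diag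
  have hsmd : ∀ v : ℝ × X × X → ℂ, ContMDiffOn 𝓙[n] 𝓘(ℝ, ℂ) ∞ v O → ∀ χ,
      IsTest 𝓘₁[n] (diag ⁻¹' O) χ → IsTest 𝓘₁[n] (diag ⁻¹' O) (fun q => v (diag q) * χ q) :=
    fun v hv χ hχ => hχ.mul_left hOd hχ.2.2 (hv.comp contMDiff_diag.contMDiffOn subset_rfl)
  have hint : ∀ v : ℝ × X × X → ℂ, ContMDiffOn 𝓙[n] 𝓘(ℝ, ℂ) ∞ v O → ∀ χ,
      IsTest 𝓘₁[n] (diag ⁻¹' O) χ →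
        Integrable (fun q => v (diag q) * χ q) (volume.prod μ) := fun v hv χ hχ =>
    (hsmd v hv χ hχ).continuous.integrable_of_hasCompactSupport (hsmd v hv χ hχ).2.1
  refine IsTest.induction_on (P := fun χ => ∃ Λ : ℂ,
      Tendsto (fun j => ∫ q, v j (diag q) * χ q ∂(volume.prod μ)) atTop (𝓝 Λ) ∧
      Tendsto (fun j => ∫ q, v' j (diag q) * χ q ∂(volume.prod μ)) atTop (𝓝 Λ))
      ⟨0, by simp, by simp⟩ ?_ ?_ hχ
  · rintro Φ Ψ hΦ hΨ ⟨Λ₁, h1, h1'⟩ ⟨Λ₂, h2, h2'⟩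
    refine ⟨Λ₁ + Λ₂, ?_, ?_⟩
    · refine (h1.add h2).congr fun j => ?_
      rw [← integral_add (hint _ (hv.1 j) _ hΦ) (hint _ (hv.1 j) _ hΨ)]
      simp_rw [mul_add]
    · refine (h1'.add h2').congr fun j => ?_
      rw [← integral_add (hint _ (hv'.1 j) _ hΦ) (hint _ (hv'.1 j) _ hΨ)]
      simp_rw [mul_add]
  · intro q hq
    obtain ⟨Φ, hΦ, hΦs, hΦ0, hΦd⟩ := exists_common_cutoff hμ hO hv hq
    obtain ⟨Φ', hΦ', hΦs', hΦ0', hΦd'⟩ := exists_common_cutoff hμ hO hv' hq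
    -- On `N` the product of the two cutoffs is invertible along the diagonal, so it can be inserted
    -- in the kernels and divided out of the test function.
    set N : Set (ℝ × X) := {q' | Φ' (diag q') * Φ (diag q') ≠ 0} with hN
    have hcN : Continuous fun q' : ℝ × X => Φ' (diag q') * Φ (diag q') :=
      (hΦ'.continuous.comp continuous_diag).mul (hΦ.continuous.comp continuous_diag)
    have hNo : IsOpen N := isOpen_ne.preimage hcN
    refine ⟨N, hNo.mem_nhds (mul_ne_zero hΦ0' hΦ0), fun χ hχ hχN => ?_⟩
    have hNs : ∀ q' ∈ N, q'.2 ∈ (extChartAt (𝓡 n) q.2).source := by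
      intro q' hq'
      have h1 : diag q' ∈ tsupport Φ := by
        by_contra h
        exact hq' (by rw [eq_zero_of_notMem_tsupport h, mul_zero])
      exact ((mem_extChartAt_triple_source _ _).1 (hΦs h1)).1
    -- the amplitude on the diagonal
    have hχ' : IsTest 𝓘₁[n] (diag ⁻¹' O)
        (fun q' => (Φ' (diag q') * Φ (diag q'))⁻¹ * χ q') := by
      refine hχ.mul_left hNo hχN ?_
      intro q' hq'
      refine ContMDiffAt.contMDiffWithinAt ?_
      have h1 : ContMDiffAt 𝓘₁[n] 𝓘(ℝ, ℂ) ∞ (fun q' => Φ' (diag q') * Φ (diag q')) q' :=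
        contMDiffAt_mul ((hΦ'.1.comp contMDiff_diag) q') ((hΦ.1.comp contMDiff_diag) q')
      have h2 : ContDiffAt ℝ ∞ (fun z : ℂ => z⁻¹) (Φ' (diag q') * Φ (diag q')) :=
        contDiffAt_inv ℝ hq'
      exact h2.contMDiffAt.comp q' h1
    have hsub : tsupport (fun q' => (Φ' (diag q') * Φ (diag q'))⁻¹ * χ q') ⊆ tsupport χ :=
      tsupport_comp_eq_subset fun x hx => by simp [hx]
    obtain ⟨hA, hAc⟩ := smooth_rep_time (n := n) q.2
      (r := fun d => ((chartDensity hμ q.2 d.2 : ℂ))⁻¹)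
      (by
        refine ContDiffOn.inv (Complex.ofRealCLM.contDiff.comp_contDiffOn
          ((contDiffOn_chartDensity hμ q.2).comp contDiff_snd.contDiffOn fun d hd => hd)) ?_
        intro d hd
        exact_mod_cast (chartDensity_pos hμ hd).ne')
      (fun d hd => by rw [chartDensity_of_notMem hμ hd]; simp) hχ'
      (fun q' hq' => hNs q' (hχN (hsub hq')))
    obtain ⟨Λ, hΛ⟩ := exists_tendsto_integral_comp_linear volume volume (diagLin n) hA hAc
    -- `pullChart` carries the density twice, once for each factor `X`, while the measure on the
    -- diagonal carries it once; this explains the single inverse density in the amplitude.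
    have hform : ∀ v : ℝ × X × X → ℂ, ContMDiffOn 𝓙[n] 𝓘(ℝ, ℂ) ∞ v O →
        ∫ q, v (diag q) * χ q ∂(volume.prod μ) =
        ∫ d : ℝ × 𝔼[n], pullChart hμ q.2 q.2 (fun x => v x * (Φ' x * Φ x)) (diagLin n d) *
          (((chartDensity hμ q.2 d.2 : ℂ))⁻¹ *
            ((Φ' (diag (d.1, chartInv q.2 d.2)) * Φ (diag (d.1, chartInv q.2 d.2)))⁻¹ *
              χ (d.1, chartInv q.2 d.2))) := by
      intro v hv
      rw [integral_chart_time hμ q.2 (hsmd v hv χ hχ).continuous.stronglyMeasurable]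
      · congr 1
        ext d
        by_cases hd : d.2 ∈ (extChartAt (𝓡 n) q.2).target
        · have h1 : (chartDensity hμ q.2 d.2 : ℂ) ≠ 0 := by
            exact_mod_cast (chartDensity_pos hμ hd).ne'
          by_cases hx : χ (d.1, chartInv q.2 d.2) = 0
          · simp [hx]
          · have h2 : Φ' (diag (d.1, chartInv q.2 d.2)) * Φ (diag (d.1, chartInv q.2 d.2)) ≠ 0 :=
              hχN (subset_tsupport _ hx)
            have h3 : pullChart hμ q.2 q.2 (fun x => v x * (Φ' x * Φ x)) (diagLin n d) =
              (chartDensity hμ q.2 d.2 : ℂ) * (chartDensity hμ q.2 d.2 : ℂ) *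
                (v (diag (d.1, chartInv q.2 d.2)) * (Φ' (diag (d.1, chartInv q.2 d.2)) *
                  Φ (diag (d.1, chartInv q.2 d.2)))) := by
              rw [pullChart, Complex.ofReal_mul]
              rfl
            rw [h3]
            generalize Φ' (diag (d.1, chartInv q.2 d.2)) * Φ (diag (d.1, chartInv q.2 d.2)) = a
              at h2 ⊢
            field_simp
        · rw [chartDensity_of_notMem hμ hd]
          simp
      · intro q' hq'
        have : q' ∉ tsupport χ := fun h => hq' (hNs q' (hχN h))
        rw [eq_zero_of_notMem_tsupport this, mul_zero]
    -- The limit is `Λ` of the local Fourier transform of `u` itself, an expression in which the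
    -- sequence no longer occurs.
    have hfin : ∀ v : ℕ → ℝ × X × X → ℂ,
        ConvergesOffNormals 𝓙[n] 𝓘₁[n] (volume.prod (μ.prod μ)) diag O v u →
        (∀ ζ : (ℝ × 𝔼[n] × 𝔼[n]) →L[ℝ] ℝ, ‖ζ‖ = 1 → ζ.comp (diagLin n) = 0 →
          DecaysNear volume
            (fun j => pullChart hμ q.2 q.2 (fun x => v j x * (Φ' x * Φ x))) ζ) →
        Tendsto (fun j => ∫ q, v j (diag q) * χ q ∂(volume.prod μ)) atTop
          (𝓝 (Λ fun η => localFourier 𝓙[n] u (fun x => Φ' x * Φ x) (diag q) η)) := by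
      intro v hv hd
      have hT : IsTest 𝓙[n] O (fun x => Φ' x * Φ x) := hΦ.mul hΦ'.1
      have hTs : tsupport (fun x => Φ' x * Φ x) ⊆ (extChartAt 𝓙[n] (diag q)).source :=
        (tsupport_comp_eq_subset fun x hx => by simp [hx]).trans hΦs
      have hw : ∀ j, IsTest 𝓙[n] O (fun x => v j x * (Φ' x * Φ x)) := fun j =>
        hT.mul_left hO hT.2.2 (hv.1 j)
      have hws : ∀ j, ∀ x ∈ tsupport (fun x => v j x * (Φ' x * Φ x)),
          x.2.1 ∈ (extChartAt (𝓡 n) q.2).source ∧ x.2.2 ∈ (extChartAt (𝓡 n) q.2).source :=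
        fun j x hx => (mem_extChartAt_triple_source (diag q) x).1
          (((tsupport_comp_eq_subset fun x hx => by
            rw [mul_eq_zero]; exact Or.inr hx).trans hTs) hx)
      simp_rw [fun j => hform (v j) (hv.1 j)]
      refine hΛ _ _ (fun j => (contDiff_pullChart hμ (hw j) (hws j)).1)
        (fun j => (contDiff_pullChart hμ (hw j) (hws j)).2)
        (polyBounded_pullChart hμ (p := diag q) hO hv hT hTs) hd fun η => ?_
      have h1 : ∀ j, fourierAt volume (pullChart hμ q.2 q.2 (fun x => v j x * (Φ' x * Φ x))) η =
          localFourier 𝓙[n] (fun Φ => ∫ q, v j q * Φ q ∂(volume.prod (μ.prod μ)))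
            (fun x => Φ' x * Φ x) (diag q) η := fun j =>
        fourierAt_pullChart hμ (p := diag q) hO (hv.1 j) hT hTs η
      simp_rw [h1]
      unfold localFourier
      refine hv.2.1 _ ?_
      have h2 : IsTest 𝓙[n] O (fun x =>
          Complex.exp (-Complex.I * (η (extChartAt 𝓙[n] (diag q) x) : ℂ)) * (Φ' x * Φ x)) := by
        refine hT.mul_left (isOpen_extChartAt_source (diag q)) hTs ?_
        have h1 : ContMDiffOn 𝓙[n] 𝓘(ℝ, ℝ × 𝔼[n] × 𝔼[n]) ∞ (extChartAt 𝓙[n] (diag q))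
            (extChartAt 𝓙[n] (diag q)).source := by
          rw [extChartAt_source]
          exact contMDiffOn_extChartAt
        have h3 : ContDiff ℝ ∞ (fun d => Complex.exp (-Complex.I * (η d : ℂ))) :=
          Complex.contDiff_exp.comp
            (contDiff_const.mul (Complex.ofRealCLM.contDiff.comp η.contDiff))
        exact h3.contMDiff.comp_contMDiffOn h1
      simpa only [mul_comm] using h2
    refine ⟨_, hfin v hv fun ζ h1 h2 => hΦd Φ' hΦ' hΦs' ζ h1 h2, hfin v' hv' fun ζ h1 h2 => ?_⟩
    have h3 := hΦd' Φ hΦ hΦs ζ h1 h2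
    have h5 : ∀ j, (fun x => v' j x * (Φ' x * Φ x)) = fun x => v' j x * (Φ x * Φ' x) := fun j =>
      funext fun x => by rw [mul_comm (Φ x)]
    simp_rw [h5]
    exact h3

end Restriction

end Guillemin

end

/-! ### Differentials of the flow. -/

noncomputable section

namespace Guillemin

set_option linter.unusedSectionVars false

local notation "𝔼[" n "]" => EuclideanSpace ℝ (Fin n)
local notation "𝓙[" n "]" => ModelWithCorners.prod 𝓘(ℝ, ℝ) (ModelWithCorners.prod (𝓡 n) (𝓡 n))
local notation "𝓘₁[" n "]" => ModelWithCorners.prod 𝓘(ℝ, ℝ) (𝓡 n)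

section FlowDerivative

variable {n : ℕ} {X : Type*} [TopologicalSpace X] [ChartedSpace 𝔼[n] X]

/-- The differential of `φ_t` at `x`, as an endomorphism of the model space. -/
def dflow (φ : ℝ → X → X) (t : ℝ) (x : X) : 𝔼[n] →L[ℝ] 𝔼[n] := mfderiv (𝓡 n) (𝓡 n) (φ t) x

/-- The generator at `x`, as an element of the model space. -/
def gen (φ : ℝ → X → X) (x : X) : 𝔼[n] := generator φ x

variable {φ : ℝ → X → X}

namespace IsSmoothFlow

theorem contMDiff_apply (h : IsSmoothFlow (n := n) φ) (t : ℝ) : ContMDiff (𝓡 n) (𝓡 n) ∞ (φ t) :=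
  h.smooth.comp (contMDiff_const.prodMk contMDiff_id)

theorem contMDiff_orbit (h : IsSmoothFlow (n := n) φ) (x : X) : ContMDiff 𝓘(ℝ, ℝ) (𝓡 n) ∞ (fun t => φ t x) :=
  h.smooth.comp (contMDiff_id.prodMk contMDiff_const)

theorem continuous_uncurry (h : IsSmoothFlow (n := n) φ) : Continuous (fun p : ℝ × X => φ p.1 p.2) := h.smooth.continuous

theorem contMDiff_backward (h : IsSmoothFlow (n := n) φ) : ContMDiff 𝓘₁[n] (𝓡 n) ∞ (fun p : ℝ × X => φ (-p.1) p.2) :=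
  h.smooth.comp ((contDiff_neg.contMDiff.comp contMDiff_fst).prodMk contMDiff_snd)

theorem neg_apply (h : IsSmoothFlow (n := n) φ) (t : ℝ) (x : X) : φ (-t) (φ t x) = x := by
  rw [← h.add, neg_add_cancel, h.zero]

theorem comm (h : IsSmoothFlow (n := n) φ) (s t : ℝ) (x : X) : φ s (φ t x) = φ t (φ s x) := by
  rw [← h.add, ← h.add, add_comm]

theorem neg_period_iff (h : IsSmoothFlow (n := n) φ) {x : X} {T : ℝ} : φ (-T) x = x ↔ φ T x = x :=
  ⟨fun hx => by simpa using h.neg_period hx, h.neg_period⟩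

theorem period_apply (h : IsSmoothFlow (n := n) φ) {x : X} {T : ℝ} (hx : φ T x = x) (s : ℝ) : φ T (φ s x) = φ s x := by
  rw [h.comm, hx]

theorem period_add (h : IsSmoothFlow (n := n) φ) {x : X} {S T : ℝ} (hS : φ S x = x) (hT : φ T x = x) : φ (S + T) x = x := by
  rw [h.add, hT, hS]

theorem period_nat_mul (h : IsSmoothFlow (n := n) φ) {x : X} {T : ℝ} (hx : φ T x = x) (m : ℕ) : φ (m * T) x = x := by
  induction m with
  | zero => simp [h.zero]
  | succ m ih => rw [Nat.cast_succ, add_mul, one_mul, h.period_add ih hx]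

variable [IsManifold (𝓡 n) ∞ X]

theorem hasMFDerivAt_apply (h : IsSmoothFlow (n := n) φ) (t : ℝ) (x : X) :
    HasMFDerivAt (𝓡 n) (𝓡 n) (φ t) x (dflow (n := n) φ t x) :=
  ((h.contMDiff_apply t).mdifferentiable (by simp) x).hasMFDerivAt

theorem hasMFDerivAt_orbit_zero (h : IsSmoothFlow (n := n) φ) (x : X) :
    HasMFDerivAt 𝓘(ℝ, ℝ) (𝓡 n) (fun t : ℝ => φ t x) (0 : ℝ)
      (ContinuousLinearMap.toSpanSingleton ℝ (gen (n := n) φ x) : ℝ →L[ℝ] 𝔼[n]) := by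
  have h1 := ((h.contMDiff_orbit x).mdifferentiable (by simp) 0).hasMFDerivAt
  have h2 : (mfderiv 𝓘(ℝ, ℝ) (𝓡 n) (fun t => φ t x) 0 : ℝ →L[ℝ] 𝔼[n]) =
      ContinuousLinearMap.toSpanSingleton ℝ (gen (n := n) φ x) := by
    refine ContinuousLinearMap.ext_ring ?_
    exact (one_smul ℝ (gen (n := n) φ x)).symm
  rw [← h2]
  exact h1

theorem dflow_add (h : IsSmoothFlow (n := n) φ) (s t : ℝ) (x : X) :
    dflow (n := n) φ (s + t) x = (dflow φ s (φ t x)).comp (dflow φ t x) := by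
  have h1 := (h.hasMFDerivAt_apply s (φ t x)).comp x (h.hasMFDerivAt_apply t x)
  have h2 : φ s ∘ φ t = φ (s + t) := funext fun x => (h.add s t x).symm
  rw [h2] at h1
  exact h1.mfderiv

theorem dflow_zero (h : IsSmoothFlow (n := n) φ) (x : X) : dflow (n := n) φ 0 x = ContinuousLinearMap.id ℝ _ := by
  have h2 : φ 0 = id := funext h.zero
  rw [dflow, h2, mfderiv_id]
  rfl

theorem dflow_neg_apply (h : IsSmoothFlow (n := n) φ) (t : ℝ) (x : X) (v : 𝔼[n]) :
    dflow φ (-t) (φ t x) (dflow φ t x v) = v := by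
  have := h.dflow_add (-t) t x
  rw [neg_add_cancel, h.dflow_zero] at this
  exact (DFunLike.congr_fun this v).symm

theorem dflow_apply_neg (h : IsSmoothFlow (n := n) φ) (t : ℝ) (x : X) (v : 𝔼[n]) :
    dflow φ t x (dflow φ (-t) (φ t x) v) = v := by
  have := h.dflow_neg_apply (-t) (φ t x) v
  rwa [neg_neg, h.neg_apply] at this

/-- Differentiate `φ_t ∘ φ_s = φ_s ∘ φ_t` in `s` at `s = 0`. -/
theorem dflow_gen (h : IsSmoothFlow (n := n) φ) (t : ℝ) (x : X) : dflow φ t x (gen (n := n) φ x) = gen φ (φ t x) := by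
  have h0 : HasMFDerivAt (𝓡 n) (𝓡 n) (φ t) (φ 0 x) (dflow (n := n) φ t x) := by
    rw [h.zero]
    exact h.hasMFDerivAt_apply t x
  have h1 := HasMFDerivAt.comp (f := fun s : ℝ => φ s x) (0 : ℝ) h0 (h.hasMFDerivAt_orbit_zero x)
  have h2 : φ t ∘ (fun s => φ s x) = fun s => φ s (φ t x) := funext fun s => h.comm t s x
  rw [h2] at h1
  have h3 := hasMFDerivAt_unique h1 (h.hasMFDerivAt_orbit_zero (φ t x))
  have h4 := congrArg (fun L : ℝ →L[ℝ] 𝔼[n] => L 1) h3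
  rw [ContinuousLinearMap.toSpanSingleton_apply, one_smul] at h4
  rw [← h4]
  exact congrArg (dflow φ t x) (one_smul ℝ (gen (n := n) φ x)).symm

theorem hasMFDerivAt_orbit (h : IsSmoothFlow (n := n) φ) (s : ℝ) (x : X) :
    HasMFDerivAt 𝓘(ℝ, ℝ) (𝓡 n) (fun t => φ t x) s
      (ContinuousLinearMap.toSpanSingleton ℝ (gen (n := n) φ (φ s x)) : ℝ →L[ℝ] 𝔼[n]) := by
  have h0 : HasMFDerivAt 𝓘(ℝ, ℝ) (𝓡 n) (fun t => φ t (φ s x)) (s - s)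
      (ContinuousLinearMap.toSpanSingleton ℝ (gen (n := n) φ (φ s x)) : ℝ →L[ℝ] 𝔼[n]) := by
    rw [sub_self]
    exact h.hasMFDerivAt_orbit_zero (φ s x)
  have h1 := HasMFDerivAt.comp (f := fun t : ℝ => id t - s) (s : ℝ) h0 (((hasFDerivAt_id (𝕜 := ℝ) s).sub_const s).hasMFDerivAt)
  have h2 : (fun t => φ t (φ s x)) ∘ (fun t => t - s) = fun t => φ t x := by
    ext t
    simp [← h.add]
  have h3 : (fun t => φ t (φ s x)) ∘ (fun t => id t - s) = fun t => φ t x := h2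
  rw [h3] at h1
  exact h1

end IsSmoothFlow

end FlowDerivative

end Guillemin

end

/-! ### Linear algebra of transversality, and hyperbolicity of the Poincaré map. -/

noncomputable section

namespace Guillemin

set_option linter.unusedSectionVars false

local notation "𝔼[" n "]" => EuclideanSpace ℝ (Fin n)

section LinearAlgebra

variable {M N W W' : Type*} [AddCommGroup M] [Module ℝ M] [AddCommGroup N] [Module ℝ N]
  [AddCommGroup W] [Module ℝ W] [AddCommGroup W'] [Module ℝ W']
  [FiniteDimensional ℝ M] [FiniteDimensional ℝ N] [FiniteDimensional ℝ W]

theorem det_blockTriangular (J : M →ₗ[ℝ] M) (L : N →ₗ[ℝ] M) (Q : N →ₗ[ℝ] N) :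
    LinearMap.det ((J.coprod L).prod (Q ∘ₗ LinearMap.snd ℝ M N)) =
      LinearMap.det J * LinearMap.det Q := by
  classical
  let b := Module.Free.chooseBasis ℝ M
  let b' := Module.Free.chooseBasis ℝ N
  have h : LinearMap.toMatrix (b.prod b') (b.prod b') ((J.coprod L).prod (Q ∘ₗ LinearMap.snd ℝ M N))
      = Matrix.fromBlocks (LinearMap.toMatrix b b J) (LinearMap.toMatrix b' b L) 0
        (LinearMap.toMatrix b' b' Q) := by
    ext i j
    rcases i with i | i <;> rcases j with j | j <;> simp [LinearMap.toMatrix_apply]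
  rw [← LinearMap.det_toMatrix (b.prod b'), h, Matrix.det_fromBlocks_zero₂₁, LinearMap.det_toMatrix,
    LinearMap.det_toMatrix]

theorem abs_det_neg (Q : W →ₗ[ℝ] W) : |LinearMap.det (-Q)| = |LinearMap.det Q| := by
  have : -Q = (-1 : ℝ) • Q := by simp
  rw [this, LinearMap.det_smul, abs_mul, abs_pow]
  simp

variable {v₀ : W} {E' : Submodule ℝ W} {R : W →ₗ[ℝ] W}

/-- Write `w = A(a v₀ + v)` with `v ∈ E'`. Since `R` fixes `v₀`, the coordinate `a` drops out of the
second component, and in the coordinates `((τ, a), v)` the map is block triangular, with blocks `(τ,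
a) ↦ (ℓ(A v₀) a, -τ)` and `-(I - R)` on `E'`. With `R = dφ_{-T}` this is the Jacobian behind the
trace formula. -/
theorem abs_det_transversal (hv₀ : v₀ ≠ 0) (hE : IsCompl (Submodule.span ℝ {v₀}) E')
    (hR₀ : R v₀ = v₀) (hR : ∀ v ∈ E', R v ∈ E') (A : W ≃ₗ[ℝ] W') (ℓ : W' →ₗ[ℝ] ℝ)
    {D : ℝ × W' →ₗ[ℝ] ℝ × W'}
    (hD : ∀ τ w, D (τ, w) = (ℓ w, -τ • A v₀ + A (R (A.symm w)) - w)) :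
    |LinearMap.det D| = |ℓ (A v₀)| * |LinearMap.det (LinearMap.id - R.restrict hR)| := by
  let e₁ : (ℝ × E') ≃ₗ[ℝ] W' :=
    ((LinearEquiv.toSpanNonzeroSingleton ℝ W v₀ hv₀).prodCongr (LinearEquiv.refl ℝ E')).trans
      ((Submodule.prodEquivOfIsCompl _ _ hE).trans A)
  let e : ((ℝ × ℝ) × E') ≃ₗ[ℝ] (ℝ × W') :=
    (LinearEquiv.prodAssoc ℝ ℝ ℝ E').trans ((LinearEquiv.refl ℝ ℝ).prodCongr e₁)
  have he : ∀ τ a (v : E'), e ((τ, a), v) = (τ, A (a • v₀ + v)) := fun τ a v => rfl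
  let J : ℝ × ℝ →ₗ[ℝ] ℝ × ℝ :=
    (ℓ (A v₀) • LinearMap.snd ℝ ℝ ℝ).prod (-LinearMap.fst ℝ ℝ ℝ)
  let L : E' →ₗ[ℝ] ℝ × ℝ := (ℓ ∘ₗ A.toLinearMap ∘ₗ E'.subtype).prod 0
  have hconj : D = e.toLinearMap ∘ₗ ((J.coprod L).prod
      ((-(LinearMap.id - R.restrict hR)) ∘ₗ LinearMap.snd ℝ _ _)) ∘ₗ e.symm.toLinearMap := by
    rw [← LinearMap.comp_assoc, LinearEquiv.eq_comp_toLinearMap_symm]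
    refine LinearMap.ext fun q => ?_
    obtain ⟨⟨τ, a⟩, v⟩ := q
    have h1 : A.symm (A (a • v₀ + v)) = a • v₀ + v := A.symm_apply_apply _
    have h2 : ((J.coprod L).prod ((-(LinearMap.id - R.restrict hR)) ∘ₗ LinearMap.snd ℝ _ _))
        ((τ, a), v) = ((ℓ (A v₀) * a + ℓ (A v), -τ), R.restrict hR v - v) := by
      simp [J, L]
    simp only [LinearMap.comp_apply, LinearEquiv.coe_coe]
    rw [h2, he, he, hD, h1]
    ext
    · simp [mul_comm]
    · simp only [map_add, map_smul, hR₀, Submodule.coe_sub, LinearMap.coe_restrict_apply, map_sub]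
      module
  have hJ : |LinearMap.det J| = |ℓ (A v₀)| := by
    have : LinearMap.toMatrix (Module.Basis.finTwoProd ℝ) (Module.Basis.finTwoProd ℝ) J =
        !![0, ℓ (A v₀); -1, 0] := by
      ext i j
      fin_cases i <;> fin_cases j <;> simp [LinearMap.toMatrix_apply, J]
    rw [← LinearMap.det_toMatrix (Module.Basis.finTwoProd ℝ), this]
    simp
  rw [hconj, LinearMap.det_conj, det_blockTriangular, abs_mul, hJ, abs_det_neg]

/-- Otherwise `ξ` kills `v₀` and the range of `I - R`. As `I - R` maps `E'` onto itself, `ξ` would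
kill `E'` as well, hence everything. This is what makes the phase nonstationary. -/
theorem exists_transversal_ne_zero (hE : IsCompl (Submodule.span ℝ {v₀}) E')
    (hR : ∀ v ∈ E', R v ∈ E')
    (hdet : LinearMap.det (LinearMap.id - R.restrict hR) ≠ 0) {ξ : W →ₗ[ℝ] ℝ} (hξ : ξ ≠ 0) :
    ∃ (τ : ℝ) (w : W), ξ w - ξ (-τ • v₀ + R w) ≠ 0 := by
  by_contra! h
  have h0 : ξ v₀ = 0 := by simpa using h 1 0
  have h1 : ∀ w, ξ (w - R w) = 0 := fun w => by simpa using h 0 w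
  have hsurj : Function.Surjective (LinearMap.id - R.restrict hR : E' →ₗ[ℝ] E') := by
    rw [← LinearMap.range_eq_top, ← LinearMap.isUnit_iff_range_eq_top]
    exact LinearMap.isUnit_iff_isUnit_det _ |>.2 hdet.isUnit
  have h2 : ∀ v ∈ E', ξ v = 0 := by
    intro v hv
    obtain ⟨u, hu⟩ := hsurj ⟨v, hv⟩
    rw [← h1 u]
    exact congrArg (fun w : E' => ξ (w : W)) hu.symm
  refine hξ (LinearMap.ext fun w => ?_)
  have hw : w ∈ Submodule.span ℝ {v₀} ⊔ E' := by rw [hE.sup_eq_top]; trivial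
  obtain ⟨a, ha, b, hb, rfl⟩ := Submodule.mem_sup.1 hw
  obtain ⟨c, rfl⟩ := Submodule.mem_span_singleton.1 ha
  simp [h0, h2 b hb]

/-- For a fixed vector `a + b`, the vector `R a - a = b - R b` lies in both summands and vanishes;
so `a` and `b` are fixed separately. -/
theorem eq_zero_of_fixed_of_mem_sup {E₁ E₂ : Submodule ℝ W} (hd : Disjoint E₁ E₂)
    (h₁ : ∀ v ∈ E₁, R v ∈ E₁) (h₂ : ∀ v ∈ E₂, R v ∈ E₂) (hf₁ : ∀ v ∈ E₁, R v = v → v = 0)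
    (hf₂ : ∀ v ∈ E₂, R v = v → v = 0) {v : W} (hv : v ∈ E₁ ⊔ E₂) (hRv : R v = v) : v = 0 := by
  obtain ⟨a, ha, b, hb, rfl⟩ := Submodule.mem_sup.1 hv
  have h3 : R a - a = b - R b := by
    rw [map_add] at hRv
    rw [sub_eq_sub_iff_add_eq_add, hRv, add_comm]
  have h4 := Submodule.disjoint_def.1 hd _ (sub_mem (h₁ a ha) ha)
    (by rw [h3]; exact sub_mem hb (h₂ b hb))
  rw [hf₁ a ha (sub_eq_zero.1 h4), hf₂ b hb (sub_eq_zero.1 (h3.symm.trans h4)).symm, add_zero]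

end LinearAlgebra

section Hyperbolic

variable {n : ℕ} {X : Type*} [TopologicalSpace X] [ChartedSpace 𝔼[n] X] [IsManifold (𝓡 n) ∞ X]
  {φ : ℝ → X → X} {Es Eu : ∀ x : X, Submodule ℝ (TangentSpace (𝓡 n) x)}

/-- Iterating a period `m` times and letting `m → ∞`: a vector that returns to itself cannot be
exponentially contracted. -/
theorem eq_zero_of_le_exp {a C θ T : ℝ} (ha : 0 ≤ a) (hθ : 0 < θ) (hT : 0 < T)
    (h : ∀ m : ℕ, 0 < m → a ≤ C * Real.exp (-θ * (m * T)) * a) : a = 0 := by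
  refine le_antisymm ?_ ha
  have h1 : Tendsto (fun m : ℕ => C * Real.exp (-θ * (m * T)) * a) atTop (𝓝 (C * 0 * a)) := by
    refine ((Real.tendsto_exp_atBot.comp ?_).const_mul C).mul_const a
    refine Tendsto.const_mul_atTop_of_neg (by linarith) ?_
    exact tendsto_natCast_atTop_atTop.atTop_mul_const hT
  rw [mul_zero, zero_mul] at h1
  exact ge_of_tendsto h1 (eventually_atTop.2 ⟨1, fun m hm => h m hm⟩)

namespace IsAnosov

theorem dflow_period_of_fixed (h : IsSmoothFlow (n := n) φ) {x : X} {T : ℝ} (hx : φ T x = x)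
    {v : 𝔼[n]} (hv : dflow φ T x v = v) (m : ℕ) : dflow φ (m * T) x v = v := by
  induction m with
  | zero => simp [h.dflow_zero]
  | succ m ih =>
    rw [Nat.cast_succ, add_mul, one_mul, h.dflow_add, hx]
    simp [hv, ih]

theorem eq_zero_of_fixed_stable (h : IsAnosov φ Es Eu) {x : X} {T : ℝ} (hT : 0 < T)
    (hx : φ T x = x) {v : 𝔼[n]} (hvE : v ∈ Es x) (hv : dflow φ T x v = v) : v = 0 := by
  obtain ⟨g, C, θ, hθ, hs, -⟩ := h.hyperbolic
  by_contra h0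
  have hpos := g.pos x v h0
  have h1 := eq_zero_of_le_exp (C := C) (Real.sqrt_nonneg (g.inner x v v)) hθ hT fun m hm => by
    have hm' : (0 : ℝ) < m * T := mul_pos (by exact_mod_cast hm) hT
    have h2 := hs x v hvE (m * T) hm'
    have h3 : (mfderiv (𝓡 n) (𝓡 n) (φ (m * T)) x : 𝔼[n] →L[ℝ] 𝔼[n]) v = v :=
      dflow_period_of_fixed h.toIsSmoothFlow hx hv m
    -- The metric is taken at `φ (m * T) x`, which is only provably equal to `x`; generalizing the
    -- base point and the vector allows substitution.
    have h4 : ∀ y, y = x → ∀ w : 𝔼[n], w = v →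
        √(g.inner y w w) ≤ C * Real.exp (-θ * |m * T|) * √(g.inner x v v) →
        √(g.inner x v v) ≤ C * Real.exp (-θ * (m * T)) * √(g.inner x v v) := by
      rintro y rfl w rfl h5
      rwa [abs_of_pos hm'] at h5
    exact h4 _ (h.toIsSmoothFlow.period_nat_mul hx m) _ h3 h2
  exact (Real.sqrt_pos.2 hpos).ne' h1

theorem eq_zero_of_fixed_unstable (h : IsAnosov φ Es Eu) {x : X} {T : ℝ} (hT : T < 0)
    (hx : φ T x = x) {v : 𝔼[n]} (hvE : v ∈ Eu x) (hv : dflow φ T x v = v) : v = 0 := by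
  obtain ⟨g, C, θ, hθ, -, hs⟩ := h.hyperbolic
  by_contra h0
  have hpos := g.pos x v h0
  have h1 := eq_zero_of_le_exp (C := C) (T := -T) (Real.sqrt_nonneg (g.inner x v v)) hθ
    (by linarith) fun m hm => by
    have hm' : m * T < 0 := mul_neg_of_pos_of_neg (by exact_mod_cast hm) hT
    have h2 := hs x v hvE (m * T) hm'
    have h3 : (mfderiv (𝓡 n) (𝓡 n) (φ (m * T)) x : 𝔼[n] →L[ℝ] 𝔼[n]) v = v :=
      dflow_period_of_fixed h.toIsSmoothFlow hx hv m
    have h4 : ∀ y, y = x → ∀ w : 𝔼[n], w = v →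
        √(g.inner y w w) ≤ C * Real.exp (-θ * |m * T|) * √(g.inner x v v) →
        √(g.inner x v v) ≤ C * Real.exp (-θ * (m * -T)) * √(g.inner x v v) := by
      rintro y rfl w rfl h5
      rwa [abs_of_neg hm', ← mul_neg] at h5
    exact h4 _ (h.toIsSmoothFlow.period_nat_mul hx m) _ h3 h2
  exact (Real.sqrt_pos.2 hpos).ne' h1

theorem dflow_neg_of_fixed (h : IsSmoothFlow (n := n) φ) {x : X} {T : ℝ} (hx : φ T x = x)
    {v : 𝔼[n]} (hv : dflow φ T x v = v) : dflow φ (-T) x v = v := by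
  have := h.dflow_neg_apply T x v
  rwa [hx, hv] at this

end IsAnosov

/-- A family of subspaces of the tangent spaces, as subspaces of the model space. -/
def fib (E : ∀ x : X, Submodule ℝ (TangentSpace (𝓡 n) x)) (x : X) : Submodule ℝ 𝔼[n] := E x

theorem dflow_mem {E : ∀ x : X, Submodule ℝ (TangentSpace (𝓡 n) x)}
    (hE : ∀ t x, (E x).map (mfderiv (𝓡 n) (𝓡 n) (φ t) x).toLinearMap = E (φ t x))
    (t : ℝ) {x : X} {v : 𝔼[n]} (hv : v ∈ fib E x) : dflow φ t x v ∈ fib E (φ t x) := by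
  have h3 := Submodule.mem_map_of_mem (f := (mfderiv (𝓡 n) (𝓡 n) (φ t) x).toLinearMap)
    (show v ∈ E x from hv)
  rw [hE t x] at h3
  exact h3

theorem dflow_mem_fixed {E : ∀ x : X, Submodule ℝ (TangentSpace (𝓡 n) x)}
    (hE : ∀ t x, (E x).map (mfderiv (𝓡 n) (𝓡 n) (φ t) x).toLinearMap = E (φ t x))
    {t : ℝ} {x : X} (hx : φ t x = x) {v : 𝔼[n]} (hv : v ∈ fib E x) :
    dflow φ t x v ∈ fib E x := by
  have := dflow_mem hE t hv
  rwa [hx] at this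

namespace IsAnosov

theorem dflow_mem_sup (h : IsAnosov φ Es Eu) {t : ℝ} {x : X} (v : 𝔼[n])
    (hv : v ∈ fib Eu x ⊔ fib Es x) : dflow φ t x v ∈ fib Eu (φ t x) ⊔ fib Es (φ t x) := by
  obtain ⟨a, ha, b, hb, rfl⟩ := Submodule.mem_sup.1 hv
  rw [map_add]
  exact add_mem (Submodule.mem_sup_left (dflow_mem h.map_unstable t ha))
    (Submodule.mem_sup_right (dflow_mem h.map_stable t hb))

theorem dflow_mem_sup_fixed (h : IsAnosov φ Es Eu) {t : ℝ} {x : X} (hx : φ t x = x) (v : 𝔼[n])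
    (hv : v ∈ fib Eu x ⊔ fib Es x) :
    (dflow φ t x).toLinearMap v ∈ fib Eu x ⊔ fib Es x := by
  have := h.dflow_mem_sup (t := t) v hv
  rwa [hx] at this

theorem isCompl_fib (h : IsAnosov φ Es Eu) (x : X) :
    IsCompl (Submodule.span ℝ {gen (n := n) φ x}) (fib Eu x ⊔ fib Es x) := h.isCompl x

theorem gen_ne_zero (h : IsAnosov φ Es Eu) (x : X) : gen (n := n) φ x ≠ 0 := h.generator_ne_zero x

/-- The linearized Poincaré map, on a subspace of the model space. -/
def returnFib (h : IsAnosov φ Es Eu) {x : X} {T : ℝ} (hx : φ T x = x) :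
    ↥(fib Eu x ⊔ fib Es x) →ₗ[ℝ] ↥(fib Eu x ⊔ fib Es x) :=
  (dflow φ (-T) x).toLinearMap.restrict
    (h.dflow_mem_sup_fixed (h.toIsSmoothFlow.neg_period hx))

theorem absDet_eq (h : IsAnosov φ Es Eu) {x : X} {T : ℝ} (hx : φ T x = x) :
    h.absDet hx = |LinearMap.det (LinearMap.id - h.returnFib hx)| := rfl

theorem traceExt_eq (h : IsAnosov φ Es Eu) {x : X} {T : ℝ} (hx : φ T x = x) (k : ℕ) :
    h.traceExt hx k = LinearMap.trace ℝ _ (exteriorPower.map k (h.returnFib hx)) := rfl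

/-- A kernel vector of `I - P` is fixed by `dφ_{-T}`, and so are its stable and unstable components.
The first is contracted by the positive one of `T` and `-T`, the second by the negative one, so both
vanish. -/
theorem absDet_pos (h : IsAnosov φ Es Eu) {x : X} {T : ℝ} (hT : T ≠ 0) (hx : φ T x = x) :
    0 < h.absDet hx := by
  rw [absDet_eq, abs_pos]
  have hx' := h.toIsSmoothFlow.neg_period hx
  suffices hk : LinearMap.ker (LinearMap.id - h.returnFib hx) = ⊥ from
    ((LinearMap.isUnit_iff_isUnit_det _).1 ((LinearMap.isUnit_iff_ker_eq_bot _).2 hk)).ne_zero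
  rw [LinearMap.ker_eq_bot']
  rintro ⟨v, hv⟩ hv0
  have h1 : dflow φ (-T) x v = v := (congrArg (Subtype.val) (sub_eq_zero.1 hv0)).symm
  have hfix : ∀ w : 𝔼[n], dflow φ (-T) x w = w → dflow φ T x w = w := fun w hw => by
    simpa using dflow_neg_of_fixed h.toIsSmoothFlow hx' hw
  refine Subtype.ext (eq_zero_of_fixed_of_mem_sup (R := (dflow φ (-T) x).toLinearMap)
    (h.disjoint x) (fun v hv => dflow_mem_fixed h.map_unstable hx' hv)
    (fun v hv => dflow_mem_fixed h.map_stable hx' hv) (fun a ha ha1 => ?_) (fun a ha ha1 => ?_)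
    hv h1)
  · rcases hT.lt_or_gt with hT | hT
    · exact h.eq_zero_of_fixed_unstable hT hx ha (hfix a ha1)
    · exact h.eq_zero_of_fixed_unstable (neg_neg_of_pos hT) hx' ha ha1
  · rcases hT.lt_or_gt with hT | hT
    · exact h.eq_zero_of_fixed_stable (neg_pos.2 hT) hx' ha ha1
    · exact h.eq_zero_of_fixed_stable hT hx ha (hfix a ha1)

/-- The differential of the flow, as an isomorphism of the transversal subspaces. -/
def transport (h : IsAnosov φ Es Eu) (s : ℝ) (x : X) :
    ↥(fib Eu x ⊔ fib Es x) ≃ₗ[ℝ] ↥(fib Eu (φ s x) ⊔ fib Es (φ s x)) :=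
  LinearEquiv.ofLinearMap
    ((dflow φ s x).toLinearMap.restrict fun v hv => h.dflow_mem_sup v hv)
    ((dflow φ (-s) (φ s x)).toLinearMap.restrict fun v hv => by
      have := h.dflow_mem_sup (t := -s) v hv
      rwa [h.toIsSmoothFlow.neg_apply] at this)
    (LinearMap.ext fun v => Subtype.ext (h.toIsSmoothFlow.dflow_apply_neg s x v))
    (LinearMap.ext fun v => Subtype.ext (h.toIsSmoothFlow.dflow_neg_apply s x v))

/-- `φ_{-T}` commutes with `φ_s`, so `dφ_s` conjugates the Poincaré maps at `x` and at `φ_s x`.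
Determinant and exterior traces are therefore constant along the orbit, and the base point is
arbitrary. -/
theorem returnFib_transport (h : IsAnosov φ Es Eu) {x : X} {T : ℝ} (hx : φ T x = x) (s : ℝ)
    (hx' : φ T (φ s x) = φ s x) :
    h.returnFib hx' = (h.transport s x).conj (h.returnFib hx) := by
  refine LinearMap.ext fun v => ?_
  obtain ⟨w, rfl⟩ := (h.transport s x).surjective v
  rw [LinearEquiv.conj_apply_apply, LinearEquiv.symm_apply_apply]
  refine Subtype.ext ?_
  show dflow φ (-T) (φ s x) (dflow φ s x (w : 𝔼[n])) = dflow φ s x (dflow φ (-T) x (w : 𝔼[n]))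
  have h1 := DFunLike.congr_fun (h.toIsSmoothFlow.dflow_add (-T) s x) (w : 𝔼[n])
  have h2 := DFunLike.congr_fun (h.toIsSmoothFlow.dflow_add s (-T) x) (w : 𝔼[n])
  rw [h.toIsSmoothFlow.neg_period hx] at h2
  rw [add_comm] at h2
  exact h1.symm.trans h2

theorem absDet_transport (h : IsAnosov φ Es Eu) {x : X} {T : ℝ} (hx : φ T x = x) (s : ℝ)
    (hx' : φ T (φ s x) = φ s x) : h.absDet hx' = h.absDet hx := by
  have : LinearMap.id - h.returnFib hx' =
      (h.transport s x).conj (LinearMap.id - h.returnFib hx) := by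
    rw [map_sub, LinearEquiv.conj_id, ← h.returnFib_transport hx s hx']
  rw [absDet_eq, absDet_eq, this]
  congr 1
  rw [LinearEquiv.conj_apply, LinearMap.comp_assoc]
  exact LinearMap.det_conj _ (h.transport s x)

theorem traceExt_transport (h : IsAnosov φ Es Eu) {x : X} {T : ℝ} (hx : φ T x = x) (s : ℝ)
    (hx' : φ T (φ s x) = φ s x) (k : ℕ) : h.traceExt hx' k = h.traceExt hx k := by
  rw [traceExt_eq, traceExt_eq, h.returnFib_transport hx s hx']
  have h1 : ∀ (W W' : Type) [AddCommGroup W] [AddCommGroup W'] [Module ℝ W] [Module ℝ W']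
      (e : W ≃ₗ[ℝ] W') (f : W →ₗ[ℝ] W), LinearMap.trace ℝ _ (exteriorPower.map k (e.conj f)) =
        LinearMap.trace ℝ _ (exteriorPower.map k f) := by
    intro W W' _ _ _ _ e f
    let e' : (⋀[ℝ]^k W) ≃ₗ[ℝ] (⋀[ℝ]^k W') :=
      LinearEquiv.ofLinearMap (exteriorPower.map k e.toLinearMap)
        (exteriorPower.map k e.symm.toLinearMap)
        (by rw [← exteriorPower.map_comp]; simp)
        (by rw [← exteriorPower.map_comp]; simp)
    rw [← LinearMap.trace_conj' (exteriorPower.map k f) e']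
    congr 1
    rw [LinearEquiv.conj_apply, LinearEquiv.conj_apply, exteriorPower.map_comp,
      exteriorPower.map_comp]
    rfl
  exact h1 _ _ (h.transport s x) (h.returnFib hx)

end IsAnosov

end Hyperbolic

end Guillemin

end

/-! ### The flow in charts and its derivative at periodic points. -/

noncomputable section

namespace Guillemin

set_option linter.unusedSectionVars false

local notation "𝔼[" n "]" => EuclideanSpace ℝ (Fin n)
local notation "𝓘₁[" n "]" => ModelWithCorners.prod 𝓘(ℝ, ℝ) (𝓡 n)

section ChartFlow

variable {n : ℕ} {X : Type*} [TopologicalSpace X] [ChartedSpace 𝔼[n] X] [IsManifold (𝓡 n) ∞ X]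
  {φ : ℝ → X → X}

/-- The chart composed with its inverse is the identity near the point, which forces the derivative
of `chartInv` to be the inverse of that of the chart. Having both derivatives as one equivalence of
the model space keeps tangent spaces out of later determinants. -/
theorem exists_hasMFDerivAt_extChartAt {α x : X} (hx : x ∈ (extChartAt (𝓡 n) α).source) :
    ∃ A : 𝔼[n] ≃L[ℝ] 𝔼[n],
      HasMFDerivAt (𝓡 n) 𝓘(ℝ, 𝔼[n]) (extChartAt (𝓡 n) α) x (A : 𝔼[n] →L[ℝ] 𝔼[n]) ∧
      HasMFDerivAt 𝓘(ℝ, 𝔼[n]) (𝓡 n) (chartInv α) (extChartAt (𝓡 n) α x)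
        (A.symm : 𝔼[n] →L[ℝ] 𝔼[n]) := by
  obtain ⟨A, hA⟩ : ∃ A : 𝔼[n] ≃L[ℝ] 𝔼[n], (A : 𝔼[n] →L[ℝ] 𝔼[n]) =
      (mfderiv (𝓡 n) 𝓘(ℝ, 𝔼[n]) (extChartAt (𝓡 n) α) x : 𝔼[n] →L[ℝ] 𝔼[n]) :=
    isInvertible_mfderiv_extChartAt (I := 𝓡 n) hx
  have hx' : x ∈ (chartAt 𝔼[n] α).source := by rwa [extChartAt_source] at hx
  have h1 : HasMFDerivAt (𝓡 n) 𝓘(ℝ, 𝔼[n]) (extChartAt (𝓡 n) α) x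
      (mfderiv (𝓡 n) 𝓘(ℝ, 𝔼[n]) (extChartAt (𝓡 n) α) x : 𝔼[n] →L[ℝ] 𝔼[n]) :=
    (mdifferentiableAt_extChartAt hx').hasMFDerivAt
  rw [← hA] at h1
  have ht := (extChartAt (𝓡 n) α).map_source hx
  have h2 := (((contMDiffOn_chartInv α).contMDiffAt
    ((isOpen_extChartAt_target (I := 𝓡 n) α).mem_nhds ht)).mdifferentiableAt
      (by simp)).hasMFDerivAt
  have h1' : HasMFDerivAt (𝓡 n) 𝓘(ℝ, 𝔼[n]) (extChartAt (𝓡 n) α)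
      (chartInv α (extChartAt (𝓡 n) α x)) (A : 𝔼[n] →L[ℝ] 𝔼[n]) := by
    rw [chartInv_extChartAt hx]
    exact h1
  have h3 := HasMFDerivAt.comp _ h1' h2
  have h4 : HasMFDerivAt 𝓘(ℝ, 𝔼[n]) 𝓘(ℝ, 𝔼[n]) (extChartAt (𝓡 n) α ∘ chartInv α)
      (extChartAt (𝓡 n) α x) (ContinuousLinearMap.id ℝ 𝔼[n]) := by
    refine (hasFDerivAt_id (extChartAt (𝓡 n) α x)).hasMFDerivAt.congr_of_eventuallyEq ?_
    filter_upwards [(isOpen_extChartAt_target (I := 𝓡 n) α).mem_nhds ht] with z hz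
    exact extChartAt_chartInv hz
  have h5 := hasMFDerivAt_unique h3 h4
  refine ⟨A, h1, ?_⟩
  have h6 : (mfderiv 𝓘(ℝ, 𝔼[n]) (𝓡 n) (chartInv α) (extChartAt (𝓡 n) α x) : 𝔼[n] →L[ℝ] 𝔼[n]) =
      (A.symm : 𝔼[n] →L[ℝ] 𝔼[n]) := by
    refine ContinuousLinearMap.ext fun v => ?_
    have h7 : A ((mfderiv 𝓘(ℝ, 𝔼[n]) (𝓡 n) (chartInv α) (extChartAt (𝓡 n) α x) :
      𝔼[n] →L[ℝ] 𝔼[n]) v) = v := congrArg (fun L : 𝔼[n] →L[ℝ] 𝔼[n] => L v) h5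
    exact (A.symm_apply_eq.2 h7.symm).symm
  rw [← h6]
  exact h2

/-- The flow backwards in time, in the charts at `β` and `α`. -/
def chartFlow (φ : ℝ → X → X) (β α : X) (d : ℝ × 𝔼[n]) : 𝔼[n] :=
  extChartAt (𝓡 n) α (φ (-d.1) (chartInv β d.2))

namespace IsSmoothFlow

theorem contMDiffOn_backward_chartInv (h : IsSmoothFlow (n := n) φ) (β : X) :
    ContMDiffOn 𝓘(ℝ, ℝ × 𝔼[n]) (𝓡 n) ∞ (fun d : ℝ × 𝔼[n] => φ (-d.1) (chartInv β d.2))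
      {d | d.2 ∈ (extChartAt (𝓡 n) β).target} := by
  refine h.contMDiff_backward.comp_contMDiffOn
    (ContMDiffOn.prodMk contDiff_fst.contMDiff.contMDiffOn ?_)
  exact (contMDiffOn_chartInv β).comp contDiff_snd.contMDiff.contMDiffOn fun d hd => hd

theorem isOpen_chartFlow_domain (h : IsSmoothFlow (n := n) φ) (β α : X) :
    IsOpen {d : ℝ × 𝔼[n] | d.2 ∈ (extChartAt (𝓡 n) β).target ∧
      φ (-d.1) (chartInv β d.2) ∈ (extChartAt (𝓡 n) α).source} :=
  (h.contMDiffOn_backward_chartInv β).continuousOn.isOpen_inter_preimage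
    ((isOpen_extChartAt_target (I := 𝓡 n) β).preimage continuous_snd) (isOpen_extChartAt_source α)

theorem contDiffOn_chartFlow (h : IsSmoothFlow (n := n) φ) (β α : X) :
    ContDiffOn ℝ ∞ (chartFlow (n := n) φ β α) {d | d.2 ∈ (extChartAt (𝓡 n) β).target ∧
      φ (-d.1) (chartInv β d.2) ∈ (extChartAt (𝓡 n) α).source} := by
  have h1 : ContMDiffOn (𝓡 n) 𝓘(ℝ, 𝔼[n]) ∞ (extChartAt (𝓡 n) α) (extChartAt (𝓡 n) α).source := by
    rw [extChartAt_source]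
    exact contMDiffOn_extChartAt
  have h2 := (h.contMDiffOn_backward_chartInv β).mono (t := {d : ℝ × 𝔼[n] |
    d.2 ∈ (extChartAt (𝓡 n) β).target ∧ φ (-d.1) (chartInv β d.2) ∈ (extChartAt (𝓡 n) α).source})
    fun d hd => hd.1
  exact (h1.comp h2 fun d hd => hd.2).contDiffOn

theorem contDiffAt_chartFlow (h : IsSmoothFlow (n := n) φ) {β α : X} {d : ℝ × 𝔼[n]}
    (hd : d.2 ∈ (extChartAt (𝓡 n) β).target)
    (hd' : φ (-d.1) (chartInv β d.2) ∈ (extChartAt (𝓡 n) α).source) :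
    ContDiffAt ℝ ∞ (chartFlow (n := n) φ β α) d :=
  (h.contDiffOn_chartFlow β α).contDiffAt ((h.isOpen_chartFlow_domain β α).mem_nhds ⟨hd, hd'⟩)

theorem chartFlow_extChartAt {α x : X} (hx : x ∈ (extChartAt (𝓡 n) α).source) {t : ℝ}
    (hf : φ (-t) x = x) :
    chartFlow (n := n) φ α α (t, extChartAt (𝓡 n) α x) = extChartAt (𝓡 n) α x := by
  simp only [chartFlow]
  rw [chartInv_extChartAt hx, hf]

/-- The two partial derivatives come from the chain rule: time contributes `-V`, since the flow runs
backwards, and space contributes `dφ_{-t}` conjugated by the chart. -/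
theorem hasFDerivAt_chartFlow (h : IsSmoothFlow (n := n) φ) {α x : X} {t : ℝ}
    (hx : x ∈ (extChartAt (𝓡 n) α).source) (hf : φ (-t) x = x) {A : 𝔼[n] ≃L[ℝ] 𝔼[n]}
    (hA : HasMFDerivAt (𝓡 n) 𝓘(ℝ, 𝔼[n]) (extChartAt (𝓡 n) α) x (A : 𝔼[n] →L[ℝ] 𝔼[n]))
    (hA' : HasMFDerivAt 𝓘(ℝ, 𝔼[n]) (𝓡 n) (chartInv α) (extChartAt (𝓡 n) α x)
        (A.symm : 𝔼[n] →L[ℝ] 𝔼[n])) :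
    HasFDerivAt (chartFlow (n := n) φ α α)
      ((A : 𝔼[n] →L[ℝ] 𝔼[n]).comp
        ((-(ContinuousLinearMap.toSpanSingleton ℝ (gen (n := n) φ x))).coprod
          ((dflow (n := n) φ (-t) x).comp (A.symm : 𝔼[n] →L[ℝ] 𝔼[n]))))
      (t, extChartAt (𝓡 n) α x) := by
  have h1 := (contDiffAt_chartFlow h (β := α) (α := α) (d := (t, extChartAt (𝓡 n) α x))
    ((extChartAt (𝓡 n) α).map_source hx)
    (by simp only; rwa [chartInv_extChartAt hx, hf])).differentiableAt (by simp)
  have hA1 : HasMFDerivAt (𝓡 n) 𝓘(ℝ, 𝔼[n]) (extChartAt (𝓡 n) α) (φ (-t) x)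
      (A : 𝔼[n] →L[ℝ] 𝔼[n]) := by
    rw [hf]
    exact hA
  have hfix : chartInv α (extChartAt (𝓡 n) α x) = x := chartInv_extChartAt hx
  -- the derivative in the time direction
  have h2 : fderiv ℝ (chartFlow (n := n) φ α α) (t, extChartAt (𝓡 n) α x) ∘L
      ContinuousLinearMap.inl ℝ ℝ 𝔼[n] = (A : 𝔼[n] →L[ℝ] 𝔼[n]).comp
        (-(ContinuousLinearMap.toSpanSingleton ℝ (gen (n := n) φ x))) := by
    have h3 := h1.hasFDerivAt.comp t (hasFDerivAt_prodMk_left (𝕜 := ℝ) t (extChartAt (𝓡 n) α x))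
    have h4 := HasMFDerivAt.comp (f := fun s : ℝ => φ (-s) x) t hA1
      (HasMFDerivAt.comp (f := fun s : ℝ => -s) t (h.hasMFDerivAt_orbit (-t) x)
        (hasFDerivAt_id (𝕜 := ℝ) t).neg.hasMFDerivAt)
    have h5 : (extChartAt (𝓡 n) α ∘ fun s : ℝ => φ (-s) x) =
        chartFlow (n := n) φ α α ∘ fun s => (s, extChartAt (𝓡 n) α x) := by
      ext1 s
      simp only [Function.comp, chartFlow]
      rw [hfix]
    rw [hf] at h4
    have h6 := hasMFDerivAt_unique h4 (by rw [h5]; exact h3.hasMFDerivAt)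
    rw [← show _ = _ from h6]
    refine ContinuousLinearMap.ext_ring ?_
    show A ((-1 : ℝ) • gen (n := n) φ x) = A (-((1 : ℝ) • gen (n := n) φ x))
    simp
  have h2' : fderiv ℝ (chartFlow (n := n) φ α α) (t, extChartAt (𝓡 n) α x) ∘L
      ContinuousLinearMap.inr ℝ ℝ 𝔼[n] = (A : 𝔼[n] →L[ℝ] 𝔼[n]).comp
        ((dflow (n := n) φ (-t) x).comp (A.symm : 𝔼[n] →L[ℝ] 𝔼[n])) := by
    have h3 := h1.hasFDerivAt.comp (extChartAt (𝓡 n) α x)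
      (hasFDerivAt_prodMk_right (𝕜 := ℝ) t (extChartAt (𝓡 n) α x))
    have hφ : HasMFDerivAt (𝓡 n) (𝓡 n) (φ (-t)) (chartInv α (extChartAt (𝓡 n) α x))
        (dflow (n := n) φ (-t) x) := by
      rw [hfix]
      exact h.hasMFDerivAt_apply (-t) x
    have hA2 : HasMFDerivAt (𝓡 n) 𝓘(ℝ, 𝔼[n]) (extChartAt (𝓡 n) α)
        (φ (-t) (chartInv α (extChartAt (𝓡 n) α x))) (A : 𝔼[n] →L[ℝ] 𝔼[n]) := by
      rw [hfix]
      exact hA1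
    have h4 := HasMFDerivAt.comp (f := fun z => φ (-t) (chartInv α z)) (extChartAt (𝓡 n) α x) hA2
      (HasMFDerivAt.comp (f := chartInv α) (extChartAt (𝓡 n) α x) hφ hA')
    exact (hasMFDerivAt_unique h4 h3.hasMFDerivAt).symm
  have h7 : fderiv ℝ (chartFlow (n := n) φ α α) (t, extChartAt (𝓡 n) α x) =
      (A : 𝔼[n] →L[ℝ] 𝔼[n]).comp
        ((-(ContinuousLinearMap.toSpanSingleton ℝ (gen (n := n) φ x))).coprod
          ((dflow (n := n) φ (-t) x).comp (A.symm : 𝔼[n] →L[ℝ] 𝔼[n]))) := by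
    refine ContinuousLinearMap.ext fun v => ?_
    have e1 := DFunLike.congr_fun h2 v.1
    have e2 := DFunLike.congr_fun h2' v.2
    simp only [ContinuousLinearMap.comp_apply, ContinuousLinearMap.inl_apply,
      ContinuousLinearMap.inr_apply] at e1 e2
    have e3 : v = (v.1, 0) + (0, v.2) := by simp
    rw [e3, map_add, e1, e2]
    simp
  rw [← h7]
  exact h1.hasFDerivAt

theorem hasDerivAt_chart_orbit (h : IsSmoothFlow (n := n) φ) {α x : X} {s : ℝ}
    (_hx : φ s x ∈ (extChartAt (𝓡 n) α).source) {A : 𝔼[n] ≃L[ℝ] 𝔼[n]}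
    (hA : HasMFDerivAt (𝓡 n) 𝓘(ℝ, 𝔼[n]) (extChartAt (𝓡 n) α) (φ s x) (A : 𝔼[n] →L[ℝ] 𝔼[n])) :
    HasDerivAt (fun s => extChartAt (𝓡 n) α (φ s x)) (A (gen φ (φ s x))) s := by
  have h1 := HasMFDerivAt.comp (f := fun s : ℝ => φ s x) s hA (h.hasMFDerivAt_orbit s x)
  have h2 : HasFDerivAt (fun s => extChartAt (𝓡 n) α (φ s x))
    ((A : 𝔼[n] →L[ℝ] 𝔼[n]).comp (ContinuousLinearMap.toSpanSingleton ℝ (gen (n := n) φ (φ s x)))) s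
    := hasMFDerivAt_iff_hasFDerivAt.1 h1
  have h3 := h2.hasDerivAt
  simpa using h3

theorem contDiffAt_chart_orbit (h : IsSmoothFlow (n := n) φ) {α x : X} {s : ℝ}
    (hx : φ s x ∈ (extChartAt (𝓡 n) α).source) :
    ContDiffAt ℝ ∞ (fun s => extChartAt (𝓡 n) α (φ s x)) s := by
  have h1 : ContMDiffAt (𝓡 n) 𝓘(ℝ, 𝔼[n]) ∞ (extChartAt (𝓡 n) α) (φ s x) :=
    contMDiffAt_extChartAt' (by rwa [extChartAt_source] at hx)
  exact (ContMDiffAt.comp (f := fun s : ℝ => φ s x) s h1 (h.contMDiff_orbit x s)).contDiffAt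

end IsSmoothFlow

end ChartFlow

end Guillemin

end

/-! ### Mollifiers. -/

noncomputable section

namespace Guillemin

set_option linter.unusedSectionVars false

local notation "𝔼[" n "]" => EuclideanSpace ℝ (Fin n)

section Mollifier

variable {E : Type*} [NormedAddCommGroup E] [NormedSpace ℝ E] [MeasurableSpace E] [BorelSpace E]
  [FiniteDimensional ℝ E] {μ : Measure E} [μ.IsAddHaarMeasure]

/-- A sequence of nonnegative bump functions of integral `1` that shrinks to the origin. -/
structure IsMollifier (μ : Measure E) (ρ : ℕ → E → ℝ) : Prop where
  smooth : ∀ j, ContDiff ℝ ∞ (ρ j)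
  nonneg : ∀ j z, 0 ≤ ρ j z
  eq_zero : ∀ (j : ℕ) z, 1 / ((j : ℝ) + 1) ≤ ‖z‖ → ρ j z = 0
  integral_eq : ∀ j, ∫ z, ρ j z ∂μ = 1

variable (μ) in
theorem exists_isMollifier : ∃ ρ : ℕ → E → ℝ, IsMollifier μ ρ := by
  let b : ℕ → ContDiffBump (0 : E) := fun j =>
    ⟨1 / ((j : ℝ) + 1) / 2, 1 / ((j : ℝ) + 1), by positivity, half_lt_self (by positivity)⟩
  refine ⟨fun j => (b j).normed μ, fun j => (b j).contDiff_normed, fun j z =>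
    (b j).nonneg_normed z, fun j z hz => ?_, fun j => (b j).integral_normed⟩
  have h1 : z ∉ Function.support ((b j).normed μ) := by
    rw [(b j).support_normed_eq, Metric.mem_ball, dist_zero_right, not_lt]
    exact hz
  exact Function.notMem_support.1 h1

namespace IsMollifier

variable {ρ : ℕ → E → ℝ} (hρ : IsMollifier μ ρ)

theorem hasCompactSupport (hρ : IsMollifier μ ρ) (j : ℕ) : HasCompactSupport (ρ j) :=
  HasCompactSupport.intro (isCompact_closedBall (0 : E) (1 / ((j : ℝ) + 1))) fun z hz =>
    hρ.eq_zero j z (by rw [Metric.mem_closedBall, dist_zero_right, not_le] at hz; exact hz.le)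

theorem integrable (hρ : IsMollifier μ ρ) (j : ℕ) : Integrable (ρ j) μ :=
  (hρ.smooth j).continuous.integrable_of_hasCompactSupport (hρ.hasCompactSupport j)

theorem norm_integral_le (hρ : IsMollifier μ ρ) {g : E → ℂ} {B : ℝ} (j : ℕ)
    (hg : ∀ z, ‖z‖ < 1 / ((j : ℝ) + 1) → ‖g z‖ ≤ B) : ‖∫ z, (ρ j z : ℂ) * g z ∂μ‖ ≤ B := by
  have h1 : ∀ z, ‖(ρ j z : ℂ) * g z‖ ≤ ρ j z * B := by
    intro z
    rw [norm_mul, Complex.norm_real, Real.norm_of_nonneg (hρ.nonneg j z)]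
    by_cases hz : ‖z‖ < 1 / ((j : ℝ) + 1)
    · exact mul_le_mul_of_nonneg_left (hg z hz) (hρ.nonneg j z)
    · rw [hρ.eq_zero j z (not_lt.1 hz), zero_mul, zero_mul]
  refine (norm_integral_le_of_norm_le ((hρ.integrable j).mul_const B)
    (ae_of_all _ h1)).trans (le_of_eq ?_)
  rw [integral_mul_const, hρ.integral_eq, one_mul]

theorem tendsto_integral (hρ : IsMollifier μ ρ) {g : E → ℂ} (hg : Continuous g) :
    Tendsto (fun j => ∫ z, (ρ j z : ℂ) * g z ∂μ) atTop (𝓝 (g 0)) := by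
  rw [Metric.tendsto_atTop]
  intro ε hε
  obtain ⟨δ, hδ, hgδ⟩ := Metric.continuousAt_iff.1 hg.continuousAt (ε / 2) (half_pos hε)
  obtain ⟨J, hJ⟩ := exists_nat_one_div_lt hδ
  refine ⟨J, fun j hj => ?_⟩
  have hi : ∀ f : E → ℂ, Continuous f → Integrable (fun z => (ρ j z : ℂ) * f z) μ := fun f hf => by
    refine ((Complex.continuous_ofReal.comp (hρ.smooth j).continuous).mul
      hf).integrable_of_hasCompactSupport ?_
    exact ((hρ.hasCompactSupport j).comp_left (g := Complex.ofReal) rfl).mul_right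
  have h1 : (∫ z, (ρ j z : ℂ) * g z ∂μ) - g 0 = ∫ z, (ρ j z : ℂ) * (g z - g 0) ∂μ := by
    simp_rw [mul_sub]
    rw [integral_sub (hi g hg) (hi _ continuous_const), integral_mul_const,
      integral_complex_ofReal, hρ.integral_eq]
    simp
  rw [dist_eq_norm, h1]
  refine (hρ.norm_integral_le j (B := ε / 2) fun z hz => ?_).trans_lt (half_lt_self hε)
  rw [← dist_eq_norm]
  refine (hgδ ?_).le
  rw [dist_zero_right]
  refine hz.trans (lt_of_le_of_lt ?_ hJ)
  exact one_div_le_one_div_of_le (by positivity) (by exact_mod_cast Nat.succ_le_succ hj)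

end IsMollifier

theorem continuous_of_continuousOn_of_eq_zero {V : Type*} [TopologicalSpace V] [T2Space V]
    {f : V → ℂ} {T K : Set V} (hT : IsOpen T) (hK : IsCompact K) (hKT : K ⊆ T)
    (hf : ContinuousOn f T) (h0 : ∀ x ∉ K, f x = 0) : Continuous f ∧ HasCompactSupport f := by
  refine ⟨continuous_iff_continuousAt.2 fun x => ?_, HasCompactSupport.intro hK h0⟩
  by_cases hx : x ∈ T
  · exact hf.continuousAt (hT.mem_nhds hx)
  · have hx' : x ∈ Kᶜ := fun h => hx (hKT h)
    refine (continuousAt_const (y := (0 : ℂ))).congr ?_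
    filter_upwards [hK.isClosed.isOpen_compl.mem_nhds hx'] with y hy
    exact (h0 y hy).symm

/-- Only the second variable is mollified. By Fubini the integral is the mollification at 0 of `v ↦
∫ B(σ, v) dσ`, which is continuous because `B` is continuous with compact support. -/
theorem IsMollifier.tendsto_integral_prod {ρ : ℕ → E → ℝ} (hρ : IsMollifier μ ρ)
    {B : ℝ × E → ℂ} (hB : Continuous B) (hBc : HasCompactSupport B) :
    Tendsto (fun j => ∫ w, B w * (ρ j w.2 : ℂ) ∂((volume : Measure ℝ).prod μ)) atTop
      (𝓝 (∫ σ, B (σ, 0))) := by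
  have hK : IsCompact (Prod.fst '' tsupport B) := hBc.isCompact.image continuous_fst
  have h1 : ∀ v, ∫ σ, B (σ, v) = ∫ σ in Prod.fst '' tsupport B, B (σ, v) := fun v =>
    (setIntegral_eq_integral_of_forall_compl_eq_zero (f := fun σ => B (σ, v)) fun σ hσ =>
      by_contra fun h => hσ
        (⟨(σ, v), subset_tsupport B h, rfl⟩ : σ ∈ Prod.fst '' tsupport B)).symm
  have hc : Continuous fun v : E => ∫ σ, B (σ, v) := by
    simp_rw [h1]
    exact continuous_parametric_integral_of_continuous
      (f := fun (v : E) (σ : ℝ) => B (σ, v)) (by fun_prop) hK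
  refine (hρ.tendsto_integral hc).congr fun j => ?_
  have hint : Integrable (fun w : ℝ × E => B w * (ρ j w.2 : ℂ)) ((volume : Measure ℝ).prod μ) := by
    refine Continuous.integrable_of_hasCompactSupport ?_ hBc.mul_right
    exact hB.mul (Complex.continuous_ofReal.comp ((hρ.smooth j).continuous.comp continuous_snd))
  rw [integral_prod_symm _ hint]
  refine integral_congr_ae (ae_of_all _ fun v => ?_)
  simp only
  rw [integral_mul_const, mul_comm]

end Mollifier

end Guillemin

end

/-! ### The displacement map near a closed trajectory. -/

noncomputable section

namespace Guillemin

set_option linter.unusedSectionVars false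

local notation "𝔼[" n "]" => EuclideanSpace ℝ (Fin n)

section LocalTrace

variable {n : ℕ} {X : Type*} [TopologicalSpace X] [ChartedSpace 𝔼[n] X] [IsManifold (𝓡 n) ∞ X]
  {φ : ℝ → X → X} {Es Eu : ∀ x : X, Submodule ℝ (TangentSpace (𝓡 n) x)}

/-- The map `(t, z) ↦ (ℓ z, φ_{-t} z - z)` in the chart at `α`. -/
def displacement (φ : ℝ → X → X) (α : X) (ℓ : 𝔼[n] →L[ℝ] ℝ) (d : ℝ × 𝔼[n]) : ℝ × 𝔼[n] :=
  (ℓ d.2, chartFlow φ α α d - d.2)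

/-- The factor `|det(I - P)|` of the trace formula arises here, by `abs_det_transversal` with `R =
dφ_{-T}`, which fixes the generator and preserves `E_u ⊕ E_s`. -/
theorem IsAnosov.exists_hasFDerivAt_displacement (h : IsAnosov φ Es Eu) {α x : X} {T : ℝ}
    (hfix : φ T x = x) (hx : x ∈ (extChartAt (𝓡 n) α).source) {A : 𝔼[n] ≃L[ℝ] 𝔼[n]}
    (hA : HasMFDerivAt (𝓡 n) 𝓘(ℝ, 𝔼[n]) (extChartAt (𝓡 n) α) x (A : 𝔼[n] →L[ℝ] 𝔼[n]))
    (hA' : HasMFDerivAt 𝓘(ℝ, 𝔼[n]) (𝓡 n) (chartInv α) (extChartAt (𝓡 n) α x)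
        (A.symm : 𝔼[n] →L[ℝ] 𝔼[n])) (ℓ : 𝔼[n] →L[ℝ] ℝ) :
    ∃ D : ℝ × 𝔼[n] →L[ℝ] ℝ × 𝔼[n],
      HasFDerivAt (displacement φ α ℓ) D (T, extChartAt (𝓡 n) α x) ∧
      |D.det| = |ℓ (A (gen φ x))| * h.absDet hfix := by
  have hf := h.toIsSmoothFlow.neg_period hfix
  have h1 := h.toIsSmoothFlow.hasFDerivAt_chartFlow hx hf hA hA'
  have h2 : HasFDerivAt (fun d : ℝ × 𝔼[n] => d.2) (ContinuousLinearMap.snd ℝ ℝ 𝔼[n])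
    (T, extChartAt (𝓡 n) α x) := hasFDerivAt_snd
  refine ⟨_, ((ℓ.hasFDerivAt.comp _ h2).prodMk (h1.sub h2)), ?_⟩
  rw [h.absDet_eq]
  exact abs_det_transversal (h.gen_ne_zero x) (h.isCompl_fib x)
    (R := (dflow φ (-T) x).toLinearMap)
    (by
      have := h.toIsSmoothFlow.dflow_gen (-T) x
      rwa [hf] at this) (h.dflow_mem_sup_fixed hf)
    A.toLinearEquiv ℓ.toLinearMap (fun τ w => by
      refine Prod.ext rfl ?_
      show A (-(τ • gen φ x) + dflow φ (-T) x (A.symm w)) - w =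
        -τ • A (gen φ x) + A (dflow φ (-T) x (A.symm w)) - w
      rw [map_add, map_neg, map_smul, neg_smul])

theorem IsSmoothFlow.contDiffAt_displacement (h : IsSmoothFlow (n := n) φ) {α : X} {d : ℝ × 𝔼[n]}
    (hd : d.2 ∈ (extChartAt (𝓡 n) α).target)
    (hd' : φ (-d.1) (chartInv α d.2) ∈ (extChartAt (𝓡 n) α).source) (ℓ : 𝔼[n] →L[ℝ] ℝ) :
    ContDiffAt ℝ ∞ (displacement (n := n) φ α ℓ) d :=
  (ℓ.contDiff.comp contDiff_snd).contDiffAt.prodMk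
    ((h.contDiffAt_chartFlow hd hd').sub contDiffAt_snd)

/-- The displacement is a local diffeomorphism near a closed trajectory. -/
theorem IsAnosov.exists_displacement_chart (h : IsAnosov φ Es Eu) {α x₀ : X} {t₀ : ℝ}
    (ht₀ : t₀ ≠ 0) (hfix : φ t₀ x₀ = x₀) (hx₀ : x₀ ∈ (extChartAt (𝓡 n) α).source) :
    ∃ (ℓ : 𝔼[n] →L[ℝ] ℝ) (e : OpenPartialHomeomorph (ℝ × 𝔼[n]) (ℝ × 𝔼[n])),
      (∀ d, e d = displacement φ α ℓ d) ∧
      (∀ d ∈ e.source, d.2 ∈ (extChartAt (𝓡 n) α).target ∧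
        φ (-d.1) (chartInv α d.2) ∈ (extChartAt (𝓡 n) α).source ∧
        (fderiv ℝ (displacement φ α ℓ) d).det ≠ 0) ∧
      ∀ᶠ ε in 𝓝[>] (0 : ℝ),
        (∀ s, |s| < ε → φ s x₀ ∈ (extChartAt (𝓡 n) α).source ∧
          (t₀, extChartAt (𝓡 n) α (φ s x₀)) ∈ e.source ∧
          0 < deriv (fun s => ℓ (extChartAt (𝓡 n) α (φ s x₀))) s) ∧
        InjOn (fun s => ℓ (extChartAt (𝓡 n) α (φ s x₀))) (Ioo (-ε) ε) ∧
        (fun s => ℓ (extChartAt (𝓡 n) α (φ s x₀))) '' (Ioo (-ε) ε) ∈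
          𝓝 (ℓ (extChartAt (𝓡 n) α x₀)) := by
  have hs := h.toIsSmoothFlow
  obtain ⟨A, hA, hA'⟩ := exists_hasMFDerivAt_extChartAt hx₀
  have hV : A (gen φ x₀) ≠ 0 := by
    rw [Ne, EmbeddingLike.map_eq_zero_iff]
    exact h.gen_ne_zero x₀
  -- `ℓ` is positive on the generator, so it is a coordinate along the orbit; the other component of
  -- the displacement measures the failure to be periodic.
  obtain ⟨ℓ, hℓ⟩ : ∃ ℓ : 𝔼[n] →L[ℝ] ℝ, 0 < ℓ (A (gen φ x₀)) := by
    refine ⟨innerSL ℝ (A (gen φ x₀)), ?_⟩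
    rw [innerSL_apply_apply, real_inner_self_eq_norm_sq]
    exact pow_pos (norm_pos_iff.2 hV) 2
  obtain ⟨D, hD, hDdet⟩ := h.exists_hasFDerivAt_displacement hfix hx₀ hA hA' ℓ
  have hD0 : D.det ≠ 0 := by
    rw [← abs_pos, hDdet]
    exact mul_pos (abs_pos.2 hℓ.ne') (h.absDet_pos ht₀ hfix)
  set d₀ : ℝ × 𝔼[n] := (t₀, extChartAt (𝓡 n) α x₀) with hd₀
  have hf := hs.neg_period hfix
  have hmem : d₀.2 ∈ (extChartAt (𝓡 n) α).target ∧
      φ (-d₀.1) (chartInv α d₀.2) ∈ (extChartAt (𝓡 n) α).source :=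
    ⟨(extChartAt (𝓡 n) α).map_source hx₀, by
      simp only [hd₀]; rwa [chartInv_extChartAt hx₀, hf]⟩
  have hc := hs.contDiffAt_displacement hmem.1 hmem.2 ℓ
  have hD' : HasFDerivAt (displacement φ α ℓ)
      ((D.toContinuousLinearEquivOfDetNeZero hD0 : (ℝ × 𝔼[n]) ≃L[ℝ] (ℝ × 𝔼[n])) :
        ℝ × 𝔼[n] →L[ℝ] ℝ × 𝔼[n]) d₀ := by
    rw [ContinuousLinearMap.coe_toContinuousLinearEquivOfDetNeZero]
    exact hD
  set e₀ := hc.toOpenPartialHomeomorph (displacement φ α ℓ) hD' (by simp)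
  -- the open set where the displacement is regular
  have hreg : ∀ᶠ d in 𝓝 d₀, (d.2 ∈ (extChartAt (𝓡 n) α).target ∧
        φ (-d.1) (chartInv α d.2) ∈ (extChartAt (𝓡 n) α).source) ∧
        (fderiv ℝ (displacement φ α ℓ) d).det ≠ 0 := by
    refine Filter.Eventually.and ((hs.isOpen_chartFlow_domain α α).mem_nhds hmem) ?_
    have h1 : ContinuousAt (fun d => (fderiv ℝ (displacement φ α ℓ) d).det) d₀ :=
      ContinuousLinearMap.continuous_det.continuousAt.comp (hc.continuousAt_fderiv (by simp))
    refine h1.eventually_ne ?_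
    rw [hD.fderiv]
    exact hD0
  obtain ⟨S, hS, hSo, hd₀S⟩ := eventually_nhds_iff.1 hreg
  refine ⟨ℓ, e₀.restrOpen S hSo, fun d => rfl, fun d hd => ?_, ?_⟩
  · have := hS d hd.2
    exact ⟨this.1.1, this.1.2, this.2⟩
  have h0 : φ 0 x₀ ∈ (extChartAt (𝓡 n) α).source := by rwa [hs.zero]
  have hgc : ContDiffAt ℝ ∞ (fun s => ℓ (extChartAt (𝓡 n) α (φ s x₀))) 0 :=
    ℓ.contDiff.contDiffAt.comp (0 : ℝ) (hs.contDiffAt_chart_orbit h0)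
  have hg' : HasDerivAt (fun s => ℓ (extChartAt (𝓡 n) α (φ s x₀))) (ℓ (A (gen φ x₀))) 0 := by
    have hA0 : HasMFDerivAt (𝓡 n) 𝓘(ℝ, 𝔼[n]) (extChartAt (𝓡 n) α) (φ 0 x₀)
      (A : 𝔼[n] →L[ℝ] 𝔼[n]) := by rwa [hs.zero]
    have h1 := hs.hasDerivAt_chart_orbit h0 hA0
    rw [hs.zero] at h1
    exact ℓ.hasFDerivAt.comp_hasDerivAt (0 : ℝ) h1
  have hev : ∀ᶠ s in 𝓝 (0 : ℝ), φ s x₀ ∈ (extChartAt (𝓡 n) α).source ∧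
      (t₀, extChartAt (𝓡 n) α (φ s x₀)) ∈ (e₀.restrOpen S hSo).source ∧
      0 < deriv (fun s => ℓ (extChartAt (𝓡 n) α (φ s x₀))) s := by
    have hco : ContinuousAt (fun s => φ s x₀) 0 := (hs.contMDiff_orbit x₀).continuous.continuousAt
    have h1 : ∀ᶠ s in 𝓝 (0 : ℝ), φ s x₀ ∈ (extChartAt (𝓡 n) α).source :=
      hco ((isOpen_extChartAt_source α).mem_nhds h0)
    have h2 : ContinuousAt (fun s => (t₀, extChartAt (𝓡 n) α (φ s x₀))) 0 :=
      continuousAt_const.prodMk (hs.contDiffAt_chart_orbit h0).continuousAt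
    have h3 : (e₀.restrOpen S hSo).source ∈ 𝓝 ((fun s => (t₀, extChartAt (𝓡 n) α (φ s x₀))) 0) := by
      refine (e₀.restrOpen S hSo).open_source.mem_nhds ?_
      simp only [hs.zero]
      exact ⟨hc.mem_toOpenPartialHomeomorph_source hD' (by simp), hd₀S⟩
    have h4 : ContinuousAt (deriv (fun s => ℓ (extChartAt (𝓡 n) α (φ s x₀)))) 0 :=
      (hgc.continuousAt_fderiv (by simp)).clm_apply continuousAt_const
    have h5 : ∀ᶠ s in 𝓝 (0 : ℝ), 0 < deriv (fun s => ℓ (extChartAt (𝓡 n) α (φ s x₀))) s := by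
      refine h4.eventually (lt_mem_nhds ?_)
      rw [hg'.deriv]
      exact hℓ
    exact h1.and (Filter.Eventually.and (h2 h3) h5)
  obtain ⟨δ, hδ, hδs⟩ := Metric.eventually_nhds_iff.1 hev
  filter_upwards [Ioo_mem_nhdsGT hδ] with ε hε
  have hall : ∀ s, |s| < ε → _ := fun s hs => hδs (y := s) (by
    rw [dist_zero_right, Real.norm_eq_abs]; exact hs.trans hε.2)
  refine ⟨hall, ?_, ?_⟩
  · have hmono : StrictMonoOn (fun s => ℓ (extChartAt (𝓡 n) α (φ s x₀))) (Ioo (-ε) ε) := by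
      refine strictMonoOn_of_deriv_pos (convex_Ioo _ _) (fun s hs' => ?_) fun s hs' => ?_
      · exact (ℓ.continuous.continuousAt.comp (hs.contDiffAt_chart_orbit
          (hall s (abs_lt.2 hs')).1).continuousAt).continuousWithinAt
      · rw [interior_Ioo] at hs'
        exact (hall s (abs_lt.2 hs')).2.2
    exact hmono.injOn
  · have h1 := (hgc.hasStrictDerivAt' hg' (by simp)).map_nhds_eq hℓ.ne'
    simp only [hs.zero] at h1
    rw [← h1]
    exact image_mem_map (Ioo_mem_nhds (by linarith [hε.1]) hε.1)

theorem displacement_orbit (h : IsSmoothFlow (n := n) φ) {α x₀ : X} {t₀ s : ℝ}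
    (hfix : φ t₀ x₀ = x₀) (hx : φ s x₀ ∈ (extChartAt (𝓡 n) α).source) (ℓ : 𝔼[n] →L[ℝ] ℝ) :
    displacement φ α ℓ (t₀, extChartAt (𝓡 n) α (φ s x₀)) =
      (ℓ (extChartAt (𝓡 n) α (φ s x₀)), 0) := by
  rw [displacement, IsSmoothFlow.chartFlow_extChartAt hx
    (h.neg_period (h.period_apply hfix s)), sub_self]

/-- Near a closed trajectory, the only fixed points are those on the trajectory. -/
theorem IsAnosov.eventually_fixed (h : IsAnosov φ Es Eu) {x₀ : X} {t₀ : ℝ}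
    (ht₀ : t₀ ≠ 0) (hfix : φ t₀ x₀ = x₀) {ε : ℝ} (hε : 0 < ε) :
    ∀ᶠ q : ℝ × X in 𝓝 (t₀, x₀), φ q.1 q.2 = q.2 → q.1 = t₀ ∧ ∃ s, |s| < ε ∧ q.2 = φ s x₀ := by
  have hs := h.toIsSmoothFlow
  have hx₀ := mem_extChartAt_source (I := 𝓡 n) x₀
  obtain ⟨ℓ, e, he, hreg, hev⟩ := h.exists_displacement_chart ht₀ hfix hx₀
  obtain ⟨ε', ⟨h1, h2, h3⟩, hε'⟩ := (hev.and (Ioo_mem_nhdsGT hε)).exists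
  have hc : ContinuousAt (fun q : ℝ × X => (q.1, extChartAt (𝓡 n) x₀ q.2)) (t₀, x₀) :=
    continuousAt_fst.prodMk (ContinuousAt.comp (f := Prod.snd) (x := (t₀, x₀))
      (continuousAt_extChartAt x₀) continuousAt_snd)
  have hsrc : ∀ᶠ q : ℝ × X in 𝓝 (t₀, x₀), q.2 ∈ (extChartAt (𝓡 n) x₀).source :=
    continuousAt_snd ((isOpen_extChartAt_source x₀).mem_nhds hx₀)
  have hes : e.source ∈ 𝓝 (t₀, extChartAt (𝓡 n) x₀ x₀) := by
    have := (h1 0 (by rw [abs_zero]; exact hε'.1)).2.1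
    rw [hs.zero] at this
    exact e.open_source.mem_nhds this
  have hc2 : ContinuousAt (fun q : ℝ × X => ℓ (extChartAt (𝓡 n) x₀ q.2)) (t₀, x₀) :=
    ℓ.continuous.continuousAt.comp (continuousAt_snd.comp hc)
  filter_upwards [hsrc, hc hes, hc2 h3] with q hq1 hq2 hq3 hqf
  obtain ⟨s, hs1, hs2⟩ := hq3
  have hs1' := abs_lt.2 hs1
  -- Both points have second displacement component 0 and the same value of `ℓ`, so injectivity of
  -- the displacement identifies them, times included.
  have key : (q.1, extChartAt (𝓡 n) x₀ q.2) = (t₀, extChartAt (𝓡 n) x₀ (φ s x₀)) := by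
    refine e.injOn hq2 (h1 s hs1').2.1 ?_
    rw [he, he, displacement_orbit hs hfix (h1 s hs1').1, displacement,
      IsSmoothFlow.chartFlow_extChartAt hq1 (hs.neg_period hqf), sub_self]
    exact Prod.ext hs2.symm rfl
  rw [Prod.mk.injEq] at key
  exact ⟨key.1, s, hs1'.trans hε'.2, (extChartAt (𝓡 n) x₀).injOn hq1 (h1 s hs1').1 key.2⟩

end LocalTrace

end Guillemin

end

/-! ### The local trace formula in a chart. -/

noncomputable section

namespace Guillemin

set_option linter.unusedSectionVars false

local notation "𝔼[" n "]" => EuclideanSpace ℝ (Fin n)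

section LocalTraceFormula

variable {n : ℕ} {X : Type*} [TopologicalSpace X] [ChartedSpace 𝔼[n] X] [IsManifold (𝓡 n) ∞ X]
  {φ : ℝ → X → X} {Es Eu : ∀ x : X, Submodule ℝ (TangentSpace (𝓡 n) x)}

/-- The local trace formula in a chart, near a closed trajectory. -/
theorem IsAnosov.tendsto_integral_displacement (h : IsAnosov φ Es Eu) {α x₀ : X} {t₀ : ℝ}
    (ht₀ : t₀ ≠ 0) (hfix : φ t₀ x₀ = x₀) (hx₀ : x₀ ∈ (extChartAt (𝓡 n) α).source) :
    ∀ᶠ ε in 𝓝[>] (0 : ℝ), ∃ N ∈ 𝓝 (t₀, extChartAt (𝓡 n) α x₀), ∀ b : ℝ × 𝔼[n] → ℂ,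
      Continuous b → HasCompactSupport b → tsupport b ⊆ N → ∀ ρ, IsMollifier volume ρ →
      Tendsto (fun j => ∫ d, b d * (ρ j (chartFlow φ α α d - d.2) : ℂ)) atTop
        (𝓝 (((1 / h.absDet hfix : ℝ) : ℂ) *
          ∫ s in (-ε)..ε, b (t₀, extChartAt (𝓡 n) α (φ s x₀)))) := by
  have hs := h.toIsSmoothFlow
  obtain ⟨ℓ, e, he, hreg, hev⟩ := h.exists_displacement_chart ht₀ hfix hx₀
  filter_upwards [hev, self_mem_nhdsWithin] with ε ⟨h1, h2, h3⟩ hε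
  set g : ℝ → ℝ := fun s => ℓ (extChartAt (𝓡 n) α (φ s x₀)) with hg
  have hdiff : ∀ d ∈ e.source, ContDiffAt ℝ ∞ (displacement φ α ℓ) d := fun d hd =>
    hs.contDiffAt_displacement (hreg d hd).1 (hreg d hd).2.1 ℓ
  have hsrc0 : (t₀, extChartAt (𝓡 n) α x₀) ∈ e.source := by
    have := (h1 0 (by rwa [abs_zero])).2.1
    rwa [hs.zero] at this
  -- The second condition keeps the `ℓ`-values on the support of `b` inside the image of the orbit
  -- segment `|s| < ε`, so that the limiting integral over the line `(σ, 0)` sees only this segment.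
  refine ⟨e.source ∩ (fun d => ℓ d.2) ⁻¹' (g '' Ioo (-ε) ε),
    inter_mem (e.open_source.mem_nhds hsrc0)
      ((ℓ.continuous.comp continuous_snd).continuousAt.preimage_mem_nhds h3), ?_⟩
  intro b hb hbc hbN ρ hρ
  have hbs : tsupport b ⊆ e.source := hbN.trans inter_subset_left
  -- the amplitude in the coordinates given by the displacement
  set c : ℝ × 𝔼[n] → ℂ := fun d =>
    b d * ((|(fderiv ℝ (displacement φ α ℓ) d).det| : ℝ) : ℂ)⁻¹ with hcdef
  set B : ℝ × 𝔼[n] → ℂ := e.target.indicator (fun w => c (e.symm w)) with hB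
  have hdet : ContinuousOn (fun d => (fderiv ℝ (displacement φ α ℓ) d).det) e.source := fun d hd =>
    (ContinuousLinearMap.continuous_det.continuousAt.comp
      ((hdiff d hd).continuousAt_fderiv (by simp))).continuousWithinAt
  have hcc : ContinuousOn c e.source := by
    refine hb.continuousOn.mul (ContinuousOn.inv₀
      (Complex.continuous_ofReal.comp_continuousOn hdet.abs) fun d hd => ?_)
    exact_mod_cast (abs_pos.2 (hreg d hd).2.2).ne'
  have hBt : ∀ d ∈ e.source, B (e d) = c d := fun d hd => by
    rw [hB, indicator_of_mem (e.map_source hd), e.left_inv hd]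
  have hB0 : ∀ w ∉ e '' tsupport b, B w = 0 := by
    intro w hw
    by_cases hwt : w ∈ e.target
    · rw [hB, indicator_of_mem hwt, hcdef]
      have : b (e.symm w) = 0 := by
        by_contra h0
        exact hw ⟨e.symm w, subset_tsupport _ h0, e.right_inv hwt⟩
      simp [this]
    · exact indicator_of_notMem hwt _
  have hBc := continuous_of_continuousOn_of_eq_zero e.open_target
    (hbc.isCompact.image_of_continuousOn (e.continuousOn.mono hbs))
    (by rintro _ ⟨d, hd, rfl⟩; exact e.map_source (hbs hd))
    ((hcc.comp e.continuousOn_symm fun w hw => e.map_target hw).congr fun w hw =>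
      indicator_of_mem hw _) hB0
  -- the change of variables
  have hcv : ∀ j, ∫ d, b d * (ρ j (chartFlow φ α α d - d.2) : ℂ) =
      ∫ w : ℝ × 𝔼[n], B w * (ρ j w.2 : ℂ) := by
    intro j
    have hl : ∫ d, b d * (ρ j (chartFlow φ α α d - d.2) : ℂ) =
        ∫ d in e.source, b d * (ρ j (chartFlow φ α α d - d.2) : ℂ) :=
      (setIntegral_eq_integral_of_forall_compl_eq_zero fun d hd => by
        rw [image_eq_zero_of_notMem_tsupport fun h => hd (hbs h), zero_mul]).symm
    have hr : ∫ w : ℝ × 𝔼[n], B w * (ρ j w.2 : ℂ) =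
        ∫ w in displacement φ α ℓ '' e.source, B w * (ρ j w.2 : ℂ) := by
      have : displacement φ α ℓ '' e.source = e.target := by
        rw [← e.image_source_eq_target]
        exact image_congr fun d _ => (he d).symm
      rw [this]
      exact (setIntegral_eq_integral_of_forall_compl_eq_zero fun w hw => by
        rw [hB, indicator_of_notMem hw, zero_mul]).symm
    have hinj : InjOn (displacement φ α ℓ) e.source := e.injOn.congr fun d _ => he d
    rw [hl, hr, integral_image_eq_integral_abs_det_fderiv_smul volume
      e.open_source.measurableSet (fun d hd =>
        ((hdiff d hd).differentiableAt (by simp)).hasFDerivAt.hasFDerivWithinAt) hinj]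
    refine setIntegral_congr_fun e.open_source.measurableSet fun d hd => ?_
    have h4 : ((|(fderiv ℝ (displacement φ α ℓ) d).det| : ℝ) : ℂ) ≠ 0 := by
      exact_mod_cast (abs_pos.2 (hreg d hd).2.2).ne'
    rw [← he d, hBt d hd, he d, Complex.real_smul, hcdef]
    simp only [displacement]
    generalize (ρ j (chartFlow φ α α d - d.2) : ℂ) = r
    field_simp
  simp_rw [hcv]
  have hlim := hρ.tendsto_integral_prod hBc.1 hBc.2
  -- The line `(σ, 0)` is parametrized by the orbit through `σ = g s`. Its element of length `|g' s|
  -- ds` cancels the factor `|ℓ(V)|` of the Jacobian, and the remaining factor `|det(I - P)|` is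
  -- constant along the orbit.
  have hfin : ∫ σ, B (σ, 0) = ((1 / h.absDet hfix : ℝ) : ℂ) *
      ∫ s in (-ε)..ε, b (t₀, extChartAt (𝓡 n) α (φ s x₀)) := by
    have hl : ∫ σ, B (σ, 0) = ∫ σ in g '' Ioo (-ε) ε, B (σ, 0) := by
      refine (setIntegral_eq_integral_of_forall_compl_eq_zero fun σ hσ => hB0 _ ?_).symm
      rintro ⟨d, hd, hdσ⟩
      apply hσ
      have h4 := (hbN hd).2
      have h5 : ℓ d.2 = σ := by
        rw [he] at hdσ
        exact congrArg Prod.fst hdσ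
      rw [mem_preimage, h5] at h4
      exact h4
    have hgd : ∀ s ∈ Ioo (-ε) ε, HasDerivWithinAt g (deriv g s) (Ioo (-ε) ε) s := by
      intro s hs'
      have h4 : DifferentiableAt ℝ g s := ℓ.differentiableAt.comp s
        ((hs.contDiffAt_chart_orbit (h1 s (abs_lt.2 hs')).1).differentiableAt (by simp))
      exact h4.hasDerivAt.hasDerivWithinAt
    rw [hl, integral_image_eq_integral_abs_deriv_smul measurableSet_Ioo hgd h2,
      intervalIntegral.integral_of_le (by linarith [show (0 : ℝ) < ε from hε]),
      integral_Ioc_eq_integral_Ioo, ← integral_const_mul]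
    refine setIntegral_congr_fun measurableSet_Ioo fun s hs' => ?_
    obtain ⟨h4, h5, h6⟩ := h1 s (abs_lt.2 hs')
    have h7 : (g s, (0 : 𝔼[n])) = e (t₀, extChartAt (𝓡 n) α (φ s x₀)) := by
      rw [he, displacement_orbit hs hfix h4]
    rw [h7, hBt _ h5, hcdef]
    simp only
    obtain ⟨A, hA, hA'⟩ := exists_hasMFDerivAt_extChartAt h4
    have hfs := hs.period_apply hfix s
    obtain ⟨D, hD, hDdet⟩ := h.exists_hasFDerivAt_displacement hfs h4 hA hA' ℓ
    have hgs : deriv g s = ℓ (A (gen φ (φ s x₀))) :=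
      (ℓ.hasFDerivAt.comp_hasDerivAt s (hs.hasDerivAt_chart_orbit h4 hA)).deriv
    rw [hD.fderiv, hDdet, h.absDet_transport hfix s hfs, ← hgs, Complex.real_smul]
    have h8 : ((|deriv g s| : ℝ) : ℂ) ≠ 0 := by
      exact_mod_cast (abs_pos.2 h6.ne').ne'
    have h9 : ((h.absDet hfix : ℝ) : ℂ) ≠ 0 := by
      exact_mod_cast (h.absDet_pos ht₀ hfix).ne'
    push_cast
    field_simp
  rw [← hfin]
  exact hlim

end LocalTraceFormula

end Guillemin

end

/-! ### Periods: lower bound, finiteness, primitive periods. -/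

noncomputable section

namespace Guillemin

set_option linter.unusedSectionVars false

local notation "𝔼[" n "]" => EuclideanSpace ℝ (Fin n)
local notation "𝓘₁[" n "]" => ModelWithCorners.prod 𝓘(ℝ, ℝ) (𝓡 n)

section Periods

variable {n : ℕ} {X : Type*} [TopologicalSpace X] [ChartedSpace 𝔼[n] X] [IsManifold (𝓡 n) ∞ X]
  {φ : ℝ → X → X} {Es Eu : ∀ x : X, Submodule ℝ (TangentSpace (𝓡 n) x)}

/-- By strict differentiability at `(0, x₀)`, the difference between `φ_{-t} y` and `y` in the chart
is `-tV` up to an error of at most `|t| ‖V‖ / 2`, so it vanishes only for `t = 0`. -/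
theorem IsAnosov.eventually_period_eq_zero (h : IsAnosov φ Es Eu) (x₀ : X) :
    ∀ᶠ q : ℝ × X in 𝓝 (0, x₀), φ q.1 q.2 = q.2 → q.1 = 0 := by
  have hs := h.toIsSmoothFlow
  have hx₀ := mem_extChartAt_source (I := 𝓡 n) x₀
  obtain ⟨A, hA, hA'⟩ := exists_hasMFDerivAt_extChartAt hx₀
  have hf : φ (-0) x₀ = x₀ := by rw [neg_zero, hs.zero]
  have h1 := hs.hasFDerivAt_chartFlow (t := 0) hx₀ hf hA hA'
  have h2 := (hs.contDiffAt_chartFlow (β := x₀) (α := x₀) (d := (0, extChartAt (𝓡 n) x₀ x₀))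
    ((extChartAt (𝓡 n) x₀).map_source hx₀)
    (by simp only; rwa [chartInv_extChartAt hx₀, hf])).hasStrictFDerivAt' h1 (by simp)
  have hV : 0 < ‖A (gen φ x₀)‖ := by
    rw [norm_pos_iff, Ne, EmbeddingLike.map_eq_zero_iff]
    exact h.gen_ne_zero x₀
  have h3 := h2.isLittleO.def (half_pos hV)
  have hc : ContinuousAt (fun q : ℝ × X => (q.1, extChartAt (𝓡 n) x₀ q.2)) (0, x₀) :=
    continuousAt_fst.prodMk (ContinuousAt.comp (f := Prod.snd) (x := ((0 : ℝ), x₀))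
      (continuousAt_extChartAt x₀) continuousAt_snd)
  have hc0 : ContinuousAt (fun q : ℝ × X => ((0 : ℝ), extChartAt (𝓡 n) x₀ q.2)) (0, x₀) :=
    continuousAt_const.prodMk (continuousAt_snd.comp hc)
  have hsrc : ∀ᶠ q : ℝ × X in 𝓝 (0, x₀), q.2 ∈ (extChartAt (𝓡 n) x₀).source :=
    continuousAt_snd ((isOpen_extChartAt_source x₀).mem_nhds hx₀)
  filter_upwards [hsrc, (hc.prodMk hc0) h3] with q hq hq3 hqf
  have h4 : chartFlow φ x₀ x₀ (q.1, extChartAt (𝓡 n) x₀ q.2) = extChartAt (𝓡 n) x₀ q.2 :=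
    IsSmoothFlow.chartFlow_extChartAt hq (hs.neg_period hqf)
  have h5 : chartFlow φ x₀ x₀ (0, extChartAt (𝓡 n) x₀ q.2) = extChartAt (𝓡 n) x₀ q.2 :=
    IsSmoothFlow.chartFlow_extChartAt hq (by rw [neg_zero, hs.zero])
  simp only [mem_preimage, mem_ofPred_eq] at hq3
  rw [h4, h5] at hq3
  have h6 : ((A : 𝔼[n] →L[ℝ] 𝔼[n]).comp
        ((-(ContinuousLinearMap.toSpanSingleton ℝ (gen (n := n) φ x₀))).coprod
          ((dflow (n := n) φ (-0) x₀).comp (A.symm : 𝔼[n] →L[ℝ] 𝔼[n]))))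
        ((q.1, extChartAt (𝓡 n) x₀ q.2) - (0, extChartAt (𝓡 n) x₀ q.2)) =
      -(q.1 • A (gen φ x₀)) := by
    simp
  rw [h6, sub_self, zero_sub, neg_neg, norm_smul, Prod.mk_sub_mk, sub_self, sub_zero,
    Prod.norm_def, norm_zero, max_eq_left (norm_nonneg _)] at hq3
  by_contra h0
  have h7 : 0 < ‖q.1‖ := norm_pos_iff.2 h0
  nlinarith

variable [CompactSpace X]

theorem IsAnosov.exists_period_lower_bound (h : IsAnosov φ Es Eu) :
    ∃ δ > 0, ∀ t x, |t| < δ → φ t x = x → t = 0 := by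
  have h1 := isCompact_univ.eventually_forall_of_forall_eventually (x₀ := (0 : ℝ))
    (P := fun t x => φ t x = x → t = 0) fun x (_ : x ∈ (univ : Set X)) =>
      h.eventually_period_eq_zero x
  obtain ⟨δ, hδ, hδs⟩ := Metric.eventually_nhds_iff.1 h1
  exact ⟨δ, hδ, fun t x ht => hδs (by rwa [dist_zero_right, Real.norm_eq_abs]) x (mem_univ x)⟩

variable [T2Space X]

theorem IsSmoothFlow.isClosed_fixed (h : IsSmoothFlow (n := n) φ) :
    IsClosed {q : ℝ × X | φ q.1 q.2 = q.2} :=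
  isClosed_eq h.continuous_uncurry continuous_snd

/-- The periodic points with `δ ≤ |t| ≤ R` form a compact set, `δ` being the lower bound for
periods, and `eventually_fixed` gives each one a neighbourhood that contains no periodic points
besides those of its own orbit and time. -/
theorem IsAnosov.exists_finite_fixed (h : IsAnosov φ Es Eu) (R : ℝ) :
    ∃ S : Set (ℝ × X), S.Finite ∧ ∀ t x, t ≠ 0 → |t| ≤ R → φ t x = x →
      ∃ q ∈ S, t = q.1 ∧ ∃ s, x = φ s q.2 := by
  obtain ⟨δ, hδ, hδs⟩ := h.exists_period_lower_bound
  have hK : IsCompact ({q : ℝ × X | φ q.1 q.2 = q.2} ∩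
      ((Icc (-R) R ∩ {t | δ ≤ |t|}) ×ˢ univ)) := by
    refine IsCompact.inter_left ?_ h.toIsSmoothFlow.isClosed_fixed
    exact (isCompact_Icc.inter_right (isClosed_le continuous_const continuous_abs)).prod
      isCompact_univ
  obtain ⟨t, ht, htc⟩ := hK.elim_nhds_subcover
    (fun q => {q' : ℝ × X | φ q'.1 q'.2 = q'.2 → q'.1 = q.1 ∧ ∃ s, |s| < 1 ∧ q'.2 = φ s q.2})
    fun q hq => h.eventually_fixed (t₀ := q.1) (x₀ := q.2)
      (by have := hq.2.1.2; rintro h0; simp [h0] at this; linarith) hq.1 one_pos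
  refine ⟨t, t.finite_toSet, fun T x hT hTR hx => ?_⟩
  have hmem : (T, x) ∈ {q : ℝ × X | φ q.1 q.2 = q.2} ∩
      ((Icc (-R) R ∩ {t | δ ≤ |t|}) ×ˢ univ) :=
    ⟨hx, ⟨⟨abs_le.1 hTR, not_lt.1 fun h0 => hT (hδs T x h0 hx)⟩, mem_univ _⟩⟩
  obtain ⟨q, hq, hq'⟩ := mem_iUnion₂.1 (htc hmem)
  obtain ⟨h1, s, -, h2⟩ := hq' hx
  exact ⟨q, hq, h1, s, h2⟩

theorem IsSmoothFlow.range_orbit (h : IsSmoothFlow (n := n) φ) (s : ℝ) (x : X) :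
    range (fun t => φ t (φ s x)) = range (fun t => φ t x) := by
  ext y
  constructor
  · rintro ⟨t, rfl⟩
    exact ⟨t + s, h.add t s x⟩
  · rintro ⟨t, rfl⟩
    refine ⟨t - s, ?_⟩
    simp only
    rw [← h.add, sub_add_cancel]

theorem IsAnosov.finite_closedOrbit (h : IsAnosov φ Es Eu) (R : ℝ) :
    {γ : ClosedOrbit φ | γ.period ≤ R}.Finite := by
  obtain ⟨S, hS, hSR⟩ := h.exists_finite_fixed R
  refine Set.Finite.of_finite_image (f := fun γ => (γ.period, γ.carrier))
    ((hS.image fun q => (q.1, range fun t => φ t q.2)).subset ?_) ?_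
  · rintro _ ⟨γ, hγ, rfl⟩
    obtain ⟨x, hx, hp⟩ := γ.exists_base
    obtain ⟨q, hq, hq1, s, hs⟩ := hSR γ.period x γ.period_pos.ne'
      (by rw [abs_of_pos γ.period_pos]; exact hγ) hp
    refine ⟨q, hq, ?_⟩
    simp only
    rw [hx, hq1, hs, h.toIsSmoothFlow.range_orbit]
  · intro γ _ γ' _ he
    rw [Prod.mk.injEq] at he
    exact ClosedOrbit.ext he.2 he.1

/-- The positive periods of `x` form a closed set because they are bounded away from 0; hence the
infimum is attained. -/
theorem IsAnosov.primitivePeriod_mem (h : IsAnosov φ Es Eu) {x : X} {T : ℝ} (hT : T ≠ 0)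
    (hx : φ T x = x) : 0 < primitivePeriod φ x ∧ φ (primitivePeriod φ x) x = x := by
  obtain ⟨δ, hδ, hδs⟩ := h.exists_period_lower_bound
  have hset : {t | 0 < t ∧ φ t x = x} = Ici δ ∩ {t | φ t x = x} := by
    ext t
    simp only [mem_ofPred_eq, mem_inter_iff, mem_Ici]
    constructor
    · rintro ⟨h0, h1⟩
      refine ⟨not_lt.1 fun h2 => h0.ne' (hδs t x (by rwa [abs_of_pos h0]) h1), h1⟩
    · rintro ⟨h0, h1⟩
      exact ⟨hδ.trans_le h0, h1⟩
  have hcl : IsClosed {t | 0 < t ∧ φ t x = x} := by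
    rw [hset]
    exact isClosed_Ici.inter
      (isClosed_eq (h.toIsSmoothFlow.contMDiff_orbit x).continuous continuous_const)
  have hne : {t | 0 < t ∧ φ t x = x}.Nonempty := by
    rcases hT.lt_or_gt with hT | hT
    · exact ⟨-T, neg_pos.2 hT, h.toIsSmoothFlow.neg_period hx⟩
    · exact ⟨T, hT, hx⟩
  exact hcl.csInf_mem hne ⟨0, fun t ht => ht.1.le⟩

theorem IsSmoothFlow.eq_zero_of_abs_lt_primitivePeriod (h : IsSmoothFlow (n := n) φ) {x : X}
    {s : ℝ} (hs : |s| < primitivePeriod φ x) (hx : φ s x = x) : s = 0 := by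
  have key : ∀ s, 0 < s → s < primitivePeriod φ x → φ s x ≠ x := fun s h0 h1 h2 =>
    absurd h1 (not_lt.2 (csInf_le (s := {t | 0 < t ∧ φ t x = x}) ⟨0, fun t ht => ht.1.le⟩
      ⟨h0, h2⟩))
  rcases lt_trichotomy s 0 with h0 | h0 | h0
  · exact absurd (h.neg_period hx) (key (-s) (neg_pos.2 h0) (by rwa [abs_of_neg h0] at hs))
  · exact h0
  · exact absurd hx (key s h0 (by rwa [abs_of_pos h0] at hs))

theorem IsSmoothFlow.period_orbit_iff (h : IsSmoothFlow (n := n) φ) {x : X} {t s : ℝ} :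
    φ t (φ s x) = φ s x ↔ φ t x = x := by
  refine ⟨fun hx => ?_, fun hx => h.period_apply hx s⟩
  have := h.period_apply hx (-s)
  rwa [h.neg_apply] at this

theorem IsSmoothFlow.primitivePeriod_orbit (h : IsSmoothFlow (n := n) φ) (x : X) (s : ℝ) :
    primitivePeriod φ (φ s x) = primitivePeriod φ x := by
  unfold primitivePeriod
  simp_rw [h.period_orbit_iff]

end Periods

/-! ### The functional given by integration over closed orbits. -/

section OrbitSum

variable {X : Type*} {φ : ℝ → X → X}

/-- A point on a closed orbit. -/
def ClosedOrbit.base (γ : ClosedOrbit φ) : X := γ.exists_base.choose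

theorem ClosedOrbit.carrier_eq (γ : ClosedOrbit φ) : γ.carrier = range fun t => φ t γ.base :=
  γ.exists_base.choose_spec.1

theorem ClosedOrbit.period_base (γ : ClosedOrbit φ) : φ γ.period γ.base = γ.base :=
  γ.exists_base.choose_spec.2

/-- The weighted integral over a closed orbit, traversed once, at time `T`. -/
def orbitTerm (wt : ℝ → X → ℂ) (χ : ℝ × X → ℂ) (γ : ClosedOrbit φ) (T : ℝ) : ℂ :=
  wt T γ.base * ∫ s in (0 : ℝ)..primitivePeriod φ γ.base, χ (T, φ s γ.base)

variable (φ) in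
/-- The sum of the weighted integrals over all closed orbits, with their positive and negative
periods. -/
def orbitSum (wt : ℝ → X → ℂ) (χ : ℝ × X → ℂ) : ℂ :=
  ∑ᶠ γ : ClosedOrbit φ, (orbitTerm wt χ γ γ.period + orbitTerm wt χ γ (-γ.period))

variable {n : ℕ} [TopologicalSpace X] [ChartedSpace 𝔼[n] X] [IsManifold (𝓡 n) ∞ X]
  {Es Eu : ∀ x : X, Submodule ℝ (TangentSpace (𝓡 n) x)} {wt : ℝ → X → ℂ}

theorem orbitTerm_eq_zero {χ : ℝ × X → ℂ} {γ : ClosedOrbit φ} {T : ℝ}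
    (h : ∀ s, χ (T, φ s γ.base) = 0) : orbitTerm wt χ γ T = 0 := by
  simp [orbitTerm, h]

variable [CompactSpace X] [T2Space X]

theorem IsAnosov.finite_orbitTerm (h : IsAnosov φ Es Eu) {χ : ℝ × X → ℂ}
    (hχ : HasCompactSupport χ) : (Function.support fun γ : ClosedOrbit φ =>
      orbitTerm wt χ γ γ.period + orbitTerm wt χ γ (-γ.period)).Finite := by
  obtain ⟨R, hR⟩ := (hχ.isCompact.image continuous_fst).isBounded.exists_norm_le
  refine (h.finite_closedOrbit R).subset fun γ hγ => ?_
  by_contra hγR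
  apply hγ
  have h1 : ∀ T, |T| = γ.period → orbitTerm wt χ γ T = 0 := fun T hT => by
    refine orbitTerm_eq_zero fun s => ?_
    by_contra h0
    refine hγR ?_
    have := hR T ⟨_, subset_tsupport _ h0, rfl⟩
    rwa [Real.norm_eq_abs, hT] at this
  simp only
  rw [h1 _ (abs_of_pos γ.period_pos), h1 _ (by rw [abs_neg, abs_of_pos γ.period_pos]), add_zero]

theorem orbitSum_eq_zero (h : IsSmoothFlow (n := n) φ) {χ : ℝ × X → ℂ}
    (hχ : ∀ t x, t ≠ 0 → φ t x = x → χ (t, x) = 0) : orbitSum φ wt χ = 0 := by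
  have h1 : ∀ γ : ClosedOrbit φ, ∀ T, T ≠ 0 → φ T γ.base = γ.base → orbitTerm wt χ γ T = 0 :=
    fun γ T hT hx => orbitTerm_eq_zero fun s => hχ _ _ hT (h.period_apply hx s)
  unfold orbitSum
  refine finsum_eq_zero_of_forall_eq_zero fun γ => ?_
  rw [h1 γ _ γ.period_pos.ne' γ.period_base,
    h1 γ _ (neg_ne_zero.2 γ.period_pos.ne') (h.neg_period γ.period_base), add_zero]

theorem IsAnosov.orbitSum_add (h : IsAnosov φ Es Eu) {χ χ' : ℝ × X → ℂ}
    (hχ : Continuous χ) (hχ' : Continuous χ') (hc : HasCompactSupport χ)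
    (hc' : HasCompactSupport χ') :
    orbitSum φ wt (fun q => χ q + χ' q) = orbitSum φ wt χ + orbitSum φ wt χ' := by
  unfold orbitSum
  rw [← finsum_add_distrib (h.finite_orbitTerm hc) (h.finite_orbitTerm hc')]
  refine finsum_congr fun γ => ?_
  have h1 : ∀ T, orbitTerm wt (fun q => χ q + χ' q) γ T =
      orbitTerm wt χ γ T + orbitTerm wt χ' γ T := by
    intro T
    have ho : Continuous fun s => (T, φ s γ.base) :=
      continuous_const.prodMk (h.toIsSmoothFlow.contMDiff_orbit γ.base).continuous
    have h2 := intervalIntegral.integral_add (μ := volume)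
      ((hχ.comp ho).intervalIntegrable 0 (primitivePeriod φ γ.base))
      ((hχ'.comp ho).intervalIntegrable 0 (primitivePeriod φ γ.base))
    simp only [Function.comp] at h2
    rw [orbitTerm, h2, mul_add]
    rfl
  rw [h1, h1]
  ring

theorem orbitSum_const_mul (c : ℂ) (χ : ℝ × X → ℂ) :
    orbitSum φ wt (fun q => c * χ q) = c * orbitSum φ wt χ := by
  unfold orbitSum
  rw [← smul_eq_mul, smul_finsum]
  refine finsum_congr fun γ => ?_
  simp only [orbitTerm, intervalIntegral.integral_const_mul, smul_eq_mul]
  ring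

/-- The functional `orbitSum` near a closed trajectory. -/
theorem IsAnosov.eventually_orbitSum_eq (h : IsAnosov φ Es Eu)
    (hwt : ∀ T x s, φ T x = x → wt T (φ s x) = wt T x) {x₀ : X} {t₀ : ℝ} (ht₀ : t₀ ≠ 0)
    (hfix : φ t₀ x₀ = x₀) :
    ∀ᶠ ε in 𝓝[>] (0 : ℝ), ∃ N ∈ 𝓝 (t₀, x₀), ∀ χ : ℝ × X → ℂ, Continuous χ →
      tsupport χ ⊆ N → orbitSum φ wt χ = wt t₀ x₀ * ∫ s in (-ε)..ε, χ (t₀, φ s x₀) := by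
  have hs := h.toIsSmoothFlow
  obtain ⟨hP0, hP⟩ := h.primitivePeriod_mem ht₀ hfix
  -- With `ε` less than half the primitive period, the arc `|s| < ε` does not meet itself and fits
  -- in one traversal of the orbit.
  filter_upwards [Ioo_mem_nhdsGT (half_pos hP0)] with ε hε
  refine ⟨_, h.eventually_fixed ht₀ hfix hε.1, fun χ hχ hχN => ?_⟩
  have hmem : ∀ t x, χ (t, x) ≠ 0 → φ t x = x → t = t₀ ∧ ∃ s, |s| < ε ∧ x = φ s x₀ :=
    fun t x h0 hx => hχN (subset_tsupport _ h0) hx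
  -- A `ClosedOrbit` records a positive period, so a negative `t₀` is accounted for by the second
  -- term of the summand of `γ₀`.
  let γ₀ : ClosedOrbit φ := ⟨range fun t => φ t x₀, |t₀|, abs_pos.2 ht₀, x₀, rfl, by
    rcases abs_choice t₀ with h0 | h0 <;> rw [h0]
    · exact hfix
    · exact hs.neg_period hfix⟩
  have hfixT : ∀ (γ : ClosedOrbit φ) T, |T| = γ.period → φ T γ.base = γ.base := by
    intro γ T hT
    rcases abs_choice T with h0 | h0
    · rw [← h0, hT]; exact γ.period_base
    · have := hs.neg_period γ.period_base
      rwa [← hT, h0, neg_neg] at this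
  have hzero : ∀ (γ : ClosedOrbit φ) T, |T| = γ.period → (T = t₀ → γ ≠ γ₀) →
      orbitTerm wt χ γ T = 0 := by
    intro γ T hT hne
    refine orbitTerm_eq_zero fun s => ?_
    by_contra h0
    obtain ⟨h1, s', -, h2⟩ := hmem _ _ h0 (hs.period_apply (hfixT γ T hT) s)
    refine hne h1 (ClosedOrbit.ext ?_ ?_)
    · rw [γ.carrier_eq, ← hs.range_orbit s, h2, hs.range_orbit]
    · rw [← hT, h1]
  have hsingle : orbitSum φ wt χ = orbitTerm wt χ γ₀ t₀ := by
    unfold orbitSum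
    rw [finsum_eq_single _ γ₀ fun γ hγ => by
      rw [hzero γ _ (abs_of_pos γ.period_pos) fun _ => hγ,
        hzero γ _ (by rw [abs_neg, abs_of_pos γ.period_pos]) fun _ => hγ, add_zero]]
    rcases ht₀.lt_or_gt with h0 | h0
    · have h1 : γ₀.period = -t₀ := abs_of_neg h0
      rw [h1, neg_neg, hzero γ₀ (-t₀) (by rw [abs_neg]) fun h2 => by linarith, zero_add]
    · have h1 : γ₀.period = t₀ := abs_of_pos h0
      rw [h1, hzero γ₀ (-t₀) (by rw [abs_neg]) fun h2 => by linarith, add_zero]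
  rw [hsingle, orbitTerm]
  have hb : γ₀.base ∈ γ₀.carrier := by
    rw [γ₀.carrier_eq]
    exact ⟨0, hs.zero _⟩
  obtain ⟨r, hr⟩ : ∃ r, φ r x₀ = γ₀.base := hb
  rw [← hr, hwt _ _ _ hfix, hs.primitivePeriod_orbit]
  congr 1
  set P := primitivePeriod φ x₀
  set f : ℝ → ℂ := fun s => χ (t₀, φ s x₀) with hf
  have hfc : Continuous f := hχ.comp
    (continuous_const.prodMk (hs.contMDiff_orbit x₀).continuous)
  have hper : Function.Periodic f P := fun s => by
    simp only [hf]
    rw [hs.add, hP]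
  have h1 : ∀ s, χ (t₀, φ s (φ r x₀)) = f (s + r) := fun s => by
    simp only [hf]
    rw [hs.add]
  simp_rw [h1]
  -- The integral over one period does not depend on where it starts; it is moved to `(-P/2, P/2)`,
  -- where the integrand vanishes for `|s| ≥ ε`.
  rw [intervalIntegral.integral_comp_add_right, zero_add, add_comm P r,
    hper.intervalIntegral_add_eq r (-(P / 2))]
  have hz : ∀ s, ε ≤ |s| → |s| ≤ P / 2 → f s = 0 := by
    intro s h2 h3
    by_contra h0
    obtain ⟨-, s', h4, h5⟩ := hmem _ _ h0 (hs.period_apply hfix s)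
    have h6 : φ (s - s') x₀ = x₀ := by
      rw [sub_eq_add_neg, add_comm, hs.add, h5, hs.neg_apply]
    have h7 := hs.eq_zero_of_abs_lt_primitivePeriod (s := s - s')
      ((abs_sub s s').trans_lt (by linarith [hε.2])) h6
    rw [sub_eq_zero] at h7
    rw [h7] at h2
    linarith
  have hi : ∀ a b, IntervalIntegrable f volume a b := fun a b => hfc.intervalIntegrable a b
  have hε1 := hε.1
  have hε2 := hε.2
  rw [show -(P / 2) + P = P / 2 by ring,
    ← intervalIntegral.integral_add_adjacent_intervals (hi (-(P / 2)) (-ε)) (hi (-ε) (P / 2)),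
    ← intervalIntegral.integral_add_adjacent_intervals (hi (-ε) ε) (hi ε (P / 2))]
  have e1 : ∫ s in (-(P / 2))..(-ε), f s = 0 := by
    rw [intervalIntegral.integral_congr (g := fun _ => (0 : ℂ))]
    · simp
    · intro s hs'
      rw [uIcc_of_le (by linarith)] at hs'
      have := abs_of_nonpos (show s ≤ 0 by linarith [hs'.2])
      exact hz s (by rw [this]; linarith [hs'.2]) (by rw [this]; linarith [hs'.1])
  have e2 : ∫ s in ε..(P / 2), f s = 0 := by
    rw [intervalIntegral.integral_congr (g := fun _ => (0 : ℂ))]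
    · simp
    · intro s hs'
      rw [uIcc_of_le (by linarith)] at hs'
      have := abs_of_nonneg (show 0 ≤ s by linarith [hs'.1])
      exact hz s (by rw [this]; linarith [hs'.1]) (by rw [this]; linarith [hs'.2])
  rw [e1, e2, zero_add, add_zero]

end OrbitSum

section Bounded

variable {F : Type*} [NormedAddCommGroup F] [NormedSpace ℝ F]
  {H : Type*} [TopologicalSpace H] {I : ModelWithCorners ℝ F H}
  {M : Type*} [TopologicalSpace M] [ChartedSpace H M]

/-- A linear functional that is locally bounded in the supremum norm is a distribution. -/
theorem isDistribution_of_bound {O : Set M} {u : (M → ℂ) → ℂ}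
    (hadd : ∀ Φ Ψ, IsTest I O Φ → IsTest I O Ψ → u (fun q => Φ q + Ψ q) = u Φ + u Ψ)
    (hmul : ∀ (c : ℂ) Φ, IsTest I O Φ → u (fun q => c * Φ q) = c * u Φ)
    (hb : ∀ p ∈ O, ∃ L ∈ 𝓝 p, ∃ C : ℝ, ∀ Φ, IsTest I O Φ → tsupport Φ ⊆ L →
      ∀ B : ℝ, (∀ q, ‖Φ q‖ ≤ B) → ‖u Φ‖ ≤ C * B) : IsDistribution I O u := by
  refine ⟨hadd, hmul, fun p hp => ?_⟩
  obtain ⟨L, hL, C, hC⟩ := hb p hp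
  refine ⟨L ∩ (extChartAt I p).source, inter_mem hL (extChartAt_source_mem_nhds p), 0, C,
    fun Φ hΦ hΦL B hB => hC Φ hΦ (hΦL.trans inter_subset_left) B fun q => ?_⟩
  have h0 : ∀ z ∈ (extChartAt I p).target, ‖Φ ((extChartAt I p).symm z)‖ ≤ B := fun z hz => by
    have := hB 0 le_rfl z hz
    rwa [norm_iteratedFDerivWithin_zero] at this
  by_cases hq : q ∈ (extChartAt I p).source
  · have := h0 _ ((extChartAt I p).map_source hq)
    rwa [(extChartAt I p).left_inv hq] at this
  · rw [image_eq_zero_of_notMem_tsupport fun h => hq (hΦL h).2, norm_zero]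
    exact (norm_nonneg _).trans (h0 _ (mem_extChartAt_target p))

end Bounded

section OrbitSumDistribution

variable {n : ℕ} {X : Type*} [TopologicalSpace X] [ChartedSpace 𝔼[n] X] [IsManifold (𝓡 n) ∞ X]
  [CompactSpace X] [T2Space X] {φ : ℝ → X → X}
  {Es Eu : ∀ x : X, Submodule ℝ (TangentSpace (𝓡 n) x)} {wt : ℝ → X → ℂ}

/-- Locally the functional is an integral over a single arc, or zero near a point that is not
periodic; either way it is bounded by the supremum norm. -/
theorem IsAnosov.isDistribution_orbitSum (h : IsAnosov φ Es Eu)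
    (hwt : ∀ T x s, φ T x = x → wt T (φ s x) = wt T x) :
    IsDistribution 𝓘₁[n] {q : ℝ × X | q.1 ≠ 0} (orbitSum φ wt) := by
  refine isDistribution_of_bound (fun Φ Ψ hΦ hΨ => h.orbitSum_add hΦ.continuous hΨ.continuous
    hΦ.2.1 hΨ.2.1) (fun c Φ _ => orbitSum_const_mul c Φ) fun p hp => ?_
  by_cases hfix : φ p.1 p.2 = p.2
  · obtain ⟨ε, ⟨N, hN, hχ⟩, hε⟩ :=
      ((h.eventually_orbitSum_eq hwt hp hfix).and self_mem_nhdsWithin).exists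
    refine ⟨N, hN, ‖wt p.1 p.2‖ * (2 * ε), fun Φ hΦ hΦN B hB => ?_⟩
    rw [hχ Φ hΦ.continuous hΦN, norm_mul, mul_assoc]
    refine mul_le_mul_of_nonneg_left ?_ (norm_nonneg _)
    refine (intervalIntegral.norm_integral_le_of_norm_le_const fun s _ =>
      hB (p.1, φ s p.2)).trans (le_of_eq ?_)
    rw [sub_neg_eq_add, abs_of_pos (add_pos hε hε)]
    ring
  · refine ⟨{q : ℝ × X | φ q.1 q.2 = q.2}ᶜ,
      h.toIsSmoothFlow.isClosed_fixed.isOpen_compl.mem_nhds hfix, 0, fun Φ hΦ hΦN B hB => ?_⟩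
    rw [orbitSum_eq_zero h.toIsSmoothFlow fun t x _ hx =>
      image_eq_zero_of_notMem_tsupport fun h0 => hΦN h0 hx]
    simp

end OrbitSumDistribution

end Guillemin

end

/-! ### Chart cutoffs and the mollified kernel. -/

noncomputable section

namespace Guillemin

set_option linter.unusedSectionVars false

local notation "𝔼[" n "]" => EuclideanSpace ℝ (Fin n)
local notation "𝓙[" n "]" => ModelWithCorners.prod 𝓘(ℝ, ℝ) (ModelWithCorners.prod (𝓡 n) (𝓡 n))
local notation "𝓘₁[" n "]" => ModelWithCorners.prod 𝓘(ℝ, ℝ) (𝓡 n)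

section ChartCutoff

variable {n : ℕ} {X : Type*} [TopologicalSpace X] [ChartedSpace 𝔼[n] X] [IsManifold (𝓡 n) ∞ X]

/-- A smooth function supported in the domain of the chart at `α`. -/
structure IsChartCutoff (α : X) (χ : X → ℂ) : Prop where
  smooth : ContMDiff (𝓡 n) 𝓘(ℝ, ℂ) ∞ χ
  supp : tsupport χ ⊆ (extChartAt (𝓡 n) α).source

/-- Squares of real bump functions are divided by their sum. Two cutoffs per chart are needed since
one is evaluated at `φ_{-t}(y)` and the other at `x`; on the graph these points agree and the
products sum to 1. -/
theorem exists_chartCutoffs [CompactSpace X] [T2Space X] :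
    ∃ (s : Finset X) (χ ψ : X → X → ℂ), (∀ α, IsChartCutoff (n := n) α (χ α)) ∧
      (∀ α, IsChartCutoff (n := n) α (ψ α)) ∧ ∀ x, ∑ α ∈ s, χ α x * ψ α x = 1 := by
  choose Φ hΦ hΦ1 using fun α : X => exists_isTest_eq_one (I := 𝓡 n) (p := α)
    (extChartAt_source_mem_nhds (I := 𝓡 n) α)
  obtain ⟨s, -, hs⟩ := isCompact_univ.elim_nhds_subcover (fun α => {x | Φ α x = 1})
    fun α _ => hΦ1 α
  have hre : ContDiff ℝ ∞ (fun z : ℂ => ((z.re : ℝ) : ℂ)) :=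
    Complex.ofRealCLM.contDiff.comp Complex.reCLM.contDiff
  have hr : ∀ α, ContMDiff (𝓡 n) 𝓘(ℝ, ℂ) ∞ (fun x => (((Φ α x).re : ℝ) : ℂ)) := fun α =>
    hre.contMDiff.comp (hΦ α).1
  have hrs : ∀ α, tsupport (fun x => (((Φ α x).re : ℝ) : ℂ)) ⊆ (extChartAt (𝓡 n) α).source :=
    fun α => (tsupport_comp_eq_subset fun x hx => by simp [hx]).trans (hΦ α).2.2
  set S : X → ℂ := fun x => ∑ α ∈ s, (((Φ α x).re : ℝ) : ℂ) * (((Φ α x).re : ℝ) : ℂ) with hS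
  have hS0 : ∀ x, S x ≠ 0 := by
    intro x
    obtain ⟨α, hα, hx⟩ := mem_iUnion₂.1 (hs (mem_univ x))
    have h1 : S x = ((∑ α ∈ s, (Φ α x).re * (Φ α x).re : ℝ) : ℂ) := by
      simp [hS]
    rw [h1]
    have h2 : 0 < ∑ α ∈ s, (Φ α x).re * (Φ α x).re := by
      refine Finset.sum_pos' (fun i _ => mul_self_nonneg _) ⟨α, hα, ?_⟩
      rw [show Φ α x = 1 from hx]
      norm_num
    exact_mod_cast h2.ne'
  have hSs : ContMDiff (𝓡 n) 𝓘(ℝ, ℂ) ∞ S := by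
    have : ∀ t : Finset X, ContMDiff (𝓡 n) 𝓘(ℝ, ℂ) ∞
        (fun x => ∑ α ∈ t, (((Φ α x).re : ℝ) : ℂ) * (((Φ α x).re : ℝ) : ℂ)) := by
      classical
      intro t
      induction t using Finset.induction_on with
      | empty => simpa using contMDiff_const
      | insert i t hi ih =>
        simp_rw [Finset.sum_insert hi]
        have h3 : ContDiff ℝ ∞ (fun p : ℂ × ℂ => p.1 + p.2) := contDiff_fst.add contDiff_snd
        exact h3.contMDiff.comp
          (ContMDiff.prodMk_space (fun x => contMDiffAt_mul (hr i x) (hr i x)) ih)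
    exact this s
  refine ⟨s, fun α x => (S x)⁻¹ * (((Φ α x).re : ℝ) : ℂ), fun α x => (((Φ α x).re : ℝ) : ℂ),
    fun α => ⟨fun x => contMDiffAt_mul ?_ (hr α x), ?_⟩, fun α => ⟨hr α, hrs α⟩, fun x => ?_⟩
  · have h2 : ContDiffAt ℝ ∞ (fun z : ℂ => z⁻¹) (S x) := contDiffAt_inv ℝ (hS0 x)
    exact h2.contMDiffAt.comp x (hSs x)
  · exact (tsupport_comp_eq_subset fun x hx => by
      have hx' : (((Φ α x).re : ℝ) : ℂ) = 0 := hx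
      exact mul_eq_zero_of_right _ hx').trans (hrs α)
  · simp_rw [mul_assoc]
    rw [← Finset.mul_sum]
    exact inv_mul_cancel₀ (hS0 x)

end ChartCutoff

section MollifiedKernel

variable {n : ℕ} {X : Type*} [TopologicalSpace X] [ChartedSpace 𝔼[n] X] [IsManifold (𝓡 n) ∞ X]
  {φ : ℝ → X → X} [MeasurableSpace X] {μ : Measure X} (hμ : IsSmoothDensity (n := n) μ)

/-- The kernel of `φ_{-t}^*`, mollified in the chart at `α`. -/
def mollKernel (φ : ℝ → X → X) (α : X) (χ ψ : X → ℂ) (ρ : 𝔼[n] → ℝ) (q : ℝ × X × X) : ℂ :=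
  -- Dividing by the density at `x` makes the mollifier a delta sequence with respect to `μ`.
  ((ρ (extChartAt (𝓡 n) α (φ (-q.1) q.2.1) - extChartAt (𝓡 n) α q.2.2) *
    (chartDensity hμ α (extChartAt (𝓡 n) α q.2.2))⁻¹ : ℝ) : ℂ) *
    (χ (φ (-q.1) q.2.1) * ψ q.2.2)

variable {α : X} {χ ψ : X → ℂ} (hχ : IsChartCutoff (n := n) α χ) (hψ : IsChartCutoff (n := n) α ψ)

theorem contMDiff_mollKernel (hs : IsSmoothFlow (n := n) φ) (hχ : IsChartCutoff (n := n) α χ)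
    (hψ : IsChartCutoff (n := n) α ψ) {ρ : 𝔼[n] → ℝ} (hρ : ContDiff ℝ ∞ ρ) :
    ContMDiff 𝓙[n] 𝓘(ℝ, ℂ) ∞ (mollKernel hμ φ α χ ψ ρ) := by
  have hb : ContMDiff 𝓙[n] (𝓡 n) ∞ (fun q : ℝ × X × X => φ (-q.1) q.2.1) :=
    hs.contMDiff_backward.comp (contMDiff_fst.prodMk (contMDiff_fst.comp contMDiff_snd))
  have h2 : ContMDiff 𝓙[n] (𝓡 n) ∞ (fun q : ℝ × X × X => q.2.2) :=
    contMDiff_snd.comp contMDiff_snd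
  set O : Set (ℝ × X × X) := {q | φ (-q.1) q.2.1 ∈ (extChartAt (𝓡 n) α).source ∧
    q.2.2 ∈ (extChartAt (𝓡 n) α).source} with hO
  have hOo : IsOpen O := ((isOpen_extChartAt_source α).preimage hb.continuous).inter
    ((isOpen_extChartAt_source α).preimage h2.continuous)
  have hκ : ContMDiffOn (𝓡 n) 𝓘(ℝ, 𝔼[n]) ∞ (extChartAt (𝓡 n) α)
      (extChartAt (𝓡 n) α).source := by
    rw [extChartAt_source]
    exact contMDiffOn_extChartAt
  refine contMDiff_mul_of_tsupport (fun q => contMDiffAt_mul ((hχ.smooth.comp hb) q)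
    ((hψ.smooth.comp h2) q)) hOo ?_ ?_
  · refine (tsupport_subset_of_forall_notMem (s := (fun q : ℝ × X × X => φ (-q.1) q.2.1) ⁻¹'
      tsupport χ ∩ (fun q : ℝ × X × X => q.2.2) ⁻¹' tsupport ψ) ?_ fun q hq => ?_).trans
      fun q hq => ⟨hχ.supp hq.1, hψ.supp hq.2⟩
    · exact ((isClosed_tsupport _).preimage hb.continuous).inter
        ((isClosed_tsupport _).preimage h2.continuous)
    · rw [mem_inter_iff, not_and_or] at hq
      rcases hq with hq | hq
      · rw [show χ (φ (-q.1) q.2.1) = 0 from image_eq_zero_of_notMem_tsupport hq, zero_mul]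
      · rw [show ψ q.2.2 = 0 from image_eq_zero_of_notMem_tsupport hq, mul_zero]
  · have e1 : ContMDiffOn 𝓙[n] 𝓘(ℝ, 𝔼[n]) ∞ (fun q : ℝ × X × X =>
        extChartAt (𝓡 n) α (φ (-q.1) q.2.1)) O := hκ.comp hb.contMDiffOn fun q hq => hq.1
    have e2 : ContMDiffOn 𝓙[n] 𝓘(ℝ, 𝔼[n]) ∞ (fun q : ℝ × X × X =>
        extChartAt (𝓡 n) α q.2.2) O := hκ.comp h2.contMDiffOn fun q hq => hq.2
    have e3 : ContDiffOn ℝ ∞ (fun p : 𝔼[n] × 𝔼[n] =>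
        ((ρ (p.1 - p.2) * (chartDensity hμ α p.2)⁻¹ : ℝ) : ℂ))
        {p | p.2 ∈ (extChartAt (𝓡 n) α).target} := by
      refine Complex.ofRealCLM.contDiff.comp_contDiffOn (ContDiffOn.mul
        (hρ.comp (contDiff_fst.sub contDiff_snd)).contDiffOn (ContDiffOn.inv ?_ ?_))
      · exact (contDiffOn_chartDensity hμ α).comp contDiff_snd.contDiffOn fun p hp => hp
      · exact fun p hp => (chartDensity_pos hμ hp).ne'
    exact e3.contMDiffOn.comp (e1.prodMk_space e2) fun q hq => (extChartAt (𝓡 n) α).map_source hq.2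

/-- Off the graph of the flow, the mollified kernels vanish in the end. -/
theorem eventually_mollKernel_eq_zero (hs : IsSmoothFlow (n := n) φ)
    (hχ : IsChartCutoff (n := n) α χ) (hψ : IsChartCutoff (n := n) α ψ) {ρ : ℕ → 𝔼[n] → ℝ}
    (hρ : IsMollifier volume ρ) {p : ℝ × X × X}
    (hp : ¬(φ (-p.1) p.2.1 = p.2.2 ∧ p.2.2 ∈ (extChartAt (𝓡 n) α).source)) :
    ∃ N ∈ 𝓝 p, ∀ᶠ j in atTop, ∀ q ∈ N, mollKernel hμ φ α χ ψ (ρ j) q = 0 := by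
  have hb : Continuous (fun q : ℝ × X × X => φ (-q.1) q.2.1) :=
    hs.contMDiff_backward.continuous.comp
      (continuous_fst.prodMk (continuous_fst.comp continuous_snd))
  have h2 : Continuous (fun q : ℝ × X × X => q.2.2) := continuous_snd.comp continuous_snd
  by_cases h1 : φ (-p.1) p.2.1 ∈ (extChartAt (𝓡 n) α).source
  swap
  · refine ⟨(fun q : ℝ × X × X => φ (-q.1) q.2.1) ⁻¹' (tsupport χ)ᶜ,
      hb.continuousAt.preimage_mem_nhds ((isClosed_tsupport χ).isOpen_compl.mem_nhds
        fun h => h1 (hχ.supp h)), Eventually.of_forall fun j q hq => ?_⟩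
    rw [mollKernel, show χ (φ (-q.1) q.2.1) = 0 from image_eq_zero_of_notMem_tsupport hq]
    simp
  by_cases h3 : p.2.2 ∈ (extChartAt (𝓡 n) α).source
  swap
  · refine ⟨(fun q : ℝ × X × X => q.2.2) ⁻¹' (tsupport ψ)ᶜ,
      h2.continuousAt.preimage_mem_nhds ((isClosed_tsupport ψ).isOpen_compl.mem_nhds
        fun h => h3 (hψ.supp h)), Eventually.of_forall fun j q hq => ?_⟩
    rw [mollKernel, show ψ q.2.2 = 0 from image_eq_zero_of_notMem_tsupport hq]
    simp
  have hne : extChartAt (𝓡 n) α (φ (-p.1) p.2.1) - extChartAt (𝓡 n) α p.2.2 ≠ 0 := by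
    rw [sub_ne_zero]
    exact fun h => hp ⟨(extChartAt (𝓡 n) α).injOn h1 h3 h, h3⟩
  have hc : ContinuousAt (fun q : ℝ × X × X =>
      ‖extChartAt (𝓡 n) α (φ (-q.1) q.2.1) - extChartAt (𝓡 n) α q.2.2‖) p := by
    refine ContinuousAt.norm (ContinuousAt.sub ?_ ?_)
    · exact ContinuousAt.comp (f := fun q : ℝ × X × X => φ (-q.1) q.2.1)
        (continuousAt_extChartAt' h1) hb.continuousAt
    · exact ContinuousAt.comp (f := fun q : ℝ × X × X => q.2.2)
        (continuousAt_extChartAt' h3) h2.continuousAt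
  obtain ⟨δ, hδ, hδ'⟩ := exists_between (norm_pos_iff.2 hne)
  obtain ⟨J, hJ⟩ := exists_nat_one_div_lt hδ
  refine ⟨_, hc.eventually (lt_mem_nhds hδ'), eventually_atTop.2 ⟨J, fun j hj q hq => ?_⟩⟩
  rw [mollKernel, hρ.eq_zero j _ ?_]
  · simp
  · refine le_trans ?_ (hJ.le.trans (le_of_lt hq))
    exact one_div_le_one_div_of_le (by positivity) (by exact_mod_cast Nat.succ_le_succ hj)

end MollifiedKernel

end Guillemin

end

/-! ### The mollified kernel as an average over shifted graphs. -/

noncomputable section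

namespace Guillemin

set_option linter.unusedSectionVars false

local notation "𝔼[" n "]" => EuclideanSpace ℝ (Fin n)
local notation "𝓙[" n "]" => ModelWithCorners.prod 𝓘(ℝ, ℝ) (ModelWithCorners.prod (𝓡 n) (𝓡 n))
local notation "𝓘₁[" n "]" => ModelWithCorners.prod 𝓘(ℝ, ℝ) (𝓡 n)

section MollifiedChart

variable {n : ℕ} {X : Type*} [TopologicalSpace X] [ChartedSpace 𝔼[n] X] [IsManifold (𝓡 n) ∞ X]
  {φ : ℝ → X → X}

/-- The graph of the flow, shifted by `z` in the chart at `α`: the parametrization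
`(t, y) ↦ (t, y, φ_{-t} y - z)`, with `y` in the chart at `β`. -/
def shiftedGraph (φ : ℝ → X → X) (β α : X) (e : 𝔼[n] × (ℝ × 𝔼[n])) : ℝ × X × X :=
  (e.2.1, chartInv β e.2.2, chartInv α (chartFlow φ β α e.2 - e.1))

/-- The domain where `shiftedGraph` is smooth. -/
def shiftedDomain (φ : ℝ → X → X) (β α : X) : Set (𝔼[n] × (ℝ × 𝔼[n])) :=
  {e | (e.2.2 ∈ (extChartAt (𝓡 n) β).target ∧
    φ (-e.2.1) (chartInv β e.2.2) ∈ (extChartAt (𝓡 n) α).source) ∧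
    chartFlow φ β α e.2 - e.1 ∈ (extChartAt (𝓡 n) α).target}

theorem contDiffOn_chartFlow_sub (hs : IsSmoothFlow (n := n) φ) (β α : X) :
    ContDiffOn ℝ ∞ (fun e : 𝔼[n] × (ℝ × 𝔼[n]) => chartFlow φ β α e.2 - e.1)
      {e | e.2.2 ∈ (extChartAt (𝓡 n) β).target ∧
        φ (-e.2.1) (chartInv β e.2.2) ∈ (extChartAt (𝓡 n) α).source} :=
  ((hs.contDiffOn_chartFlow β α).comp contDiff_snd.contDiffOn fun _ he => he).sub
    contDiff_fst.contDiffOn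

theorem isOpen_shiftedDomain (hs : IsSmoothFlow (n := n) φ) (β α : X) :
    IsOpen (shiftedDomain (n := n) φ β α) :=
  (contDiffOn_chartFlow_sub hs β α).continuousOn.isOpen_inter_preimage
    ((hs.isOpen_chartFlow_domain β α).preimage continuous_snd) (isOpen_extChartAt_target α)

theorem contMDiffOn_shiftedGraph (hs : IsSmoothFlow (n := n) φ) (β α : X) :
    ContMDiffOn 𝓘(ℝ, 𝔼[n] × (ℝ × 𝔼[n])) 𝓙[n] ∞ (shiftedGraph (n := n) φ β α)
      (shiftedDomain φ β α) := by
  refine ContMDiffOn.prodMk ?_ (ContMDiffOn.prodMk ?_ ?_)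
  · exact (contDiff_fst.comp contDiff_snd).contMDiff.contMDiffOn
  · exact (contMDiffOn_chartInv β).comp
      (contDiff_snd.comp contDiff_snd).contMDiff.contMDiffOn fun e he => he.1.1
  · exact (contMDiffOn_chartInv α).comp
      ((contDiffOn_chartFlow_sub hs β α).mono fun e he => he.1).contMDiffOn fun e he => he.2

theorem contDiffOn_comp_shiftedGraph (hs : IsSmoothFlow (n := n) φ) {β α : X}
    {Φ : ℝ × X × X → ℂ} (hΦ : ContMDiff 𝓙[n] 𝓘(ℝ, ℂ) ∞ Φ) :
    ContDiffOn ℝ ∞ (fun e => Φ (shiftedGraph (n := n) φ β α e)) (shiftedDomain φ β α) :=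
  (hΦ.comp_contMDiffOn (contMDiffOn_shiftedGraph hs β α)).contDiffOn

theorem contDiff_mul_shiftedGraph (hs : IsSmoothFlow (n := n) φ) {β α : X}
    {Φ : ℝ × X × X → ℂ} (hΦ : ContMDiff 𝓙[n] 𝓘(ℝ, ℂ) ∞ Φ) {w : 𝔼[n] × (ℝ × 𝔼[n]) → ℂ}
    (hw : ContDiff ℝ ∞ w) (hwT : tsupport w ⊆ shiftedDomain φ β α) :
    ContDiff ℝ ∞ (fun e => w e * Φ (shiftedGraph (n := n) φ β α e)) :=
  contDiff_mul_of_tsupport hw fun _ he =>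
    (contDiffOn_comp_shiftedGraph hs hΦ).contDiffAt ((isOpen_shiftedDomain hs β α).mem_nhds (hwT he))

theorem mem_shiftedDomain {β α : X} {t₀ : ℝ} {y₀ : X} (hy₀ : y₀ ∈ (extChartAt (𝓡 n) β).source)
    (hα : φ (-t₀) y₀ ∈ (extChartAt (𝓡 n) α).source) :
    ((0 : 𝔼[n]), (t₀, extChartAt (𝓡 n) β y₀)) ∈ shiftedDomain φ β α := by
  refine ⟨⟨(extChartAt (𝓡 n) β).map_source hy₀, ?_⟩, ?_⟩
  · simp only
    rwa [chartInv_extChartAt hy₀]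
  · simp only [chartFlow, sub_zero]
    rw [chartInv_extChartAt hy₀]
    exact (extChartAt (𝓡 n) α).map_source hα

variable [MeasurableSpace X] {μ : Measure X} (hμ : IsSmoothDensity (n := n) μ) [BorelSpace X]
  [T2Space X] [CompactSpace X] [SecondCountableTopology X] [IsLocallyFiniteMeasure μ]
  {α : X} {χ ψ : X → ℂ}

/-- Near a point of the graph of the flow, the pairing with the mollified kernel is an average
over shifted graphs. -/
theorem exists_mollKernel_representation (hs : IsSmoothFlow (n := n) φ)
    (hχ : IsChartCutoff (n := n) α χ) (hψ : IsChartCutoff (n := n) α ψ) {t₀ : ℝ} {β y₀ : X}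
    (hy₀ : y₀ ∈ (extChartAt (𝓡 n) β).source)
    (hα : φ (-t₀) y₀ ∈ (extChartAt (𝓡 n) α).source) {T : Set (𝔼[n] × (ℝ × 𝔼[n]))}
    (hT : T ∈ 𝓝 ((0 : 𝔼[n]), (t₀, extChartAt (𝓡 n) β y₀))) :
    ∃ w : 𝔼[n] × (ℝ × 𝔼[n]) → ℂ, ContDiff ℝ ∞ w ∧ HasCompactSupport w ∧
      tsupport w ⊆ T ∩ shiftedDomain φ β α ∧ ∃ N ∈ 𝓝 (t₀, y₀, φ (-t₀) y₀),
      (∀ ρ, IsMollifier volume ρ → ∀ᶠ j in atTop, ∀ Φ, IsTest 𝓙[n] univ Φ → tsupport Φ ⊆ N →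
        ∫ q, mollKernel hμ φ α χ ψ (ρ j) q * Φ q ∂(volume.prod (μ.prod μ)) =
          ∫ z, (ρ j z : ℂ) * ∫ d, w (z, d) * Φ (shiftedGraph φ β α (z, d))) ∧
      ∀ Φ, IsTest 𝓙[n] univ Φ → tsupport Φ ⊆ N →
        ∫ d, w (0, d) * Φ (shiftedGraph φ β α (0, d)) =
          ∫ q : ℝ × X, χ (φ (-q.1) q.2) * ψ (φ (-q.1) q.2) *
            Φ (q.1, q.2, φ (-q.1) q.2) ∂(volume.prod μ) := by
  set e₀ : 𝔼[n] × (ℝ × 𝔼[n]) := (0, (t₀, extChartAt (𝓡 n) β y₀)) with he₀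
  have hTo := isOpen_shiftedDomain hs β α
  have he₀T : e₀ ∈ shiftedDomain φ β α := mem_shiftedDomain hy₀ hα
  obtain ⟨c, hc, hc1⟩ := exists_isTest_eq_one (I := 𝓘(ℝ, 𝔼[n] × (ℝ × 𝔼[n])))
    (inter_mem hT (hTo.mem_nhds he₀T))
  have hcT : tsupport c ⊆ shiftedDomain φ β α := hc.2.2.trans inter_subset_right
  -- the amplitude
  set w : 𝔼[n] × (ℝ × 𝔼[n]) → ℂ := fun e => c e * ((chartDensity hμ β e.2.2 : ℂ) *
    (χ (φ (-e.2.1) (chartInv β e.2.2)) * ψ (shiftedGraph φ β α e).2.2)) with hw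
  have hw1 : ContDiff ℝ ∞ w := by
    refine contDiff_mul_of_tsupport hc.1.contDiff fun e he => ?_
    have heT := hTo.mem_nhds (hcT he)
    refine ContDiffAt.mul ?_ (ContDiffAt.mul ?_ ?_)
    · have h1 : ContDiffAt ℝ ∞ (chartDensity hμ β) e.2.2 := (contDiffOn_chartDensity hμ β).contDiffAt
        ((isOpen_extChartAt_target (I := 𝓡 n) β).mem_nhds (hcT he).1.1)
      exact Complex.ofRealCLM.contDiff.contDiffAt.comp e
        (h1.comp e (contDiff_snd.comp contDiff_snd).contDiffAt)
    · have h1 : ContMDiffOn 𝓘(ℝ, 𝔼[n] × (ℝ × 𝔼[n])) 𝓘(ℝ, ℂ) ∞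
          (fun e : 𝔼[n] × (ℝ × 𝔼[n]) => χ (φ (-e.2.1) (chartInv β e.2.2)))
          (shiftedDomain φ β α) :=
        (hχ.smooth.comp_contMDiffOn (hs.contMDiffOn_backward_chartInv β)).comp
          contDiff_snd.contMDiff.contMDiffOn fun e he => he.1.1
      exact h1.contDiffOn.contDiffAt heT
    · exact (contDiffOn_comp_shiftedGraph hs
        (hψ.smooth.comp (contMDiff_snd.comp contMDiff_snd))).contDiffAt heT
  have hwc : tsupport w ⊆ tsupport c :=
    tsupport_comp_eq_subset fun e he => by simp only [hw]; rw [he, zero_mul]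
  have hwcs : HasCompactSupport w := hc.2.1.mul_right
  have hwT : tsupport w ⊆ shiftedDomain φ β α := hwc.trans hcT
  have hw0 : ∀ e ∉ shiftedDomain φ β α, w e = 0 := fun e he =>
    image_eq_zero_of_notMem_tsupport fun h => he (hwT h)
  obtain ⟨r, hr, hrc⟩ := Metric.eventually_nhds_iff.1 hc1
  have hb : Continuous (fun q : ℝ × X × X => φ (-q.1) q.2.1) :=
    hs.contMDiff_backward.continuous.comp
      (continuous_fst.prodMk (continuous_fst.comp continuous_snd))
  set N : Set (ℝ × X × X) := {q | q.2.1 ∈ (extChartAt (𝓡 n) β).source ∧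
    q.2.2 ∈ (extChartAt (𝓡 n) α).source ∧ φ (-q.1) q.2.1 ∈ (extChartAt (𝓡 n) α).source ∧
    dist (q.1, extChartAt (𝓡 n) β q.2.1) (t₀, extChartAt (𝓡 n) β y₀) < r} with hN
  have hNn : N ∈ 𝓝 (t₀, y₀, φ (-t₀) y₀) := by
    have c1 : ContinuousAt (fun q : ℝ × X × X => q.2.1) (t₀, y₀, φ (-t₀) y₀) :=
      (continuous_fst.comp continuous_snd).continuousAt
    have c2 : ContinuousAt (fun q : ℝ × X × X => q.2.2) (t₀, y₀, φ (-t₀) y₀) :=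
      (continuous_snd.comp continuous_snd).continuousAt
    have c3 : ContinuousAt (fun q : ℝ × X × X => (q.1, extChartAt (𝓡 n) β q.2.1))
        (t₀, y₀, φ (-t₀) y₀) :=
      continuousAt_fst.prodMk (ContinuousAt.comp (f := fun q : ℝ × X × X => q.2.1)
        (continuousAt_extChartAt' hy₀) c1)
    exact Filter.Eventually.and (c1 ((isOpen_extChartAt_source β).mem_nhds hy₀))
      (Filter.Eventually.and (c2 ((isOpen_extChartAt_source α).mem_nhds hα))
        (Filter.Eventually.and (hb.continuousAt ((isOpen_extChartAt_source α).mem_nhds hα))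
          (c3 (Metric.ball_mem_nhds _ hr))))
  have hcN : ∀ z d, ‖z‖ < r → dist d (t₀, extChartAt (𝓡 n) β y₀) < r → c (z, d) = 1 := by
    intro z d hz hd
    refine hrc ?_
    rw [Prod.dist_eq, dist_zero_right]
    exact max_lt hz hd
  refine ⟨w, hw1, hwcs, hwc.trans hc.2.2, N, hNn, fun ρ hρ => ?_, fun Φ hΦ hΦN => ?_⟩
  · obtain ⟨J, hJ⟩ := exists_nat_one_div_lt hr
    refine eventually_atTop.2 ⟨J, fun j hj Φ hΦ hΦN => ?_⟩
    have hjr : 1 / ((j : ℝ) + 1) < r := lt_of_le_of_lt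
      (one_div_le_one_div_of_le (by positivity) (by exact_mod_cast Nat.succ_le_succ hj)) hJ
    have hv : IsTest 𝓙[n] univ (fun q => mollKernel hμ φ α χ ψ (ρ j) q * Φ q) :=
      hΦ.mul (contMDiff_mollKernel hμ hs hχ hψ (hρ.smooth j))
    have hvs : ∀ q ∈ tsupport (fun q => mollKernel hμ φ α χ ψ (ρ j) q * Φ q),
        q.2.1 ∈ (extChartAt (𝓡 n) β).source ∧ q.2.2 ∈ (extChartAt (𝓡 n) α).source := fun q hq => by
      have := hΦN ((tsupport_comp_eq_subset fun x hx => by rw [hx, mul_zero]) hq)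
      exact ⟨this.1, this.2.1⟩
    have hF := contDiff_pullChart hμ hv hvs
    have h1 : ∫ q, mollKernel hμ φ α χ ψ (ρ j) q * Φ q ∂(volume.prod (μ.prod μ)) =
        ∫ d, pullChart hμ β α (fun q => mollKernel hμ φ α χ ψ (ρ j) q * Φ q) d := by
      refine integral_chart_time_pair hμ β α hv.continuous.stronglyMeasurable fun q hq => ?_
      refine image_eq_zero_of_notMem_tsupport
        (f := fun q => mollKernel hμ φ α χ ψ (ρ j) q * Φ q) fun h => ?_
      rcases hq with hq | hq
      · exact hq (hvs q h).1
      · exact hq (hvs q h).2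
    have h2 : ∫ d, pullChart hμ β α (fun q => mollKernel hμ φ α χ ψ (ρ j) q * Φ q) d =
        ∫ d : ℝ × 𝔼[n], ∫ v : 𝔼[n],
          pullChart hμ β α (fun q => mollKernel hμ φ α χ ψ (ρ j) q * Φ q) (d.1, d.2, v) := by
      have hm := measurePreserving_prodAssoc (volume : Measure ℝ) (volume : Measure 𝔼[n])
        (volume : Measure 𝔼[n])
      have hi : Integrable (pullChart hμ β α (fun q => mollKernel hμ φ α χ ψ (ρ j) q * Φ q))
        (volume.prod (volume.prod volume)) := hF.1.continuous.integrable_of_hasCompactSupport hF.2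
      have h3 := hm.integral_comp' (g := pullChart hμ β α
        (fun q => mollKernel hμ φ α χ ψ (ρ j) q * Φ q))
      refine h3.symm.trans ?_
      exact integral_prod _ ((hm.integrable_comp_emb MeasurableEquiv.prodAssoc.measurableEmbedding).2
        hi)
    -- After the substitution `v = chartFlow φ β α d - z` the mollifier is just `ρ j z`, and the
    -- density at `v` cancels its inverse in `mollKernel`. Wherever the integrand is nonzero the
    -- cutoff `c` equals 1: on `N` for the graph variable, and for `z` because `1 / (j + 1) < r`.
    have h3 : ∀ (d : ℝ × 𝔼[n]) (z : 𝔼[n]),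
        pullChart hμ β α (fun q => mollKernel hμ φ α χ ψ (ρ j) q * Φ q)
          (d.1, d.2, chartFlow φ β α d - z) =
        (ρ j z : ℂ) * (w (z, d) * Φ (shiftedGraph φ β α (z, d))) := by
      intro d z
      by_cases hz : chartFlow φ β α d - z ∈ (extChartAt (𝓡 n) α).target
      swap
      · rw [hw0 (z, d) fun h => hz h.2, pullChart]
        simp [chartDensity_of_notMem hμ hz]
      by_cases hd : d.2 ∈ (extChartAt (𝓡 n) β).target
      swap
      · rw [hw0 (z, d) fun h => hd h.1.1, pullChart]
        simp [chartDensity_of_notMem hμ hd]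
      have hq : shiftedGraph φ β α (z, d) =
        (d.1, chartInv β d.2, chartInv α (chartFlow φ β α d - z)) := rfl
      rw [pullChart]
      simp only
      rw [← hq]
      by_cases hΦ0 : Φ (shiftedGraph φ β α (z, d)) = 0
      · rw [hΦ0]; simp
      obtain ⟨-, hN2, hN3, hN4⟩ : shiftedGraph φ β α (z, d) ∈ N := hΦN (subset_tsupport _ hΦ0)
      have hN4' : dist d (t₀, extChartAt (𝓡 n) β y₀) < r := by
        rw [hq] at hN4
        simp only at hN4
        rwa [extChartAt_chartInv hd] at hN4
      have hmoll : mollKernel hμ φ α χ ψ (ρ j) (shiftedGraph φ β α (z, d)) =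
          ((ρ j z * (chartDensity hμ α (chartFlow φ β α d - z))⁻¹ : ℝ) : ℂ) *
          (χ (φ (-d.1) (chartInv β d.2)) * ψ (shiftedGraph φ β α (z, d)).2.2) := by
        rw [mollKernel, hq]
        simp only
        rw [extChartAt_chartInv hz]
        congr 4
        rw [show extChartAt (𝓡 n) α (φ (-d.1) (chartInv β d.2)) = chartFlow φ β α d from rfl,
          sub_sub_cancel]
      rw [hmoll]
      have hdens : ((chartDensity hμ α (chartFlow φ β α d - z) : ℝ) : ℂ) ≠ 0 := by
        exact_mod_cast (chartDensity_pos hμ hz).ne'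
      by_cases hzr : ‖z‖ < r
      · rw [hw]
        simp only
        rw [hcN z d hzr hN4']
        push_cast
        field_simp
      · rw [hρ.eq_zero j z (hjr.le.trans (not_lt.1 hzr))]
        simp
    rw [h1, h2]
    have h4 : ∀ d : ℝ × 𝔼[n], ∫ v : 𝔼[n],
          pullChart hμ β α (fun q => mollKernel hμ φ α χ ψ (ρ j) q * Φ q) (d.1, d.2, v) =
        ∫ z, (ρ j z : ℂ) * (w (z, d) * Φ (shiftedGraph φ β α (z, d))) := by
      intro d
      rw [← integral_sub_left_eq_self (fun v => pullChart hμ β α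
        (fun q => mollKernel hμ φ α χ ψ (ρ j) q * Φ q) (d.1, d.2, v)) volume (chartFlow φ β α d)]
      simp_rw [h3 d]
    simp_rw [h4]
    have hwΦ := contDiff_mul_shiftedGraph hs hΦ.1 hw1 hwT
    rw [integral_integral_swap]
    · simp_rw [integral_const_mul]
    · refine Continuous.integrable_of_hasCompactSupport ?_ ?_
      · exact (Complex.continuous_ofReal.comp ((hρ.smooth j).continuous.comp continuous_snd)).mul
          (hwΦ.continuous.comp continuous_swap)
      · have h5 : HasCompactSupport fun e => w e * Φ (shiftedGraph φ β α e) := hwcs.mul_right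
        exact (h5.comp_homeomorph (Homeomorph.prodComm _ _)).mul_left
  · have hg : IsTest 𝓘₁[n] univ (fun q : ℝ × X => χ (φ (-q.1) q.2) * ψ (φ (-q.1) q.2) *
        Φ (q.1, q.2, φ (-q.1) q.2)) := by
      have hgr : ContMDiff 𝓘₁[n] 𝓙[n] ∞ (fun q : ℝ × X => (q.1, q.2, φ (-q.1) q.2)) :=
        contMDiff_fst.prodMk (contMDiff_snd.prodMk hs.contMDiff_backward)
      refine ⟨fun q => contMDiffAt_mul (contMDiffAt_mul
        ((hχ.smooth.comp hs.contMDiff_backward) q) ((hψ.smooth.comp hs.contMDiff_backward) q))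
        ((hΦ.1.comp hgr) q), ?_, subset_univ _⟩
      refine HasCompactSupport.intro (K := (Prod.fst '' tsupport Φ) ×ˢ univ)
        ((hΦ.2.1.isCompact.image continuous_fst).prod isCompact_univ) fun q hq => ?_
      rw [show Φ (q.1, q.2, φ (-q.1) q.2) = 0 from ?_, mul_zero]
      exact image_eq_zero_of_notMem_tsupport fun h => hq ⟨⟨_, h, rfl⟩, mem_univ _⟩
    rw [integral_chart_time hμ β hg.continuous.stronglyMeasurable]
    · refine integral_congr_ae (ae_of_all _ fun d => ?_)
      simp only
      by_cases hd : d.2 ∈ (extChartAt (𝓡 n) β).target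
      swap
      · rw [hw0 (0, d) fun h => hd h.1.1, chartDensity_of_notMem hμ hd]
        simp
      by_cases hx : φ (-d.1) (chartInv β d.2) ∈ (extChartAt (𝓡 n) α).source
      swap
      · rw [hw0 (0, d) fun h => hx h.1.2,
          show χ (φ (-d.1) (chartInv β d.2)) = 0 from
            image_eq_zero_of_notMem_tsupport fun h => hx (hχ.supp h)]
        simp
      have hq : shiftedGraph φ β α (0, d) =
          (d.1, chartInv β d.2, φ (-d.1) (chartInv β d.2)) := by
        rw [shiftedGraph]
        simp only [sub_zero, chartFlow]
        rw [chartInv_extChartAt hx]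
      by_cases hΦ0 : Φ (shiftedGraph φ β α (0, d)) = 0
      · rw [hΦ0, mul_zero]
        rw [hq] at hΦ0
        rw [hΦ0]
        simp
      obtain ⟨-, hN2, hN3, hN4⟩ : shiftedGraph φ β α (0, d) ∈ N := hΦN (subset_tsupport _ hΦ0)
      have hN4' : dist d (t₀, extChartAt (𝓡 n) β y₀) < r := by
        rw [hq] at hN4
        simp only at hN4
        rwa [extChartAt_chartInv hd] at hN4
      rw [hw]
      simp only
      rw [hcN 0 d (by rwa [norm_zero]) hN4', hq]
      ring
    · intro q hq
      rw [show Φ (q.1, q.2, φ (-q.1) q.2) = 0 from ?_, mul_zero]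
      exact image_eq_zero_of_notMem_tsupport fun h => hq (hΦN h).1

end MollifiedChart

end Guillemin

end

/-! ### Limits and uniform microlocal smoothness of the mollified kernel. -/

noncomputable section

namespace Guillemin

set_option linter.unusedSectionVars false

local notation "𝔼[" n "]" => EuclideanSpace ℝ (Fin n)
local notation "𝓙[" n "]" => ModelWithCorners.prod 𝓘(ℝ, ℝ) (ModelWithCorners.prod (𝓡 n) (𝓡 n))
local notation "𝓘₁[" n "]" => ModelWithCorners.prod 𝓘(ℝ, ℝ) (𝓡 n)

section MollifiedLimits

variable {n : ℕ} {X : Type*} [TopologicalSpace X] [ChartedSpace 𝔼[n] X] [IsManifold (𝓡 n) ∞ X]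
  {φ : ℝ → X → X}

theorem contMDiffOn_extChartAt_source (p : ℝ × X × X) :
    ContMDiffOn 𝓙[n] 𝓘(ℝ, ℝ × 𝔼[n] × 𝔼[n]) ∞ (extChartAt 𝓙[n] p) (extChartAt 𝓙[n] p).source := by
  rw [extChartAt_source]
  exact contMDiffOn_extChartAt

theorem isTest_mul_exp {O : Set (ℝ × X × X)} {Φ : ℝ × X × X → ℂ} {p : ℝ × X × X}
    (hΦ : IsTest 𝓙[n] O Φ) (hs : tsupport Φ ⊆ (extChartAt 𝓙[n] p).source)
    (η : (ℝ × 𝔼[n] × 𝔼[n]) →L[ℝ] ℝ) :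
    IsTest 𝓙[n] O (fun q => Φ q * Complex.exp (-Complex.I * (η (extChartAt 𝓙[n] p q) : ℂ))) := by
  have h3 : ContDiff ℝ ∞ (fun d => Complex.exp (-Complex.I * (η d : ℂ))) :=
    Complex.contDiff_exp.comp
      (contDiff_const.mul (Complex.ofRealCLM.contDiff.comp η.contDiff))
  have h2 := hΦ.mul_left (isOpen_extChartAt_source p) hs
    (h3.contMDiff.comp_contMDiffOn (contMDiffOn_extChartAt_source p))
  simpa only [mul_comm, Function.comp] using h2

variable [MeasurableSpace X] {μ : Measure X} (hμ : IsSmoothDensity (n := n) μ) [BorelSpace X]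
  [T2Space X] [CompactSpace X] [SecondCountableTopology X] [IsLocallyFiniteMeasure μ]
  {α : X} {χ ψ : X → ℂ} {ρ : ℕ → 𝔼[n] → ℝ}

/-- Near the graph, the integral over the graph shifted by `z` is continuous in `z`, and the
mollifier evaluates it at `z = 0`. Near other points, and outside the chart, both sides vanish in
the end. -/
theorem exists_tendsto_mollKernel (hs : IsSmoothFlow (n := n) φ)
    (hχ : IsChartCutoff (n := n) α χ) (hψ : IsChartCutoff (n := n) α ψ)
    (hρ : IsMollifier volume ρ) (p : ℝ × X × X) :
    ∃ N ∈ 𝓝 p, ∀ Φ, IsTest 𝓙[n] univ Φ → tsupport Φ ⊆ N →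
      Tendsto (fun j => ∫ q, mollKernel hμ φ α χ ψ (ρ j) q * Φ q ∂(volume.prod (μ.prod μ))) atTop
        (𝓝 (∫ q : ℝ × X, χ (φ (-q.1) q.2) * ψ (φ (-q.1) q.2) *
            Φ (q.1, q.2, φ (-q.1) q.2) ∂(volume.prod μ))) := by
  by_cases hp : φ (-p.1) p.2.1 = p.2.2 ∧ p.2.2 ∈ (extChartAt (𝓡 n) α).source
  · obtain ⟨t, y, x⟩ := p
    obtain ⟨hp1, hx⟩ := hp
    simp only at hp1 hx
    subst hp1
    obtain ⟨w, hw, hwc, hwT, N, hN, h1, h2⟩ := exists_mollKernel_representation hμ hs hχ hψ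
      (mem_extChartAt_source (I := 𝓡 n) y) hx univ_mem
    refine ⟨N, hN, fun Φ hΦ hΦN => ?_⟩
    rw [← h2 Φ hΦ hΦN]
    have hwΦ := contDiff_mul_shiftedGraph hs hΦ.1 hw (hwT.trans inter_subset_right)
    have hK : IsCompact (Prod.snd '' tsupport w) := hwc.isCompact.image continuous_snd
    have h3 : ∀ z, ∫ d, w (z, d) * Φ (shiftedGraph φ y α (z, d)) =
        ∫ d in Prod.snd '' tsupport w, w (z, d) * Φ (shiftedGraph φ y α (z, d)) := fun z =>
      (setIntegral_eq_integral_of_forall_compl_eq_zero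
        (f := fun d => w (z, d) * Φ (shiftedGraph φ y α (z, d))) fun d hd => by
          rw [image_eq_zero_of_notMem_tsupport fun h => hd
            (⟨(z, d), h, rfl⟩ : d ∈ Prod.snd '' tsupport w), zero_mul]).symm
    have hc : Continuous fun z => ∫ d, w (z, d) * Φ (shiftedGraph φ y α (z, d)) := by
      simp_rw [h3]
      exact continuous_parametric_integral_of_continuous
        (f := fun z d => w (z, d) * Φ (shiftedGraph φ y α (z, d))) hwΦ.continuous hK
    exact (hρ.tendsto_integral hc).congr'
      ((h1 ρ hρ).mono fun j hj => (hj Φ hΦ hΦN).symm)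
  · obtain ⟨N, hN, hj⟩ := eventually_mollKernel_eq_zero hμ hs hχ hψ hρ hp
    have hb : Continuous (fun q : ℝ × X × X => φ (-q.1) q.2.1) :=
      hs.contMDiff_backward.continuous.comp
        (continuous_fst.prodMk (continuous_fst.comp continuous_snd))
    have h2 : Continuous (fun q : ℝ × X × X => q.2.2) := continuous_snd.comp continuous_snd
    have hN' : {q : ℝ × X × X | ¬(φ (-q.1) q.2.1 = q.2.2 ∧ q.2.2 ∈ tsupport ψ)} ∈ 𝓝 p := by
      refine IsOpen.mem_nhds ?_ fun h => hp ⟨h.1, hψ.supp h.2⟩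
      exact (((isClosed_eq hb h2).inter ((isClosed_tsupport ψ).preimage h2)).isOpen_compl)
    refine ⟨N ∩ _, inter_mem hN hN', fun Φ hΦ hΦN => ?_⟩
    have h3 : ∫ q : ℝ × X, χ (φ (-q.1) q.2) * ψ (φ (-q.1) q.2) *
        Φ (q.1, q.2, φ (-q.1) q.2) ∂(volume.prod μ) = 0 := by
      refine integral_eq_zero_of_ae (ae_of_all _ fun q => ?_)
      by_cases h0 : Φ (q.1, q.2, φ (-q.1) q.2) = 0
      · simp [h0]
      · have h4 := (hΦN (subset_tsupport _ h0)).2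
        have h5 : ψ (φ (-q.1) q.2) = 0 :=
          image_eq_zero_of_notMem_tsupport fun h => h4 ⟨rfl, h⟩
        simp [h5]
    rw [h3]
    refine tendsto_const_nhds.congr' (hj.mono fun j hj => ?_)
    refine (integral_eq_zero_of_ae (ae_of_all _ fun q => ?_)).symm
    by_cases h0 : Φ q = 0
    · simp [h0]
    · simp [hj q (hΦN (subset_tsupport _ h0)).1]

/-- At a closed trajectory, the phase of the mollified kernel is nonstationary at the normals of
the diagonal. -/
theorem IsAnosov.exists_nonstationary_phase {Es Eu : ∀ x : X, Submodule ℝ (TangentSpace (𝓡 n) x)}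
    (h : IsAnosov φ Es Eu) {t₀ : ℝ} {x₀ : X} (ht₀ : t₀ ≠ 0)
    (hfix : φ (-t₀) x₀ = x₀) (hα : x₀ ∈ (extChartAt (𝓡 n) α).source)
    {ζ : (ℝ × 𝔼[n] × 𝔼[n]) →L[ℝ] ℝ} (hζ0 : ζ ≠ 0) (hζ : ζ.comp (diagLin n) = 0) :
    ∃ e : ℝ × 𝔼[n], ∃ W ∈ 𝓝 ζ, ∃ T ∈ 𝓝 ((0 : 𝔼[n]), (t₀, extChartAt (𝓡 n) x₀ x₀)),
      ∀ η ∈ W, ∀ z d, (z, d) ∈ T →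
        ContDiffAt ℝ ∞ (fun b : (((ℝ × 𝔼[n] × 𝔼[n]) →L[ℝ] ℝ) × 𝔼[n]) × (ℝ × 𝔼[n]) =>
          b.1.1 (extChartAt 𝓙[n] (t₀, x₀, x₀) (shiftedGraph φ x₀ α (b.1.2, b.2)))) ((η, z), d) ∧
        fderiv ℝ (fun b : (((ℝ × 𝔼[n] × 𝔼[n]) →L[ℝ] ℝ) × 𝔼[n]) × (ℝ × 𝔼[n]) =>
          b.1.1 (extChartAt 𝓙[n] (t₀, x₀, x₀) (shiftedGraph φ x₀ α (b.1.2, b.2)))) ((η, z), d)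
          (0, e) ≠ 0 := by
  have hs := h.toIsSmoothFlow
  set ph : (((ℝ × 𝔼[n] × 𝔼[n]) →L[ℝ] ℝ) × 𝔼[n]) × (ℝ × 𝔼[n]) → ℝ := fun b =>
    b.1.1 (extChartAt 𝓙[n] (t₀, x₀, x₀) (shiftedGraph φ x₀ α (b.1.2, b.2))) with hph
  have hx₀ := mem_extChartAt_source (I := 𝓡 n) x₀
  set d₀ : ℝ × 𝔼[n] := (t₀, extChartAt (𝓡 n) x₀ x₀) with hd₀
  have hfix' : φ t₀ x₀ = x₀ := hs.neg_period_iff.1 hfix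
  have he₀ : ((0 : 𝔼[n]), d₀) ∈ shiftedDomain φ x₀ α := mem_shiftedDomain hx₀ (by rwa [hfix])
  -- the map into the chart
  set T₁ : Set (𝔼[n] × (ℝ × 𝔼[n])) := shiftedDomain φ x₀ α ∩
    shiftedGraph φ x₀ α ⁻¹' (extChartAt 𝓙[n] (t₀, x₀, x₀)).source with hT₁
  have hT₁o : IsOpen T₁ := (contMDiffOn_shiftedGraph hs x₀ α).continuousOn.isOpen_inter_preimage
    (isOpen_shiftedDomain hs x₀ α) (isOpen_extChartAt_source _)
  have hG0 : shiftedGraph φ x₀ α (0, d₀) = (t₀, x₀, x₀) := by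
    rw [shiftedGraph]
    simp only [sub_zero, chartFlow, hd₀]
    rw [chartInv_extChartAt hx₀, hfix, chartInv_extChartAt hα]
  have he₀T₁ : ((0 : 𝔼[n]), d₀) ∈ T₁ := ⟨he₀, by
    rw [mem_preimage, hG0]
    exact mem_extChartAt_source (t₀, x₀, x₀)⟩
  have hG : ContDiffOn ℝ ∞ (fun e => extChartAt 𝓙[n] (t₀, x₀, x₀) (shiftedGraph φ x₀ α e)) T₁ :=
    ((contMDiffOn_extChartAt_source (t₀, x₀, x₀)).comp
      ((contMDiffOn_shiftedGraph hs x₀ α).mono inter_subset_left) fun e he => he.2).contDiffOn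
  have hphs : ∀ η z d, (z, d) ∈ T₁ → ContDiffAt ℝ ∞ ph ((η, z), d) := by
    intro η z d hzd
    have h1 : ContDiffAt ℝ ∞ (fun b : (((ℝ × 𝔼[n] × 𝔼[n]) →L[ℝ] ℝ) × 𝔼[n]) × (ℝ × 𝔼[n]) =>
        extChartAt 𝓙[n] (t₀, x₀, x₀) (shiftedGraph φ x₀ α (b.1.2, b.2))) ((η, z), d) :=
      ContDiffAt.comp (g := fun e => extChartAt 𝓙[n] (t₀, x₀, x₀) (shiftedGraph φ x₀ α e))
        (f := fun b : (((ℝ × 𝔼[n] × 𝔼[n]) →L[ℝ] ℝ) × 𝔼[n]) × (ℝ × 𝔼[n]) => (b.1.2, b.2))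
        ((η, z), d) (hG.contDiffAt (hT₁o.mem_nhds hzd))
        ((contDiff_snd.comp contDiff_fst).prodMk contDiff_snd).contDiffAt
    exact (contDiff_fst.comp contDiff_fst).contDiffAt.clm_apply h1
  -- the derivative at the base point
  obtain ⟨A, hA, hA'⟩ := exists_hasMFDerivAt_extChartAt hx₀
  set ξ : 𝔼[n] →L[ℝ] ℝ := ζ.comp ((ContinuousLinearMap.inr ℝ ℝ (𝔼[n] × 𝔼[n])).comp
    (ContinuousLinearMap.inr ℝ 𝔼[n] 𝔼[n])) with hξ
  -- Annihilating the directions `(τ, v, v)` leaves a covector `(0, -ξ, ξ)`.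
  have hζξ : ∀ τ v w, ζ (τ, v, w) = ξ (w - v) := by
    intro τ v w
    have h1 : ζ (τ, v, v) = 0 := DFunLike.congr_fun hζ (τ, v)
    have h2 : ((τ, v, w) : ℝ × 𝔼[n] × 𝔼[n]) = (τ, v, v) + (0, 0, w - v) := by simp
    rw [h2, map_add, h1, zero_add]
    rfl
  have hξ0 : ξ.toLinearMap ∘ₗ A.toLinearEquiv.toLinearMap ≠ 0 := by
    intro h0
    refine hζ0 (ContinuousLinearMap.ext fun v => ?_)
    obtain ⟨τ, v, w⟩ := v
    rw [hζξ]
    have := DFunLike.congr_fun h0 (A.symm (w - v))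
    simpa using this
  -- Hyperbolicity enters here: as `I - P` is invertible, some direction `(τ, u)` moves the phase.
  obtain ⟨τ, u, hτu⟩ := exists_transversal_ne_zero (h.isCompl_fib x₀)
    (R := (dflow φ (-t₀) x₀).toLinearMap) (h.dflow_mem_sup_fixed hfix)
    (by
      have := h.absDet_pos ht₀ hfix'
      rw [h.absDet_eq, abs_pos] at this
      exact this) hξ0
  have hcf := hs.hasFDerivAt_chartFlow hx₀ hfix hA hA'
  have hder : fderiv ℝ ph ((ζ, 0), d₀) (0, (τ, A u)) ≠ 0 := by
    have h1 := ((hphs ζ 0 d₀ he₀T₁).differentiableAt (by simp)).hasFDerivAt.comp d₀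
      (hasFDerivAt_prodMk_right (𝕜 := ℝ) ((ζ, (0 : 𝔼[n])) :
        ((ℝ × 𝔼[n] × 𝔼[n]) →L[ℝ] ℝ) × 𝔼[n]) d₀)
    -- On the unshifted graph the phase is `ξ` applied to the displacement `φ_{-t} z - z`, whose
    -- derivative is known. The nonvanishing then extends to nearby covectors, shifts and points by
    -- continuity.
    have h2 : ph ∘ (fun d => ((ζ, (0 : 𝔼[n])), d)) =ᶠ[𝓝 d₀]
        fun d => ξ (chartFlow φ x₀ x₀ d - d.2) := by
      have h3 : ∀ᶠ d in 𝓝 d₀, ((0 : 𝔼[n]), d) ∈ T₁ :=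
        (Continuous.continuousAt (by fun_prop : Continuous fun d : ℝ × 𝔼[n] =>
          ((0 : 𝔼[n]), d))).preimage_mem_nhds (hT₁o.mem_nhds he₀T₁)
      filter_upwards [h3] with d hd
      simp only [Function.comp, hph]
      rw [extChartAt_triple_apply, hζξ, shiftedGraph]
      simp only [sub_zero, chartFlow]
      rw [chartInv_extChartAt hd.1.1.2, extChartAt_chartInv hd.1.1.1]
    have h4 := (ξ.hasFDerivAt (x := chartFlow φ x₀ x₀ d₀ - d₀.2)).comp d₀
      (hcf.sub (hasFDerivAt_snd (𝕜 := ℝ) (p := d₀)))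
    have h5 := DFunLike.congr_fun (h1.unique (h4.congr_of_eventuallyEq h2)) (τ, A u)
    have h6 : fderiv ℝ ph ((ζ, 0), d₀) (0, (τ, A u)) =
        ξ (A (-(τ • gen φ x₀) + dflow φ (-t₀) x₀ (A.symm (A u))) - A u) := h5
    rw [h6]
    intro h7
    apply hτu
    show ξ (A u) - ξ (A (-τ • gen φ x₀ + dflow φ (-t₀) x₀ u)) = 0
    rw [A.symm_apply_apply, map_sub] at h7
    rw [neg_smul, ← neg_sub, h7, neg_zero]
  have hev : ∀ᶠ b in 𝓝 (((ζ, 0), d₀) :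
      (((ℝ × 𝔼[n] × 𝔼[n]) →L[ℝ] ℝ) × 𝔼[n]) × (ℝ × 𝔼[n])),
      (b.1.2, b.2) ∈ T₁ ∧ fderiv ℝ ph b (0, (τ, A u)) ≠ 0 := by
    refine Filter.Eventually.and ?_ ?_
    · exact (Continuous.continuousAt (by fun_prop : Continuous fun b :
        (((ℝ × 𝔼[n] × 𝔼[n]) →L[ℝ] ℝ) × 𝔼[n]) × (ℝ × 𝔼[n]) =>
          (b.1.2, b.2))).preimage_mem_nhds (hT₁o.mem_nhds he₀T₁)
    · exact (((hphs ζ 0 d₀ he₀T₁).continuousAt_fderiv (by simp)).clm_apply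
        continuousAt_const).eventually_ne hder
  have hcont : ContinuousAt (fun b : ((ℝ × 𝔼[n] × 𝔼[n]) →L[ℝ] ℝ) × (𝔼[n] × (ℝ × 𝔼[n])) =>
      (((b.1, b.2.1), b.2.2) : (((ℝ × 𝔼[n] × 𝔼[n]) →L[ℝ] ℝ) × 𝔼[n]) × (ℝ × 𝔼[n])))
      (ζ, (0, d₀)) := Continuous.continuousAt (by fun_prop)
  obtain ⟨W, hW, T, hT, hWT⟩ := mem_nhds_prod_iff.1 (hcont.eventually hev)
  refine ⟨(τ, A u), W, hW, T, hT, fun η hη z d hzd => ?_⟩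
  have := hWT (⟨hη, hzd⟩ : ((η, (z, d)) : _ × _) ∈ W ×ˢ T)
  exact ⟨hphs η z d this.1, this.2⟩

/-- The mollified kernels are uniformly microlocally smooth at the normals of the diagonal. -/
theorem IsAnosov.exists_mollKernel_decay {Es Eu : ∀ x : X, Submodule ℝ (TangentSpace (𝓡 n) x)}
    (h : IsAnosov φ Es Eu)
    (hχ : IsChartCutoff (n := n) α χ) (hψ : IsChartCutoff (n := n) α ψ)
    (hρ : IsMollifier volume ρ) {t₀ : ℝ} {x₀ : X} (ht₀ : t₀ ≠ 0)
    {ζ : (ℝ × 𝔼[n] × 𝔼[n]) →L[ℝ] ℝ} (hζ0 : ζ ≠ 0) (hζ : ζ.comp (diagLin n) = 0) :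
    ∃ N ∈ 𝓝 (t₀, x₀, x₀), ∃ W ∈ 𝓝 ζ, ∀ Φ, IsTest 𝓙[n] univ Φ → tsupport Φ ⊆ N →
      tsupport Φ ⊆ (extChartAt 𝓙[n] (t₀, x₀, x₀)).source → ∀ M : ℕ, ∃ C : ℝ, ∀ᶠ j in atTop,
      ∀ η ∈ W, ∀ s : ℝ, 1 ≤ s → s ^ M * ‖localFourier 𝓙[n] (fun Φ =>
        ∫ q, mollKernel hμ φ α χ ψ (ρ j) q * Φ q ∂(volume.prod (μ.prod μ))) Φ (t₀, x₀, x₀)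
          (s • η)‖ ≤ C := by
  have hs := h.toIsSmoothFlow
  by_cases hp : φ (-t₀) x₀ = x₀ ∧ x₀ ∈ (extChartAt (𝓡 n) α).source
  swap
  · obtain ⟨N, hN, hj⟩ := eventually_mollKernel_eq_zero hμ hs hχ hψ hρ (p := (t₀, x₀, x₀)) hp
    refine ⟨N, hN, univ, univ_mem, fun Φ hΦ hΦN _ M => ⟨0, hj.mono fun j hj η _ s _ => ?_⟩⟩
    have h1 : localFourier 𝓙[n] (fun Φ =>
        ∫ q, mollKernel hμ φ α χ ψ (ρ j) q * Φ q ∂(volume.prod (μ.prod μ))) Φ (t₀, x₀, x₀)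
          (s • η) = 0 := by
      refine integral_eq_zero_of_ae (ae_of_all _ fun q => ?_)
      by_cases h0 : Φ q = 0
      · simp [h0]
      · simp [hj q (hΦN (subset_tsupport _ h0))]
    rw [h1, norm_zero, mul_zero]
  obtain ⟨hfix, hα⟩ := hp
  obtain ⟨e, W, hW, T, hT, hWT⟩ := h.exists_nonstationary_phase ht₀ hfix hα hζ0 hζ
  obtain ⟨w, hw, hwc, hwT, N, hN, h1, -⟩ := exists_mollKernel_representation hμ hs hχ hψ
    (mem_extChartAt_source (I := 𝓡 n) x₀) (by rwa [hfix]) hT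
  rw [hfix] at hN
  obtain ⟨Ψ, hΨ, hΨ1⟩ := exists_isTest_eq_one (I := 𝓘(ℝ, (ℝ × 𝔼[n] × 𝔼[n]) →L[ℝ] ℝ)) hW
  refine ⟨N, hN, {η | Ψ η = 1}, hΨ1, fun Φ hΦ hΦN hΦs M => ?_⟩
  have hwΦ := contDiff_mul_shiftedGraph hs hΦ.1 hw (hwT.trans inter_subset_right)
  -- The covector and the shift `z` are both parameters of one amplitude, cut off by `Ψ` so as to
  -- have compact support. The resulting bound is uniform in `z`, so averaging against `ρ j`
  -- preserves it, uniformly in `j`.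
  set A : (((ℝ × 𝔼[n] × 𝔼[n]) →L[ℝ] ℝ) × 𝔼[n]) × (ℝ × 𝔼[n]) → ℂ := fun b =>
    Ψ b.1.1 * (w (b.1.2, b.2) * Φ (shiftedGraph φ x₀ α (b.1.2, b.2))) with hA
  have hA1 : ContDiff ℝ ∞ A :=
    (hΨ.1.contDiff.comp (contDiff_fst.comp contDiff_fst)).mul
      (hwΦ.comp ((contDiff_snd.comp contDiff_fst).prodMk contDiff_snd))
  have hAs : ∀ b, A b ≠ 0 → b.1.1 ∈ tsupport Ψ ∧ (b.1.2, b.2) ∈ tsupport w := fun b hb =>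
    ⟨subset_tsupport _ (left_ne_zero_of_mul hb),
      subset_tsupport _ (left_ne_zero_of_mul (right_ne_zero_of_mul hb))⟩
  have hKc : IsClosed {b : (((ℝ × 𝔼[n] × 𝔼[n]) →L[ℝ] ℝ) × 𝔼[n]) × (ℝ × 𝔼[n]) |
      b.1.1 ∈ tsupport Ψ ∧ (b.1.2, b.2) ∈ tsupport w} :=
    ((isClosed_tsupport Ψ).preimage (continuous_fst.comp continuous_fst)).inter
      ((isClosed_tsupport w).preimage (by fun_prop :
        Continuous fun b : (((ℝ × 𝔼[n] × 𝔼[n]) →L[ℝ] ℝ) × 𝔼[n]) × (ℝ × 𝔼[n]) => (b.1.2, b.2)))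
  have hAt : ∀ b ∈ tsupport A, b.1.1 ∈ tsupport Ψ ∧ (b.1.2, b.2) ∈ tsupport w := fun b hb =>
    closure_minimal hAs hKc hb
  have hA2 : HasCompactSupport A := by
    have hK : IsCompact ((fun b : ((ℝ × 𝔼[n] × 𝔼[n]) →L[ℝ] ℝ) × (𝔼[n] × (ℝ × 𝔼[n])) =>
        (((b.1, b.2.1), b.2.2) : (((ℝ × 𝔼[n] × 𝔼[n]) →L[ℝ] ℝ) × 𝔼[n]) × (ℝ × 𝔼[n]))) ''
        (tsupport Ψ ×ˢ tsupport w)) := (hΨ.2.1.isCompact.prod hwc.isCompact).image (by fun_prop)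
    refine HasCompactSupport.intro hK fun b hb => ?_
    by_contra h0
    exact hb ⟨(b.1.1, (b.1.2, b.2)), ⟨(hAs b h0).1, (hAs b h0).2⟩, rfl⟩
  obtain ⟨C, hC⟩ := exists_nonstationary_bound volume
    (fun b : (((ℝ × 𝔼[n] × 𝔼[n]) →L[ℝ] ℝ) × 𝔼[n]) × (ℝ × 𝔼[n]) =>
      b.1.1 (extChartAt 𝓙[n] (t₀, x₀, x₀) (shiftedGraph φ x₀ α (b.1.2, b.2)))) e M A hA1 hA2
    fun b hb => hWT b.1.1 (hΨ.2.2 (hAt b hb).1) b.1.2 b.2 (hwT (hAt b hb).2).1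
  refine ⟨C, (h1 ρ hρ).mono fun j hj η hη s hs1 => ?_⟩
  have hs0 : (0 : ℝ) < s ^ M := pow_pos (by linarith) M
  rw [← le_div_iff₀' hs0]
  have h2 := hj _ (isTest_mul_exp hΦ hΦs (s • η))
    ((tsupport_comp_eq_subset fun x hx => by rw [hx, zero_mul]).trans hΦN)
  rw [localFourier, h2]
  refine hρ.norm_integral_le j fun z _ => ?_
  rw [le_div_iff₀' hs0]
  refine le_trans (le_of_eq ?_) (hC (η, z) s hs1)
  congr 2
  refine integral_congr_ae (ae_of_all _ fun d => ?_)
  simp only [hA]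
  rw [show Ψ η = 1 from hη, one_mul, mul_assoc]
  simp

end MollifiedLimits

end Guillemin

end

/-! ### Graph kernels with coefficients and their approximation off the normals. -/

noncomputable section

namespace Guillemin

set_option linter.unusedSectionVars false

local notation "𝔼[" n "]" => EuclideanSpace ℝ (Fin n)
local notation "𝓙[" n "]" => ModelWithCorners.prod 𝓘(ℝ, ℝ) (ModelWithCorners.prod (𝓡 n) (𝓡 n))
local notation "𝓘₁[" n "]" => ModelWithCorners.prod 𝓘(ℝ, ℝ) (𝓡 n)

section Exhaustion

variable {n : ℕ} {X : Type*} [TopologicalSpace X] [ChartedSpace 𝔼[n] X] [IsManifold (𝓡 n) ∞ X]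

/-- The smooth functions `b j` are eventually equal to `a`, locally uniformly on `G`. -/
structure IsExhaustion (G : Set (ℝ × X)) (a : ℝ × X → ℂ) (b : ℕ → ℝ × X → ℂ) : Prop where
  smooth : ∀ j, ContMDiff 𝓘₁[n] 𝓘(ℝ, ℂ) ∞ (b j)
  eventually_eq : ∀ p ∈ G, ∃ N ∈ 𝓝 p, ∀ᶠ j in atTop, ∀ q ∈ N, b j q = a q

/-- With `h ≥ 0` nonzero exactly on `G`, the cutoff is 0 for `h ≤ 1/j` and 1 for `h ≥ 2/j`.
Coefficients of forms are smooth only where `y` and `φ_{-t}(y)` both lie in the frame domain,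
whereas the approximating kernels must be smooth everywhere over it. -/
theorem exists_isExhaustion [T2Space X] [CompactSpace X] {G : Set (ℝ × X)} (hG : IsOpen G)
    {a : ℝ × X → ℂ} (ha : ContMDiffOn 𝓘₁[n] 𝓘(ℝ, ℂ) ∞ a G) :
    ∃ b, IsExhaustion (n := n) G a b := by
  obtain ⟨h, hG', hh, hh0⟩ := hG.exists_contMDiff_support_eq (n := ⊤) 𝓘₁[n]
  have hθ : ∀ j : ℕ, ContMDiff 𝓘₁[n] 𝓘(ℝ, ℂ) ∞
      (fun q => ((Real.smoothTransition (j * h q - 1) : ℝ) : ℂ)) := fun j => by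
    have h1 : ContDiff ℝ ∞ (fun r : ℝ => ((Real.smoothTransition (j * r - 1) : ℝ) : ℂ)) :=
      Complex.ofRealCLM.contDiff.comp ((Real.smoothTransition.contDiff (n := ⊤)).comp (by fun_prop))
    exact h1.contMDiff.comp hh
  refine ⟨fun j q => a q * ((Real.smoothTransition (j * h q - 1) : ℝ) : ℂ),
    fun j => contMDiff_mul_of_tsupport (hθ j) hG ?_ ha, fun p hp => ?_⟩
  · refine (tsupport_subset_of_forall_notMem (s := {q | 1 ≤ j * h q})
      (isClosed_le continuous_const (continuous_const.mul hh.continuous)) fun q hq => ?_).trans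
      fun q hq => ?_
    · rw [mem_ofPred_eq, not_le] at hq
      rw [Real.smoothTransition.zero_of_nonpos (by linarith), Complex.ofReal_zero]
    · rw [← hG']
      intro h0
      rw [mem_ofPred_eq, h0, mul_zero] at hq
      exact absurd hq (by norm_num)
  · have hp0 : 0 < h p := (hh0 p).lt_of_ne' (by rw [← hG'] at hp; exact hp)
    refine ⟨{q | h p / 2 < h q}, (isOpen_lt continuous_const hh.continuous).mem_nhds
      (by simpa using half_lt_self hp0), ?_⟩
    filter_upwards [(tendsto_natCast_atTop_atTop (R := ℝ)).eventually_ge_atTop (4 / h p)]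
      with j hj q hq
    rw [div_le_iff₀ hp0] at hj
    have h1 : (j : ℝ) * (h p / 2) ≤ j * h q := mul_le_mul_of_nonneg_left hq.le j.cast_nonneg
    rw [Real.smoothTransition.one_of_one_le (by linarith), Complex.ofReal_one, mul_one]

end Exhaustion

section FlowGraph

variable {n : ℕ} {X : Type*} [TopologicalSpace X] [ChartedSpace 𝔼[n] X] {φ : ℝ → X → X}

/-- The graph of the backward flow. -/
def flowGraph (φ : ℝ → X → X) (q : ℝ × X) : ℝ × X × X := (q.1, q.2, φ (-q.1) q.2)

/-- The set of `(t, y)` with `y ∈ U` and `φ_{-t}(y) ∈ U`. -/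
def flowDomain (φ : ℝ → X → X) (U : Set X) : Set (ℝ × X) := {q | q.2 ∈ U ∧ φ (-q.1) q.2 ∈ U}

theorem contMDiff_flowGraph (hs : IsSmoothFlow (n := n) φ) :
    ContMDiff 𝓘₁[n] 𝓙[n] ∞ (flowGraph φ) :=
  contMDiff_fst.prodMk (contMDiff_snd.prodMk hs.contMDiff_backward)

theorem isOpen_flowDomain (hs : IsSmoothFlow (n := n) φ) {U : Set X} (hU : IsOpen U) :
    IsOpen (flowDomain φ U) :=
  (hU.preimage continuous_snd).inter (hU.preimage hs.contMDiff_backward.continuous)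

theorem isOpen_domainOver {U : Set X} (hU : IsOpen U) : IsOpen (domainOver U) :=
  (isOpen_ne.preimage continuous_fst).inter
    ((hU.preimage (continuous_fst.comp continuous_snd)).inter
      (hU.preimage (continuous_snd.comp continuous_snd)))

theorem contMDiff_firstPair : ContMDiff 𝓙[n] 𝓘₁[n] ∞ (fun q : ℝ × X × X => (q.1, q.2.1)) :=
  contMDiff_fst.prodMk (contMDiff_fst.comp contMDiff_snd)

end FlowGraph

section Kernel

variable {n : ℕ} {X : Type*} [TopologicalSpace X] [ChartedSpace 𝔼[n] X] [IsManifold (𝓡 n) ∞ X]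
  [MeasurableSpace X] {μ : Measure X} [BorelSpace X]
  [T2Space X] [CompactSpace X] [SecondCountableTopology X] [IsLocallyFiniteMeasure μ]

/-- The finitely many exceptional indices belong to smooth functions, whose local transforms decay
in all directions; shrinking `W` away from 0 turns decay in `‖s • η‖` into decay in `s`. -/
theorem uniformlyMicroSmoothAt_of_eventually (hμ : IsSmoothDensity (n := n) μ)
    {O : Set (ℝ × X × X)} (hO : IsOpen O) {v : ℕ → ℝ × X × X → ℂ}
    (hv : ∀ j, ContMDiffOn 𝓙[n] 𝓘(ℝ, ℂ) ∞ (v j) O)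
    {p : ℝ × X × X} {Φ : ℝ × X × X → ℂ} (hΦ : IsTest 𝓙[n] O Φ)
    (hΦs : tsupport Φ ⊆ (extChartAt 𝓙[n] p).source) (hΦp : Φ p ≠ 0)
    {ζ : (ℝ × 𝔼[n] × 𝔼[n]) →L[ℝ] ℝ} (hζ : ζ ≠ 0) {W : Set ((ℝ × 𝔼[n] × 𝔼[n]) →L[ℝ] ℝ)}
    (hW : W ∈ 𝓝 ζ)
    (hd : ∀ M : ℕ, ∃ C : ℝ, ∀ᶠ j in atTop, ∀ η ∈ W, ∀ s : ℝ, 1 ≤ s →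
      s ^ M * ‖localFourier 𝓙[n] (fun Φ => ∫ q, v j q * Φ q ∂(volume.prod (μ.prod μ))) Φ p
        (s • η)‖ ≤ C) :
    UniformlyMicroSmoothAt 𝓙[n] O (fun j Φ => ∫ q, v j q * Φ q ∂(volume.prod (μ.prod μ))) p ζ := by
  have hζ' : 0 < ‖ζ‖ := norm_pos_iff.2 hζ
  refine ⟨Φ, hΦ, hΦs, hΦp, W ∩ {η | ‖ζ‖ / 2 < ‖η‖}, inter_mem hW
    ((isOpen_lt continuous_const continuous_norm).mem_nhds (by simpa using half_lt_self hζ')),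
    fun M => ?_⟩
  obtain ⟨C, hC⟩ := hd M
  obtain ⟨J, hJ⟩ := eventually_atTop.1 hC
  have h1 : ∀ j, ∃ C : ℝ, ∀ η : (ℝ × 𝔼[n] × 𝔼[n]) →L[ℝ] ℝ, (1 + ‖η‖) ^ M * ‖localFourier 𝓙[n]
      (fun Φ => ∫ q, v j q * Φ q ∂(volume.prod (μ.prod μ))) Φ p η‖ ≤ C := fun j => by
    obtain ⟨h2, h3⟩ := contDiff_pullChart hμ (y₀ := p.2.1) (x₀ := p.2.2)
      (hΦ.mul_left hO hΦ.2.2 (hv j)) fun q hq => (mem_extChartAt_triple_source p q).1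
        (hΦs (tsupport_comp_eq_subset (fun x hx => by simp [hx]) hq))
    obtain ⟨C, hC⟩ := fourierAt_decay_of_ne_zero volume h2 h3 M
    exact ⟨C, fun η => by rw [← fourierAt_pullChart hμ hO (hv j) hΦ hΦs]; exact hC η⟩
  choose c hc using h1
  have hc0 : ∀ j, 0 ≤ c j := fun j => le_trans (by positivity) (hc j 0)
  refine ⟨max C (∑ j ∈ Finset.range J, (2 / ‖ζ‖) ^ M * c j), fun j η hη s hs => ?_⟩
  rcases le_or_gt J j with hj | hj
  · exact (hJ j hj η hη.1 s hs).trans (le_max_left _ _)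
  · refine le_trans ?_ (le_max_right _ _)
    refine le_trans ?_ (Finset.single_le_sum (f := fun j => (2 / ‖ζ‖) ^ M * c j)
      (fun i _ => mul_nonneg (by positivity) (hc0 i)) (Finset.mem_range.2 hj))
    have hs0 : 0 ≤ s := zero_le_one.trans hs
    have h4 : s ≤ 2 / ‖ζ‖ * (1 + ‖s • η‖) := by
      have h5 : ‖ζ‖ / 2 < ‖η‖ := hη.2
      rw [norm_smul, Real.norm_of_nonneg hs0, div_mul_eq_mul_div, le_div_iff₀ hζ']
      nlinarith
    calc _ ≤ (2 / ‖ζ‖ * (1 + ‖s • η‖)) ^ M * _ :=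
          mul_le_mul_of_nonneg_right (pow_le_pow_left₀ hs0 h4 M) (norm_nonneg _)
      _ = (2 / ‖ζ‖) ^ M * ((1 + ‖s • η‖) ^ M * _) := by rw [mul_pow, mul_assoc]
      _ ≤ _ := mul_le_mul_of_nonneg_left (hc j _) (by positivity)

/-- The transform at each covector is a pairing with a test function, so the uniform bounds pass to
the weak limit. -/
theorem disjoint_waveFrontSet_normals {O : Set (ℝ × X × X)} {v : ℕ → ℝ × X × X → ℂ}
    {u : (ℝ × X × X → ℂ) → ℂ}
    (hv : ConvergesOffNormals 𝓙[n] 𝓘₁[n] (volume.prod (μ.prod μ)) diag O v u) :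
    Disjoint (waveFrontSet 𝓙[n] O u) (normals 𝓙[n] 𝓘₁[n] (diag (X := X))) := by
  rw [Set.disjoint_left]
  rintro z ⟨hzO, hz0, hz⟩ hzn
  obtain ⟨Φ, hΦ, hΦs, hΦp, W, hW, hd⟩ := hv.2.2 z hzn hzO hz0
  refine hz ⟨Φ, hΦ, hΦs, hΦp, W, hW, fun M => ?_⟩
  obtain ⟨C, hC⟩ := hd M
  refine ⟨C, fun _ η hη s hs => ?_⟩
  have h1 := hv.2.1 _ (isTest_mul_exp hΦ hΦs (s • η))
  exact le_of_tendsto (h1.norm.const_mul (s ^ M)) (Eventually.of_forall fun j => hC j η hη s hs)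

variable {φ : ℝ → X → X}

/-- The distribution `a(t, y) δ(x - φ_{-t}(y))`. -/
def graphKernel (μ : Measure X) (φ : ℝ → X → X) (a : ℝ × X → ℂ) (Φ : ℝ × X × X → ℂ) : ℂ :=
  ∫ q : ℝ × X, a q * Φ (flowGraph φ q) ∂(volume.prod μ)

theorem isTest_mul_flowGraph (hs : IsSmoothFlow (n := n) φ) {U : Set X} (hU : IsOpen U)
    {a : ℝ × X → ℂ} (ha : ContMDiffOn 𝓘₁[n] 𝓘(ℝ, ℂ) ∞ a (flowDomain φ U))
    {Φ : ℝ × X × X → ℂ} (hΦ : IsTest 𝓙[n] (domainOver U) Φ) :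
    IsTest 𝓘₁[n] (flowDomain φ U) (fun q => a q * Φ (flowGraph φ q)) := by
  have hg := (contMDiff_flowGraph hs).continuous
  have h1 : tsupport (fun q => Φ (flowGraph φ q)) ⊆ flowGraph φ ⁻¹' tsupport Φ :=
    tsupport_subset_of_forall_notMem ((isClosed_tsupport Φ).preimage hg) fun q hq =>
      eq_zero_of_notMem_tsupport hq
  have h2 : tsupport (fun q => Φ (flowGraph φ q)) ⊆ flowDomain φ U := fun q hq =>
    (hΦ.2.2 (h1 hq)).2
  have h3 : HasCompactSupport (fun q => Φ (flowGraph φ q)) :=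
    HasCompactSupport.intro (hΦ.2.1.isCompact.image
      (continuous_fst.prodMk (continuous_fst.comp continuous_snd))) fun q hq =>
      eq_zero_of_notMem_tsupport fun h => hq ⟨flowGraph φ q, h, rfl⟩
  exact IsTest.mul_left ⟨hΦ.1.comp (contMDiff_flowGraph hs), h3, h2⟩ (isOpen_flowDomain hs hU) h2 ha

theorem integrable_mul_flowGraph (hs : IsSmoothFlow (n := n) φ) {U : Set X} (hU : IsOpen U)
    {a : ℝ × X → ℂ} (ha : ContMDiffOn 𝓘₁[n] 𝓘(ℝ, ℂ) ∞ a (flowDomain φ U))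
    {Φ : ℝ × X × X → ℂ} (hΦ : IsTest 𝓙[n] (domainOver U) Φ) :
    Integrable (fun q => a q * Φ (flowGraph φ q)) (volume.prod μ) :=
  have h := isTest_mul_flowGraph hs hU ha hΦ
  h.continuous.integrable_of_hasCompactSupport h.2.1

theorem graphKernel_add (hs : IsSmoothFlow (n := n) φ) {U : Set X} (hU : IsOpen U)
    {a : ℝ × X → ℂ} (ha : ContMDiffOn 𝓘₁[n] 𝓘(ℝ, ℂ) ∞ a (flowDomain φ U))
    {Φ Ψ : ℝ × X × X → ℂ} (hΦ : IsTest 𝓙[n] (domainOver U) Φ)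
    (hΨ : IsTest 𝓙[n] (domainOver U) Ψ) :
    graphKernel μ φ a (fun q => Φ q + Ψ q) = graphKernel μ φ a Φ + graphKernel μ φ a Ψ := by
  simp only [graphKernel, mul_add]
  exact integral_add (integrable_mul_flowGraph hs hU ha hΦ) (integrable_mul_flowGraph hs hU ha hΨ)

/-- The smooth approximation of `graphKernel` defined by mollification in charts. -/
def mollSum (hμ : IsSmoothDensity (n := n) μ) (φ : ℝ → X → X) (s : Finset X) (χ ψ : X → X → ℂ)
    (b : ℝ × X → ℂ) (ρ : 𝔼[n] → ℝ) (q : ℝ × X × X) : ℂ :=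
  ∑ α ∈ s, mollKernel hμ φ α (χ α) (ψ α) ρ q * b (q.1, q.2.1)

variable {s : Finset X} {χ ψ : X → X → ℂ} {ρ : ℕ → 𝔼[n] → ℝ} {a : ℝ × X → ℂ}
  {b : ℕ → ℝ × X → ℂ} {U : Set X}

theorem contMDiff_mollSum (hμ : IsSmoothDensity (n := n) μ) (hs : IsSmoothFlow (n := n) φ)
    (hχ : ∀ α, IsChartCutoff (n := n) α (χ α)) (hψ : ∀ α, IsChartCutoff (n := n) α (ψ α))
    {b : ℝ × X → ℂ} (hb : ContMDiff 𝓘₁[n] 𝓘(ℝ, ℂ) ∞ b) {ρ : 𝔼[n] → ℝ} (hρ : ContDiff ℝ ∞ ρ) :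
    ContMDiff 𝓙[n] 𝓘(ℝ, ℂ) ∞ (mollSum hμ φ s χ ψ b ρ) := by
  unfold mollSum
  exact contMDiff_finsetSum fun α _ q => contMDiffAt_mul
    (contMDiff_mollKernel hμ hs (hχ α) (hψ α) hρ q)
    ((hb.comp contMDiff_firstPair) q)

/-- Locally, the coefficients `b j` can be replaced by a fixed one. -/
theorem eventually_mollSum_eq (hμ : IsSmoothDensity (n := n) μ) (hs : IsSmoothFlow (n := n) φ)
    (hχ : ∀ α, IsChartCutoff (n := n) α (χ α)) (hψ : ∀ α, IsChartCutoff (n := n) α (ψ α))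
    (hρ : IsMollifier volume ρ) (hb : IsExhaustion (n := n) (flowDomain φ U) a b)
    {p : ℝ × X × X} (hp : p ∈ domainOver U) :
    ∃ N ∈ 𝓝 p, ∃ J, (∀ᶠ j in atTop, ∀ q ∈ N,
        mollSum hμ φ s χ ψ (b j) (ρ j) q = mollSum hμ φ s χ ψ (b J) (ρ j) q) ∧
      ∀ q, flowGraph φ q ∈ N → a q = b J q := by
  -- On the graph, `p` lies over `flowDomain φ U`, where the coefficients stabilize. Off the graph,
  -- all mollified kernels vanish near `p` in the end and the coefficient is irrelevant.
  by_cases h : φ (-p.1) p.2.1 = p.2.2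
  · have hG : (p.1, p.2.1) ∈ flowDomain φ U := ⟨hp.2.1, by rw [h]; exact hp.2.2⟩
    obtain ⟨N, hN, hj⟩ := hb.eventually_eq _ hG
    obtain ⟨J, hJ⟩ := eventually_atTop.1 hj
    refine ⟨_, (contMDiff_firstPair (n := n)).continuous.continuousAt.preimage_mem_nhds hN, J, ?_,
      fun q hq => (hJ J le_rfl _ hq).symm⟩
    filter_upwards [eventually_ge_atTop J] with j hj q hq
    unfold mollSum
    rw [hJ j hj _ hq, hJ J le_rfl _ hq]
  · choose N hN hj using fun α => eventually_mollKernel_eq_zero hμ hs (hχ α) (hψ α) hρ (p := p)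
      fun h' => h h'.1
    have hN' : {q : ℝ × X × X | φ (-q.1) q.2.1 ≠ q.2.2} ∈ 𝓝 p := by
      refine IsOpen.mem_nhds (isOpen_ne_fun ?_ ?_) h
      · exact hs.contMDiff_backward.continuous.comp (contMDiff_firstPair (n := n)).continuous
      · exact continuous_snd.comp continuous_snd
    refine ⟨(⋂ α ∈ s, N α) ∩ _, inter_mem ((biInter_finset_mem s).2 fun α _ => hN α) hN', 0, ?_,
      fun q hq => absurd rfl hq.2⟩
    filter_upwards [(Filter.eventually_all_finset s).2 fun α _ => hj α] with j hj q hq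
    unfold mollSum
    refine Finset.sum_congr rfl fun α hα => ?_
    rw [hj α hα q (mem_iInter₂.1 hq.1 α hα), zero_mul, zero_mul]

theorem integral_mollSum_mul (hμ : IsSmoothDensity (n := n) μ) (hs : IsSmoothFlow (n := n) φ)
    (hχ : ∀ α, IsChartCutoff (n := n) α (χ α)) (hψ : ∀ α, IsChartCutoff (n := n) α (ψ α))
    {ρ : 𝔼[n] → ℝ} (hρ : ContDiff ℝ ∞ ρ) {b : ℝ × X → ℂ} (hb : ContMDiff 𝓘₁[n] 𝓘(ℝ, ℂ) ∞ b)
    {O : Set (ℝ × X × X)} {Φ : ℝ × X × X → ℂ} (hΦ : IsTest 𝓙[n] O Φ) :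
    ∫ q, mollSum hμ φ s χ ψ b ρ q * Φ q ∂(volume.prod (μ.prod μ)) =
      ∑ α ∈ s, ∫ q, mollKernel hμ φ α (χ α) (ψ α) ρ q * (b (q.1, q.2.1) * Φ q)
        ∂(volume.prod (μ.prod μ)) := by
  simp only [mollSum, Finset.sum_mul, mul_assoc]
  refine integral_finsetSum _ fun α _ => ?_
  have h1 := (hΦ.mul (hb.comp contMDiff_firstPair)).mul (contMDiff_mollKernel hμ hs (hχ α) (hψ α) hρ)
  exact h1.continuous.integrable_of_hasCompactSupport h1.2.1

/-- By localization, the coefficient may be frozen at some `b J` and moved into the test function.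
The limits in the single charts then add up to the graph integral, because the cutoff products sum
to 1. -/
theorem tendsto_integral_mollSum (hμ : IsSmoothDensity (n := n) μ) (hs : IsSmoothFlow (n := n) φ)
    (hχ : ∀ α, IsChartCutoff (n := n) α (χ α)) (hψ : ∀ α, IsChartCutoff (n := n) α (ψ α))
    (hχψ : ∀ x, ∑ α ∈ s, χ α x * ψ α x = 1)
    (hρ : IsMollifier volume ρ) (hU : IsOpen U)
    (ha : ContMDiffOn 𝓘₁[n] 𝓘(ℝ, ℂ) ∞ a (flowDomain φ U))
    (hb : IsExhaustion (n := n) (flowDomain φ U) a b)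
    {Φ : ℝ × X × X → ℂ} (hΦ : IsTest 𝓙[n] (domainOver U) Φ) :
    Tendsto (fun j => ∫ q, mollSum hμ φ s χ ψ (b j) (ρ j) q * Φ q ∂(volume.prod (μ.prod μ))) atTop
      (𝓝 (graphKernel μ φ a Φ)) := by
  have hsm : ∀ j, ContMDiff 𝓙[n] 𝓘(ℝ, ℂ) ∞ (mollSum hμ φ s χ ψ (b j) (ρ j)) := fun j =>
    contMDiff_mollSum hμ hs hχ hψ (hb.smooth j) (hρ.smooth j)
  refine hΦ.induction_on (P := fun Φ => Tendsto (fun j => ∫ q, mollSum hμ φ s χ ψ (b j) (ρ j) q *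
    Φ q ∂(volume.prod (μ.prod μ))) atTop (𝓝 (graphKernel μ φ a Φ))) ?_ ?_ ?_
  · simp [graphKernel]
  · intro Φ Ψ hΦ hΨ h1 h2
    rw [graphKernel_add hs hU ha hΦ hΨ]
    refine (h1.add h2).congr fun j => ?_
    have hi := fun {Φ : ℝ × X × X → ℂ} (hΦ : IsTest 𝓙[n] (domainOver U) Φ) =>
      (hΦ.mul (hsm j)).continuous.integrable_of_hasCompactSupport
        (μ := volume.prod (μ.prod μ)) (hΦ.mul (hsm j)).2.1
    simp only [mul_add]
    exact (integral_add (hi hΦ) (hi hΨ)).symm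
  · intro p hp
    obtain ⟨N, hN, J, hJ, hJa⟩ := eventually_mollSum_eq (s := s) hμ hs hχ hψ hρ hb hp
    choose N' hN' hlim using fun α => exists_tendsto_mollKernel hμ hs (hχ α) (hψ α) hρ p
    refine ⟨N ∩ ⋂ α ∈ s, N' α, inter_mem hN ((biInter_finset_mem s).2 fun α _ => hN' α),
      fun Φ hΦ hΦN => ?_⟩
    have hbΦ := (hΦ.mono (subset_univ _)).mul ((hb.smooth J).comp contMDiff_firstPair)
    have hlim' := tendsto_finsetSum s fun α hα => hlim α _ hbΦ
      ((tsupport_comp_eq_subset fun q hq => by simp [hq]).trans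
        (hΦN.trans (inter_subset_right.trans (biInter_subset_of_mem (t := N') hα))))
    have hI : ∀ α ∈ s, Integrable (fun q : ℝ × X => χ α (φ (-q.1) q.2) * ψ α (φ (-q.1) q.2) *
        (((b J ∘ fun q : ℝ × X × X => (q.1, q.2.1)) (q.1, q.2, φ (-q.1) q.2)) *
          Φ (q.1, q.2, φ (-q.1) q.2))) (volume.prod μ) := fun α _ => by
      have h1 := isTest_mul_flowGraph hs hU (hb.smooth J).contMDiffOn hΦ
      have h2 := (h1.mul ((hψ α).smooth.comp hs.contMDiff_backward)).mul
        ((hχ α).smooth.comp hs.contMDiff_backward)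
      simp only [mul_assoc]
      exact h2.continuous.integrable_of_hasCompactSupport h2.2.1
    have hval : graphKernel μ φ a Φ = ∑ α ∈ s, ∫ q : ℝ × X, χ α (φ (-q.1) q.2) *
        ψ α (φ (-q.1) q.2) * (((b J ∘ fun q : ℝ × X × X => (q.1, q.2.1)) (q.1, q.2, φ (-q.1) q.2)) *
          Φ (q.1, q.2, φ (-q.1) q.2)) ∂(volume.prod μ) := by
      rw [← integral_finsetSum _ hI]
      refine integral_congr_ae (ae_of_all _ fun q => ?_)
      simp only [← Finset.sum_mul]
      rw [hχψ, one_mul]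
      change _ = b J q * Φ (flowGraph φ q)
      by_cases h0 : Φ (flowGraph φ q) = 0
      · simp only [h0, mul_zero]
      · simp only [hJa q (hΦN (subset_tsupport _ h0)).1]
    rw [hval]
    refine hlim'.congr' ?_
    filter_upwards [hJ] with j hj
    refine (integral_mollSum_mul hμ hs hχ hψ (hρ.smooth j) (hb.smooth J) hΦ).symm.trans ?_
    refine integral_congr_ae (ae_of_all _ fun q => ?_)
    by_cases h0 : Φ q = 0
    · simp [h0]
    · simp only [hj q (hΦN (subset_tsupport _ h0)).1]

/-- This gives both the wave front statement and the existence of an admissible approximation for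
the pullback. The frozen coefficient is again part of the cutoff, and the decay of finitely many
mollified kernels is added up. -/
theorem IsAnosov.convergesOffNormals_mollSum (hμ : IsSmoothDensity (n := n) μ)
    {Es Eu : ∀ x : X, Submodule ℝ (TangentSpace (𝓡 n) x)} (h : IsAnosov φ Es Eu)
    (hχ : ∀ α, IsChartCutoff (n := n) α (χ α)) (hψ : ∀ α, IsChartCutoff (n := n) α (ψ α))
    (hχψ : ∀ x, ∑ α ∈ s, χ α x * ψ α x = 1)
    (hρ : IsMollifier volume ρ) (hU : IsOpen U)
    (ha : ContMDiffOn 𝓘₁[n] 𝓘(ℝ, ℂ) ∞ a (flowDomain φ U))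
    (hb : IsExhaustion (n := n) (flowDomain φ U) a b) :
    ConvergesOffNormals 𝓙[n] 𝓘₁[n] (volume.prod (μ.prod μ)) diag (domainOver U)
      (fun j => mollSum hμ φ s χ ψ (b j) (ρ j)) (graphKernel μ φ a) := by
  have hs := h.toIsSmoothFlow
  have hsm : ∀ j, ContMDiff 𝓙[n] 𝓘(ℝ, ℂ) ∞ (mollSum hμ φ s χ ψ (b j) (ρ j)) := fun j =>
    contMDiff_mollSum hμ hs hχ hψ (hb.smooth j) (hρ.smooth j)
  refine ⟨fun j => (hsm j).contMDiffOn, fun Φ hΦ =>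
    tendsto_integral_mollSum hμ hs hχ hψ hχψ hρ hU ha hb hΦ, ?_⟩
  rintro _ ⟨⟨t₀, x₀⟩, ζ, hζ, rfl⟩ hO hζ0
  replace hζ : (show (ℝ × 𝔼[n] × 𝔼[n]) →L[ℝ] ℝ from ζ).comp (diagLin n) = 0 := by
    rw [mfderiv_diag] at hζ
    exact hζ
  obtain ⟨N, hN, J, hJ, -⟩ := eventually_mollSum_eq (s := s) hμ hs hχ hψ hρ hb hO
  choose N' hN' W hW hdec using fun α =>
    h.exists_mollKernel_decay hμ (hχ α) (hψ α) hρ (x₀ := x₀) hO.1 hζ0 hζ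
  have hDO := isOpen_domainOver hU
  obtain ⟨Φ, hΦ, hΦ1⟩ := exists_isTest_eq_one (I := 𝓙[n]) (p := diag (t₀, x₀))
    (inter_mem (inter_mem hN ((biInter_finset_mem s).2 fun α _ => hN' α))
      (inter_mem (hDO.mem_nhds hO) (extChartAt_source_mem_nhds (I := 𝓙[n]) (diag (t₀, x₀)))))
  have hΦO : IsTest 𝓙[n] (domainOver U) Φ := hΦ.mono (hΦ.2.2.trans fun q hq => hq.2.1)
  have hΦs : tsupport Φ ⊆ (extChartAt 𝓙[n] (diag (t₀, x₀))).source := hΦ.2.2.trans fun q hq => hq.2.2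
  refine uniformlyMicroSmoothAt_of_eventually hμ hDO (fun j => (hsm j).contMDiffOn) hΦO hΦs
    (by rw [hΦ1.self_of_nhds]; exact one_ne_zero) hζ0 ((biInter_finset_mem s).2 fun α _ => hW α)
    fun M => ?_
  have hbΦ := (hΦ.mono (subset_univ _)).mul ((hb.smooth J).comp contMDiff_firstPair)
  have hbs : tsupport (fun q => (b J ∘ fun q : ℝ × X × X => (q.1, q.2.1)) q * Φ q) ⊆ tsupport Φ :=
    tsupport_comp_eq_subset fun q hq => by simp [hq]
  choose C hC using fun α => fun hα : α ∈ s => hdec α _ hbΦ (hbs.trans (hΦ.2.2.trans fun q hq =>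
    mem_iInter₂.1 hq.1.2 α hα)) (hbs.trans hΦs) M
  refine ⟨∑ α ∈ s.attach, C α.1 α.2, ?_⟩
  filter_upwards [hJ, (Filter.eventually_all_finset s.attach).2 fun α _ => hC α.1 α.2]
    with j hj hCj η hη r hr
  have h1 : localFourier 𝓙[n] (fun Φ => ∫ q, mollSum hμ φ s χ ψ (b j) (ρ j) q * Φ q
      ∂(volume.prod (μ.prod μ))) Φ (diag (t₀, x₀)) (r • η) =
      ∑ α ∈ s, localFourier 𝓙[n] (fun Φ => ∫ q, mollKernel hμ φ α (χ α) (ψ α) (ρ j) q * Φ q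
        ∂(volume.prod (μ.prod μ))) (fun q => (b J ∘ fun q : ℝ × X × X => (q.1, q.2.1)) q * Φ q)
        (diag (t₀, x₀)) (r • η) := by
    have h2 := isTest_mul_exp hΦO hΦs (r • η)
    have h3 := integral_mollSum_mul (s := s) hμ hs hχ hψ (hρ.smooth j) (hb.smooth J) h2
    have h4 : ∫ q, mollSum hμ φ s χ ψ (b j) (ρ j) q * (Φ q * Complex.exp (-Complex.I *
        (((r • η) (extChartAt 𝓙[n] (diag (t₀, x₀)) q) : ℝ) : ℂ))) ∂(volume.prod (μ.prod μ)) =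
        ∫ q, mollSum hμ φ s χ ψ (b J) (ρ j) q * (Φ q * Complex.exp (-Complex.I *
        (((r • η) (extChartAt 𝓙[n] (diag (t₀, x₀)) q) : ℝ) : ℂ))) ∂(volume.prod (μ.prod μ)) := by
      refine integral_congr_ae (ae_of_all _ fun q => ?_)
      by_cases h0 : Φ q = 0
      · simp [h0]
      · simp only [hj q (hΦ.2.2 (subset_tsupport _ h0)).1.1]
    refine h4.trans (h3.trans ?_)
    simp only [localFourier, Function.comp, mul_assoc]
  rw [h1, ← Finset.sum_attach]
  calc _ ≤ r ^ M * ∑ α ∈ s.attach, ‖localFourier 𝓙[n] (fun Φ =>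
        ∫ q, mollKernel hμ φ α (χ α) (ψ α) (ρ j) q * Φ q ∂(volume.prod (μ.prod μ)))
          (fun q => (b J ∘ fun q : ℝ × X × X => (q.1, q.2.1)) q * Φ q) (diag (t₀, x₀)) (r • η)‖ := by
        gcongr
        exact norm_sum_le _ _
    _ ≤ _ := by
        rw [Finset.mul_sum]
        exact Finset.sum_le_sum fun α _ => hCj α (Finset.mem_attach _ _) η
          (mem_iInter₂.1 hη α.1 α.2) r hr

/-- Near a point over `flowDomain φ U` the bound is the integral of `‖a‖` over a compact
neighbourhood; near any other point of the domain the graph is absent and the functional is zero. -/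
theorem isDistribution_graphKernel (hs : IsSmoothFlow (n := n) φ) (hU : IsOpen U)
    (ha : ContMDiffOn 𝓘₁[n] 𝓘(ℝ, ℂ) ∞ a (flowDomain φ U)) :
    IsDistribution 𝓙[n] (domainOver U) (graphKernel μ φ a) := by
  refine isDistribution_of_bound (fun Φ Ψ hΦ hΨ => graphKernel_add hs hU ha hΦ hΨ)
    (fun c Φ _ => ?_) fun p hp => ?_
  · simp only [graphKernel, ← integral_const_mul]
    exact integral_congr_ae (ae_of_all _ fun q => by ring)
  · by_cases hG : (p.1, p.2.1) ∈ flowDomain φ U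
    · have : LocallyCompactSpace X := inferInstance
      obtain ⟨K, hK, hKG, hKc⟩ := local_compact_nhds ((isOpen_flowDomain hs hU).mem_nhds hG)
      refine ⟨_, (contMDiff_firstPair (n := n)).continuous.continuousAt.preimage_mem_nhds hK,
        ∫ q in K, ‖a q‖ ∂(volume.prod μ), fun Φ hΦ hΦK B hB => ?_⟩
      have hi : IntegrableOn a K (volume.prod μ) :=
        (ha.continuousOn.mono hKG).integrableOn_compact hKc
      have h0 : ∀ q ∉ K, a q * Φ (flowGraph φ q) = 0 := fun q hq => by
        by_cases h : Φ (flowGraph φ q) = 0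
        · rw [h, mul_zero]
        · exact absurd (hΦK (subset_tsupport _ h)) hq
      rw [graphKernel, ← setIntegral_eq_integral_of_forall_compl_eq_zero h0, ← integral_mul_const]
      refine norm_integral_le_of_norm_le (hi.norm.mul_const B) (ae_of_all _ fun q => ?_)
      rw [norm_mul]
      exact mul_le_mul_of_nonneg_left (hB _) (norm_nonneg _)
    · have hN' : {q : ℝ × X × X | φ (-q.1) q.2.1 ≠ q.2.2} ∈ 𝓝 p := by
        refine IsOpen.mem_nhds (isOpen_ne_fun ?_ ?_) fun h => hG ⟨hp.2.1, by
          rw [h]; exact hp.2.2⟩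
        · exact hs.contMDiff_backward.continuous.comp (contMDiff_firstPair (n := n)).continuous
        · exact continuous_snd.comp continuous_snd
      refine ⟨_, hN', 0, fun Φ hΦ hΦN B hB => ?_⟩
      have h0 : graphKernel μ φ a Φ = 0 := by
        refine integral_eq_zero_of_ae (ae_of_all _ fun q => ?_)
        by_cases h : Φ (flowGraph φ q) = 0
        · simp [h]
        · exact absurd rfl (hΦN (subset_tsupport _ h))
      rw [h0]
      simp

end Kernel

end Guillemin

end

/-! ### The diagonal restriction is the sum over closed orbits. -/

noncomputable section

namespace Guillemin

set_option linter.unusedSectionVars false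

local notation "𝔼[" n "]" => EuclideanSpace ℝ (Fin n)
local notation "𝓙[" n "]" => ModelWithCorners.prod 𝓘(ℝ, ℝ) (ModelWithCorners.prod (𝓡 n) (𝓡 n))
local notation "𝓘₁[" n "]" => ModelWithCorners.prod 𝓘(ℝ, ℝ) (𝓡 n)

section OrbitNear

variable {n : ℕ} {X : Type*} [TopologicalSpace X] [ChartedSpace 𝔼[n] X] [IsManifold (𝓡 n) ∞ X]
  {φ : ℝ → X → X}

theorem IsSmoothFlow.eventually_orbit_mem (hs : IsSmoothFlow (n := n) φ) {x : X} {V : Set X}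
    (hV : V ∈ 𝓝 x) : ∀ᶠ ε in 𝓝[>] (0 : ℝ), ∀ s ∈ uIcc (-ε) ε, φ s x ∈ V := by
  have h1 : ∀ᶠ s in 𝓝 (0 : ℝ), φ s x ∈ V :=
    (hs.contMDiff_orbit x).continuous.continuousAt (by rw [hs.zero]; exact hV)
  obtain ⟨δ, hδ, hδV⟩ := Metric.eventually_nhds_iff.1 h1
  filter_upwards [Ioo_mem_nhdsGT hδ] with ε hε s hs
  rw [uIcc_of_le (by linarith [hε.1]), mem_Icc, ← abs_le] at hs
  exact hδV (by rw [Real.dist_eq, sub_zero]; exact hs.trans_lt hε.2)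

end OrbitNear

section DiagonalLimit

variable {n : ℕ} {X : Type*} [TopologicalSpace X] [ChartedSpace 𝔼[n] X] [IsManifold (𝓡 n) ∞ X]
  [MeasurableSpace X] {μ : Measure X} [BorelSpace X]
  [T2Space X] [CompactSpace X] [SecondCountableTopology X] [IsLocallyFiniteMeasure μ]
  {φ : ℝ → X → X} {Es Eu : ∀ x : X, Submodule ℝ (TangentSpace (𝓡 n) x)}

/-- In the chart, the kernel on the diagonal is the mollifier applied to the displacement, so
`tendsto_integral_displacement` applies, the density cancelling once more. If `x₀` is outside the
chart, both sides vanish nearby. -/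
theorem IsAnosov.tendsto_integral_mollKernel_diag (hμ : IsSmoothDensity (n := n) μ)
    (h : IsAnosov φ Es Eu) {α : X} {χ ψ : X → ℂ} {ρ : ℕ → 𝔼[n] → ℝ}
    (hχ : IsChartCutoff (n := n) α χ) (hψ : IsChartCutoff (n := n) α ψ)
    (hρ : IsMollifier volume ρ) {t₀ : ℝ} {x₀ : X} (ht₀ : t₀ ≠ 0) (hfix : φ t₀ x₀ = x₀) :
    ∀ᶠ ε in 𝓝[>] (0 : ℝ), ∃ N ∈ 𝓝 (t₀, x₀), ∀ (O : Set (ℝ × X)) (Ψ : ℝ × X → ℂ),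
      IsTest 𝓘₁[n] O Ψ → tsupport Ψ ⊆ N →
      Tendsto (fun j => ∫ q, mollKernel hμ φ α χ ψ (ρ j) (diag q) * Ψ q ∂(volume.prod μ)) atTop
        (𝓝 (((1 / h.absDet hfix : ℝ) : ℂ) *
          ∫ s in (-ε)..ε, χ (φ s x₀) * ψ (φ s x₀) * Ψ (t₀, φ s x₀))) := by
  have hs := h.toIsSmoothFlow
  by_cases hα : x₀ ∈ (extChartAt (𝓡 n) α).source
  · filter_upwards [h.tendsto_integral_displacement ht₀ hfix hα,
      hs.eventually_orbit_mem ((isOpen_extChartAt_source α).mem_nhds hα)]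
      with ε ⟨N, hN, hlim⟩ hε
    have hN' : {q : ℝ × X | (q.1, extChartAt (𝓡 n) α q.2) ∈ N} ∈ 𝓝 (t₀, x₀) := by
      refine (ContinuousAt.prodMk continuousAt_fst ?_).preimage_mem_nhds hN
      exact (continuousAt_extChartAt' hα).comp continuousAt_snd
    refine ⟨_, hN', fun O Ψ hΨ hΨN => ?_⟩
    classical
    set w : ℝ × X → ℂ := fun q => ψ q.2 * (χ (φ (-q.1) q.2) * Ψ q) with hw
    have hwT : IsTest 𝓘₁[n] O w :=
      (hΨ.mul (hχ.smooth.comp hs.contMDiff_backward)).mul (hψ.smooth.comp contMDiff_snd)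
    have hwΨ : tsupport w ⊆ tsupport Ψ := tsupport_comp_eq_subset fun q hq => by simp [hw, hq]
    have hws : ∀ q ∈ tsupport w, q.2 ∈ (extChartAt (𝓡 n) α).source := fun q hq => by
      refine hψ.supp (tsupport_subset_of_forall_notMem
        (s := Prod.snd ⁻¹' tsupport ψ) ((isClosed_tsupport ψ).preimage continuous_snd)
        (fun q hq => ?_) hq)
      simp only [hw]
      rw [eq_zero_of_notMem_tsupport (x := q.2) hq, zero_mul]
    set r : ℝ × 𝔼[n] → ℂ := fun d => if d.2 ∈ (extChartAt (𝓡 n) α).target then 1 else 0 with hr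
    have hr1 : ∀ d : ℝ × 𝔼[n], d.2 ∈ (extChartAt (𝓡 n) α).target → r d = 1 := fun d hd => if_pos hd
    have hr0 : ∀ d : ℝ × 𝔼[n], d.2 ∉ (extChartAt (𝓡 n) α).target → r d = 0 := fun d hd => if_neg hd
    obtain ⟨hB, hBc⟩ := smooth_rep_time α (r := r) (contDiffOn_const.congr hr1) hr0 hwT hws
    have hBN : tsupport (fun d : ℝ × 𝔼[n] => r d * w (d.1, chartInv α d.2)) ⊆ N := by
      have hK : IsCompact ((fun q : ℝ × X => (q.1, extChartAt (𝓡 n) α q.2)) '' tsupport w) := by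
        refine hwT.2.1.isCompact.image_of_continuousOn ?_
        exact continuousOn_fst.prodMk ((continuousOn_extChartAt α).comp continuousOn_snd hws)
      refine (tsupport_subset_of_forall_notMem hK.isClosed fun d hd => ?_).trans ?_
      · by_cases hd2 : d.2 ∈ (extChartAt (𝓡 n) α).target
        · rw [eq_zero_of_notMem_tsupport (Φ := w) fun hm => hd ⟨_, hm, ?_⟩, mul_zero]
          simp only [extChartAt_chartInv hd2]
        · rw [hr0 d hd2, zero_mul]
      · rintro _ ⟨q, hq, rfl⟩
        exact hΨN (hwΨ hq)
    have h1 := hlim _ hB.continuous hBc hBN ρ hρ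
    have hval : ∫ s in (-ε)..ε, χ (φ s x₀) * ψ (φ s x₀) * Ψ (t₀, φ s x₀) =
        ∫ s in (-ε)..ε, r (t₀, extChartAt (𝓡 n) α (φ s x₀)) *
          w (t₀, chartInv α (extChartAt (𝓡 n) α (φ s x₀))) := by
      refine intervalIntegral.integral_congr fun s hs' => ?_
      rw [hr1 _ ((extChartAt (𝓡 n) α).map_source (hε s hs')), chartInv_extChartAt (hε s hs'), one_mul]
      simp only [hw]
      rw [hs.comm, hs.neg_period hfix]
      ring
    rw [hval]
    refine h1.congr fun j => ?_
    have hm := (hwT.continuous.comp continuous_id).stronglyMeasurable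
    have h2 : IsTest 𝓘₁[n] O (fun q => mollKernel hμ φ α χ ψ (ρ j) (diag q) * Ψ q) :=
      hΨ.mul ((contMDiff_mollKernel hμ hs hχ hψ (hρ.smooth j)).comp contMDiff_diag)
    rw [integral_chart_time hμ α h2.continuous.stronglyMeasurable]
    · refine integral_congr_ae (ae_of_all _ fun d => ?_)
      by_cases hd2 : d.2 ∈ (extChartAt (𝓡 n) α).target
      · have hne : (chartDensity hμ α d.2 : ℂ) ≠ 0 :=
          Complex.ofReal_ne_zero.2 (chartDensity_pos hμ hd2).ne'
        simp only [hr1 d hd2, hw, mollKernel, diag, extChartAt_chartInv hd2, chartFlow]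
        push_cast
        field_simp
      · simp only [hr0 d hd2, chartDensity_of_notMem hμ hd2]
        simp
    · intro q hq
      simp only [mollKernel, diag]
      rw [eq_zero_of_notMem_tsupport (Φ := ψ) fun hm => hq (hψ.supp hm)]
      simp
  · have hψ0 : (tsupport ψ)ᶜ ∈ 𝓝 x₀ :=
      (isClosed_tsupport ψ).isOpen_compl.mem_nhds fun hm => hα (hψ.supp hm)
    filter_upwards [hs.eventually_orbit_mem hψ0] with ε hε
    obtain ⟨N, hN, hj⟩ := eventually_mollKernel_eq_zero hμ hs hχ hψ hρ (p := diag (t₀, x₀))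
      fun hm => hα hm.2
    refine ⟨_, continuous_diag.continuousAt.preimage_mem_nhds hN, fun O Ψ hΨ hΨN => ?_⟩
    have hval : ∫ s in (-ε)..ε, χ (φ s x₀) * ψ (φ s x₀) * Ψ (t₀, φ s x₀) = 0 := by
      rw [← intervalIntegral.integral_zero (a := -ε) (b := ε) (μ := volume)]
      refine intervalIntegral.integral_congr fun s hs' => ?_
      rw [eq_zero_of_notMem_tsupport (hε s hs')]
      simp
    rw [hval, mul_zero]
    refine tendsto_const_nhds.congr' ?_
    filter_upwards [hj] with j hj
    refine (integral_eq_zero_of_ae (ae_of_all _ fun q => ?_)).symm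
    by_cases h0 : Ψ q = 0
    · simp [h0]
    · simp [hj _ (hΨN (subset_tsupport _ h0))]

variable {s : Finset X} {χ ψ : X → X → ℂ} {ρ : ℕ → 𝔼[n] → ℝ} {a : ℝ × X → ℂ}
  {b : ℕ → ℝ × X → ℂ} {U : Set X} {wt : ℝ → X → ℂ}

theorem integral_mollSum_diag_mul (hμ : IsSmoothDensity (n := n) μ) (hs : IsSmoothFlow (n := n) φ)
    (hχ : ∀ α, IsChartCutoff (n := n) α (χ α)) (hψ : ∀ α, IsChartCutoff (n := n) α (ψ α))
    {ρ : 𝔼[n] → ℝ} (hρ : ContDiff ℝ ∞ ρ) {b : ℝ × X → ℂ} (hb : ContMDiff 𝓘₁[n] 𝓘(ℝ, ℂ) ∞ b)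
    {O : Set (ℝ × X)} {Ψ : ℝ × X → ℂ} (hΨ : IsTest 𝓘₁[n] O Ψ) :
    ∫ q, mollSum hμ φ s χ ψ b ρ (diag q) * Ψ q ∂(volume.prod μ) =
      ∑ α ∈ s, ∫ q, mollKernel hμ φ α (χ α) (ψ α) ρ (diag q) * (b q * Ψ q)
        ∂(volume.prod μ) := by
  simp only [mollSum, Finset.sum_mul, mul_assoc]
  refine integral_finsetSum _ fun α _ => ?_
  have h1 := (hΨ.mul hb).mul
    ((contMDiff_mollKernel hμ hs (hχ α) (hψ α) hρ).comp contMDiff_diag)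
  exact h1.continuous.integrable_of_hasCompactSupport h1.2.1

/-- Condition `hwa` ties the coefficient to the weight times `|det(I - P)|` at periodic points, so
the determinant cancels against the local formula and the local limits agree with those of
`orbitSum`. Near points that are not periodic both sides vanish. -/
theorem IsAnosov.tendsto_integral_mollSum_diag (hμ : IsSmoothDensity (n := n) μ)
    (h : IsAnosov φ Es Eu)
    (hχ : ∀ α, IsChartCutoff (n := n) α (χ α)) (hψ : ∀ α, IsChartCutoff (n := n) α (ψ α))
    (hχψ : ∀ x, ∑ α ∈ s, χ α x * ψ α x = 1) (hρ : IsMollifier volume ρ)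
    (hb : IsExhaustion (n := n) (flowDomain φ U) a b)
    (hwt : ∀ T x s, φ T x = x → wt T (φ s x) = wt T x)
    (hwa : ∀ T x (hx : φ T x = x), T ≠ 0 → x ∈ U → a (T, x) = wt T x * (h.absDet hx : ℂ))
    {Ψ : ℝ × X → ℂ} (hΨ : IsTest 𝓘₁[n] (diag ⁻¹' domainOver U) Ψ) :
    Tendsto (fun j => ∫ q, mollSum hμ φ s χ ψ (b j) (ρ j) (diag q) * Ψ q ∂(volume.prod μ)) atTop
      (𝓝 (orbitSum φ wt Ψ)) := by
  have hs := h.toIsSmoothFlow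
  have hsm : ∀ j, ContMDiff 𝓘₁[n] 𝓘(ℝ, ℂ) ∞ (fun q => mollSum hμ φ s χ ψ (b j) (ρ j) (diag q)) :=
    fun j => (contMDiff_mollSum hμ hs hχ hψ (hb.smooth j) (hρ.smooth j)).comp contMDiff_diag
  refine hΨ.induction_on (P := fun Ψ => Tendsto (fun j => ∫ q, mollSum hμ φ s χ ψ (b j) (ρ j)
    (diag q) * Ψ q ∂(volume.prod μ)) atTop (𝓝 (orbitSum φ wt Ψ))) ?_ ?_ ?_
  · rw [orbitSum_eq_zero hs fun t x _ _ => rfl]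
    simp
  · intro Φ Ψ hΦ hΨ h1 h2
    rw [h.orbitSum_add hΦ.continuous hΨ.continuous hΦ.2.1 hΨ.2.1]
    refine (h1.add h2).congr fun j => ?_
    have hi := fun {Φ : ℝ × X → ℂ} (hΦ : IsTest 𝓘₁[n] (diag ⁻¹' domainOver U) Φ) =>
      (hΦ.mul (hsm j)).continuous.integrable_of_hasCompactSupport
        (μ := volume.prod μ) (hΦ.mul (hsm j)).2.1
    simp only [mul_add]
    exact (integral_add (hi hΦ) (hi hΨ)).symm
  · rintro ⟨t₀, x₀⟩ hp
    have ht₀ : t₀ ≠ 0 := hp.1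
    obtain ⟨N, hN, J, hJ, hJa⟩ := eventually_mollSum_eq (s := s) hμ hs hχ hψ hρ hb hp
    have hNd : diag ⁻¹' N ∈ 𝓝 (t₀, x₀) := continuous_diag.continuousAt.preimage_mem_nhds hN
    have hred : ∀ Ψ, IsTest 𝓘₁[n] (diag ⁻¹' domainOver U) Ψ → tsupport Ψ ⊆ diag ⁻¹' N →
        (fun j => ∑ α ∈ s, ∫ q, mollKernel hμ φ α (χ α) (ψ α) (ρ j) (diag q) * (b J q * Ψ q)
          ∂(volume.prod μ)) =ᶠ[atTop] fun j =>
        ∫ q, mollSum hμ φ s χ ψ (b j) (ρ j) (diag q) * Ψ q ∂(volume.prod μ) := fun Ψ hΨ hΨN => by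
      filter_upwards [hJ] with j hj
      refine (integral_mollSum_diag_mul hμ hs hχ hψ (hρ.smooth j) (hb.smooth J) hΨ).symm.trans ?_
      refine integral_congr_ae (ae_of_all _ fun q => ?_)
      by_cases h0 : Ψ q = 0
      · simp [h0]
      · simp only [hj _ (hΨN (subset_tsupport _ h0))]
    by_cases hfix : φ t₀ x₀ = x₀
    · obtain ⟨ε, ⟨⟨N₁, hN₁, hsum⟩, hmoll⟩, hε⟩ := ((h.eventually_orbitSum_eq hwt ht₀ hfix).and
        ((Filter.eventually_all_finset s).2 fun α _ =>
          h.tendsto_integral_mollKernel_diag hμ (hχ α) (hψ α) hρ ht₀ hfix)).and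
        self_mem_nhdsWithin |>.exists
      choose! N₂ hN₂ hlim using hmoll
      refine ⟨(diag ⁻¹' N ∩ N₁) ∩ ⋂ α ∈ s, N₂ α, inter_mem (inter_mem hNd hN₁)
        ((biInter_finset_mem s).2 hN₂), fun Ψ hΨ hΨN => ?_⟩
      refine Tendsto.congr' (hred Ψ hΨ fun q hq => (hΨN hq).1.1) ?_
      have hbΨ := hΨ.mul (hb.smooth J)
      have h3 := tendsto_finsetSum s fun α hα => hlim α hα _ _ hbΨ
        ((tsupport_comp_eq_subset fun q hq => by simp [hq]).trans
          (hΨN.trans (inter_subset_right.trans (biInter_subset_of_mem (t := N₂) hα))))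
      convert h3 using 2
      rw [hsum Ψ hΨ.continuous fun q hq => (hΨN hq).1.2, ← Finset.mul_sum,
        ← intervalIntegral.integral_finsetSum]
      · rw [← intervalIntegral.integral_const_mul, ← intervalIntegral.integral_const_mul]
        refine intervalIntegral.integral_congr fun r _ => ?_
        simp only [← Finset.sum_mul]
        rw [hχψ, one_mul]
        by_cases h0 : Ψ (t₀, φ r x₀) = 0
        · simp [h0]
        have hr := hs.period_apply hfix r
        have hm := hΨN (subset_tsupport _ h0)
        have hg : flowGraph φ (t₀, φ r x₀) = diag (t₀, φ r x₀) := by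
          simp only [flowGraph, diag]
          rw [hs.neg_period hr]
        rw [← hJa (t₀, φ r x₀) (by rw [hg]; exact hm.1.1),
          hwa t₀ (φ r x₀) hr ht₀ (hΨ.2.2 (subset_tsupport _ h0)).2.1, hwt _ _ _ hfix,
          h.absDet_transport hfix r hr]
        have hne : (h.absDet hfix : ℂ) ≠ 0 := Complex.ofReal_ne_zero.2 (h.absDet_pos ht₀ hfix).ne'
        push_cast
        field_simp
      · intro α _
        refine Continuous.intervalIntegrable ?_ _ _
        have ho := (hs.contMDiff_orbit x₀).continuous
        exact ((((hχ α).smooth.continuous.comp ho).mul ((hψ α).smooth.continuous.comp ho))).mul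
          (hbΨ.continuous.comp (continuous_const.prodMk ho))
    · choose N₂ hN₂ hj using fun α => eventually_mollKernel_eq_zero hμ hs (hχ α) (hψ α) hρ
        (p := diag (t₀, x₀)) fun hm => hfix (hs.neg_period_iff.1 hm.1)
      have hN₃ : {q : ℝ × X | φ q.1 q.2 ≠ q.2} ∈ 𝓝 (t₀, x₀) :=
        (isOpen_ne_fun hs.smooth.continuous continuous_snd).mem_nhds hfix
      refine ⟨(diag ⁻¹' N ∩ {q : ℝ × X | φ q.1 q.2 ≠ q.2}) ∩ ⋂ α ∈ s, diag ⁻¹' N₂ α,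
        inter_mem (inter_mem hNd hN₃) ((biInter_finset_mem s).2 fun α _ =>
          continuous_diag.continuousAt.preimage_mem_nhds (hN₂ α)), fun Ψ hΨ hΨN => ?_⟩
      refine Tendsto.congr' (hred Ψ hΨ fun q hq => (hΨN hq).1.1) ?_
      rw [orbitSum_eq_zero hs fun t x _ hx => by
        by_contra h0
        exact (hΨN (subset_tsupport _ h0)).1.2 hx]
      refine tendsto_const_nhds.congr' ?_
      filter_upwards [(Filter.eventually_all_finset s).2 fun α _ => hj α] with j hj
      refine (Finset.sum_eq_zero fun α hα => integral_eq_zero_of_ae (ae_of_all _ fun q => ?_)).symm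
      by_cases h0 : Ψ q = 0
      · simp [h0]
      · simp [hj α hα _ (mem_iInter₂.1 (hΨN (subset_tsupport _ h0)).2 α hα)]

/-- The kernel `a(t, y) δ(x - φ_{-t}(y))` restricts to the diagonal, as a sum over the closed
trajectories. -/
theorem IsAnosov.graphKernel_restriction (hμ : IsSmoothDensity (n := n) μ)
    (h : IsAnosov φ Es Eu) (hU : IsOpen U)
    (ha : ContMDiffOn 𝓘₁[n] 𝓘(ℝ, ℂ) ∞ a (flowDomain φ U))
    (hwt : ∀ T x s, φ T x = x → wt T (φ s x) = wt T x)
    (hwa : ∀ T x (hx : φ T x = x), T ≠ 0 → x ∈ U → a (T, x) = wt T x * (h.absDet hx : ℂ)) :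
    IsDiagonalPullback n μ U (graphKernel μ φ a) (orbitSum φ wt) ∧
      ∀ σ, IsDiagonalPullback n μ U (graphKernel μ φ a) σ →
        ∀ χ, IsTest 𝓘₁[n] (diag ⁻¹' domainOver U) χ → σ χ = orbitSum φ wt χ := by
  obtain ⟨s, χ, ψ, hχ, hψ, hχψ⟩ := exists_chartCutoffs (n := n) (X := X)
  obtain ⟨ρ, hρ⟩ := exists_isMollifier (volume : Measure 𝔼[n])
  obtain ⟨b, hb⟩ := exists_isExhaustion (isOpen_flowDomain h.toIsSmoothFlow hU) ha
  have hv := h.convergesOffNormals_mollSum hμ hχ hψ hχψ hρ hU ha hb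
  have hlim := fun χ' (hχ' : IsTest 𝓘₁[n] (diag ⁻¹' domainOver U) χ') =>
    h.tendsto_integral_mollSum_diag hμ hχ hψ hχψ hρ hb hwt hwa hχ'
  refine ⟨⟨⟨_, hv⟩, fun v' hv' χ' hχ' => ?_⟩, fun σ hσ χ' hχ' =>
    tendsto_nhds_unique (hσ.2 _ hv χ' hχ') (hlim χ' hχ')⟩
  obtain ⟨Λ, h1, h2⟩ := exists_tendsto_diag (isOpen_domainOver hU) hv hv' hμ hχ'
  rwa [tendsto_nhds_unique (hlim χ' hχ') h1]

theorem IsAnosov.disjoint_waveFrontSet_graphKernel (hμ : IsSmoothDensity (n := n) μ)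
    (h : IsAnosov φ Es Eu) (hU : IsOpen U)
    (ha : ContMDiffOn 𝓘₁[n] 𝓘(ℝ, ℂ) ∞ a (flowDomain φ U)) :
    Disjoint (waveFrontSet 𝓙[n] (domainOver U) (graphKernel μ φ a))
      (normals 𝓙[n] 𝓘₁[n] (diag (X := X))) := by
  obtain ⟨s, χ, ψ, hχ, hψ, hχψ⟩ := exists_chartCutoffs (n := n) (X := X)
  obtain ⟨ρ, hρ⟩ := exists_isMollifier (volume : Measure 𝔼[n])
  obtain ⟨b, hb⟩ := exists_isExhaustion (isOpen_flowDomain h.toIsSmoothFlow hU) ha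
  exact disjoint_waveFrontSet_normals (h.convergesOffNormals_mollSum hμ hχ hψ hχψ hρ hU ha hb)

end DiagonalLimit

end Guillemin

end

/-! ### Alternating forms: extension, smooth composition, coordinates in frames. -/

noncomputable section

namespace Guillemin

set_option linter.unusedSectionVars false

section AlternatingForms

variable {E : Type*} [NormedAddCommGroup E] [NormedSpace ℝ E] [FiniteDimensional ℝ E] {k : ℕ}

instance finiteDimensional_continuousMultilinearMap (G : Type*) [NormedAddCommGroup G]
    [NormedSpace ℝ G] [FiniteDimensional ℝ G] :
    FiniteDimensional ℝ (ContinuousMultilinearMap ℝ (fun _ : Fin k => E) G) :=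
  FiniteDimensional.of_injective
    ({ toFun := fun f => f.toMultilinearMap
       map_add' := fun _ _ => rfl
       map_smul' := fun _ _ => rfl } : ContinuousMultilinearMap ℝ (fun _ : Fin k => E) G →ₗ[ℝ]
        MultilinearMap ℝ (fun _ : Fin k => E) G)
    ContinuousMultilinearMap.toMultilinearMap_injective

instance finiteDimensional_continuousAlternatingMap (G : Type*) [NormedAddCommGroup G]
    [NormedSpace ℝ G] [FiniteDimensional ℝ G] : FiniteDimensional ℝ (E [⋀^Fin k]→L[ℝ] G) :=
  FiniteDimensional.of_injective
    (ContinuousAlternatingMap.toContinuousMultilinearMapLI (𝕜 := ℝ) (E := E) (F := G)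
      (ι := Fin k)).toLinearMap
    (ContinuousAlternatingMap.toContinuousMultilinearMapLI (𝕜 := ℝ) (E := E) (F := G)
      (ι := Fin k)).injective

/-- An alternating map on a finite dimensional space is continuous. -/
def continuousAlternating (f : E [⋀^Fin k]→ₗ[ℝ] ℂ) : E [⋀^Fin k]→L[ℝ] ℂ where
  toMultilinearMap := f.toMultilinearMap
  cont := by
    have b := Module.finBasis ℝ E
    have h : ∀ v : Fin k → E, f v = ∑ r : Fin k → Fin (Module.finrank ℝ E),
        (∏ i, b.coord (r i) (v i)) • f fun i => b (r i) := fun v => by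
      conv_lhs => rw [show v = fun i => ∑ j, b.coord j (v i) • b j from
        funext fun i => (b.sum_repr (v i)).symm]
      have h1 := f.toMultilinearMap.map_sum (fun (i : Fin k) j => b.coord j (v i) • b j)
      refine h1.trans (Finset.sum_congr rfl fun r _ => ?_)
      exact f.toMultilinearMap.map_smul_univ _ _
    change Continuous fun v => f v
    refine Continuous.congr ?_ fun v => (h v).symm
    refine continuous_finsetSum _ fun r _ => ?_
    have h1 : Continuous fun v : Fin k → E => ∏ i, b.coord (r i) (v i) :=
      continuous_finsetProd _ fun i _ =>
        (LinearMap.continuous_of_finiteDimensional (b.coord (r i))).comp (continuous_apply i)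
    exact h1.smul continuous_const
  map_eq_zero_of_eq' := f.map_eq_zero_of_eq'

/-- A form annihilated by `X` depends on its arguments only modulo `X`; the arguments are changed
one at a time. -/
theorem alternating_add_smul_eq {α : E [⋀^Fin k]→L[ℝ] ℂ} {X : E}
    (h : ∀ v : Fin k → E, (∃ i, v i = X) → α v = 0) (v : Fin k → E) (c : Fin k → ℝ) :
    α (fun i => v i + c i • X) = α v := by
  classical
  have key : ∀ s : Finset (Fin k), α (fun i => if i ∈ s then v i + c i • X else v i) = α v := by
    intro s
    induction s using Finset.induction_on with
    | empty => simp
    | insert j s hj ih =>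
      rw [← ih]
      set w : Fin k → E := fun i => if i ∈ s then v i + c i • X else v i with hw
      have h1 : (fun i => if i ∈ insert j s then v i + c i • X else v i) =
          Function.update w j (w j + c j • X) := by
        funext i
        rcases eq_or_ne i j with rfl | hij
        · simp [hw, hj]
        · simp [hw, hij, Function.update_of_ne]
      rw [h1, ContinuousAlternatingMap.map_update_add, ContinuousAlternatingMap.map_update_smul,
        Function.update_eq_self, h (Function.update w j X) ⟨j, Function.update_self ..⟩, smul_zero,
        add_zero]
  have := key Finset.univ
  simpa using this

variable {H : Type*} [NormedAddCommGroup H] [NormedSpace ℝ H]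
  {B : Type*} [TopologicalSpace B] {I : ModelWithCorners ℝ H B}
  {Y : Type*} [TopologicalSpace Y] [ChartedSpace B Y]

/-- For multilinear maps, composition is polynomial in `A`. Alternating maps embed in multilinear
maps with a continuous linear left inverse in finite dimension, which carries smoothness back. -/
theorem contMDiffAt_compContinuousLinearMap {f : Y → E [⋀^Fin k]→L[ℝ] ℂ} {A : Y → E →L[ℝ] E}
    {y : Y} (hf : ContMDiffAt I 𝓘(ℝ, E [⋀^Fin k]→L[ℝ] ℂ) ∞ f y)
    (hA : ContMDiffAt I 𝓘(ℝ, E →L[ℝ] E) ∞ A y) :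
    ContMDiffAt I 𝓘(ℝ, E [⋀^Fin k]→L[ℝ] ℂ) ∞
      (fun y => (f y).compContinuousLinearMap (A y)) y := by
  obtain ⟨g, hg⟩ := ContinuousLinearMap.HasLeftInverse.of_injective_of_finiteDimensional
    (f := ContinuousAlternatingMap.toContinuousMultilinearMapCLM (𝕜 := ℝ) (E := E) (F := ℂ)
      (ι := Fin k) ℝ) ContinuousAlternatingMap.toContinuousMultilinearMap_injective
  have h1 : ContDiff ℝ ∞ (fun A : E →L[ℝ] E =>
      ContinuousMultilinearMap.compContinuousLinearMapContinuousMultilinear ℝ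
        (fun _ : Fin k => E) (fun _ : Fin k => E) ℂ (fun _ => A)) :=
    (ContinuousMultilinearMap.contDiff _).comp (contDiff_pi.2 fun _ => contDiff_id)
  have h2 := (h1.contMDiff.contMDiffAt.comp y hA).clm_apply
    ((ContinuousAlternatingMap.toContinuousMultilinearMapCLM (𝕜 := ℝ) (E := E) (F := ℂ)
      (ι := Fin k) ℝ).contDiff.contMDiff.contMDiffAt.comp y hf)
  have h3 := g.contDiff.contMDiff.contMDiffAt.comp y h2
  refine h3.congr_of_eventuallyEq (Eventually.of_forall fun z => ?_)
  exact (hg ((f z).compContinuousLinearMap (A z))).symm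

/-- Coordinates in a smooth frame are smooth. -/
theorem contMDiffAt_of_sum_smul {V : Type*} [NormedAddCommGroup V] [NormedSpace ℝ V]
    [NormedSpace ℂ V] [IsScalarTower ℝ ℂ V] [FiniteDimensional ℝ V] {r : ℕ}
    {e : Fin r → Y → V} {f : Y → V} {c : Y → Fin r → ℂ} {y : Y}
    (he : ∀ j, ContMDiffAt I 𝓘(ℝ, V) ∞ (e j) y) (hf : ContMDiffAt I 𝓘(ℝ, V) ∞ f y)
    (hinj : ∀ a : Fin r → ℂ, ∑ j, a j • e j y = 0 → a = 0)
    (hc : ∀ᶠ z in 𝓝 y, ∑ j, c z j • e j z = f z) :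
    ContMDiffAt I 𝓘(ℝ, Fin r → ℂ) ∞ c y := by
  set T : V →L[ℝ] ℂ →L[ℝ] V := (ContinuousLinearMap.lsmul ℝ ℂ).flip with hT
  set G : Y → (Fin r → ℂ) →L[ℝ] V := fun z =>
    ∑ j, (T (e j z)).comp (ContinuousLinearMap.proj (R := ℝ) (φ := fun _ : Fin r => ℂ) j) with hG
  have hGa : ∀ z a, G z a = ∑ j, a j • e j z := fun z a => by
    simp [hG, hT]
  have hGs : ContMDiffAt I 𝓘(ℝ, (Fin r → ℂ) →L[ℝ] V) ∞ G y := by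
    have h1 : ContDiff ℝ ∞ (fun w : Fin r → V => ∑ j, (T (w j)).comp
        (ContinuousLinearMap.proj (R := ℝ) (φ := fun _ : Fin r => ℂ) j)) :=
      ContDiff.sum fun j _ => (T.contDiff.comp (contDiff_apply ℝ V j)).clm_comp contDiff_const
    exact h1.contMDiff.contMDiffAt.comp y (contMDiffAt_pi_space.2 he)
  -- `L` inverts the frame map at the point `y` only, but `M z = L ∘ G z` is the identity at `y` and
  -- hence invertible nearby; there `c = M⁻¹ L f`, a smooth expression.
  obtain ⟨L, hL⟩ := ContinuousLinearMap.HasLeftInverse.of_injective_of_finiteDimensional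
    (f := G y) ((injective_iff_map_eq_zero (G y)).2 fun a ha => hinj a (by rw [← hGa, ha]))
  set M : Y → (Fin r → ℂ) →L[ℝ] (Fin r → ℂ) := fun z => L.comp (G z) with hM
  have hMy : M y = 1 := ContinuousLinearMap.ext fun a => hL a
  have hMs : ContMDiffAt I 𝓘(ℝ, (Fin r → ℂ) →L[ℝ] (Fin r → ℂ)) ∞ M y :=
    contMDiffAt_const.clm_comp hGs
  have hMi : ContMDiffAt I 𝓘(ℝ, (Fin r → ℂ) →L[ℝ] (Fin r → ℂ)) ∞
      (fun z => Ring.inverse (M z)) y := by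
    have h1 := contDiffAt_ringInverse ℝ (n := ∞) (1 : ((Fin r → ℂ) →L[ℝ] (Fin r → ℂ))ˣ)
    rw [Units.val_one, ← hMy] at h1
    exact h1.contMDiffAt.comp y hMs
  have h2 := hMi.clm_apply ((L.contDiff.contMDiff.contMDiffAt (x := f y)).comp y hf)
  refine h2.congr_of_eventuallyEq ?_
  have hu : ∀ᶠ z in 𝓝 y, IsUnit (M z) :=
    hMs.continuousAt.eventually (Units.isOpen.mem_nhds (by rw [hMy]; exact isUnit_one))
  filter_upwards [hu, hc] with z hz hcz
  have h3 : M z (c z) = L (f z) := by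
    rw [← hcz, ← hGa]
    rfl
  simp only [Function.comp]
  rw [← h3, ← mul_apply_eq_comp, Ring.inverse_mul_cancel _ hz,
    one_apply_eq_self]

end AlternatingForms

end Guillemin

end

/-! ### The propagator on forms and its matrix entries. -/

noncomputable section

namespace Guillemin

set_option linter.unusedSectionVars false

local notation "𝔼[" n "]" => EuclideanSpace ℝ (Fin n)
local notation "𝓘₁[" n "]" => ModelWithCorners.prod 𝓘(ℝ, ℝ) (𝓡 n)

section Forms

variable {n : ℕ} {X : Type*} [TopologicalSpace X] [ChartedSpace 𝔼[n] X] [IsManifold (𝓡 n) ∞ X]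
  {φ : ℝ → X → X} {k : ℕ}

/-- The trivialization at `x₀` of the tangent bundle, from the fibre at `x`. -/
def toTriv (x₀ x : X) : 𝔼[n] →L[ℝ] 𝔼[n] :=
  (trivializationAt 𝔼[n] (TangentSpace (𝓡 n)) x₀).continuousLinearMapAt ℝ x

/-- The inverse of the trivialization at `x₀` of the tangent bundle, to the fibre at `x`. -/
def ofTriv (x₀ x : X) : 𝔼[n] →L[ℝ] 𝔼[n] :=
  (trivializationAt 𝔼[n] (TangentSpace (𝓡 n)) x₀).symmL ℝ x

theorem ofTriv_toTriv {x₀ x : X} (hx : x ∈ (chartAt 𝔼[n] x₀).source) (v : 𝔼[n]) :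
    ofTriv x₀ x (toTriv x₀ x v) = v :=
  (trivializationAt 𝔼[n] (TangentSpace (𝓡 n)) x₀).symmL_continuousLinearMapAt (R := ℝ) hx v

theorem toTriv_ofTriv {x₀ x : X} (hx : x ∈ (chartAt 𝔼[n] x₀).source) (v : 𝔼[n]) :
    toTriv x₀ x (ofTriv x₀ x v) = v :=
  (trivializationAt 𝔼[n] (TangentSpace (𝓡 n)) x₀).continuousLinearMapAt_symmL (R := ℝ) hx v

/-- The value of a form, as a form on the model space. -/
def Form.val (u : Form n X k) (x : X) : 𝔼[n] [⋀^Fin k]→L[ℝ] ℂ := u x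

/-- The coefficients of a form in the trivialization at `x₀`. -/
def Form.coeff (u : Form n X k) (x₀ x : X) : 𝔼[n] [⋀^Fin k]→L[ℝ] ℂ :=
  (u.val x).compContinuousLinearMap (ofTriv x₀ x)

theorem Form.smoothAt_iff {u : Form n X k} {x₀ : X} : u.SmoothAt x₀ ↔
    ContMDiffAt (𝓡 n) 𝓘(ℝ, 𝔼[n] [⋀^Fin k]→L[ℝ] ℂ) ∞ (u.coeff x₀) x₀ := Iff.rfl

theorem Form.val_eq {u : Form n X k} {x₀ x : X} (hx : x ∈ (chartAt 𝔼[n] x₀).source) :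
    u.val x = (u.coeff x₀ x).compContinuousLinearMap (toTriv x₀ x) := by
  ext v
  exact congrArg (u.val x) (funext fun i => (ofTriv_toTriv hx (v i)).symm)

theorem pullForm_val (t : ℝ) (u : Form n X k) (y : X) :
    (pullForm φ t u).val y = (u.val (φ t y)).compContinuousLinearMap (dflow φ t y) := rfl

/-- The pullback of a form by the flow is smooth in time and space. -/
theorem IsSmoothFlow.contMDiffAt_pullForm (hs : IsSmoothFlow (n := n) φ) {u : Form n X k} {t : ℝ}
    {y : X} (hu : u.SmoothAt (φ t y)) :
    ContMDiffAt 𝓘₁[n] 𝓘(ℝ, 𝔼[n] [⋀^Fin k]→L[ℝ] ℂ) ∞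
      (fun q => (pullForm φ q.1 u).coeff y q.2) (t, y) := by
  -- Joint smoothness of `dφ_t(y)`, read in trivializations at source and target, is the smoothness
  -- of a derivative with parameters.
  have hA : ContMDiffAt 𝓘₁[n] 𝓘(ℝ, 𝔼[n] →L[ℝ] 𝔼[n]) ∞
      (fun q : ℝ × X => (toTriv (φ t y) (φ q.1 q.2)).comp
        ((dflow (n := n) φ q.1 q.2).comp (ofTriv y q.2))) (t, y) := by
    refine ContMDiffAt.mfderiv (J := 𝓘₁[n]) (I := 𝓡 n) (I' := 𝓡 n) (M := X) (M' := X) (x₀ := (t, y)) (n := ∞) (m := ∞)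
      (fun q x => φ q.1 x) (fun q => q.2) ?_ contMDiffAt_snd le_rfl
    exact (hs.smooth.comp ((contMDiff_fst.comp contMDiff_fst).prodMk contMDiff_snd)) _
  have hU : ContMDiffAt 𝓘₁[n] 𝓘(ℝ, 𝔼[n] [⋀^Fin k]→L[ℝ] ℂ) ∞
      (fun q : ℝ × X => u.coeff (φ t y) (φ q.1 q.2)) (t, y) :=
    ContMDiffAt.comp (t, y) (g := u.coeff (φ t y)) (Form.smoothAt_iff.1 hu) hs.smooth.contMDiffAt
  refine (contMDiffAt_compContinuousLinearMap hU hA).congr_of_eventuallyEq ?_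
  have h1 : ∀ᶠ q : ℝ × X in 𝓝 (t, y), φ q.1 q.2 ∈ (chartAt 𝔼[n] (φ t y)).source :=
    hs.smooth.continuous.continuousAt.eventually (chart_source_mem_nhds _ _)
  filter_upwards [h1] with q hq
  rw [Form.coeff, pullForm_val, Form.val_eq hq]
  rfl

theorem Form.SmoothAt.pullForm (hs : IsSmoothFlow (n := n) φ) {u : Form n X k} {t : ℝ}
    {y : X} (hu : u.SmoothAt (φ t y)) : (pullForm φ t u).SmoothAt y := by
  have h1 : ContMDiffAt (𝓡 n) 𝓘₁[n] ∞ (fun x : X => (t, x)) y :=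
    contMDiffAt_const.prodMk contMDiffAt_id
  exact ContMDiffAt.comp y (g := fun q : ℝ × X => (Guillemin.pullForm φ q.1 u).coeff y q.2)
    (hs.contMDiffAt_pullForm hu) h1

theorem IsSmoothFlow.differentiableAt_pullForm (hs : IsSmoothFlow (n := n) φ) {u : Form n X k}
    {t : ℝ} {y : X} (hu : u.SmoothAt (φ t y)) (v : Fin k → 𝔼[n]) :
    DifferentiableAt ℝ (fun t => (pullForm φ t u).val y v) t := by
  have h1 : ContMDiffAt 𝓘(ℝ, ℝ) 𝓘₁[n] ∞ (fun t : ℝ => (t, y)) t :=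
    contMDiffAt_id.prodMk contMDiffAt_const
  have h2 : ContMDiffAt 𝓘(ℝ, ℝ) 𝓘(ℝ, 𝔼[n] [⋀^Fin k]→L[ℝ] ℂ) ∞
      (fun t => (pullForm φ t u).coeff y y) t :=
    ContMDiffAt.comp t (g := fun q : ℝ × X => (pullForm φ q.1 u).coeff y q.2)
    (hs.contMDiffAt_pullForm hu) h1
  have h3 : DifferentiableAt ℝ (fun t => (pullForm φ t u).coeff y y) t :=
    h2.contDiffAt.differentiableAt (by simp)
  have h4 := (ContinuousAlternatingMap.apply ℝ 𝔼[n] ℂ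
    (fun i => toTriv y y (v i))).differentiableAt.comp t h3
  refine h4.congr_of_eventuallyEq (Eventually.of_forall fun t => ?_)
  simp only [Function.comp, ContinuousAlternatingMap.apply_apply]
  rw [Form.val_eq (mem_chart_source _ y)]
  rfl

theorem Form.val_eq_of_eq (u : Form n X k) {x y : X} (h : x = y) : u.val x = u.val y := by rw [h]

theorem IsSmoothFlow.pullForm_zero (hs : IsSmoothFlow (n := n) φ) (u : Form n X k) :
    pullForm φ 0 u = u := by
  funext y
  change (pullForm φ 0 u).val y = u.val y
  rw [pullForm_val, hs.dflow_zero, u.val_eq_of_eq (hs.zero y)]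
  rfl

theorem IsSmoothFlow.pullForm_add (hs : IsSmoothFlow (n := n) φ) (s t : ℝ) (u : Form n X k) :
    pullForm φ s (pullForm φ t u) = pullForm φ (t + s) u := by
  funext y
  change (pullForm φ s (pullForm φ t u)).val y = (pullForm φ (t + s) u).val y
  rw [pullForm_val, pullForm_val, pullForm_val, hs.dflow_add, u.val_eq_of_eq (hs.add t s y)]
  rfl

theorem IsSmoothFlow.annihilated_pullForm (hs : IsSmoothFlow (n := n) φ) {u : Form n X k} {t : ℝ}
    {y : X} (hu : Annihilated φ (φ t y) (u (φ t y))) : Annihilated φ y (pullForm φ t u y) := by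
  rintro v ⟨i, hi⟩
  refine hu (fun i => dflow φ t y (v i)) ⟨i, ?_⟩
  rw [hi]
  exact hs.dflow_gen t y

/-- By the group law, the derivative of `φ_{-s}^* u` at `s = t` is minus the Lie derivative of
`φ_{-t}^* u`; the factor `1/i` in `P` turns it into `-iP`. -/
theorem IsSmoothFlow.hasDerivAt_propagator (hs : IsSmoothFlow (n := n) φ) {u : Form n X k}
    (hu : ∀ x, u.SmoothAt x) (t : ℝ) (x : X) (v : Fin k → TangentSpace (𝓡 n) x) :
    HasDerivAt (fun s : ℝ => propagator φ s u x v)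
      (-Complex.I * opP φ (propagator φ t u) x v) t := by
  set F : ℝ → ℂ := fun s => (pullForm φ s u).val x v with hF
  have hd : HasDerivAt F (deriv F (-t)) (-t) :=
    (hs.differentiableAt_pullForm (hu _) v).hasDerivAt
  have h1 : (fun s : ℝ => pullForm φ s (propagator φ t u) x v) = fun s => F (-t + s) := by
    funext s
    rw [propagator, hs.pullForm_add]
    rfl
  have h2 : deriv (fun s : ℝ => pullForm φ s (propagator φ t u) x v) 0 = deriv F (-t) := by
    rw [h1, deriv_comp_const_add, add_zero]
  have h3 : HasDerivAt (fun s : ℝ => F (-s)) (-deriv F (-t)) t := by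
    have := hd.scomp t (hasDerivAt_neg t)
    rwa [neg_one_smul] at this
  have h4 : opP φ (propagator φ t u) x v = (1 / Complex.I) * deriv F (-t) := by
    rw [← h2]
    rfl
  refine h3.congr_deriv ?_
  rw [h4, ← mul_assoc]
  have : -Complex.I * (1 / Complex.I) = -1 := by
    rw [neg_mul, mul_one_div_cancel Complex.I_ne_zero]
  rw [this, neg_one_mul]

variable {U : Set X} {r : ℕ}

theorem LocalFrame.entry_eq (𝓕 : LocalFrame (n := n) φ k U r) (j l : Fin r) (t : ℝ) (f : X → ℂ)
    (y : X) : 𝓕.entry j l t f y = 𝓕.coord j y (pullForm φ (-t) (𝓕.e l) y) * f (φ (-t) y) := by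
  have h1 : propagator φ t (fun x => f x • 𝓕.e l x) y =
      f (φ (-t) y) • pullForm φ (-t) (𝓕.e l) y := rfl
  rw [LocalFrame.entry, h1, map_smul, smul_eq_mul, mul_comm]

/-- The coefficient of `f ∘ φ_{-t}` in the matrix entries of the propagator is smooth. -/
theorem LocalFrame.contMDiffOn_coord (hs : IsSmoothFlow (n := n) φ) (hU : IsOpen U)
    (𝓕 : LocalFrame (n := n) φ k U r) (j l : Fin r) :
    ContMDiffOn 𝓘₁[n] 𝓘(ℝ, ℂ) ∞
      (fun q : ℝ × X => 𝓕.coord j q.2 (pullForm φ (-q.1) (𝓕.e l) q.2)) (flowDomain φ U) := by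
  rintro ⟨t, y⟩ ht
  refine ContMDiffAt.contMDiffWithinAt ?_
  set c : ℝ × X → Fin r → ℂ := fun q j => 𝓕.coord j q.2 (pullForm φ (-q.1) (𝓕.e l) q.2) with hc
  suffices h : ContMDiffAt 𝓘₁[n] 𝓘(ℝ, Fin r → ℂ) ∞ c (t, y) from contMDiffAt_pi_space.1 h j
  -- No regularity of `coord` is assumed. Its values on the pulled back frame are smooth because
  -- they are the coordinates of a smooth form in a smooth frame.
  refine contMDiffAt_of_sum_smul (e := fun j q => (𝓕.e j).coeff y q.2)
    (f := fun q => (pullForm φ (-q.1) (𝓕.e l)).coeff y q.2) (fun j => ?_) ?_ (fun a ha => ?_) ?_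
  · exact ContMDiffAt.comp (t, y) (g := (𝓕.e j).coeff y)
      (Form.smoothAt_iff.1 (𝓕.smooth j y ht.1)) contMDiffAt_snd
  · have h1 : ContMDiff 𝓘₁[n] 𝓘₁[n] ∞ (fun q : ℝ × X => (-q.1, q.2)) :=
      (contDiff_neg.contMDiff.comp contMDiff_fst).prodMk contMDiff_snd
    exact ContMDiffAt.comp (t, y)
      (g := fun q : ℝ × X => (pullForm φ q.1 (𝓕.e l)).coeff y q.2)
      (hs.contMDiffAt_pullForm (𝓕.smooth l _ ht.2)) h1.contMDiffAt
  · have h1 : ∑ j, a j • 𝓕.e j y = 0 := by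
      have h2 : ∑ j, a j • (𝓕.e j).val y = 0 := by
        have h3 : ∀ j, a j • (𝓕.e j).val y =
            (a j • (𝓕.e j).coeff y y).compContinuousLinearMap (toTriv y y) := fun j => by
          rw [Form.val_eq (mem_chart_source _ y)]
          rfl
        ext v
        simp only [h3, ContinuousAlternatingMap.sum_apply,
          ContinuousAlternatingMap.compContinuousLinearMap_apply]
        have h4 := DFunLike.congr_fun ha (toTriv y y ∘ v)
        rwa [ContinuousAlternatingMap.sum_apply] at h4
      exact h2
    funext i
    have h5 := congrArg (𝓕.coord i y) h1
    rw [map_sum, map_zero] at h5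
    simp only [map_smul, 𝓕.coord_e _ _ y ht.1, smul_eq_mul, mul_ite, mul_one, mul_zero,
      Finset.sum_ite_eq, Finset.mem_univ, if_true] at h5
    exact h5
  · filter_upwards [(isOpen_flowDomain hs hU).mem_nhds ht] with q hq
    have h1 := 𝓕.sum_coord q.2 hq.1 _
      (hs.annihilated_pullForm (u := 𝓕.e l) (t := -q.1) (𝓕.annihilated l _ hq.2))
    have h2 : ∑ j, c q j • (𝓕.e j).val q.2 = (pullForm φ (-q.1) (𝓕.e l)).val q.2 := h1
    ext v
    have h3 := DFunLike.congr_fun h2 (ofTriv y q.2 ∘ v)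
    rw [ContinuousAlternatingMap.sum_apply] at h3 ⊢
    exact h3

end Forms

end Guillemin

end

/-! ### The trace of the pullback on forms annihilated by the generator. -/

noncomputable section

namespace Guillemin

set_option linter.unusedSectionVars false

local notation "𝔼[" n "]" => EuclideanSpace ℝ (Fin n)

section TraceAlgebra

variable {E : Type*} [NormedAddCommGroup E] [NormedSpace ℝ E] [FiniteDimensional ℝ E] {k : ℕ}

/-- The restriction of an alternating form to a subspace, as a functional on the exterior power. -/
def restrictExt (S : Submodule ℝ E) (α : E [⋀^Fin k]→L[ℝ] ℂ) : ⋀[ℝ]^k S →ₗ[ℝ] ℂ :=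
  exteriorPower.alternatingMapLinearEquiv (α.toAlternatingMap.compLinearMap S.subtype)

/-- The extension of a functional on the exterior power of a subspace to an alternating form, by
means of a projection onto the subspace. -/
def extendExt {S : Submodule ℝ E} (π : E →ₗ[ℝ] S) (g : ⋀[ℝ]^k S →ₗ[ℝ] ℂ) : E [⋀^Fin k]→L[ℝ] ℂ :=
  continuousAlternating ((g.compAlternatingMap (exteriorPower.ιMulti ℝ k)).compLinearMap π)

theorem restrictExt_ιMulti (S : Submodule ℝ E) (α : E [⋀^Fin k]→L[ℝ] ℂ) (s : Fin k → S) :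
    restrictExt S α (exteriorPower.ιMulti ℝ k s) = α fun i => (s i : E) :=
  exteriorPower.alternatingMapLinearEquiv_apply_ιMulti _ _

theorem extendExt_apply {S : Submodule ℝ E} (π : E →ₗ[ℝ] S) (g : ⋀[ℝ]^k S →ₗ[ℝ] ℂ)
    (v : Fin k → E) : extendExt π g v = g (exteriorPower.ιMulti ℝ k fun i => π (v i)) := rfl

theorem trace_eq_sum_repr {V ι : Type*} [AddCommGroup V] [Module ℝ V] [Fintype ι]
    (b : Module.Basis ι ℝ V) (f : V →ₗ[ℝ] V) : LinearMap.trace ℝ V f = ∑ i, b.repr (f (b i)) i := by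
  classical
  rw [LinearMap.trace_eq_matrix_trace ℝ b, Matrix.trace]
  simp [LinearMap.toMatrix_apply]

/-- The trace, on alternating forms that are annihilated by a fixed vector of `R`, of the pullback
by `R`. -/
theorem sum_coord_comp_eq_trace {X₀ : E} {S : Submodule ℝ E} (hS : IsCompl (Submodule.span ℝ {X₀}) S)
    {R : E →L[ℝ] E} (hR : R X₀ = X₀) {P : S →ₗ[ℝ] S} (hP : ∀ s : S, (P s : E) = R s) {r : ℕ}
    {e : Fin r → E [⋀^Fin k]→L[ℝ] ℂ} {c : Fin r → (E [⋀^Fin k]→L[ℝ] ℂ) →ₗ[ℂ] ℂ}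
    (he : ∀ j, ∀ v : Fin k → E, (∃ i, v i = X₀) → e j v = 0)
    (hc : ∀ α : E [⋀^Fin k]→L[ℝ] ℂ, (∀ v : Fin k → E, (∃ i, v i = X₀) → α v = 0) →
      ∑ j, c j α • e j = α) :
    ∑ j, c j ((e j).compContinuousLinearMap R) =
      (LinearMap.trace ℝ _ (exteriorPower.map k P) : ℂ) := by
  set π := S.projectionOnto _ hS.symm with hπ
  have hπX : π X₀ = 0 := Submodule.projectionOnto_apply_of_mem_right hS.symm
    (Submodule.mem_span_singleton_self X₀)
  have hπS : ∀ s : S, π s = s := Submodule.projectionOnto_apply_left hS.symm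
  have hdec : ∀ v, ∃ a : ℝ, v = π v + a • X₀ := fun v => by
    obtain ⟨x, hx, y, hy, rfl⟩ := Submodule.mem_sup.1
      (hS.sup_eq_top ▸ Submodule.mem_top : v ∈ Submodule.span ℝ {X₀} ⊔ S)
    obtain ⟨a, rfl⟩ := Submodule.mem_span_singleton.1 hx
    refine ⟨a, ?_⟩
    rw [map_add, map_smul, hπX, smul_zero, zero_add, hπS ⟨y, hy⟩, add_comm]
  choose a ha using hdec
  set b := Module.finBasis ℝ (⋀[ℝ]^k S) with hb
  set D : Fin _ → (⋀[ℝ]^k S →ₗ[ℝ] ℂ) := fun i => Complex.ofRealCLM.toLinearMap.comp (b.coord i) with hD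
  have hDann : ∀ i, ∀ v : Fin k → E, (∃ i, v i = X₀) → extendExt π (D i) v = 0 := fun i v hv => by
    obtain ⟨l, hl⟩ := hv
    rw [extendExt_apply, AlternatingMap.map_coord_zero _ (i := l) (by rw [hl, hπX]), map_zero]
  -- The pullback of `e j` is still annihilated by `X₀`, so it is determined by its restriction to
  -- `S` and expands in the extensions of the dual basis of `⋀^k S`.
  have hpull : ∀ j, (e j).compContinuousLinearMap R =
      ∑ i, restrictExt S (e j) (exteriorPower.map k P (b i)) • extendExt π (D i) := fun j => by
    ext v
    have h1 : (e j).compContinuousLinearMap R v =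
        restrictExt S (e j) (exteriorPower.map k P (exteriorPower.ιMulti ℝ k fun i => π (v i))) := by
      rw [exteriorPower.map_apply_ιMulti, restrictExt_ιMulti]
      simp only [Function.comp, hP]
      rw [← alternating_add_smul_eq (he j) _ fun i => a (v i)]
      refine congrArg (e j) (funext fun i => ?_)
      change R (v i) = R (π (v i) : E) + a (v i) • X₀
      conv_lhs => rw [ha (v i), map_add, map_smul, hR]
    rw [h1]
    conv_lhs => rw [← b.sum_repr (exteriorPower.ιMulti ℝ k fun i => π (v i))]
    simp only [map_sum, map_smul, ContinuousAlternatingMap.sum_apply,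
      ContinuousAlternatingMap.smul_apply, extendExt_apply, hD]
    refine Finset.sum_congr rfl fun i _ => ?_
    rw [Complex.real_smul, smul_eq_mul, mul_comm]
    rfl
  -- Completeness of the frame, applied to the extended dual basis; it eliminates the frame from the
  -- trace and leaves the diagonal entries of `⋀^k P`.
  have hsum : ∀ i w, ∑ j, c j (extendExt π (D i)) * restrictExt S (e j) w = D i w := fun i w => by
    have h1 : ∑ j, (c j (extendExt π (D i))) • restrictExt S (e j) = D i := by
      refine exteriorPower.linearMap_ext (AlternatingMap.ext fun s => ?_)
      have h2 := DFunLike.congr_fun (hc _ (hDann i)) fun i => (s i : E)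
      rw [ContinuousAlternatingMap.sum_apply, extendExt_apply] at h2
      simp only [hπS] at h2
      simp only [LinearMap.compAlternatingMap_apply, LinearMap.sum_apply, LinearMap.smul_apply,
        restrictExt_ιMulti]
      exact h2
    have h3 := DFunLike.congr_fun h1 w
    rwa [LinearMap.sum_apply] at h3
  calc ∑ j, c j ((e j).compContinuousLinearMap R)
      = ∑ j, ∑ i, c j (extendExt π (D i)) *
          restrictExt S (e j) (exteriorPower.map k P (b i)) := by
        refine Finset.sum_congr rfl fun j _ => ?_
        rw [hpull, map_sum]
        exact Finset.sum_congr rfl fun i _ => by rw [map_smul, smul_eq_mul, mul_comm]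
    _ = ∑ i, D i (exteriorPower.map k P (b i)) := by
        rw [Finset.sum_comm]
        exact Finset.sum_congr rfl fun i _ => hsum i _
    _ = _ := by
        rw [trace_eq_sum_repr b, Complex.ofReal_sum]
        rfl

end TraceAlgebra

section FrameTrace

variable {n : ℕ} {X : Type*} [TopologicalSpace X] [ChartedSpace 𝔼[n] X] [IsManifold (𝓡 n) ∞ X]
  {φ : ℝ → X → X} {Es Eu : ∀ x : X, Submodule ℝ (TangentSpace (𝓡 n) x)} {k : ℕ} {U : Set X} {r : ℕ}

theorem IsAnosov.sum_coord_eq_traceExt (h : IsAnosov φ Es Eu) {x : X} {T : ℝ} (hx : φ T x = x)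
    (𝓕 : LocalFrame (n := n) φ k U r) (hxU : x ∈ U) :
    ∑ j, 𝓕.coord j x (pullForm φ (-T) (𝓕.e j) x) = (h.traceExt hx k : ℂ) := by
  have hs := h.toIsSmoothFlow
  have hx' := hs.neg_period hx
  have hgen : dflow φ (-T) x (gen φ x) = gen (n := n) φ x := by
    rw [hs.dflow_gen, hx']
  have h1 : ∀ j, (pullForm φ (-T) (𝓕.e j)).val x =
      ((𝓕.e j).val x).compContinuousLinearMap (dflow φ (-T) x) := fun j => by
    rw [pullForm_val, Form.val_eq_of_eq _ hx']
  have h2 := sum_coord_comp_eq_trace (k := k) (r := r) (h.isCompl_fib x) hgen (P := h.returnFib hx)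
    (fun s => rfl) (e := fun j => (𝓕.e j).val x) (c := fun j => 𝓕.coord j x)
    (fun j => 𝓕.annihilated j x hxU) (𝓕.sum_coord x hxU)
  rw [h.traceExt_eq, ← h2]
  exact Finset.sum_congr rfl fun j _ => congrArg (𝓕.coord j x) (h1 j)

end FrameTrace

end Guillemin

end

/-! ### Existence of local frames. -/

noncomputable section

namespace Guillemin

set_option linter.unusedSectionVars false

local notation "𝔼[" n "]" => EuclideanSpace ℝ (Fin n)

section Frames

variable {n : ℕ} {X : Type*} [TopologicalSpace X] [ChartedSpace 𝔼[n] X] [IsManifold (𝓡 n) ∞ X]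
  {φ : ℝ → X → X} {k : ℕ}

theorem contMDiffAt_toTriv_comp_ofTriv {x₀ x : X} (hx : x ∈ (chartAt 𝔼[n] x₀).source) :
    ContMDiffAt (𝓡 n) 𝓘(ℝ, 𝔼[n] →L[ℝ] 𝔼[n]) ∞ (fun y => (toTriv (n := n) x₀ y).comp (ofTriv x y)) x := by
  set e := trivializationAt 𝔼[n] (TangentSpace (𝓡 n)) x
  set e' := trivializationAt 𝔼[n] (TangentSpace (𝓡 n)) x₀
  have h1 : x ∈ e.baseSet := mem_chart_source _ x
  have h2 : x ∈ e'.baseSet := hx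
  refine (contMDiffAt_coordChangeL (IB := 𝓡 n) (n := ∞) (e := e) (e' := e') h1
    h2).congr_of_eventuallyEq ?_
  filter_upwards [(e.open_baseSet.inter e'.open_baseSet).mem_nhds ⟨h1, h2⟩] with y hy
  ext1 v
  change e'.continuousLinearMapAt ℝ y (e.symmL ℝ y v) = e.coordChangeL ℝ e' y v
  rw [e.coordChangeL_apply e' hy, e'.continuousLinearMapAt_apply_of_mem ℝ hy.2, e.symmL_apply hy.1]

/-- `V` is the time derivative at 0 of a map smooth in `(t, y)`. The general result trivializes at
`φ 0 x`, which has to be replaced by `x`. -/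
theorem IsSmoothFlow.contMDiffAt_toTriv_gen_self (hs : IsSmoothFlow (n := n) φ) (x : X) :
    ContMDiffAt (𝓡 n) 𝓘(ℝ, 𝔼[n]) ∞ (fun y => toTriv x y (gen (n := n) φ y)) x := by
  have h1 : ContMDiffAt (𝓡 n) 𝓘(ℝ, ℝ →L[ℝ] 𝔼[n]) ∞
      (inTangentCoordinates 𝓘(ℝ, ℝ) (𝓡 n) (fun _ : X => (0 : ℝ)) (fun y => φ 0 y)
        (fun y => mfderiv 𝓘(ℝ, ℝ) (𝓡 n) (fun t : ℝ => φ t y) 0) x) x := by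
    refine ContMDiffAt.mfderiv (J := 𝓡 n) (I := 𝓘(ℝ, ℝ)) (I' := 𝓡 n) (M := ℝ) (M' := X) (x₀ := x)
      (n := ∞) (m := ∞) (fun y t => φ t y) (fun _ => 0) ?_ contMDiffAt_const le_rfl
    exact (hs.smooth.comp (contMDiff_snd.prodMk contMDiff_fst)) _
  refine (h1.clm_apply (contMDiffAt_const (c := (1 : ℝ)))).congr_of_eventuallyEq
    (Eventually.of_forall fun y => ?_)
  have h2 : ∀ z z', z = x → z' = y → toTriv x y (gen (n := n) φ y) =
      (trivializationAt 𝔼[n] (TangentSpace (𝓡 n)) z).continuousLinearMapAt ℝ z' (gen φ y) := by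
    rintro _ _ rfl rfl
    rfl
  refine (h2 _ _ (hs.zero x) (hs.zero y)).trans ?_
  have h3 : (trivializationAt ℝ (TangentSpace 𝓘(ℝ, ℝ)) (0 : ℝ)).symmL ℝ (0 : ℝ) =
      ContinuousLinearMap.id ℝ ℝ := by
    simp only [TangentBundle.symmL_model_space]
    rfl
  change _ = (trivializationAt 𝔼[n] (TangentSpace (𝓡 n)) (φ 0 x)).continuousLinearMapAt ℝ (φ 0 y)
    ((mfderiv 𝓘(ℝ, ℝ) (𝓡 n) (fun t : ℝ => φ t y) 0)
      ((trivializationAt ℝ (TangentSpace 𝓘(ℝ, ℝ)) (0 : ℝ)).symmL ℝ (0 : ℝ) (1 : ℝ)))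
  rw [h3]
  rfl

/-- The generator is a smooth vector field. -/
theorem IsSmoothFlow.contMDiffAt_toTriv_gen (hs : IsSmoothFlow (n := n) φ) {x₀ x : X}
    (hx : x ∈ (chartAt 𝔼[n] x₀).source) :
    ContMDiffAt (𝓡 n) 𝓘(ℝ, 𝔼[n]) ∞ (fun y => toTriv x₀ y (gen (n := n) φ y)) x := by
  refine ((contMDiffAt_toTriv_comp_ofTriv hx).clm_apply
    (hs.contMDiffAt_toTriv_gen_self x)).congr_of_eventuallyEq ?_
  filter_upwards [chart_source_mem_nhds 𝔼[n] x] with y hy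
  rw [ContinuousLinearMap.comp_apply, ofTriv_toTriv hy]

/-- The projection along `V` onto the kernel of `ℓ`. -/
def projAlong (ℓ : 𝔼[n] →L[ℝ] ℝ) (V : 𝔼[n]) : 𝔼[n] →L[ℝ] 𝔼[n] :=
  ContinuousLinearMap.id ℝ _ - (ℓ V)⁻¹ • ℓ.smulRight V

theorem projAlong_apply (ℓ : 𝔼[n] →L[ℝ] ℝ) (V w : 𝔼[n]) :
    projAlong ℓ V w = w - ((ℓ V)⁻¹ * ℓ w) • V := by
  simp [projAlong, smul_smul]

theorem projAlong_mem_ker {ℓ : 𝔼[n] →L[ℝ] ℝ} {V : 𝔼[n]} (hV : ℓ V ≠ 0) (w : 𝔼[n]) :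
    projAlong ℓ V w ∈ ℓ.toLinearMap.ker := by
  rw [LinearMap.mem_ker, ContinuousLinearMap.coe_coe, projAlong_apply, map_sub, map_smul, smul_eq_mul]
  field_simp
  ring

theorem projAlong_of_mem_ker {ℓ : 𝔼[n] →L[ℝ] ℝ} (V : 𝔼[n]) {w : 𝔼[n]}
    (hw : w ∈ ℓ.toLinearMap.ker) : projAlong ℓ V w = w := by
  rw [LinearMap.mem_ker, ContinuousLinearMap.coe_coe] at hw
  rw [projAlong_apply, hw, mul_zero, zero_smul, sub_zero]

theorem contDiffAt_projAlong (ℓ : 𝔼[n] →L[ℝ] ℝ) {V : 𝔼[n]} (hV : ℓ V ≠ 0) :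
    ContDiffAt ℝ ∞ (projAlong ℓ) V := by
  unfold projAlong
  have h1 : ContDiff ℝ ∞ (fun V => ℓ.smulRight V) :=
    ((ContinuousLinearMap.smulRightL ℝ 𝔼[n] 𝔼[n]) ℓ).contDiff
  exact contDiffAt_const.sub ((ℓ.contDiff.contDiffAt.inv hV).smul h1.contDiffAt)

variable {ℓ : 𝔼[n] →L[ℝ] ℝ} {x₀ : X}

variable (k) in
/-- The pullback of alternating forms by a linear map. -/
def precomp {E F : Type*} [NormedAddCommGroup E] [NormedSpace ℝ E] [NormedAddCommGroup F]
    [NormedSpace ℝ F] (A : F →L[ℝ] E) : (E [⋀^Fin k]→L[ℝ] ℂ) →ₗ[ℂ] (F [⋀^Fin k]→L[ℝ] ℂ) where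
  toFun α := α.compContinuousLinearMap A
  map_add' _ _ := rfl
  map_smul' _ _ := rfl

/-- The local frame of `E_0^k` obtained from a basis of the forms on the kernel of `ℓ`. -/
def frameOfBasis (hs : IsSmoothFlow (n := n) φ) {r : ℕ}
    (b : Module.Basis (Fin r) ℂ (ℓ.toLinearMap.ker [⋀^Fin k]→L[ℝ] ℂ))
    {p : 𝔼[n] →L[ℝ] ℓ.toLinearMap.ker} (hp : ∀ w : ℓ.toLinearMap.ker, p w = w) {U : Set X}
    (hU : U ⊆ (chartAt 𝔼[n] x₀).source) (hUℓ : ∀ x ∈ U, ℓ (toTriv x₀ x (gen φ x)) ≠ 0) :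
    LocalFrame (n := n) φ k U r where
  -- Projecting along `V` before applying a form on `ker ℓ` makes the form vanish on `V`; conversely
  -- a form annihilated by `V` is recovered from its restriction to `ker ℓ`, which gives the
  -- coordinates.
  e j x := (b j).compContinuousLinearMap
    (p.comp ((projAlong ℓ (toTriv x₀ x (gen φ x))).comp (toTriv x₀ x)))
  coord j x := (b.coord j).comp
    (precomp k ((ofTriv x₀ x).comp ℓ.toLinearMap.ker.subtypeL))
  smooth j x hx := by
    have h1 : ContMDiffAt (𝓡 n) 𝓘(ℝ, 𝔼[n] →L[ℝ] 𝔼[n]) ∞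
        (fun y => (projAlong ℓ (toTriv x₀ y (gen φ y))).comp
          ((toTriv x₀ y).comp (ofTriv x y))) x :=
      ((contDiffAt_projAlong ℓ (hUℓ x hx)).contMDiffAt.comp x
        (hs.contMDiffAt_toTriv_gen (hU hx))).clm_comp (contMDiffAt_toTriv_comp_ofTriv (hU hx))
    have h2 := contMDiffAt_compContinuousLinearMap
      (contMDiffAt_const (c := (b j).compContinuousLinearMap p)) h1
    exact h2
  annihilated j x hx := by
    rintro v ⟨i, hi⟩
    refine (b j).map_coord_zero i ?_
    have h1 : projAlong ℓ (toTriv x₀ x (gen φ x)) (toTriv x₀ x (gen (n := n) φ x)) = 0 := by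
      rw [projAlong_apply, inv_mul_cancel₀ (hUℓ x hx), one_smul, sub_self]
    have h2 : p (projAlong ℓ (toTriv x₀ x (gen φ x)) (toTriv x₀ x (gen (n := n) φ x))) = 0 := by
      rw [h1, map_zero]
    simp only [hi]
    exact h2
  coord_e i j x hx := by
    have h1 : ((b j).compContinuousLinearMap
        (p.comp ((projAlong ℓ (toTriv x₀ x (gen φ x))).comp (toTriv x₀ x)))).compContinuousLinearMap
        ((ofTriv x₀ x).comp ℓ.toLinearMap.ker.subtypeL) = b j := by
      ext v
      refine congrArg (b j) (funext fun l => ?_)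
      change p (projAlong ℓ _ (toTriv x₀ x (ofTriv x₀ x (v l : 𝔼[n])))) = v l
      rw [toTriv_ofTriv (hU hx), projAlong_of_mem_ker _ (v l).2, hp]
    refine (congrArg (b.coord i) h1).trans ?_
    rw [Module.Basis.coord_apply, Module.Basis.repr_self, Finsupp.single_apply]
    exact if_congr eq_comm rfl rfl
  sum_coord x hx α hα := by
    set α' : 𝔼[n] [⋀^Fin k]→L[ℝ] ℂ := α with hα'
    set β := α'.compContinuousLinearMap ((ofTriv x₀ x).comp ℓ.toLinearMap.ker.subtypeL) with hβ
    set Q := p.comp ((projAlong ℓ (toTriv x₀ x (gen (n := n) φ x))).comp (toTriv x₀ x)) with hQ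
    have h1 : ∑ j, b.coord j β • (b j).compContinuousLinearMap Q = α' := by
      have h2 : ∑ j, b.coord j β • b j = β := b.sum_repr β
      ext v
      have h3 := DFunLike.congr_fun h2 fun i => Q (v i)
      rw [ContinuousAlternatingMap.sum_apply] at h3 ⊢
      refine h3.trans ?_
      rw [← alternating_add_smul_eq (X := gen φ x) hα v
        (fun i => -((ℓ (toTriv x₀ x (gen φ x)))⁻¹ * ℓ (toTriv x₀ x (v i))))]
      refine congrArg α' (funext fun i => ?_)
      change ofTriv x₀ x (p (projAlong ℓ _ (toTriv x₀ x (v i))) : 𝔼[n]) = _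
      have h4 := hp ⟨_, projAlong_mem_ker (hUℓ x hx) (toTriv x₀ x (v i))⟩
      rw [show (p (projAlong ℓ (toTriv x₀ x (gen φ x)) (toTriv x₀ x (v i))) : 𝔼[n]) =
        projAlong ℓ (toTriv x₀ x (gen φ x)) (toTriv x₀ x (v i)) from congrArg Subtype.val h4,
        projAlong_apply, map_sub, map_smul, ofTriv_toTriv (hU hx), ofTriv_toTriv (hU hx), neg_smul,
        sub_eq_add_neg]
    exact h1

/-- A functional with `ℓ(V) ≠ 0` at `x₀` satisfies this nearby. Frames around every point are what
makes `IsDiagonalTrace` determine its distribution. -/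
theorem exists_localFrame (hs : IsSmoothFlow (n := n) φ) {x₀ : X} (hx₀ : gen (n := n) φ x₀ ≠ 0)
    (k : ℕ) : ∃ U : Set X, IsOpen U ∧ x₀ ∈ U ∧ ∃ r, Nonempty (LocalFrame (n := n) φ k U r) := by
  have hm := mem_chart_source 𝔼[n] x₀
  have hV : toTriv x₀ x₀ (gen (n := n) φ x₀) ≠ 0 := fun h0 => hx₀ (by
    rw [← ofTriv_toTriv hm (gen φ x₀), h0, map_zero])
  obtain ⟨ℓ, -, hℓ⟩ := exists_dual_vector ℝ _ (norm_ne_zero_iff.2 hV)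
  have hℓ0 : ℓ (toTriv x₀ x₀ (gen (n := n) φ x₀)) ≠ 0 := by
    rw [hℓ]
    exact_mod_cast norm_ne_zero_iff.2 hV
  obtain ⟨p, hp⟩ := ContinuousLinearMap.HasLeftInverse.of_injective_of_finiteDimensional
    (f := ℓ.toLinearMap.ker.subtypeL) Subtype.val_injective
  have : Module.Finite ℂ (ℓ.toLinearMap.ker [⋀^Fin k]→L[ℝ] ℂ) :=
    Module.Finite.of_restrictScalars_finite ℝ ℂ _
  have hc : ContinuousOn (fun x => ℓ (toTriv x₀ x (gen (n := n) φ x))) (chartAt 𝔼[n] x₀).source :=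
    fun x hx => (ℓ.continuous.continuousAt.comp
      (hs.contMDiffAt_toTriv_gen hx).continuousAt).continuousWithinAt
  refine ⟨(chartAt 𝔼[n] x₀).source ∩ (fun x => ℓ (toTriv x₀ x (gen (n := n) φ x))) ⁻¹' {0}ᶜ,
    hc.isOpen_inter_preimage (chartAt 𝔼[n] x₀).open_source isOpen_compl_singleton, ⟨hm, hℓ0⟩, _,
    ⟨frameOfBasis hs (Module.finBasis ℂ _) hp inter_subset_left fun x hx => hx.2⟩⟩

end Frames

end Guillemin

end

/-! ### The trace formula. -/

noncomputable section

namespace Guillemin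

set_option linter.unusedSectionVars false

local notation "𝔼[" n "]" => EuclideanSpace ℝ (Fin n)
local notation "𝓙[" n "]" => ModelWithCorners.prod 𝓘(ℝ, ℝ) (ModelWithCorners.prod (𝓡 n) (𝓡 n))
local notation "𝓘₁[" n "]" => ModelWithCorners.prod 𝓘(ℝ, ℝ) (𝓡 n)

section TraceFormula

variable {n : ℕ} {X : Type*} [TopologicalSpace X] [ChartedSpace 𝔼[n] X] [IsManifold (𝓡 n) ∞ X]
  [T2Space X] [CompactSpace X]
  {φ : ℝ → X → X} {Es Eu : ∀ x : X, Submodule ℝ (TangentSpace (𝓡 n) x)}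

/-- The weight `F / |det(I - P)|` at the periodic points. -/
def IsAnosov.weight (h : IsAnosov φ Es Eu) (F : ∀ T x, φ T x = x → ℝ) (T : ℝ) (x : X) : ℂ :=
  open Classical in if hx : φ T x = x then ((F T x hx / h.absDet hx : ℝ) : ℂ) else 0

theorem IsAnosov.weight_of_fixed (h : IsAnosov φ Es Eu) {F : ∀ T x, φ T x = x → ℝ} {T : ℝ} {x : X}
    (hx : φ T x = x) : h.weight F T x = ((F T x hx / h.absDet hx : ℝ) : ℂ) := dif_pos hx

theorem IsAnosov.weight_orbit (h : IsAnosov φ Es Eu) {F : ∀ T x, φ T x = x → ℝ}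
    (hF : ∀ T x s (hx : φ T x = x) (hx' : φ T (φ s x) = φ s x), F T (φ s x) hx' = F T x hx)
    (T : ℝ) (x : X) (s : ℝ) (hx : φ T x = x) : h.weight F T (φ s x) = h.weight F T x := by
  have hx' := h.toIsSmoothFlow.period_apply hx s
  rw [h.weight_of_fixed hx, h.weight_of_fixed hx', hF T x s hx hx', h.absDet_transport hx s hx']

variable {wt : ℝ → X → ℂ}

/-- Near a closed trajectory, `orbitSum` is an integral over a segment of the trajectory. -/
theorem IsAnosov.exists_orbitSum_eq (h : IsAnosov φ Es Eu)
    (hwt : ∀ T x s, φ T x = x → wt T (φ s x) = wt T x) {x₀ : X} {t₀ : ℝ} (ht₀ : t₀ ≠ 0)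
    (hfix : φ t₀ x₀ = x₀) {V : Set X} (hV : V ∈ 𝓝 x₀) :
    ∃ ε > 0, ∃ U : Set X, IsOpen U ∧ x₀ ∈ U ∧ (∀ s, |s| < ε → φ s x₀ ∈ U) ∧ U ⊆ V ∧
      (∀ t ∈ Ioo (t₀ - ε) (t₀ + ε), t ≠ 0) ∧
      ∀ χ : ℝ × X → ℂ, Continuous χ → tsupport χ ⊆ Ioo (t₀ - ε) (t₀ + ε) ×ˢ U →
        orbitSum φ wt χ = wt t₀ x₀ * ∫ s in (-ε)..ε, χ (t₀, φ s x₀) := by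
  have hs := h.toIsSmoothFlow
  obtain ⟨hP0, -⟩ := h.primitivePeriod_mem ht₀ hfix
  obtain ⟨ε', ⟨N, hN, hsum⟩, hε'⟩ := ((h.eventually_orbitSum_eq hwt ht₀ hfix).and
    (Ioo_mem_nhdsGT (half_pos hP0))).exists
  obtain ⟨A, hA, B, hB, hAB⟩ := mem_nhds_prod_iff.1 hN
  obtain ⟨δ, hδ, hδA⟩ := Metric.mem_nhds_iff.1 hA
  have hW : interior (B ∩ V) ∈ 𝓝 x₀ := interior_mem_nhds.2 (inter_mem hB hV)
  obtain ⟨ε, horb, hε⟩ := ((hs.eventually_orbit_mem hW).and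
    (Ioo_mem_nhdsGT (lt_min (lt_min hδ hε'.1) (abs_pos.2 ht₀)))).exists
  have hεδ : ε < δ := hε.2.trans_le ((min_le_left _ _).trans (min_le_left _ _))
  have hεε' : ε < ε' := hε.2.trans_le ((min_le_left _ _).trans (min_le_right _ _))
  have hεt : ε < |t₀| := hε.2.trans_le (min_le_right _ _)
  -- The neighbourhood `N` depends on `ε'`, so `ε` can be made small only afterwards. Removing the
  -- closed arcs `ε ≤ |s| ≤ ε'` from `U` reduces the integral over `|s| < ε'` to `|s| < ε`; the
  -- central arc avoids them because `ε'` is less than half the primitive period.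
  set K : Set X := (fun s => φ s x₀) '' (Icc (-ε') (-ε) ∪ Icc ε ε') with hK
  have hKc : IsClosed K :=
    ((isCompact_Icc.union isCompact_Icc).image (hs.contMDiff_orbit x₀).continuous).isClosed
  have hmem : ∀ s, |s| < ε → φ s x₀ ∈ interior (B ∩ V) \ K := fun s hsε => by
    refine ⟨horb s (by rw [uIcc_of_le (by linarith [hε.1]), mem_Icc, ← abs_le]; exact hsε.le), ?_⟩
    rintro ⟨r, hr, hrs⟩
    have hr' : ε ≤ |r| ∧ |r| ≤ ε' := by
      rcases hr with hr | hr
      · exact ⟨le_abs.2 (Or.inr (by linarith [hr.2])), abs_le.2 ⟨hr.1, by linarith [hr.2, hε.1, hε'.1]⟩⟩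
      · exact ⟨le_abs.2 (Or.inl hr.1), abs_le.2 ⟨by linarith [hr.1, hε.1, hε'.1], hr.2⟩⟩
    have h1 : φ (s - r) x₀ = x₀ := by
      rw [show s - r = -r + s by ring, hs.add, ← hrs]
      exact hs.neg_apply r x₀
    have h2 := hs.eq_zero_of_abs_lt_primitivePeriod
      ((abs_sub s r).trans_lt (by linarith [hε'.2, hr'.2])) h1
    rw [sub_eq_zero] at h2
    rw [h2] at hsε
    exact absurd hr'.1 (not_le.2 hsε)
  refine ⟨ε, hε.1, interior (B ∩ V) \ K, isOpen_interior.sdiff hKc, ?_, hmem,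
    fun x hx => (interior_subset hx.1).2, ?_, fun χ hχ hχN => ?_⟩
  · have := hmem 0 (by rw [abs_zero]; exact hε.1)
    rwa [hs.zero] at this
  · rintro t ht rfl
    have h1 : |t₀| < ε := abs_lt.2 ⟨by linarith [ht.2], by linarith [ht.1]⟩
    exact absurd h1 (not_lt.2 hεt.le)
  · rw [hsum χ hχ fun q hq => hAB ⟨hδA (by
      have := (hχN hq).1
      rw [Metric.mem_ball, Real.dist_eq, abs_lt]
      constructor <;> linarith [this.1, this.2]), (interior_subset (hχN hq).2.1).1⟩]
    have h0 : ∀ s ∈ Icc (-ε') (-ε) ∪ Icc ε ε', χ (t₀, φ s x₀) = 0 := fun s hs' => by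
      by_contra hne
      exact (hχN (subset_tsupport _ hne)).2.2 ⟨s, hs', rfl⟩
    have hi : ∀ a b, IntervalIntegrable (fun s => χ (t₀, φ s x₀)) volume a b := fun a b =>
      (hχ.comp (continuous_const.prodMk (hs.contMDiff_orbit x₀).continuous)).intervalIntegrable a b
    have h1 : ∫ s in (-ε')..(-ε), χ (t₀, φ s x₀) = 0 := by
      rw [intervalIntegral.integral_congr (g := fun _ => (0 : ℂ)) fun s hs' => h0 s (Or.inl (by
        rwa [uIcc_of_le (by linarith)] at hs')), intervalIntegral.integral_zero]
    have h2 : ∫ s in ε..ε', χ (t₀, φ s x₀) = 0 := by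
      rw [intervalIntegral.integral_congr (g := fun _ => (0 : ℂ)) fun s hs' => h0 s (Or.inr (by
        rwa [uIcc_of_le hεε'.le] at hs')), intervalIntegral.integral_zero]
    rw [← intervalIntegral.integral_add_adjacent_intervals (hi (-ε') (-ε)) (hi (-ε) ε'),
      ← intervalIntegral.integral_add_adjacent_intervals (hi (-ε) ε) (hi ε ε'), h1, h2, zero_add,
      add_zero]

theorem orbitTerm_comp_fst (χ : ℝ → ℂ) (γ : ClosedOrbit φ) (T : ℝ) :
    orbitTerm wt (fun q => χ q.1) γ T = wt T γ.base * (primitivePeriod φ γ.base * χ T) := by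
  simp [orbitTerm]

theorem hasCompactSupport_comp_fst {χ : ℝ → ℂ} (hχ : HasCompactSupport χ) :
    HasCompactSupport (fun q : ℝ × X => χ q.1) :=
  HasCompactSupport.intro (hχ.isCompact.prod isCompact_univ) fun _ hq =>
    eq_zero_of_notMem_tsupport fun h0 => hq ⟨h0, mem_univ _⟩

theorem isTest_comp_fst {O : Set ℝ} {χ : ℝ → ℂ} (hχ : IsTest 𝓘(ℝ, ℝ) O χ) :
    IsTest 𝓘₁[n] {q : ℝ × X | q.1 ∈ O} (fun q => χ q.1) := by
  refine ⟨hχ.1.comp contMDiff_fst, hasCompactSupport_comp_fst hχ.2.1, fun q hq => hχ.2.2 ?_⟩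
  exact tsupport_subset_of_forall_notMem (s := Prod.fst ⁻¹' tsupport χ)
    ((isClosed_tsupport χ).preimage continuous_fst) (fun q hq => eq_zero_of_notMem_tsupport hq) hq

/-- The pushforward of `orbitSum` to the time variable is a distribution. -/
theorem IsAnosov.isDistribution_orbitSum_comp_fst (h : IsAnosov φ Es Eu) (O : Set ℝ) :
    IsDistribution 𝓘(ℝ, ℝ) O (fun χ => orbitSum φ wt fun q => χ q.1) := by
  refine isDistribution_of_bound (fun Φ Ψ hΦ hΨ => h.orbitSum_add (hΦ.continuous.comp continuous_fst)
    (hΨ.continuous.comp continuous_fst) (hasCompactSupport_comp_fst hΦ.2.1)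
    (hasCompactSupport_comp_fst hΨ.2.1)) (fun c Φ _ => orbitSum_const_mul c _) fun p _ => ?_
  -- Only orbits of period at most `|p| + 1` contribute to test functions supported in `[p - 1, p +
  -- 1]`.
  set S := (h.finite_closedOrbit (|p| + 1)).toFinset with hS
  refine ⟨Icc (p - 1) (p + 1), Icc_mem_nhds (by linarith) (by linarith),
    ∑ γ ∈ S, (‖wt γ.period γ.base‖ * ‖(primitivePeriod φ γ.base : ℂ)‖ +
      ‖wt (-γ.period) γ.base‖ * ‖(primitivePeriod φ γ.base : ℂ)‖), fun Φ hΦ hΦL B hB => ?_⟩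
  have h0 : ∀ t, |p| + 1 < |t| → Φ t = 0 := fun t ht => eq_zero_of_notMem_tsupport fun hm => by
    have h1 := hΦL hm
    have h2 : |t - p| ≤ 1 := abs_le.2 ⟨by linarith [h1.1], by linarith [h1.2]⟩
    have h3 := abs_add_le (t - p) p
    rw [sub_add_cancel] at h3
    linarith
  have hsub : (Function.support fun γ : ClosedOrbit φ => orbitTerm wt (fun q => Φ q.1) γ γ.period +
      orbitTerm wt (fun q => Φ q.1) γ (-γ.period)) ⊆ S := fun γ hγ => by
    rw [hS, Set.Finite.coe_toFinset]
    by_contra hγ'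
    rw [mem_ofPred_eq, not_le] at hγ'
    refine hγ ?_
    simp only [orbitTerm_comp_fst]
    rw [h0 _ (by rwa [abs_of_pos γ.period_pos]), h0 _ (by rwa [abs_neg, abs_of_pos γ.period_pos])]
    simp
  rw [orbitSum, finsum_eq_sum_of_support_subset _ hsub, Finset.sum_mul]
  refine (norm_sum_le _ _).trans (Finset.sum_le_sum fun γ _ => ?_)
  simp only [orbitTerm_comp_fst]
  refine (norm_add_le _ _).trans ?_
  rw [norm_mul, norm_mul, norm_mul, norm_mul, ← mul_assoc, ← mul_assoc, add_mul]
  gcongr <;> exact hB _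

variable [MeasurableSpace X] [BorelSpace X] [SecondCountableTopology X] {μ : Measure X}
  [IsLocallyFiniteMeasure μ]

theorem schwartzKernel_propagatorFun :
    schwartzKernel μ (propagatorFun φ) = graphKernel μ φ (fun _ => 1) := by
  funext Φ
  simp only [schwartzKernel, graphKernel, propagatorFun, one_mul]
  rfl

/-- Each entry acts as composition with `φ_{-t}` followed by multiplication by a coefficient, so
functions and forms are both covered by `graphKernel`. -/
theorem LocalFrame.schwartzKernel_entry {k : ℕ} {U : Set X} {r : ℕ}
    (𝓕 : LocalFrame (n := n) φ k U r) (j l : Fin r) : schwartzKernel μ (𝓕.entry j l) =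
      graphKernel μ φ (fun q => 𝓕.coord j q.2 (pullForm φ (-q.1) (𝓕.e l) q.2)) := by
  funext Φ
  simp only [schwartzKernel, graphKernel, 𝓕.entry_eq]
  rfl

theorem LocalFrame.schwartzKernel_trace {k : ℕ} {U : Set X} {r : ℕ}
    (𝓕 : LocalFrame (n := n) φ k U r) :
    schwartzKernel μ (fun t f y => ∑ j, 𝓕.entry j j t f y) =
      graphKernel μ φ (fun q => ∑ j, 𝓕.coord j q.2 (pullForm φ (-q.1) (𝓕.e j) q.2)) := by
  funext Φ
  simp only [schwartzKernel, graphKernel, 𝓕.entry_eq, ← Finset.sum_mul]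
  rfl

theorem IsAnosov.kernel_restriction (hμ : IsSmoothDensity (n := n) μ) (h : IsAnosov φ Es Eu) :
    IsDiagonalPullback n μ univ (schwartzKernel μ (propagatorFun φ))
        (orbitSum φ (h.weight fun _ _ _ => 1)) ∧
      ∀ σ, IsDiagonalPullback n μ univ (schwartzKernel μ (propagatorFun φ)) σ →
        ∀ χ, IsTest 𝓘₁[n] (diag ⁻¹' domainOver univ) χ →
          σ χ = orbitSum φ (h.weight fun _ _ _ => 1) χ := by
  rw [schwartzKernel_propagatorFun]
  refine h.graphKernel_restriction hμ isOpen_univ contMDiffOn_const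
    (h.weight_orbit fun _ _ _ _ _ => rfl) fun T x hx hT _ => ?_
  rw [h.weight_of_fixed hx]
  have := (h.absDet_pos hT hx).ne'
  rw [← Complex.ofReal_mul, div_mul_cancel₀ _ this, Complex.ofReal_one]

/-- The weight of the trace formula on `k`-forms. -/
def IsAnosov.traceWeight (h : IsAnosov φ Es Eu) (k : ℕ) : ℝ → X → ℂ :=
  h.weight fun _ _ hx => h.traceExt hx k

theorem IsAnosov.traceWeight_orbit (h : IsAnosov φ Es Eu) (k : ℕ) (T : ℝ) (x : X) (s : ℝ)
    (hx : φ T x = x) : h.traceWeight k T (φ s x) = h.traceWeight k T x :=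
  h.weight_orbit (fun _ _ s hx hx' => h.traceExt_transport hx s hx' k) T x s hx

theorem IsAnosov.trace_restriction (hμ : IsSmoothDensity (n := n) μ) (h : IsAnosov φ Es Eu)
    {k : ℕ} {U : Set X} (hU : IsOpen U) {r : ℕ} (𝓕 : LocalFrame (n := n) φ k U r) :
    IsDiagonalPullback n μ U (schwartzKernel μ fun t f y => ∑ j, 𝓕.entry j j t f y)
        (orbitSum φ (h.traceWeight k)) ∧
      ∀ σ, IsDiagonalPullback n μ U (schwartzKernel μ fun t f y => ∑ j, 𝓕.entry j j t f y) σ →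
        ∀ χ, IsTest 𝓘₁[n] (diag ⁻¹' domainOver U) χ → σ χ = orbitSum φ (h.traceWeight k) χ := by
  rw [𝓕.schwartzKernel_trace]
  refine h.graphKernel_restriction hμ hU (fun q hq => ?_) (h.traceWeight_orbit k)
    fun T x hx hT hxU => ?_
  · exact ContMDiffWithinAt.sum fun j _ =>
      𝓕.contMDiffOn_coord h.toIsSmoothFlow hU j j q hq
  · simp only
    rw [h.sum_coord_eq_traceExt hx 𝓕 hxU, IsAnosov.traceWeight, h.weight_of_fixed hx,
      ← Complex.ofReal_mul, div_mul_cancel₀ _ (h.absDet_pos hT hx).ne']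

theorem IsAnosov.isDiagonalTrace_orbitSum (hμ : IsSmoothDensity (n := n) μ)
    (h : IsAnosov φ Es Eu) (k : ℕ) : IsDiagonalTrace n φ μ k (orbitSum φ (h.traceWeight k)) :=
  ⟨h.isDistribution_orbitSum (h.traceWeight_orbit k),
    fun _ hU _ 𝓕 => (h.trace_restriction hμ hU 𝓕).1⟩

/-- Both sides are additive, and a test function of small support lies over the domain of a local
frame, where the pullback is unique. -/
theorem IsDiagonalTrace.eq_orbitSum (hμ : IsSmoothDensity (n := n) μ) (h : IsAnosov φ Es Eu)
    {k : ℕ} {τ : (ℝ × X → ℂ) → ℂ} (hτ : IsDiagonalTrace n φ μ k τ) {χ : ℝ × X → ℂ}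
    (hχ : IsTest 𝓘₁[n] {q : ℝ × X | q.1 ≠ 0} χ) : τ χ = orbitSum φ (h.traceWeight k) χ := by
  refine hχ.induction_on (P := fun χ => τ χ = orbitSum φ (h.traceWeight k) χ) ?_ ?_ ?_
  · rw [orbitSum_eq_zero h.toIsSmoothFlow fun _ _ _ _ => rfl]
    have h1 := hτ.1.2.1 0 _ (isTest_zero {q : ℝ × X | q.1 ≠ 0})
    simpa using h1
  · intro Φ Ψ hΦ hΨ h1 h2
    rw [hτ.1.1 Φ Ψ hΦ hΨ, h1, h2,
      h.orbitSum_add hΦ.continuous hΨ.continuous hΦ.2.1 hΨ.2.1]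
  · intro q hq
    obtain ⟨U, hU, hqU, r, ⟨𝓕⟩⟩ := exists_localFrame h.toIsSmoothFlow (h.gen_ne_zero q.2) k
    refine ⟨Prod.snd ⁻¹' U, (hU.preimage continuous_snd).mem_nhds hqU, fun Φ hΦ hΦU => ?_⟩
    exact (h.trace_restriction hμ hU 𝓕).2 τ (hτ.2 U hU r 𝓕) Φ
      (hΦ.mono fun q hq => ⟨hΦ.2.2 hq, hΦU hq, hΦU hq⟩)

theorem IsFlatTrace.eq_orbitSum (hμ : IsSmoothDensity (n := n) μ) (h : IsAnosov φ Es Eu)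
    {k : ℕ} {T : (ℝ → ℂ) → ℂ} (hT : IsFlatTrace n φ μ k T) {χ : ℝ → ℂ}
    (hχ : IsTest 𝓘(ℝ, ℝ) {t : ℝ | t ≠ 0} χ) :
    T χ = orbitSum φ (h.traceWeight k) (fun q => χ q.1) := by
  obtain ⟨τ, hτ, hTτ⟩ := hT
  rw [hTτ χ hχ]
  exact hτ.eq_orbitSum hμ h (isTest_comp_fst hχ)

/-- Support in `t > 0` removes the terms with negative periods, and each orbit integral of a
function of `t` alone is the primitive period times its value. Invariance along the orbit allows any
base point. -/
theorem IsFlatTrace.hasSum (hμ : IsSmoothDensity (n := n) μ) (h : IsAnosov φ Es Eu)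
    {k : ℕ} {T : (ℝ → ℂ) → ℂ} (hT : IsFlatTrace n φ μ k T) {x : ClosedOrbit φ → X}
    (hx : ∀ γ, x γ ∈ γ.carrier) {χ : ℝ → ℂ} (hχ : IsTest 𝓘(ℝ, ℝ) (Ioi (0 : ℝ)) χ) :
    HasSum (fun γ : ClosedOrbit φ => ((primitivePeriod φ (x γ) *
        h.traceExt (γ.apply_period h.toIsSmoothFlow (hx γ)) k /
        h.absDet (γ.apply_period h.toIsSmoothFlow (hx γ)) : ℝ) : ℂ) * χ γ.period) (T χ) := by
  have hs := h.toIsSmoothFlow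
  rw [hT.eq_orbitSum hμ h (hχ.mono fun t ht => (hχ.2.2 ht).ne')]
  have hfin := h.finite_orbitTerm (wt := h.traceWeight k) (hasCompactSupport_comp_fst (X := X) hχ.2.1)
  have hterm : (fun γ : ClosedOrbit φ => ((primitivePeriod φ (x γ) *
      h.traceExt (γ.apply_period h.toIsSmoothFlow (hx γ)) k /
      h.absDet (γ.apply_period h.toIsSmoothFlow (hx γ)) : ℝ) : ℂ) * χ γ.period) = fun γ =>
      orbitTerm (h.traceWeight k) (fun q => χ q.1) γ γ.period +
        orbitTerm (h.traceWeight k) (fun q => χ q.1) γ (-γ.period) := by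
    funext γ
    have h0 : χ (-γ.period) = 0 := eq_zero_of_notMem_tsupport fun hm => by
      have h1 : (0 : ℝ) < -γ.period := hχ.2.2 hm
      linarith [γ.period_pos]
    obtain ⟨s, hxs⟩ : ∃ s, φ s γ.base = x γ := by
      have := hx γ
      rwa [γ.carrier_eq] at this
    have hp := γ.apply_period hs (hx γ)
    rw [orbitTerm_comp_fst, orbitTerm_comp_fst, h0, mul_zero, mul_zero, add_zero,
      ← h.traceWeight_orbit k _ _ s γ.period_base, ← hs.primitivePeriod_orbit γ.base s, hxs,
      IsAnosov.traceWeight, h.weight_of_fixed hp]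
    push_cast
    ring
  rw [hterm, orbitSum, finsum_eq_sum _ hfin]
  exact hasSum_sum_of_ne_finset_zero fun γ hγ => by
    by_contra h0
    exact hγ (hfin.mem_toFinset.2 h0)

end TraceFormula

end Guillemin

end

theorem mainTheorem6 {n : ℕ} {X : Type*} [TopologicalSpace X] [CompactSpace X] [T2Space X]
    [ChartedSpace (EuclideanSpace ℝ (Fin n)) X] [IsManifold (𝓡 n) ∞ X]
    [MeasurableSpace X] [BorelSpace X]
    (φ : ℝ → X → X) (Es Eu : ∀ x : X, Submodule ℝ (TangentSpace (𝓡 n) x))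
    (hφ : Guillemin.IsAnosov φ Es Eu)
    (μ : Measure X) (hμ : Guillemin.IsSmoothDensity (n := n) μ) (k : ℕ) :
    -- `φ_{-t}^*` is the group `e^{-itP}`, and it acts on the smooth sections of `E_0^k`
    (∀ u : Guillemin.Form n X k, (∀ x, u.SmoothAt x) → (∀ x, Guillemin.Annihilated φ x (u x)) →
      Guillemin.propagator φ 0 u = u ∧
      ∀ t x, (Guillemin.propagator φ t u).SmoothAt x ∧
        Guillemin.Annihilated φ x (Guillemin.propagator φ t u x) ∧
        ∀ v : Fin k → TangentSpace (𝓡 n) x,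
          HasDerivAt (fun s : ℝ => Guillemin.propagator φ s u x v)
            (-Complex.I * Guillemin.opP φ (Guillemin.propagator φ t u) x v) t) ∧
    -- the wave front set of the kernel on functions avoids the conormal bundle of the diagonal
    (Guillemin.IsDistribution (𝓘(ℝ, ℝ).prod ((𝓡 n).prod (𝓡 n))) (Guillemin.domainOver univ)
        (Guillemin.schwartzKernel μ (Guillemin.propagatorFun φ)) ∧
      Disjoint
        (Guillemin.waveFrontSet (𝓘(ℝ, ℝ).prod ((𝓡 n).prod (𝓡 n))) (Guillemin.domainOver univ)
          (Guillemin.schwartzKernel μ (Guillemin.propagatorFun φ)))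
        (Guillemin.normals (𝓘(ℝ, ℝ).prod ((𝓡 n).prod (𝓡 n))) (𝓘(ℝ, ℝ).prod (𝓡 n))
          (Guillemin.diag (X := X)))) ∧
    -- the same for the matrix entries of the kernel on sections of `E_0^k`
    (∀ (U : Set X), IsOpen U → ∀ (r : ℕ) (𝓕 : Guillemin.LocalFrame (n := n) φ k U r)
      (j l : Fin r),
      Guillemin.IsDistribution (𝓘(ℝ, ℝ).prod ((𝓡 n).prod (𝓡 n))) (Guillemin.domainOver U)
        (Guillemin.schwartzKernel μ (𝓕.entry j l)) ∧
      Disjoint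
        (Guillemin.waveFrontSet (𝓘(ℝ, ℝ).prod ((𝓡 n).prod (𝓡 n))) (Guillemin.domainOver U)
          (Guillemin.schwartzKernel μ (𝓕.entry j l)))
        (Guillemin.normals (𝓘(ℝ, ℝ).prod ((𝓡 n).prod (𝓡 n))) (𝓘(ℝ, ℝ).prod (𝓡 n))
          (Guillemin.diag (X := X)))) ∧
    -- the kernel on functions restricts to the diagonal
    (∃ σ, Guillemin.IsDistribution (𝓘(ℝ, ℝ).prod (𝓡 n)) {q : ℝ × X | q.1 ≠ 0} σ ∧
      Guillemin.IsDiagonalPullback n μ univ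
        (Guillemin.schwartzKernel μ (Guillemin.propagatorFun φ)) σ) ∧
    -- the flat trace on `E_0^k` is well defined
    (∃ T, Guillemin.IsDistribution 𝓘(ℝ, ℝ) {t : ℝ | t ≠ 0} T ∧
      Guillemin.IsFlatTrace n φ μ k T ∧ ∀ T', Guillemin.IsFlatTrace n φ μ k T' →
      ∀ χ, Guillemin.IsTest 𝓘(ℝ, ℝ) {t : ℝ | t ≠ 0} χ → T' χ = T χ) ∧
    -- the local formula for the kernel on functions, near a closed trajectory
    (∀ (x₀ : X) (t₀ : ℝ), t₀ ≠ 0 → ∀ hx : φ t₀ x₀ = x₀,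
      0 < hφ.absDet hx ∧
      ∃ ε > 0, ∃ U : Set X, IsOpen U ∧ x₀ ∈ U ∧ (∀ s, |s| < ε → φ s x₀ ∈ U) ∧
        ∀ σ, Guillemin.IsDiagonalPullback n μ univ
            (Guillemin.schwartzKernel μ (Guillemin.propagatorFun φ)) σ →
          ∀ χ, Guillemin.IsTest (𝓘(ℝ, ℝ).prod (𝓡 n)) (Ioo (t₀ - ε) (t₀ + ε) ×ˢ U) χ →
            σ χ = ((1 / hφ.absDet hx : ℝ) : ℂ) * ∫ s in (-ε)..ε, χ (t₀, φ s x₀)) ∧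
    -- the local formula for the kernel on sections of `E_0^k`
    (∀ (x₀ : X) (t₀ : ℝ), t₀ ≠ 0 → ∀ hx : φ t₀ x₀ = x₀,
      ∃ ε > 0, ∃ U : Set X, IsOpen U ∧ x₀ ∈ U ∧ (∀ s, |s| < ε → φ s x₀ ∈ U) ∧
        ∀ τ, Guillemin.IsDiagonalTrace n φ μ k τ →
          ∀ χ, Guillemin.IsTest (𝓘(ℝ, ℝ).prod (𝓡 n)) (Ioo (t₀ - ε) (t₀ + ε) ×ˢ U) χ →
            τ χ = ((hφ.traceExt hx k / hφ.absDet hx : ℝ) : ℂ) *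
              ∫ s in (-ε)..ε, χ (t₀, φ s x₀)) ∧
    -- the trace formula for `t > 0`; the sum over periodic orbits is locally finite
    (∀ R : ℝ, {γ : Guillemin.ClosedOrbit φ | γ.period ≤ R}.Finite) ∧
    (∀ (x : Guillemin.ClosedOrbit φ → X) (hx : ∀ γ, x γ ∈ γ.carrier),
      ∀ T, Guillemin.IsFlatTrace n φ μ k T →
        ∀ χ, Guillemin.IsTest 𝓘(ℝ, ℝ) (Ioi (0 : ℝ)) χ →
          HasSum (fun γ : Guillemin.ClosedOrbit φ =>
            ((Guillemin.primitivePeriod φ (x γ) *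
              hφ.traceExt (γ.apply_period hφ.toIsSmoothFlow (hx γ)) k /
              hφ.absDet (γ.apply_period hφ.toIsSmoothFlow (hx γ)) : ℝ) : ℂ) * χ γ.period)
            (T χ)) := by
  have hs := hφ.toIsSmoothFlow
  -- Second countability, from compactness, and local finiteness of the density are what the
  -- integrals over products with `X` require.
  have : SecondCountableTopology X :=
    ChartedSpace.secondCountable_of_sigmaCompact (EuclideanSpace ℝ (Fin n)) X
  have : IsLocallyFiniteMeasure μ := hμ.isLocallyFiniteMeasure
  refine ⟨fun u hu hua => ⟨?_, fun t x => ⟨(hu _).pullForm hs, hs.annihilated_pullForm (hua _),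
    hs.hasDerivAt_propagator hu t x⟩⟩, ⟨?_, ?_⟩, fun U hU r 𝓕 j l => ⟨?_, ?_⟩,
    ⟨_, hφ.isDistribution_orbitSum (hφ.weight_orbit fun _ _ _ _ _ => rfl),
      (hφ.kernel_restriction hμ).1⟩,
    ⟨_, hφ.isDistribution_orbitSum_comp_fst _, ⟨_, hφ.isDiagonalTrace_orbitSum hμ k,
      fun _ _ => rfl⟩, fun T' hT' χ hχ => hT'.eq_orbitSum hμ hφ hχ⟩,
    fun x₀ t₀ ht₀ hx => ⟨hφ.absDet_pos ht₀ hx, ?_⟩, fun x₀ t₀ ht₀ hx => ?_,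
    hφ.finite_closedOrbit, fun x hx T hT χ hχ => hT.hasSum hμ hφ hx hχ⟩
  · rw [Guillemin.propagator, neg_zero, hs.pullForm_zero]
  · rw [Guillemin.schwartzKernel_propagatorFun]
    exact Guillemin.isDistribution_graphKernel hs isOpen_univ contMDiffOn_const
  · rw [Guillemin.schwartzKernel_propagatorFun]
    exact hφ.disjoint_waveFrontSet_graphKernel hμ isOpen_univ contMDiffOn_const
  · rw [𝓕.schwartzKernel_entry]
    exact Guillemin.isDistribution_graphKernel hs hU (𝓕.contMDiffOn_coord hs hU j l)
  · rw [𝓕.schwartzKernel_entry]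
    exact hφ.disjoint_waveFrontSet_graphKernel hμ hU (𝓕.contMDiffOn_coord hs hU j l)
  · obtain ⟨ε, hε, U, hU, hx₀U, horb, -, hne, hsum⟩ := hφ.exists_orbitSum_eq
      (hφ.weight_orbit (F := fun _ _ _ => 1) fun _ _ _ _ _ => rfl) ht₀ hx univ_mem
    refine ⟨ε, hε, U, hU, hx₀U, horb, fun σ hσ χ hχ => ?_⟩
    rw [(hφ.kernel_restriction hμ).2 σ hσ χ (hχ.mono fun q hq =>
      ⟨hne _ (hχ.2.2 hq).1, mem_univ _, mem_univ _⟩), hsum χ hχ.continuous hχ.2.2,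
      hφ.weight_of_fixed hx]
  · obtain ⟨ε, hε, U, hU, hx₀U, horb, -, hne, hsum⟩ := hφ.exists_orbitSum_eq
      (hφ.traceWeight_orbit k) ht₀ hx univ_mem
    refine ⟨ε, hε, U, hU, hx₀U, horb, fun τ hτ χ hχ => ?_⟩
    rw [hτ.eq_orbitSum hμ hφ (hχ.mono fun q hq => hne _ (hχ.2.2 hq).1),
      hsum χ hχ.continuous hχ.2.2, Guillemin.IsAnosov.traceWeight, hφ.weight_of_fixed hx]
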